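/- Let $M$ be a (Hausdorff, paracompact) complex manifold, $\mathcal L$ a holomorphic Lie algebroid on $M$ with anchor $\rho_{\mathcal L}$ (the bracket is a bracket on the sheaf of holomorphic sections), and $\mathscr E$ a holomorphic vector bundle on $M$. Let $E$ be the smooth complex vector bundle underlying $\mathscr E$, and let $L$ be the smooth Lie $\mathbb C$-algebroid underlying $\mathcal L$: the underlying smooth complex vector bundle of $\mathcal L$, with anchor $\rho_L$ the composite of $\rho_{\mathcal L}$ with $\mathscr TM\cong T^{1,0}M$, and a bracket of smooth sections extending that of holomorphic sections (such an $L$ exists). For a smooth Lie $\mathbb C$-algebroid $A$, let $\mathfrak D_A(E)$ be the $A$-Atiyah algebroid of $E$: its fibre at $m$ consists of the pairs $(\delta,l)$ with $l\in A_m$ and $\delta$ a $\mathbb C$-linear operator from germs at $m$ of smooth sections of $E$ to $E_m$ with $\delta(fe)=f(m)\,\delta(e)+(\rho_A(l)f)\,e(m)$; its anchor is $(\delta,l)\mapsto\rho_A(l)$ and its bracket is $[(\delta,l),(\delta',l')]=([\delta,\delta'],[l,l'])$. Let $\bar\partial$ denote the Dolbeault operators of $\mathcal L$ and $\mathscr E$,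 and for $X\in\Gamma(T^{0,1}M)$ let $\partial_{\rho_L(l)}X$ be the $(0,1)$-part of $[\rho_L(l),X]$. For Lie algebroids $A,B$ with mutual flat connections $D$, the matched sum $A\bowtie B$ is the bundle $A\oplus B$ with anchor $\rho_A+\rho_B$ and with the bracket that extends those of $A$ and $B$ and satisfies $[a,b]=D_ab-D_ba$. Then: (a) $T^{0,1}M$ and $L$, with the flat connections $\bar\partial_Xl$ and $\partial_{\rho_L(l)}X$, form a matched pair, i.e. $T^{0,1}M\bowtie L$ is a Lie algebroid having $T^{0,1}M$ and $L$ as Lie subalgebroids; and $(T^{0,1}M\bowtie L,\,T^{0,1}M,\,E)$ is a Lie triad, i.e. moreover $\bar\partial$ is a flat $T^{0,1}M$-connection on $E$. (b) $\mathfrak D_L(E)$ and $\mathfrak D_{T^{0,1}M\bowtie L}(E)$ are smooth Lie $\mathbb C$-algebroids; $T^{0,1}M$ and $\mathfrak D_L(E)$ form a matched pair with the flat connections $$D_X(\delta,l)=\big([\bar\partial_X,\delta]+\bar\partial_{\partial_{\rho_L(l)}X},\ \bar\partial_Xl\big),\qquad D_{(\delta,l)}X=\partial_{\rho_L(l)}X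 ;$$ the map $X\oplus(\delta,l)\mapsto(\bar\partial_X+\delta,\ X\oplus l)$ is an isomorphism of Lie algebroids $$T^{0,1}M\bowtie\mathfrak D_L(E)\ \cong\ \mathfrak D_{T^{0,1}M\bowtie L}(E);$$ and $\mathfrak D_L(E)$ underlies a holomorphic Lie algebroid $\mathfrak D_{\mathcal L}(\mathscr E)$, whose Dolbeault operator $\bar\partial_X$ is $D_X$. (c) For every open $U\subseteq M$, $$\mathfrak D_{\mathcal L}(\mathscr E)(U)=\{(\delta,l)\in\Gamma_U(\mathfrak D_L(E)) \mid \bar\partial_X(\delta,l)=0\ \ \forall X\in\Gamma_U(T^{0,1}M)\},$$ and a section $(\delta,l)\in\Gamma_U(\mathfrak D_L(E))$ belongs to this space if and only if $l\in\mathcal L(U)$ and $\delta$ is a holomorphic covariant $\mathcal L$-differential operator with symbol $l$, i.e. a $\mathbb C$-linear sheaf endomorphism $\delta$ of $\mathscr E|_U$ with $\delta(fe)=f\delta(e)+(\rho_{\mathcal L}(l)f)\,e$ for all open $W\subseteq U$, $f\in\mathcal O(W)$, $e\in\mathscr E(W)$. Every pair of an $l\in\mathcal L(U)$ and a holomorphic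 covariant $\mathcal L$-differential operator on $\mathscr E|_U$ with symbol $l$ arises in this way from exactly one element of $\mathfrak D_{\mathcal L}(\mathscr E)(U)$. -/

import Mathlib

open Bundle
open scoped Manifold ContDiff TensorProduct

noncomputable section

namespace HolAtiyah

/-! ### Complex manifolds and complexified tangent vectors

`V` is a finite-dimensional complex vector space and `M` a complex manifold modelled on `V`.
The underlying real manifold is `M` with the model `𝓘(ℝ, V)`.
Local sections over an open set `U` are represented by sections defined everywhere, of which only
the values on `U` matter. -/

section Tangent

variable (V : Type*) [NormedAddCommGroup V] [NormedSpace ℂ V]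
  {M : Type*} [TopologicalSpace M] [ChartedSpace V M]

/-- A complex manifold is a real manifold. -/
instance isManifold_real [h : IsManifold 𝓘(ℂ, V) ω M] (n : ℕ∞ω) : IsManifold 𝓘(ℝ, V) n M := by
  apply isManifold_of_contDiffOn
  intro e e' he he'
  have h1 := (contDiffGroupoid ω 𝓘(ℂ, V)).compatible (M := M) he he'
  rw [contDiffGroupoid, mem_groupoid_of_pregroupoid] at h1
  have h2 := h1.1
  simp only [contDiffPregroupoid, modelWithCornersSelf_coe, modelWithCornersSelf_coe_symm,
    Function.id_comp, Function.comp_id, Set.range_id, Set.inter_univ, Set.preimage_id] at h2 ⊢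
  exact (h2.restrict_scalars ℝ).of_le le_top

/-- The fibre at `x` of the complexified tangent bundle `T_ℂ M = TM ⊗ ℂ`. -/
abbrev CTan (x : M) : Type _ := ℂ ⊗[ℝ] (TangentSpace 𝓘(ℝ, V) x)

/-- The real part `u` of the complexified tangent vector `u + i v`. -/
def cRe (x : M) : CTan V x →ₗ[ℝ] TangentSpace 𝓘(ℝ, V) x :=
  (TensorProduct.lid ℝ (TangentSpace 𝓘(ℝ, V) x)).toLinearMap ∘ₗ
    LinearMap.rTensor (TangentSpace 𝓘(ℝ, V) x) Complex.reLm

/-- The imaginary part `v` of the complexified tangent vector `u + i v`. -/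
def cIm (x : M) : CTan V x →ₗ[ℝ] TangentSpace 𝓘(ℝ, V) x :=
  (TensorProduct.lid ℝ (TangentSpace 𝓘(ℝ, V) x)).toLinearMap ∘ₗ
    LinearMap.rTensor (TangentSpace 𝓘(ℝ, V) x) Complex.imLm

theorem cRe_smul (x : M) (c : ℂ) (X : CTan V x) :
    cRe V x (c • X) = c.re • cRe V x X - c.im • cIm V x X := by
  induction X using TensorProduct.induction_on with
  | zero => simp
  | tmul z v => simp [cRe, cIm, TensorProduct.smul_tmul', sub_smul, mul_smul]
  | add a b ha hb => simp only [smul_add, map_add, ha, hb]; abel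

theorem cIm_smul (x : M) (c : ℂ) (X : CTan V x) :
    cIm V x (c • X) = c.re • cIm V x X + c.im • cRe V x X := by
  induction X using TensorProduct.induction_on with
  | zero => simp
  | tmul z v => simp [cRe, cIm, TensorProduct.smul_tmul', add_smul, mul_smul]
  | add a b ha hb => simp only [smul_add, map_add, ha, hb]; abel

/-- The value `d(u) + i d(v)` of the complex-linear extension of `d` at `X = u + i v`. -/
def cApply {F : Type*} [NormedAddCommGroup F] [NormedSpace ℂ F] (x : M)
    (d : TangentSpace 𝓘(ℝ, V) x →ₗ[ℝ] F) (X : CTan V x) : F :=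
  d (cRe V x X) + Complex.I • d (cIm V x X)

theorem cApply_add (x : M) (d : TangentSpace 𝓘(ℝ, V) x →ₗ[ℝ] ℂ) (X Y : CTan V x) :
    cApply V x d (X + Y) = cApply V x d X + cApply V x d Y := by
  simp only [cApply, map_add, smul_add]
  abel

theorem cApply_smul (x : M) (d : TangentSpace 𝓘(ℝ, V) x →ₗ[ℝ] ℂ) (c : ℂ) (X : CTan V x) :
    cApply V x d (c • X) = c * cApply V x d X := by
  simp only [cApply, cRe_smul, cIm_smul, map_add, map_sub, map_smul, smul_eq_mul,
    Complex.real_smul]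
  linear_combination (-(c.im : ℂ) * d (cIm V x X)) * Complex.I_sq
    + (d (cRe V x X) + Complex.I * d (cIm V x X)) * Complex.re_add_im c

/-- The derivative `X(g) = dg(u) + i dg(v)` at `x` of a function with values in a complex vector
space along the complexified tangent vector `X = u + i v`. -/
def cDeriv {F : Type*} [NormedAddCommGroup F] [NormedSpace ℂ F] (x : M) (X : CTan V x)
    (g : M → F) : F :=
  cApply V x (F := F) (mfderiv 𝓘(ℝ, V) 𝓘(ℝ, F) g x).toLinearMap X

theorem cDeriv_add (x : M) (X Y : CTan V x) (f : M → ℂ) :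
    cDeriv V x (X + Y) f = cDeriv V x X f + cDeriv V x Y f := cApply_add V x _ X Y

theorem cDeriv_smul (x : M) (c : ℂ) (X : CTan V x) (f : M → ℂ) :
    cDeriv V x (c • X) f = c * cDeriv V x X f := cApply_smul V x _ c X

/-- Smoothness on `U` of a complex vector field `X`: its real and imaginary parts are smooth. -/
def CSmoothOn [IsManifold 𝓘(ℂ, V) ω M] (X : Π x : M, CTan V x) (U : Set M) : Prop :=
  ContMDiffOn 𝓘(ℝ, V) 𝓘(ℝ, V).tangent ∞
      (fun x => (⟨x, cRe V x (X x)⟩ : TangentBundle 𝓘(ℝ, V) M)) U ∧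
    ContMDiffOn 𝓘(ℝ, V) 𝓘(ℝ, V).tangent ∞
      (fun x => (⟨x, cIm V x (X x)⟩ : TangentBundle 𝓘(ℝ, V) M)) U

/-- The complex-bilinear extension to `T_ℂ M` of the Lie bracket of vector fields. -/
def cLie (X Y : Π x : M, CTan V x) (x : M) : CTan V x :=
  (1 : ℂ) ⊗ₜ[ℝ]
      (VectorField.mlieBracket 𝓘(ℝ, V) (fun y => cRe V y (X y)) (fun y => cRe V y (Y y)) x
        - VectorField.mlieBracket 𝓘(ℝ, V) (fun y => cIm V y (X y)) (fun y => cIm V y (Y y)) x)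
    + Complex.I ⊗ₜ[ℝ]
      (VectorField.mlieBracket 𝓘(ℝ, V) (fun y => cRe V y (X y)) (fun y => cIm V y (Y y)) x
        + VectorField.mlieBracket 𝓘(ℝ, V) (fun y => cIm V y (X y)) (fun y => cRe V y (Y y)) x)

/-- Multiplication by `i` on a complex vector space, as a real-linear map. -/
def mulI : V →ₗ[ℝ] V where
  toFun v := Complex.I • v
  map_add' v w := smul_add Complex.I v w
  map_smul' c v := smul_comm Complex.I c v

/-- The complex structure `J` of the tangent space. -/
def J (x : M) : TangentSpace 𝓘(ℝ, V) x →ₗ[ℝ] TangentSpace 𝓘(ℝ, V) x := mulI V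

/-- The complex-linear extension of `J` to `T_ℂ M`. -/
def JC (x : M) : Module.End ℂ (CTan V x) := (J V x).baseChange ℂ

/-- The fibre of `T^{0,1} M`: the `(-i)`-eigenspace of `J` in `T_ℂ M`. -/
def T01 (x : M) : Submodule ℂ (CTan V x) := Module.End.eigenspace (JC V x) (-Complex.I)

theorem J_J (x : M) (v : TangentSpace 𝓘(ℝ, V) x) : J V x (J V x v) = -v := by
  have h : ∀ w : V, mulI V (mulI V w) = -w := fun w => by
    change Complex.I • (Complex.I • w) = -w
    rw [smul_smul, Complex.I_mul_I, neg_one_smul]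
  exact h v

theorem JC_JC (x : M) (X : CTan V x) : JC V x (JC V x X) = -X := by
  induction X using TensorProduct.induction_on with
  | zero => simp
  | tmul z v => simp [JC, J_J, TensorProduct.tmul_neg]
  | add a b ha hb => rw [map_add, map_add, ha, hb, neg_add]

/-- The projection `T_ℂ M = T^{1,0} M ⊕ T^{0,1} M → T^{0,1} M`, `X ↦ (X + i J X) / 2`. -/
def pr01 (x : M) : CTan V x →ₗ[ℂ] T01 V x :=
  LinearMap.codRestrict (T01 V x)
    ((1 / 2 : ℂ) • ((LinearMap.id : CTan V x →ₗ[ℂ] CTan V x) + Complex.I • JC V x))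
    (fun X => by
      rw [T01, Module.End.mem_eigenspace_iff]
      simp only [LinearMap.smul_apply, LinearMap.add_apply, LinearMap.id_apply, map_smul, map_add,
        JC_JC, smul_smul, smul_add, smul_neg]
      rw [show -Complex.I * (1 / 2 * Complex.I) = (1 / 2 : ℂ) by
            linear_combination (-1 / 2 : ℂ) * Complex.I_mul_I,
        show -Complex.I * (1 / 2 : ℂ) = -(1 / 2 * Complex.I) by ring, neg_smul]
      abel)

/-- The map `v ↦ (v - i J v) / 2` from `V` to its complexification. -/
def halfMap : V →ₗ[ℂ] ℂ ⊗[ℝ] V where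
  toFun v := (1 / 2 : ℂ) • ((1 : ℂ) ⊗ₜ[ℝ] v - Complex.I ⊗ₜ[ℝ] mulI V v)
  map_add' v w := by
    rw [map_add, TensorProduct.tmul_add, TensorProduct.tmul_add, ← smul_add]
    congr 1
    abel
  map_smul' c v := by
    have key : c • v = c.re • v + c.im • mulI V v := by
      change c • v = c.re • v + c.im • (Complex.I • v)
      conv_lhs => rw [← Complex.re_add_im c, add_smul, mul_smul]
      rfl
    have hJ : mulI V (mulI V v) = -v := by
      change Complex.I • (Complex.I • v) = -v
      rw [smul_smul, Complex.I_mul_I, neg_one_smul]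
    have h1 : ∀ (z : ℂ) (w : V), (z ⊗ₜ[ℝ] w : ℂ ⊗[ℝ] V) = z • ((1 : ℂ) ⊗ₜ[ℝ] w) := fun z w => by
      rw [TensorProduct.smul_tmul', smul_eq_mul, mul_one]
    have h2 : ∀ (r : ℝ) (w : V), ((1 : ℂ) ⊗ₜ[ℝ] (r • w) : ℂ ⊗[ℝ] V)
        = (r : ℂ) • ((1 : ℂ) ⊗ₜ[ℝ] w) := fun r w => by
      rw [TensorProduct.tmul_smul, TensorProduct.smul_tmul', ← h1, Complex.real_smul, mul_one]
    have h3 : c = (c.re : ℂ) + c.im * Complex.I := (Complex.re_add_im c).symm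
    rw [RingHom.id_apply, key, map_add, map_smul, map_smul, hJ, h1 Complex.I, h1 Complex.I,
      TensorProduct.tmul_add, TensorProduct.tmul_add, h2, h2, h2, h2, TensorProduct.tmul_neg,
      smul_comm c]
    congr 1
    conv_rhs => rw [h3]
    match_scalars
    · ring_nf
      try rw [Complex.I_sq]
      try ring
    · ring_nf
      try rw [Complex.I_sq]
      try ring

/-- The complex-linear isomorphism of the holomorphic tangent space `𝒯M` onto `T^{1,0} M`,
`v ↦ (v - i J v) / 2`, as a map into `T_ℂ M`. -/
def holTan (x : M) : TangentSpace 𝓘(ℂ, V) x →ₗ[ℂ] CTan V x := halfMap V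

/-- The derivative `v(f)` of a holomorphic function along a holomorphic tangent vector. -/
def holDeriv (x : M) (v : TangentSpace 𝓘(ℂ, V) x) (f : M → ℂ) : ℂ :=
  mfderiv 𝓘(ℂ, V) 𝓘(ℂ, ℂ) f x v

end Tangent

/-! ### Vector bundles and their local sections -/

/-- A family of complex vector spaces over `M`, with a notion of smoothness over open sets for its
sections. -/
structure SectionFamily (M : Type*) where
  /-- the fibres -/
  Fib : M → Type*
  [addCommGroup : ∀ x, AddCommGroup (Fib x)]
  [module : ∀ x, Module ℂ (Fib x)]
  /-- smoothness of the section `s` on `U` -/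
  SmoothOn : (Π x, Fib x) → Set M → Prop

attribute [instance] SectionFamily.addCommGroup SectionFamily.module

section Bundles

variable (V : Type*) [NormedAddCommGroup V] [NormedSpace ℂ V]
  {M : Type*} [TopologicalSpace M] [ChartedSpace V M]

/-- A structure of smooth complex vector bundle of finite rank on the family of vector spaces
`Fib`: the trivializations are complex linear and their transition functions are smooth over
the real manifold `M`. -/
structure SmoothVectorBundle (Fib : M → Type*) [∀ x, AddCommGroup (Fib x)]
    [∀ x, Module ℂ (Fib x)] where
  /-- the model fibre -/
  F : Type
  [normedAddCommGroup : NormedAddCommGroup F]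
  [normedSpace : NormedSpace ℂ F]
  [finiteDimensional : FiniteDimensional ℂ F]
  [topFib : ∀ x, TopologicalSpace (Fib x)]
  [topTotal : TopologicalSpace (TotalSpace F Fib)]
  [fiberBundle : FiberBundle F Fib]
  [vectorBundle : VectorBundle ℂ F Fib]
  [realVectorBundle : VectorBundle ℝ F Fib]
  [smooth : ContMDiffVectorBundle ∞ F Fib 𝓘(ℝ, V)]

/-- A structure of holomorphic vector bundle of finite rank on the family of vector spaces
`Fib`. -/
structure HolVectorBundle (Fib : M → Type*) [∀ x, AddCommGroup (Fib x)]
    [∀ x, Module ℂ (Fib x)] where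
  /-- the model fibre -/
  F : Type*
  [normedAddCommGroup : NormedAddCommGroup F]
  [normedSpace : NormedSpace ℂ F]
  [finiteDimensional : FiniteDimensional ℂ F]
  [topFib : ∀ x, TopologicalSpace (Fib x)]
  [topTotal : TopologicalSpace (TotalSpace F Fib)]
  [fiberBundle : FiberBundle F Fib]
  [vectorBundle : VectorBundle ℂ F Fib]
  [holomorphic : ContMDiffVectorBundle ω F Fib 𝓘(ℂ, V)]

attribute [instance] SmoothVectorBundle.normedAddCommGroup SmoothVectorBundle.normedSpace
  SmoothVectorBundle.topTotal HolVectorBundle.normedAddCommGroup HolVectorBundle.normedSpace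
  HolVectorBundle.topTotal

variable {V}

/-- The smooth sections on `U` of a smooth vector bundle. -/
def SmoothVectorBundle.SmoothOn {Fib : M → Type*} [∀ x, AddCommGroup (Fib x)]
    [∀ x, Module ℂ (Fib x)] (B : SmoothVectorBundle V Fib) (s : Π x, Fib x) (U : Set M) : Prop :=
  letI := B.topFib
  letI := B.fiberBundle
  ContMDiffOn 𝓘(ℝ, V) (𝓘(ℝ, V).prod 𝓘(ℝ, B.F)) ∞ (fun x => TotalSpace.mk' B.F x (s x)) U

variable (V) in
/-- `E` is a smooth complex vector bundle: its smooth local sections are those of a structure of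
smooth complex vector bundle on its fibres. -/
def IsSmoothVectorBundle (E : SectionFamily M) : Prop :=
  ∃ B : SmoothVectorBundle V E.Fib,
    ∀ U : Set M, IsOpen U → ∀ s : Π x, E.Fib x, E.SmoothOn s U ↔ B.SmoothOn s U

namespace HolVectorBundle

variable {Fib : M → Type*} [∀ x, AddCommGroup (Fib x)] [∀ x, Module ℂ (Fib x)]

/-- The holomorphic sections on `U` of a holomorphic vector bundle. -/
def HolOn (E : HolVectorBundle V Fib) (s : Π x, Fib x) (U : Set M) : Prop :=
  letI := E.topFib
  letI := E.fiberBundle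
  ContMDiffOn 𝓘(ℂ, V) (𝓘(ℂ, V).prod 𝓘(ℂ, E.F)) ω (fun x => TotalSpace.mk' E.F x (s x)) U

/-- The underlying smooth complex vector bundle of a holomorphic vector bundle. -/
abbrev smooth (E : HolVectorBundle V Fib) : SectionFamily M where
  Fib := Fib
  SmoothOn s U :=
    letI := E.topFib
    letI := E.fiberBundle
    ContMDiffOn 𝓘(ℝ, V) (𝓘(ℝ, V).prod 𝓘(ℝ, E.F)) ∞ (fun x => TotalSpace.mk' E.F x (s x)) U

/-- The Dolbeault operator `∂̄_X e` at `x`, for `X` in the fibre of `T^{0,1} M` at `x`: in the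
holomorphic trivialization at `x`, it is the derivative along `X` of the components of `e`. -/
def dbarAt (E : HolVectorBundle V Fib) (x : M) (X : T01 V x) (e : Π y, Fib y) : Fib x :=
  letI := E.topFib
  letI := E.fiberBundle
  (trivializationAt E.F Fib x).symm x
    (cDeriv V x (X : CTan V x) (fun y => (trivializationAt E.F Fib x ⟨y, e y⟩).2))

/-- The Dolbeault operator on sections, `(X, e) ↦ ∂̄_X e`. -/
def dbar (E : HolVectorBundle V Fib) (X : Π x : M, T01 V x) (e : Π x, Fib x) : Π x, Fib x :=
  fun x => E.dbarAt x (X x) e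

end HolVectorBundle

/-! ### Smooth Lie algebroids -/

variable (V M) in
/-- The data of a (smooth, complex) Lie algebroid. The brackets on the spaces of sections over all
open sets are recorded as one operation on sections; its value at `x` is only meaningful
for sections which are smooth near `x`. -/
structure LieAlgebroidData extends SectionFamily M where
  /-- the anchor -/
  anchor : ∀ x, Fib x →ₗ[ℂ] CTan V x
  /-- the bracket of sections -/
  bracket : (Π x, Fib x) → (Π x, Fib x) → Π x, Fib x

variable [IsManifold 𝓘(ℂ, V) ω M]

/-- `A` is a smooth Lie `ℂ`-algebroid. -/
structure IsLieAlgebroid (A : LieAlgebroidData V M) : Prop where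
  vectorBundle : IsSmoothVectorBundle V A.toSectionFamily
  anchor_smooth : ∀ U : Set M, IsOpen U → ∀ s, A.SmoothOn s U →
    CSmoothOn V (fun x => A.anchor x (s x)) U
  bracket_smooth : ∀ U : Set M, IsOpen U → ∀ s t, A.SmoothOn s U → A.SmoothOn t U →
    A.SmoothOn (A.bracket s t) U
  bracket_local : ∀ U : Set M, IsOpen U → ∀ s s' t t', A.SmoothOn s U → A.SmoothOn t U →
    (∀ x ∈ U, s x = s' x) → (∀ x ∈ U, t x = t' x) → ∀ x ∈ U, A.bracket s t x = A.bracket s' t' x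
  bracket_add : ∀ U : Set M, IsOpen U → ∀ s t t', A.SmoothOn s U → A.SmoothOn t U →
    A.SmoothOn t' U → ∀ x ∈ U, A.bracket s (t + t') x = A.bracket s t x + A.bracket s t' x
  bracket_smul : ∀ U : Set M, IsOpen U → ∀ (c : ℂ) (s t), A.SmoothOn s U → A.SmoothOn t U →
    ∀ x ∈ U, A.bracket s (c • t) x = c • A.bracket s t x
  bracket_skew : ∀ U : Set M, IsOpen U → ∀ s t, A.SmoothOn s U → A.SmoothOn t U →
    ∀ x ∈ U, A.bracket s t x = -A.bracket t s x
  jacobi : ∀ U : Set M, IsOpen U → ∀ s t u, A.SmoothOn s U → A.SmoothOn t U → A.SmoothOn u U →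
    ∀ x ∈ U, A.bracket s (A.bracket t u) x + A.bracket t (A.bracket u s) x
      + A.bracket u (A.bracket s t) x = 0
  anchor_bracket : ∀ U : Set M, IsOpen U → ∀ s t, A.SmoothOn s U → A.SmoothOn t U →
    ∀ x ∈ U, A.anchor x (A.bracket s t x)
      = cLie V (fun y => A.anchor y (s y)) (fun y => A.anchor y (t y)) x
  leibniz : ∀ U : Set M, IsOpen U → ∀ (f : M → ℂ) (s t),
    ContMDiffOn 𝓘(ℝ, V) 𝓘(ℝ, ℂ) ∞ f U → A.SmoothOn s U → A.SmoothOn t U →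
    ∀ x ∈ U, A.bracket s (fun y => f y • t y) x
      = cDeriv V x (A.anchor x (s x)) f • t x + f x • A.bracket s t x

/-- Base-preserving morphisms of Lie algebroids. -/
structure IsLieAlgebroidMorphism (A B : LieAlgebroidData V M)
    (φ : ∀ x, A.Fib x →ₗ[ℂ] B.Fib x) : Prop where
  smooth : ∀ U : Set M, IsOpen U → ∀ s, A.SmoothOn s U → B.SmoothOn (fun x => φ x (s x)) U
  anchor : ∀ x a, B.anchor x (φ x a) = A.anchor x a
  bracket : ∀ U : Set M, IsOpen U → ∀ s t, A.SmoothOn s U → A.SmoothOn t U →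
    ∀ x ∈ U, φ x (A.bracket s t x) = B.bracket (fun y => φ y (s y)) (fun y => φ y (t y)) x

/-- Base-preserving isomorphisms of Lie algebroids. -/
def IsLieAlgebroidIso (A B : LieAlgebroidData V M) (φ : ∀ x, A.Fib x ≃ₗ[ℂ] B.Fib x) : Prop :=
  IsLieAlgebroidMorphism A B (fun x => (φ x).toLinearMap) ∧
    IsLieAlgebroidMorphism B A (fun x => (φ x).symm.toLinearMap)

/-- `(L, A)` is a Lie pair: `A` is a Lie subalgebroid of `L` through the inclusion `i`. -/
structure IsLiePair (L A : LieAlgebroidData V M) (i : ∀ x, A.Fib x →ₗ[ℂ] L.Fib x) : Prop where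
  lieAlgebroid : IsLieAlgebroid L
  lieAlgebroid_sub : IsLieAlgebroid A
  morphism : IsLieAlgebroidMorphism A L i
  injective : ∀ x, Function.Injective (i x)

/-- `nab` is a flat connection of the Lie algebroid `A` on the vector bundle `E`. -/
structure IsFlatConnection (A : LieAlgebroidData V M) (E : SectionFamily M)
    (nab : (Π x, A.Fib x) → (Π x, E.Fib x) → Π x, E.Fib x) : Prop where
  smooth : ∀ U : Set M, IsOpen U → ∀ a e, A.SmoothOn a U → E.SmoothOn e U →
    E.SmoothOn (nab a e) U
  nab_local : ∀ U : Set M, IsOpen U → ∀ a a' e e', A.SmoothOn a U → E.SmoothOn e U →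
    (∀ x ∈ U, a x = a' x) → (∀ x ∈ U, e x = e' x) → ∀ x ∈ U, nab a e x = nab a' e' x
  add_left : ∀ U : Set M, IsOpen U → ∀ a a' e, A.SmoothOn a U → A.SmoothOn a' U →
    E.SmoothOn e U → ∀ x ∈ U, nab (a + a') e x = nab a e x + nab a' e x
  add_right : ∀ U : Set M, IsOpen U → ∀ a e e', A.SmoothOn a U → E.SmoothOn e U →
    E.SmoothOn e' U → ∀ x ∈ U, nab a (e + e') x = nab a e x + nab a e' x
  smul_left : ∀ U : Set M, IsOpen U → ∀ (f : M → ℂ) (a e),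
    ContMDiffOn 𝓘(ℝ, V) 𝓘(ℝ, ℂ) ∞ f U → A.SmoothOn a U → E.SmoothOn e U →
    ∀ x ∈ U, nab (fun y => f y • a y) e x = f x • nab a e x
  leibniz : ∀ U : Set M, IsOpen U → ∀ (f : M → ℂ) (a e),
    ContMDiffOn 𝓘(ℝ, V) 𝓘(ℝ, ℂ) ∞ f U → A.SmoothOn a U → E.SmoothOn e U →
    ∀ x ∈ U, nab a (fun y => f y • e y) x
      = f x • nab a e x + cDeriv V x (A.anchor x (a x)) f • e x
  flat : ∀ U : Set M, IsOpen U → ∀ a b e, A.SmoothOn a U → A.SmoothOn b U → E.SmoothOn e U →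
    ∀ x ∈ U, nab a (nab b e) x - nab b (nab a e) x - nab (A.bracket a b) e x = 0

/-- `(L, A, E)` is a Lie triad, where `A` is included in `L` by `i` and `nab` is the flat
`A`-connection on `E`. -/
structure IsLieTriad (L A : LieAlgebroidData V M) (i : ∀ x, A.Fib x →ₗ[ℂ] L.Fib x)
    (E : SectionFamily M) (nab : (Π x, A.Fib x) → (Π x, E.Fib x) → Π x, E.Fib x) : Prop where
  liePair : IsLiePair L A i
  vectorBundle : IsSmoothVectorBundle V E
  flatConnection : IsFlatConnection A E nab

/-- The direct sum `A ⊕ B` with the bracket and the anchor given by a pair of operations `DA` of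
`A` on `B` and `DB` of `B` on `A`:
`[a + b, a' + b'] = [a, a'] + D_b a' - D_{b'} a + [b, b'] + D_a b' - D_{a'} b`. -/
abbrev matchedSum (A B : LieAlgebroidData V M)
    (DA : (Π x, A.Fib x) → (Π x, B.Fib x) → Π x, B.Fib x)
    (DB : (Π x, B.Fib x) → (Π x, A.Fib x) → Π x, A.Fib x) : LieAlgebroidData V M where
  Fib x := A.Fib x × B.Fib x
  SmoothOn s U := A.SmoothOn (fun x => (s x).1) U ∧ B.SmoothOn (fun x => (s x).2) U
  anchor x := (A.anchor x).coprod (B.anchor x)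
  bracket s t x :=
    let a := fun y => (s y).1
    let b := fun y => (s y).2
    let a' := fun y => (t y).1
    let b' := fun y => (t y).2
    (A.bracket a a' x + DB b a' x - DB b' a x, B.bracket b b' x + DA a b' x - DA a' b x)

/-- `A` and `B` form a matched pair, with matched sum `A ⋈ B` given by the (Bott) connections
`DA` and `DB`: the sum is a Lie algebroid which has `A ⊕ 0` and `0 ⊕ B` as Lie subalgebroids. -/
structure IsMatchedPair (A B : LieAlgebroidData V M)
    (DA : (Π x, A.Fib x) → (Π x, B.Fib x) → Π x, B.Fib x)
    (DB : (Π x, B.Fib x) → (Π x, A.Fib x) → Π x, A.Fib x) : Prop where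
  left : IsLiePair (matchedSum A B DA DB) A (fun _ => LinearMap.inl ℂ _ _)
  right : IsLiePair (matchedSum A B DA DB) B (fun _ => LinearMap.inr ℂ _ _)
  bott_left : IsFlatConnection A B.toSectionFamily DA
  bott_right : IsFlatConnection B A.toSectionFamily DB

variable (V M) in
/-- The Lie algebroid `T^{0,1} M`, with the inclusion in `T_ℂ M` as anchor and the Lie bracket of
complex vector fields. -/
abbrev T01Algebroid : LieAlgebroidData V M where
  Fib x := T01 V x
  SmoothOn X U := CSmoothOn V (fun x => (X x : CTan V x)) U
  anchor x := (T01 V x).subtype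
  bracket X Y x := pr01 V x (cLie V (fun y => (X y : CTan V y)) (fun y => (Y y : CTan V y)) x)

/-- For a Lie algebroid `A` with anchor in `T^{1,0} M`, the operation `∂_{ρ(l)} X` of `A` on
`T^{0,1} M`: the `(0,1)`-part of `[ρ(l), X]`. -/
def del (A : LieAlgebroidData V M) (l : Π x, A.Fib x) (X : Π x : M, T01 V x) :
    Π x : M, T01 V x :=
  fun x => pr01 V x (cLie V (fun y => A.anchor y (l y)) (fun y => (X y : CTan V y)) x)

/-! ### Atiyah algebroids -/

/-- `e` is smooth in a neighbourhood of `x`. -/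
def SectionFamily.SmoothNear (E : SectionFamily M) (e : Π x, E.Fib x) (x : M) : Prop :=
  ∃ U : Set M, IsOpen U ∧ x ∈ U ∧ E.SmoothOn e U

variable (V) in
/-- The fibre at `m` of the Atiyah algebroid `𝔇(E)`: covariant derivative operators `δ` at `m`,
with values in `E_m`, equipped with a symbol `X` in `T_ℂ M` at `m`, such that
`δ(f e) = f(m) δ(e) + X(f) e(m)`. They act on the sections of `E` which are smooth near `m`
(by the Leibniz rule with a cut-off `f`, only the germ of `e` matters); we put
`δ(e) = 0` if `e` is not smooth near `m`, so that `δ` is determined by its meaningful values. -/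
def covDer (E : SectionFamily M) (m : M) :
    Submodule ℂ (((Π x, E.Fib x) → E.Fib m) × CTan V m) where
  carrier := {p | (∀ e, ¬ E.SmoothNear e m → p.1 e = 0) ∧
    (∀ e e', E.SmoothNear e m → E.SmoothNear e' m → p.1 (e + e') = p.1 e + p.1 e') ∧
    (∀ (c : ℂ) (e), E.SmoothNear e m → p.1 (c • e) = c • p.1 e) ∧
    ∀ (f : M → ℂ) (e), (∃ U : Set M, IsOpen U ∧ m ∈ U ∧ ContMDiffOn 𝓘(ℝ, V) 𝓘(ℝ, ℂ) ∞ f U) →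
      E.SmoothNear e m → p.1 (fun y => f y • e y) = f m • p.1 e + cDeriv V m p.2 f • e m}
  zero_mem' := by
    refine ⟨fun _ _ => rfl, fun _ _ _ _ => by simp, fun _ _ _ => by simp, fun f e _ _ => ?_⟩
    have : cDeriv V m (0 : CTan V m) f = 0 := by
      simpa using cDeriv_smul V m 0 (0 : CTan V m) f
    simp [this]
  add_mem' := by
    rintro p q ⟨p0, p1, p2, p3⟩ ⟨q0, q1, q2, q3⟩
    refine ⟨fun e h => ?_, fun e e' h h' => ?_, fun c e h => ?_, fun f e hf h => ?_⟩
    · simp [p0 e h, q0 e h]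
    · simp only [Prod.fst_add, Pi.add_apply, p1 e e' h h', q1 e e' h h']
      abel
    · simp only [Prod.fst_add, Pi.add_apply, p2 c e h, q2 c e h, smul_add]
    · simp only [Prod.fst_add, Prod.snd_add, Pi.add_apply, p3 f e hf h, q3 f e hf h, smul_add,
        cDeriv_add, add_smul]
      abel
  smul_mem' := by
    rintro c p ⟨p0, p1, p2, p3⟩
    refine ⟨fun e h => ?_, fun e e' h h' => ?_, fun c' e h => ?_, fun f e hf h => ?_⟩
    · simp [p0 e h]
    · simp only [Prod.smul_fst, Pi.smul_apply, p1 e e' h h', smul_add]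
    · simp only [Prod.smul_fst, Pi.smul_apply, p2 c' e h, smul_comm c c']
    · simp only [Prod.smul_fst, Prod.smul_snd, Pi.smul_apply, p3 f e hf h, smul_add,
        smul_comm c (f m), cDeriv_smul, mul_smul]

/-- The fibre at `m` of the `A`-Atiyah algebroid `𝔇_A(E)`: the pairs `(δ, l)` in
`𝔇(E)_m × A_m` such that the symbol of `δ` is the anchor of `l`. -/
def atiyahFib (A : LieAlgebroidData V M) (E : SectionFamily M) (m : M) :
    Submodule ℂ ((((Π x, E.Fib x) → E.Fib m) × CTan V m) × A.Fib m) :=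
  (covDer V E m).comap (LinearMap.fst ℂ _ _) ⊓
    LinearMap.eqLocus (LinearMap.snd ℂ _ _ ∘ₗ LinearMap.fst ℂ _ _)
      (A.anchor m ∘ₗ LinearMap.snd ℂ _ _)

variable {A : LieAlgebroidData V M} {E : SectionFamily M}

/-- The operator `δ` of `(δ, l)`, on sections of `E` near `m`. -/
def opAt {m : M} (d : atiyahFib A E m) (e : Π x, E.Fib x) : E.Fib m := d.1.1.1 e

/-- The `A`-symbol `l` of `(δ, l)`. -/
def symAt {m : M} (d : atiyahFib A E m) : A.Fib m := d.1.2

/-- The operator `δ` of a section `(δ, l)` of `𝔇_A(E)`. -/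
def op (s : Π x, atiyahFib A E x) (e : Π x, E.Fib x) : Π x, E.Fib x := fun x => opAt (s x) e

/-- The `A`-symbol `l` of a section `(δ, l)` of `𝔇_A(E)`. -/
def sym (s : Π x, atiyahFib A E x) : Π x, A.Fib x := fun x => symAt (s x)

variable (A E) in
open Classical in
/-- The element of `𝔇_A(E)` at `m` with operator `δ` and `A`-symbol `l`, if there is one
(and `0` otherwise). -/
def atiyahMk (m : M) (δ : (Π x, E.Fib x) → E.Fib m) (l : A.Fib m) : atiyahFib A E m :=
  let p : (((Π x, E.Fib x) → E.Fib m) × CTan V m) × A.Fib m :=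
    ((fun e => if E.SmoothNear e m then δ e else 0, A.anchor m l), l)
  if h : p ∈ atiyahFib A E m then ⟨p, h⟩ else 0

variable (A E) in
/-- The `A`-Atiyah algebroid `𝔇_A(E)`. A section `(δ, l)` is smooth if `l` is smooth and `δ` maps
smooth sections to smooth sections. The bracket is `([δ, δ'], [l, l'])` and the anchor of
`(δ, l)` is the anchor of `l`. -/
abbrev atiyah : LieAlgebroidData V M where
  Fib m := atiyahFib A E m
  SmoothOn s U := A.SmoothOn (sym s) U ∧
    ∀ W : Set M, IsOpen W → W ⊆ U → ∀ e, E.SmoothOn e W → E.SmoothOn (op s e) W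
  anchor m := A.anchor m ∘ₗ LinearMap.snd ℂ _ _ ∘ₗ (atiyahFib A E m).subtype
  bracket s t m := atiyahMk A E m
    (fun e => opAt (s m) (op t e) - opAt (t m) (op s e)) (A.bracket (sym s) (sym t) m)

variable (A E) in
/-- For smooth sections, the bracket of `𝔇_A(E)` is `([δ, δ'], [l, l'])`, i.e. this pair is an
element of the fibre of `𝔇_A(E)`. -/
def AtiyahBracketFormula : Prop :=
  ∀ U : Set M, IsOpen U → ∀ s t : Π x, atiyahFib A E x,
    (atiyah A E).SmoothOn s U → (atiyah A E).SmoothOn t U → ∀ x ∈ U,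
      symAt ((atiyah A E).bracket s t x) = A.bracket (sym s) (sym t) x ∧
      ∀ e, E.SmoothNear e x →
        opAt ((atiyah A E).bracket s t x) e = op s (op t e) x - op t (op s e) x

/-- For connections `DA` of `A` on `B`, `DB` of `B` on `A` and `nab` of `A` on `E`, the operation
of `A` on `𝔇_B(E)` given by `D_a(δ, b) = ([∇_a, δ] + ∇_{D_b a}, D_a b)`. -/
def bottAtiyah (A B : LieAlgebroidData V M) (E : SectionFamily M)
    (DA : (Π x, A.Fib x) → (Π x, B.Fib x) → Π x, B.Fib x)
    (DB : (Π x, B.Fib x) → (Π x, A.Fib x) → Π x, A.Fib x)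
    (nab : (Π x, A.Fib x) → (Π x, E.Fib x) → Π x, E.Fib x)
    (a : Π x, A.Fib x) (s : Π x, atiyahFib B E x) : Π x, atiyahFib B E x :=
  fun m => atiyahMk B E m
    (fun e => nab a (op s e) m - opAt (s m) (nab a e) + nab (DB (sym s) a) e m) (DA a (sym s) m)

/-- For smooth sections, `bottAtiyah` is indeed given by
`D_a(δ, b) = ([∇_a, δ] + ∇_{D_b a}, D_a b)`, i.e. this pair is an element of the fibre of
`𝔇_B(E)`. -/
def BottAtiyahFormula (A B : LieAlgebroidData V M) (E : SectionFamily M)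
    (DA : (Π x, A.Fib x) → (Π x, B.Fib x) → Π x, B.Fib x)
    (DB : (Π x, B.Fib x) → (Π x, A.Fib x) → Π x, A.Fib x)
    (nab : (Π x, A.Fib x) → (Π x, E.Fib x) → Π x, E.Fib x) : Prop :=
  ∀ U : Set M, IsOpen U → ∀ (a : Π x, A.Fib x) (s : Π x, atiyahFib B E x),
    A.SmoothOn a U → (atiyah B E).SmoothOn s U → ∀ x ∈ U,
      symAt (bottAtiyah A B E DA DB nab a s x) = DA a (sym s) x ∧
      ∀ e, E.SmoothNear e x →
        opAt (bottAtiyah A B E DA DB nab a s x) e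
          = nab a (op s e) x - op s (nab a e) x + nab (DB (sym s) a) e x

/-! ### Holomorphic Lie algebroids -/

variable (V) in
/-- A structure of holomorphic Lie algebroid on the family of complex vector spaces `Fib`. The
brackets on the spaces of holomorphic sections over all open sets are recorded as one operation on
sections, of which only the values on holomorphic local sections are meaningful. -/
structure HolLieAlgebroid (Fib : M → Type*) [∀ x, AddCommGroup (Fib x)]
    [∀ x, Module ℂ (Fib x)] extends HolVectorBundle V Fib where
  /-- the anchor -/
  anchor : ∀ x, Fib x →ₗ[ℂ] TangentSpace 𝓘(ℂ, V) x
  /-- the bracket of sections -/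
  bracket : (Π x, Fib x) → (Π x, Fib x) → Π x, Fib x
  anchor_hol : ∀ U : Set M, IsOpen U → ∀ s, toHolVectorBundle.HolOn s U →
    ContMDiffOn 𝓘(ℂ, V) 𝓘(ℂ, V).tangent ω
      (fun x => (⟨x, anchor x (s x)⟩ : TangentBundle 𝓘(ℂ, V) M)) U
  bracket_hol : ∀ U : Set M, IsOpen U → ∀ s t, toHolVectorBundle.HolOn s U →
    toHolVectorBundle.HolOn t U → toHolVectorBundle.HolOn (bracket s t) U
  bracket_local : ∀ U : Set M, IsOpen U → ∀ s s' t t', toHolVectorBundle.HolOn s U →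
    toHolVectorBundle.HolOn t U → (∀ x ∈ U, s x = s' x) → (∀ x ∈ U, t x = t' x) →
    ∀ x ∈ U, bracket s t x = bracket s' t' x
  bracket_add : ∀ U : Set M, IsOpen U → ∀ s t t', toHolVectorBundle.HolOn s U →
    toHolVectorBundle.HolOn t U → toHolVectorBundle.HolOn t' U →
    ∀ x ∈ U, bracket s (t + t') x = bracket s t x + bracket s t' x
  bracket_smul : ∀ U : Set M, IsOpen U → ∀ (c : ℂ) (s t), toHolVectorBundle.HolOn s U →
    toHolVectorBundle.HolOn t U → ∀ x ∈ U, bracket s (c • t) x = c • bracket s t x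
  bracket_skew : ∀ U : Set M, IsOpen U → ∀ s t, toHolVectorBundle.HolOn s U →
    toHolVectorBundle.HolOn t U → ∀ x ∈ U, bracket s t x = -bracket t s x
  jacobi : ∀ U : Set M, IsOpen U → ∀ s t u, toHolVectorBundle.HolOn s U →
    toHolVectorBundle.HolOn t U → toHolVectorBundle.HolOn u U →
    ∀ x ∈ U, bracket s (bracket t u) x + bracket t (bracket u s) x + bracket u (bracket s t) x = 0
  anchor_bracket : ∀ U : Set M, IsOpen U → ∀ s t, toHolVectorBundle.HolOn s U →
    toHolVectorBundle.HolOn t U → ∀ x ∈ U, anchor x (bracket s t x)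
      = VectorField.mlieBracket 𝓘(ℂ, V) (fun y => anchor y (s y)) (fun y => anchor y (t y)) x
  leibniz : ∀ U : Set M, IsOpen U → ∀ (f : M → ℂ) (s t),
    ContMDiffOn 𝓘(ℂ, V) 𝓘(ℂ, ℂ) ω f U → toHolVectorBundle.HolOn s U →
    toHolVectorBundle.HolOn t U → ∀ x ∈ U, bracket s (fun y => f y • t y) x
      = holDeriv V x (anchor x (s x)) f • t x + f x • bracket s t x

section Hol

variable {Fib : M → Type*} [∀ x, AddCommGroup (Fib x)] [∀ x, Module ℂ (Fib x)]

/-- The underlying smooth complex vector bundle of `𝓛`, with the anchor corresponding to that of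
`𝓛` under `𝒯M ≅ T^{1,0} M`, and with a given bracket of smooth sections. -/
abbrev HolLieAlgebroid.withBracket (𝓛 : HolLieAlgebroid V Fib)
    (br : (Π x, Fib x) → (Π x, Fib x) → Π x, Fib x) : LieAlgebroidData V M where
  toSectionFamily := 𝓛.toHolVectorBundle.smooth
  anchor x := holTan V x ∘ₗ 𝓛.anchor x
  bracket := br

end Hol

/-- The Bott connection of `T^{0,1} M` on `𝔇_L(E)`, for `L` the Lie algebroid `𝓛.withBracket br`
and `E` underlying `𝓔`: `D_X(δ, l) = ([∂̄_X, δ] + ∂̄_{∂_{ρ(l)} X}, ∂̄_X l)`. -/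
abbrev dbarAtiyah {LF EF : M → Type*} [∀ x, AddCommGroup (LF x)] [∀ x, Module ℂ (LF x)]
    [∀ x, AddCommGroup (EF x)] [∀ x, Module ℂ (EF x)]
    (𝓛 : HolLieAlgebroid V LF) (br : (Π x, LF x) → (Π x, LF x) → Π x, LF x)
    (𝓔 : HolVectorBundle V EF) (X : Π x : M, T01 V x)
    (s : Π x, atiyahFib (𝓛.withBracket br) 𝓔.smooth x) :
    Π x, atiyahFib (𝓛.withBracket br) 𝓔.smooth x :=
  bottAtiyah (T01Algebroid V M) (𝓛.withBracket br) 𝓔.smooth 𝓛.dbar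
    (del (𝓛.withBracket br)) 𝓔.dbar X s

/-- The smooth Lie algebroid `A` underlies the holomorphic Lie algebroid `𝓐` (with the same
fibres): it has the underlying smooth vector bundle, the anchors correspond under
`𝒯M ≅ T^{1,0} M`, and the bracket of `A` extends that of holomorphic sections. -/
structure Underlies (A : LieAlgebroidData V M) (𝓐 : HolLieAlgebroid V A.Fib) : Prop where
  lieAlgebroid : IsLieAlgebroid A
  smoothOn : ∀ U : Set M, IsOpen U → ∀ s : Π x, A.Fib x,
    A.SmoothOn s U ↔ 𝓐.toHolVectorBundle.smooth.SmoothOn s U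
  anchor : ∀ x a, A.anchor x a = holTan V x (𝓐.anchor x a)
  bracket : ∀ U : Set M, IsOpen U → ∀ s t, 𝓐.HolOn s U → 𝓐.HolOn t U →
    ∀ x ∈ U, A.bracket s t x = 𝓐.bracket s t x

/-- `δ` is a holomorphic covariant `𝓛`-differential operator on `𝓔` over the open set `U`, with
holomorphic symbol `l`: over the open subsets of `U`, it maps holomorphic sections to holomorphic
sections compatibly with restrictions, it is additive, and
`δ(f e) = f δ(e) + ρ(l)(f) e` for holomorphic functions `f`. -/
structure IsHolCovDiffOp {LF EF : M → Type*} [∀ x, AddCommGroup (LF x)] [∀ x, Module ℂ (LF x)]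
    [∀ x, AddCommGroup (EF x)] [∀ x, Module ℂ (EF x)]
    (𝓛 : HolLieAlgebroid V LF) (𝓔 : HolVectorBundle V EF) (U : Set M)
    (δ : (Π x, EF x) → Π x, EF x) (l : Π x, LF x) : Prop where
  symbol_hol : 𝓛.HolOn l U
  hol : ∀ W : Set M, IsOpen W → W ⊆ U → ∀ e, 𝓔.HolOn e W → 𝓔.HolOn (δ e) W
  op_local : ∀ W : Set M, IsOpen W → W ⊆ U → ∀ e e', 𝓔.HolOn e W →
    (∀ x ∈ W, e x = e' x) → ∀ x ∈ W, δ e x = δ e' x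
  add : ∀ W : Set M, IsOpen W → W ⊆ U → ∀ e e', 𝓔.HolOn e W → 𝓔.HolOn e' W →
    ∀ x ∈ W, δ (e + e') x = δ e x + δ e' x
  leibniz : ∀ W : Set M, IsOpen W → W ⊆ U → ∀ (f : M → ℂ) (e),
    ContMDiffOn 𝓘(ℂ, V) 𝓘(ℂ, ℂ) ω f W → 𝓔.HolOn e W →
    ∀ x ∈ W, δ (fun y => f y • e y) x = f x • δ e x
      + holDeriv V x (𝓛.anchor x (l x)) f • e x

end Bundles

end HolAtiyah

end

noncomputable section

open scoped Topology

set_option linter.unusedSectionVars false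

/-! The whole argument is local and takes place in frames.

Calculus. A complex tangent vector is determined by its action on the chart coordinates `z_k` and
their conjugates, and the bracket of complex fields acts on functions as a commutator
(`cDeriv_cLie`). Vectors of type (0,1) kill holomorphic functions, and vectors of type (1,0) kill
antiholomorphic ones. In any holomorphic frame the Dolbeault operator differentiates components
(`HolFrame.c_dbarAt`), because the transition functions are holomorphic and therefore killed by
(0,1)-vectors. Likewise `∂_{ρ(l)}` differentiates components in the frame `∂/∂z̄_k`
(`cDeriv_del_zbar`). Any operation of this shape is a flat connection, by the commutator formula
(`isFlatConnection_of_frames`).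

Matched pair. If a bracket is skew and local and satisfies the Leibniz rule, then its smoothness,
its compatibility with the anchor and the Jacobi identity need only be checked on local frames
(`IsPreLie.isLieAlgebroid`), since the defects are linear over smooth functions. For the sum of
`T^{0,1} M` and `L`, take the frame consisting of the `∂/∂z̄_k` and a holomorphic frame of `L`.
Every bracket involving some `∂/∂z̄_k` vanishes, and the others are brackets of holomorphic
sections, so the axioms reduce to those of the holomorphic algebroid
(`Underlies.matchedSum_isLieAlgebroid`). The same principle constructs `L` itself: the bracket of a
holomorphic frame is extended to smooth sections by the Leibniz rule
(`HolLieAlgebroid.exists_underlies`).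

Atiyah algebroid. By the Leibniz rule an element `(δ, l)` is determined by `l` and by the values of
`δ` on a frame (`opAt_frame`). Hence matrix units together with frame-parallel derivatives form a
frame of the Atiyah algebroid. Its bracket is the commutator of operators, so the axioms follow from
those of operators and symbols. Built from holomorphic frames, these frames have holomorphic
transition functions. They define a holomorphic bundle whose holomorphic sections are the pairs with
holomorphic symbol whose operator preserves holomorphic sections (`exists_isHolAtiyah`), and this
bundle is a holomorphic Lie algebroid. Its Dolbeault operator is the Bott operator `D_X`
(`IsHolAtiyah.dbar_eq`): applied to a holomorphic frame section `e_j`, two of the three terms of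
`D_X` vanish and `∂̄_X(δ e_j)` remains. Consequently the matched pair for the Atiyah algebroid needs
no separate computation: it is the matched pair statement for the holomorphic Atiyah algebroid in
place of the original one. The isomorphism is a direct check, in which flatness of `∂̄` on `E`
accounts for the (0,1)-brackets and the formula for `D_X` for the mixed terms.

Holomorphic sections. A smooth section killed by `∂̄` satisfies the Cauchy–Riemann equations in
holomorphic frames, hence is analytic by Osgood's lemma (`HolVectorBundle.holOn_of_dbarAt`). An
operator given only on holomorphic sections extends to smooth ones by its values on a holomorphic
frame and the Leibniz rule (`IsHolCovDiffOp.exists_section`), and such values determine it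
(`HolAtiyahOn.eq_of`). -/

namespace HolAtiyah

/-! ### Osgood's lemma: from complex differentiability to analyticity in several variables. -/

section Osgood
variable {V F : Type*} [NormedAddCommGroup V] [NormedSpace ℂ V]
  [NormedAddCommGroup F] [NormedSpace ℂ F]

/-- A real-linear map which commutes with `i`, as a complex-linear map. -/
def complexOfReal (g : V →L[ℝ] F) (h : ∀ v, g (Complex.I • v) = Complex.I • g v) : V →L[ℂ] F where
  toFun := g
  map_add' := g.map_add
  map_smul' c v := by
    have h1 : ∀ w : V, c • w = c.re • w + c.im • (Complex.I • w) := fun w => by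
      conv_lhs => rw [← Complex.re_add_im c, add_smul, mul_smul]
      rfl
    have h2 : ∀ w : F, c • w = c.re • w + c.im • (Complex.I • w) := fun w => by
      conv_lhs => rw [← Complex.re_add_im c, add_smul, mul_smul]
      rfl
    simp [h1, h2, h]
  cont := g.cont

theorem differentiableAt_complex_of_real {f : V → F} {x : V} (hf : DifferentiableAt ℝ f x)
    (h : ∀ v, fderiv ℝ f x (Complex.I • v) = Complex.I • fderiv ℝ f x v) :
    DifferentiableAt ℂ f x :=
  (hasFDerivAt_of_restrictScalars ℝ (f' := complexOfReal _ h) hf.hasFDerivAt rfl).differentiableAt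

/-- Induction works because each directional derivative of f is again complex differentiable. By
symmetry of the second derivative, `D²f(iv, y) = D²f(y, iv)`, which is the derivative along y of
`i·Df(v)`, hence equal to `i·D²f(v, y)`. -/
theorem contDiffOn_nat_of_differentiableOn_complex [FiniteDimensional ℂ V] {U : Set V}
    (hU : IsOpen U) (n : ℕ) : ∀ {f : V → F}, ContDiffOn ℝ ∞ f U → DifferentiableOn ℂ f U →
    ContDiffOn ℂ n f U := by
  induction n with
  | zero => intro f _ hf; exact contDiffOn_zero.2 hf.continuousOn
  | succ n ih =>
    intro f hr hf
    have h1 : ∀ x ∈ U, ∀ v, fderiv ℂ f x v = fderiv ℝ f x v := fun x hx v => by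
      rw [((hf.differentiableAt (hU.mem_nhds hx)).hasFDerivAt.restrictScalars ℝ).fderiv]; rfl
    have hI : ∀ x ∈ U, ∀ v, fderiv ℝ f x (Complex.I • v) = Complex.I • fderiv ℝ f x v :=
      fun x hx v => by rw [← h1 x hx, ← h1 x hx, map_smul]
    have hsm : ContDiffOn ℝ ∞ (fderiv ℝ f) U := hr.fderiv_of_isOpen hU (by simp)
    push_cast
    rw [contDiffOn_succ_iff_fderiv_apply hU.uniqueDiffOn]
    refine ⟨hf, by simp, fun y => ?_⟩
    refine (ih (f := fun x => fderiv ℝ f x y) (hsm.clm_apply contDiffOn_const) ?_).congr ?_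
    · intro x hx
      refine DifferentiableAt.differentiableWithinAt ?_
      have hd : DifferentiableAt ℝ (fderiv ℝ f) x :=
        (hsm.differentiableOn (by simp)).differentiableAt (hU.mem_nhds hx)
      have hd' : ∀ w, HasFDerivAt (fun x => fderiv ℝ f x w)
          ((ContinuousLinearMap.apply ℝ F w).comp (fderiv ℝ (fderiv ℝ f) x)) x := fun w =>
        (ContinuousLinearMap.apply ℝ F w).hasFDerivAt.comp x hd.hasFDerivAt
      have hsymm : IsSymmSndFDerivAt ℝ f x :=
        (hr.contDiffAt (hU.mem_nhds hx)).isSymmSndFDerivAt (by simpa using WithTop.coe_le_coe.2 (le_top : (2 : ℕ∞) ≤ ⊤))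
      refine differentiableAt_complex_of_real (hd' y).differentiableAt fun v => ?_
      rw [(hd' y).fderiv]
      change fderiv ℝ (fderiv ℝ f) x (Complex.I • v) y = Complex.I • fderiv ℝ (fderiv ℝ f) x v y
      rw [hsymm.eq, hsymm.eq v]
      have e1 := (hd' (Complex.I • v)).congr_of_eventuallyEq
        (f₁ := fun x => Complex.I • fderiv ℝ f x v)
        (by filter_upwards [hU.mem_nhds hx] with z hz using (hI z hz v).symm)
      have e2 := (hd' v).const_smul (Complex.I)
      exact congrArg (fun L => L y) (e1.unique e2)
    · intro x hx
      rw [fderivWithin_of_isOpen hU hx]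
      exact h1 x hx y

/-- Cauchy's estimate in one variable, applied to f on the complex line through x in the direction
v, over the disc of radius `r / ‖v‖`. -/
theorem norm_fderiv_le_of_ball {f : V → F} {x : V} {r C : ℝ} (hr : 0 < r)
    (hf : ∀ y ∈ Metric.closedBall x r, DifferentiableAt ℂ f y)
    (hC : ∀ y ∈ Metric.closedBall x r, ‖f y‖ ≤ C) : ‖fderiv ℂ f x‖ ≤ C / r := by
  have hC0 : 0 ≤ C := (norm_nonneg _).trans (hC x (Metric.mem_closedBall_self hr.le))
  refine ContinuousLinearMap.opNorm_le_bound _ (by positivity) fun v => ?_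
  rcases eq_or_ne v 0 with rfl | hv
  · simp
  have hv' : 0 < ‖v‖ := norm_pos_iff.2 hv
  have hmem : ∀ z : ℂ, z ∈ Metric.closedBall (0 : ℂ) (r / ‖v‖) →
      x + z • v ∈ Metric.closedBall x r := fun z hz => by
    rw [mem_closedBall_zero_iff, le_div_iff₀ hv'] at hz
    rwa [mem_closedBall_iff_norm, add_sub_cancel_left, norm_smul]
  have hline : ∀ z : ℂ, HasDerivAt (fun z : ℂ => x + z • v) v z := fun z => by
    simpa using ((hasDerivAt_id z).smul_const v).const_add x
  have hd : DifferentiableOn ℂ (fun z : ℂ => f (x + z • v)) (Metric.closedBall 0 (r / ‖v‖)) :=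
    fun z hz => ((hf _ (hmem z hz)).comp z (hline z).differentiableAt).differentiableWithinAt
  have h1 := Complex.norm_deriv_le_of_forall_mem_sphere_norm_le (c := (0 : ℂ)) (C := C)
    (div_pos hr hv') (f := fun z : ℂ => f (x + z • v))
    ⟨hd.mono Metric.ball_subset_closedBall, by
      rw [closure_ball _ (div_pos hr hv').ne']; exact hd.continuousOn⟩
    (fun z hz => hC _ (hmem z (Metric.sphere_subset_closedBall hz)))
  have h2 : HasDerivAt (fun z : ℂ => f (x + z • v)) (fderiv ℂ f x v) 0 := by
    have h3 : HasFDerivAt f (fderiv ℂ f x) (x + (0 : ℂ) • v) := by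
      simpa using (hf x (Metric.mem_closedBall_self hr.le)).hasFDerivAt
    exact h3.comp_hasDerivAt 0 (hline 0)
  rw [h2.deriv, div_div_eq_mul_div] at h1
  linarith [mul_div_right_comm C ‖v‖ r]

/-- The first-order estimate is iterated: each derivative costs a shrinking of the ball by r and a
factor `1 / r`. -/
theorem norm_iteratedFDeriv_le_of_ball {f : V → F} {x : V} {R r C : ℝ} (hr : 0 < r)
    (hf : ContDiffOn ℂ ∞ f (Metric.ball x R)) (hC : ∀ y ∈ Metric.ball x R, ‖f y‖ ≤ C) (k : ℕ) :
    ∀ y ∈ Metric.ball x (R - k * r), ‖iteratedFDeriv ℂ k f y‖ ≤ C / r ^ k := by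
  induction k with
  | zero => intro y hy; simpa using hC y (by simpa using hy)
  | succ k ih =>
    intro y hy
    have hsub : ∀ z ∈ Metric.closedBall y r, z ∈ Metric.ball x (R - k * r) := fun z hz => by
      rw [Metric.mem_closedBall] at hz
      rw [Metric.mem_ball] at hy ⊢
      push_cast at hy
      linarith [dist_triangle z y x]
    rw [← norm_fderiv_iteratedFDeriv, pow_succ, ← div_div]
    refine norm_fderiv_le_of_ball hr (fun z hz => ?_) (fun z hz => ih z (hsub z hz))
    have hz' : z ∈ Metric.ball x R := by
      have := hsub z hz
      rw [Metric.mem_ball] at this ⊢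
      have : 0 ≤ k * r := by positivity
      linarith
    exact (((hf.contDiffAt (Metric.isOpen_ball.mem_nhds hz')).iteratedFDeriv_right
      (m := 1) (i := k) (by norm_cast; exact le_top)).differentiableAt (by simp))

/-- Identifies the Taylor series of f in several variables, evaluated at y, with the one-variable
Taylor series on the line through x in the direction y. -/
theorem iteratedDeriv_comp_line {f : V → F} {x y : V} {U : Set V} (hU : IsOpen U)
    (hf : ContDiffOn ℂ ∞ f U) (n : ℕ) : ∀ z : ℂ, x + z • y ∈ U →
    iteratedDeriv n (fun z : ℂ => f (x + z • y)) z = iteratedFDeriv ℂ n f (x + z • y) fun _ => y := by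
  induction n with
  | zero => intro z _; simp
  | succ n ih =>
    intro z hz
    have hline : ∀ z : ℂ, HasDerivAt (fun z : ℂ => x + z • y) y z := fun z => by
      simpa using ((hasDerivAt_id z).smul_const y).const_add x
    rw [iteratedDeriv_succ]
    have hev : ∀ᶠ w in 𝓝 z, x + w • y ∈ U :=
      (hline z).continuousAt.preimage_mem_nhds (hU.mem_nhds hz)
    have h1 : iteratedDeriv n (fun z : ℂ => f (x + z • y)) =ᶠ[𝓝 z]
        fun w => iteratedFDeriv ℂ n f (x + w • y) fun _ => y := hev.mono fun w hw => ih w hw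
    rw [h1.deriv_eq]
    have hd : DifferentiableAt ℂ (iteratedFDeriv ℂ n f) (x + z • y) :=
      (((hf.contDiffAt (hU.mem_nhds hz)).iteratedFDeriv_right
        (m := 1) (i := n) (by norm_cast; exact le_top)).differentiableAt (by simp))
    have h2 := (ContinuousMultilinearMap.apply ℂ (fun _ : Fin n => V) F
      (fun _ => y)).hasFDerivAt.comp_hasDerivAt z (hd.hasFDerivAt.comp_hasDerivAt z (hline z))
    rw [iteratedFDeriv_succ_apply_left]
    exact h2.deriv

/-- Osgood's lemma for smooth functions: a smooth function which is complex differentiable on an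
open subset of a finite-dimensional space is analytic. -/
theorem contDiffOn_omega_of_differentiableOn_complex [FiniteDimensional ℂ V] [CompleteSpace F]
    {U : Set V} (hU : IsOpen U) {f : V → F} (hr : ContDiffOn ℝ ∞ f U)
    (hf : DifferentiableOn ℂ f U) : ContDiffOn ℂ ω f U := by
  have hs : ContDiffOn ℂ ∞ f U := contDiffOn_infty.2 fun n =>
    contDiffOn_nat_of_differentiableOn_complex hU n hr hf
  refine AnalyticOn.contDiffOn (fun x hx => AnalyticAt.analyticWithinAt ?_) hU.uniqueDiffOn
  obtain ⟨R, hR, hRU, hb⟩ : ∃ R > 0, Metric.ball x R ⊆ U ∧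
      ∀ y ∈ Metric.ball x R, ‖f y‖ ≤ ‖f x‖ + 1 := by
    have h1 : ∀ᶠ y in 𝓝 x, ‖f y‖ < ‖f x‖ + 1 :=
      ((hs.continuousOn.continuousAt (hU.mem_nhds hx)).norm).eventually_lt continuousAt_const
        (by simp)
    obtain ⟨R, hR, h⟩ := Metric.mem_nhds_iff.1 (Filter.inter_mem (hU.mem_nhds hx) h1)
    exact ⟨R, hR, fun y hy => (h hy).1, fun y hy => (h hy).2.le⟩
  set C := ‖f x‖ + 1
  have hC : 0 < C := by positivity
  let p : FormalMultilinearSeries ℂ V F := fun n => ((n.factorial : ℂ)⁻¹) • iteratedFDeriv ℂ n f x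
  -- The n-th derivative will be estimated with n steps of size `R / (2n)`, which gives a bound `C
  -- nⁿ / (R/2)ⁿ`. Since `nⁿ / n! ≤ eⁿ`, dividing `R / 2` by e makes the Taylor coefficients times
  -- `ρⁿ` bounded by C.
  let ρ : ℝ := R / 2 / Real.exp 1
  have hρ : 0 < ρ := by positivity
  have hρR : ρ ≤ R / 2 := div_le_self (by positivity) (Real.one_le_exp zero_le_one)
  have hbound : ∀ n, ‖p n‖ * ρ ^ n ≤ C := fun n => by
    rcases Nat.eq_zero_or_pos n with rfl | hn
    · simp [p, C]
    have hn' : (0 : ℝ) < n := by exact_mod_cast hn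
    have hr0 : (0 : ℝ) < R / 2 / n := by positivity
    have h1 := norm_iteratedFDeriv_le_of_ball hr0 (hs.mono hRU) hb n x (by
      rw [mul_div_cancel₀ _ hn'.ne']; simpa using by linarith)
    have h2 : (n : ℝ) ^ n / n.factorial ≤ Real.exp 1 ^ n := by
      simpa using Real.pow_div_factorial_le_exp (x := n) (by positivity) n
    have h4 : ‖p n‖ = ((n.factorial : ℝ)⁻¹) * ‖iteratedFDeriv ℂ n f x‖ := by
      simp [p, norm_smul]
    rw [h4]
    calc ((n.factorial : ℝ)⁻¹) * ‖iteratedFDeriv ℂ n f x‖ * ρ ^ n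
        ≤ ((n.factorial : ℝ)⁻¹) * (C / (R / 2 / n) ^ n) * ρ ^ n := by gcongr
      _ = C * ((n : ℝ) ^ n / n.factorial) / Real.exp 1 ^ n := by
        simp only [ρ, div_pow]; field_simp
      _ ≤ C * (Real.exp 1 ^ n) / Real.exp 1 ^ n := by gcongr
      _ = C := by field_simp
  refine ⟨p, ENNReal.ofReal ρ, ?_, by simpa using hρ, fun {y} hy => ?_⟩
  · exact p.le_radius_of_bound (r := ⟨ρ, hρ.le⟩) C hbound |>.trans' (by
      rw [ENNReal.ofReal_eq_coe_nnreal hρ.le]; exact le_rfl)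
  · rw [Metric.eball_ofReal, mem_ball_zero_iff] at hy
    have hline : ∀ z : ℂ, HasDerivAt (fun z : ℂ => x + z • y) y z := fun z => by
      simpa using ((hasDerivAt_id z).smul_const y).const_add x
    -- As `‖y‖ < ρ ≤ R / 2`, the disc of radius 2 on the line stays in the ball of radius R. It
    -- contains z = 1, where the one-variable series sums to `f (x + y)`.
    have hmem : ∀ z ∈ Metric.ball (0 : ℂ) 2, x + z • y ∈ U := fun z hz => by
      apply hRU
      rw [mem_ball_zero_iff] at hz
      rw [mem_ball_iff_norm, add_sub_cancel_left, norm_smul]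
      nlinarith [norm_nonneg z, norm_nonneg y]
    have hd : DifferentiableOn ℂ (fun z : ℂ => f (x + z • y)) (Metric.ball 0 2) :=
      fun z hz => ((hf.differentiableAt (hU.mem_nhds (hmem z hz))).comp z
        (hline z).differentiableAt).differentiableWithinAt
    have h1 := Complex.hasSum_taylorSeries_on_ball (c := 0) (r := 2) hd (z := 1) (by simp)
    simp only [sub_zero, one_pow, one_smul] at h1
    convert h1 using 2 with n
    rw [iteratedDeriv_comp_line hU hs n 0 (by simpa using hx)]
    simp [p]

end Osgood

/-! ### Derivatives along vector fields and the Lie bracket as a commutator. -/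

section DirectionalDerivatives

variable {𝕜 : Type*} [RCLike 𝕜] {E : Type*} [NormedAddCommGroup E] [NormedSpace 𝕜 E]
  {M : Type*} [TopologicalSpace M] [ChartedSpace E M] [IsManifold 𝓘(𝕜, E) ω M]

/-- The derivative of f along A is the fibre component of the tangent map of f composed with the
section A, so one order of smoothness is lost. -/
theorem contMDiffOn_mvfderiv_apply {F : Type*} [NormedAddCommGroup F] [NormedSpace 𝕜 F]
    {m n : ℕ∞ω} (hmn : m + 1 ≤ n) {U : Set M} (hU : IsOpen U) {f : M → F}
    (hf : ContMDiffOn 𝓘(𝕜, E) 𝓘(𝕜, F) n f U) {A : Π x : M, TangentSpace 𝓘(𝕜, E) x}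
    (hA : ContMDiffOn 𝓘(𝕜, E) 𝓘(𝕜, E).tangent m (fun x => (⟨x, A x⟩ : TangentBundle 𝓘(𝕜, E) M)) U) :
    ContMDiffOn 𝓘(𝕜, E) 𝓘(𝕜, F) m (fun x => mvfderiv 𝓘(𝕜, E) f x (A x)) U := by
  have : IsManifold 𝓘(𝕜, E) 1 M := .of_le (n := ω) le_top
  have h1 := hf.contMDiffOn_tangentMapWithin hmn hU.uniqueMDiffOn
  have h2 := ((contMDiff_snd_tangentBundle_modelSpace F 𝓘(𝕜, F)).contMDiffOn (s := Set.univ)).comp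
    (h1.comp hA (fun x hx => hx)) (fun x hx => Set.mem_univ _)
  refine h2.congr fun x hx => ?_
  change _ = mfderivWithin 𝓘(𝕜, E) 𝓘(𝕜, F) f U x (A x)
  rw [mfderivWithin_of_isOpen hU hx]
  rfl

theorem contMDiffOn_trivializationAt_symm (x₀ : M) (v : E) :
    ContMDiffOn 𝓘(𝕜, E) 𝓘(𝕜, E).tangent ∞ (fun x => (⟨x,
      (trivializationAt E (TangentSpace 𝓘(𝕜, E) (M := M)) x₀).symm x v⟩ : TangentBundle 𝓘(𝕜, E) M))
      (chartAt E x₀).source := by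
  have : IsManifold 𝓘(𝕜, E) 1 M := .of_le (n := ω) le_top
  have : IsManifold 𝓘(𝕜, E) (∞ + 1) M := .of_le (n := ω) le_top
  have : ContMDiffVectorBundle ∞ E (TangentSpace 𝓘(𝕜, E) (M := M)) 𝓘(𝕜, E) :=
    TangentBundle.contMDiffVectorBundle
  refine ((trivializationAt E (TangentSpace 𝓘(𝕜, E) (M := M)) x₀).contMDiffOn_section_baseSet_iff).2
    ((contMDiffOn_const (c := v)).congr fun y hy => ?_)
  rw [Trivialization.apply_mk_symm _ hy]

/-- The Lie bracket of vector fields acts on functions as the commutator. -/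
theorem mvfderiv_mlieBracket [CompleteSpace E] {x : M} {A B : Π x : M, TangentSpace 𝓘(𝕜, E) x}
    {U : Set M} (hU : IsOpen U) (hx : x ∈ U)
    (hA : ContMDiffOn 𝓘(𝕜, E) 𝓘(𝕜, E).tangent ∞ (fun x => (⟨x, A x⟩ : TangentBundle 𝓘(𝕜, E) M)) U)
    (hB : ContMDiffOn 𝓘(𝕜, E) 𝓘(𝕜, E).tangent ∞ (fun x => (⟨x, B x⟩ : TangentBundle 𝓘(𝕜, E) M)) U)
    {f : M → 𝕜} (hf : ContMDiffOn 𝓘(𝕜, E) 𝓘(𝕜, 𝕜) ∞ f U) :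
    mvfderiv 𝓘(𝕜, E) f x (VectorField.mlieBracket 𝓘(𝕜, E) A B x)
      = mvfderiv 𝓘(𝕜, E) (fun y => mvfderiv 𝓘(𝕜, E) f y (B y)) x (A x)
        - mvfderiv 𝓘(𝕜, E) (fun y => mvfderiv 𝓘(𝕜, E) f y (A y)) x (B x) := by
  have i1 : IsManifold 𝓘(𝕜, E) 1 M := .of_le (n := ω) le_top
  have i2 : IsManifold 𝓘(𝕜, E) (minSmoothness 𝕜 2) M := .of_le (n := ω) le_top
  have i3 : IsManifold 𝓘(𝕜, E) (minSmoothness 𝕜 3) M := .of_le (n := ω) le_top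
  have i4 : IsManifold 𝓘(𝕜, E) (((⊤ : ℕ∞) : ℕ∞ω) + 1) M := .of_le (n := ω) le_top
  cases subsingleton_or_nontrivial E with
  | inl h =>
    have h0 : ∀ v : TangentSpace 𝓘(𝕜, E) x, v = 0 := fun v => Subsingleton.elim (α := E) _ _
    rw [h0 (A x), h0 (B x), h0 (VectorField.mlieBracket 𝓘(𝕜, E) A B x)]
    simp
  | inr h =>
    obtain ⟨v, hv⟩ := exists_ne (0 : E)
    -- Auxiliary field with Z(x) ≠ 0, constant in the chart. The Jacobi identities for (A, B, fZ)
    -- and for (A, B, Z) differ only by multiples of Z(x), and comparing coefficients yields the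
    -- action of [A, B] on f.
    obtain ⟨Z, W, hW, hxW, hWU, hZ, hZx⟩ : ∃ (Z : Π x : M, TangentSpace 𝓘(𝕜, E) x) (W : Set M),
        IsOpen W ∧ x ∈ W ∧ W ⊆ U ∧ ContMDiffOn 𝓘(𝕜, E) 𝓘(𝕜, E).tangent ∞
          (fun x => (⟨x, Z x⟩ : TangentBundle 𝓘(𝕜, E) M)) W ∧ Z x ≠ 0 := by
      refine ⟨_, (chartAt E x).source ∩ U, (chartAt E x).open_source.inter hU,
        ⟨mem_chart_source E x, hx⟩, Set.inter_subset_right,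
        (contMDiffOn_trivializationAt_symm x v).mono Set.inter_subset_left, fun h0 => hv ?_⟩
      have h1 := Trivialization.apply_mk_symm (trivializationAt E (TangentSpace 𝓘(𝕜, E) (M := M)) x)
        (b := x) (mem_chart_source E x) v
      have h2 := ((trivializationAt E (TangentSpace 𝓘(𝕜, E) (M := M)) x).linear 𝕜
        (mem_chart_source E x)).map_zero
      rw [h0] at h1
      exact (congrArg Prod.snd h1).symm.trans h2
    replace hA := hA.mono hWU
    replace hB := hB.mono hWU
    replace hf := hf.mono hWU
    have sm : ∀ {S T : Π x : M, TangentSpace 𝓘(𝕜, E) x},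
        ContMDiffOn 𝓘(𝕜, E) 𝓘(𝕜, E).tangent ∞ (fun x => (⟨x, S x⟩ : TangentBundle 𝓘(𝕜, E) M)) W →
        ContMDiffOn 𝓘(𝕜, E) 𝓘(𝕜, E).tangent ∞ (fun x => (⟨x, T x⟩ : TangentBundle 𝓘(𝕜, E) M)) W →
        ContMDiffOn 𝓘(𝕜, E) 𝓘(𝕜, E).tangent ∞ (fun x =>
          (⟨x, VectorField.mlieBracket 𝓘(𝕜, E) S T x⟩ : TangentBundle 𝓘(𝕜, E) M)) W :=
      fun {S T} hS hT y hy => ((hS.contMDiffAt (hW.mem_nhds hy)).mlieBracket_vectorField (m := ⊤)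
        (n := ⊤) (hT.contMDiffAt (hW.mem_nhds hy)) (by simp)).contMDiffWithinAt
    have df : ∀ {S : Π x : M, TangentSpace 𝓘(𝕜, E) x} {g : M → 𝕜},
        ContMDiffOn 𝓘(𝕜, E) 𝓘(𝕜, 𝕜) ∞ g W →
        ContMDiffOn 𝓘(𝕜, E) 𝓘(𝕜, E).tangent ∞ (fun x => (⟨x, S x⟩ : TangentBundle 𝓘(𝕜, E) M)) W →
        ContMDiffOn 𝓘(𝕜, E) 𝓘(𝕜, 𝕜) ∞ (fun x => mvfderiv 𝓘(𝕜, E) g x (S x)) W :=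
      fun hg hS => contMDiffOn_mvfderiv_apply (by simp) hW hg hS
    have md : ∀ {S : Π x : M, TangentSpace 𝓘(𝕜, E) x} {y : M}, y ∈ W →
        ContMDiffOn 𝓘(𝕜, E) 𝓘(𝕜, E).tangent ∞ (fun x => (⟨x, S x⟩ : TangentBundle 𝓘(𝕜, E) M)) W →
        MDifferentiableAt 𝓘(𝕜, E) 𝓘(𝕜, E).tangent
          (fun x => (⟨x, S x⟩ : TangentBundle 𝓘(𝕜, E) M)) y :=
      fun hy hS => (hS.contMDiffAt (hW.mem_nhds hy)).mdifferentiableAt (by simp)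
    have mf : ∀ {g : M → 𝕜} {y : M}, y ∈ W → ContMDiffOn 𝓘(𝕜, E) 𝓘(𝕜, 𝕜) ∞ g W →
        MDifferentiableAt 𝓘(𝕜, E) 𝓘(𝕜, 𝕜) g y :=
      fun hy hg => (hg.contMDiffAt (hW.mem_nhds hy)).mdifferentiableAt (by simp)
    have c2 : ∀ {S : Π x : M, TangentSpace 𝓘(𝕜, E) x},
        ContMDiffOn 𝓘(𝕜, E) 𝓘(𝕜, E).tangent ∞ (fun x => (⟨x, S x⟩ : TangentBundle 𝓘(𝕜, E) M)) W →
        ContMDiffAt 𝓘(𝕜, E) 𝓘(𝕜, E).tangent (minSmoothness 𝕜 2)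
          (fun x => (⟨x, S x⟩ : TangentBundle 𝓘(𝕜, E) M)) x :=
      fun hS => (hS.contMDiffAt (hW.mem_nhds hxW)).of_le
        (by simpa using WithTop.coe_le_coe.2 (le_top : (2 : ℕ∞) ≤ ⊤))
    have sec : ∀ {S T : Π x : M, TangentSpace 𝓘(𝕜, E) x},
        ContMDiffOn 𝓘(𝕜, E) 𝓘(𝕜, E).tangent ∞ (fun x => (⟨x, S x⟩ : TangentBundle 𝓘(𝕜, E) M)) W →
        ContMDiffOn 𝓘(𝕜, E) 𝓘(𝕜, E).tangent ∞ (fun x => (⟨x, T x⟩ : TangentBundle 𝓘(𝕜, E) M)) W →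
        VectorField.mlieBracket 𝓘(𝕜, E) S (VectorField.mlieBracket 𝓘(𝕜, E) T (f • Z)) x
          = mvfderiv 𝓘(𝕜, E) (fun y => mvfderiv 𝓘(𝕜, E) f y (T y)) x (S x) • Z x
            + mvfderiv 𝓘(𝕜, E) f x (T x) • VectorField.mlieBracket 𝓘(𝕜, E) S Z x
            + (mvfderiv 𝓘(𝕜, E) f x (S x) • VectorField.mlieBracket 𝓘(𝕜, E) T Z x
            + f x • VectorField.mlieBracket 𝓘(𝕜, E) S (VectorField.mlieBracket 𝓘(𝕜, E) T Z) x) := by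
      intro S T hS hT
      have e1 : VectorField.mlieBracket 𝓘(𝕜, E) T (f • Z) =ᶠ[𝓝 x]
          ((fun y => mvfderiv 𝓘(𝕜, E) f y (T y)) • Z
            + f • VectorField.mlieBracket 𝓘(𝕜, E) T Z) := by
        filter_upwards [hW.mem_nhds hxW] with y hy
        exact VectorField.mlieBracket_smul_right (mf hy hf) (md hy hZ)
      have e2 := Filter.EventuallyEq.mlieBracket_vectorField_eq (I := 𝓘(𝕜, E))
        (Filter.EventuallyEq.refl (𝓝 x) S) e1
      rw [e2, VectorField.mlieBracket_add_right (md hxW ((df hf hT).smul_section hZ))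
          (md hxW (hf.smul_section (sm hT hZ))),
        VectorField.mlieBracket_smul_right (mf hxW (df hf hT)) (md hxW hZ),
        VectorField.mlieBracket_smul_right (mf hxW hf) (md hxW (sm hT hZ))]
    have hJ := VectorField.leibniz_identity_mlieBracket_apply (c2 hA) (c2 hB)
      (c2 (hf.smul_section hZ))
    have hJ0 := VectorField.leibniz_identity_mlieBracket_apply (c2 hA) (c2 hB) (c2 hZ)
    -- The terms with [A, Z] and [B, Z] appear symmetrically and cancel, and those with f(x) cancel
    -- by the Jacobi identity for Z. What is left is a multiple of Z(x).
    rw [sec hA hB, sec hB hA, VectorField.mlieBracket_smul_right (mf hxW hf) (md hxW hZ), hJ0] at hJ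
    have key : (mvfderiv 𝓘(𝕜, E) (fun y => mvfderiv 𝓘(𝕜, E) f y (B y)) x (A x)
        - mvfderiv 𝓘(𝕜, E) (fun y => mvfderiv 𝓘(𝕜, E) f y (A y)) x (B x)
        - mvfderiv 𝓘(𝕜, E) f x (VectorField.mlieBracket 𝓘(𝕜, E) A B x)) • Z x = 0 := by
      rw [sub_smul, sub_smul]
      linear_combination (norm := module) hJ
    rcases smul_eq_zero.1 key with h | h
    · exact (sub_eq_zero.1 h).symm
    · exact absurd h hZx

end DirectionalDerivatives

/-! ### Comparison of real and complex differentiability on a complex manifold. -/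

section RealComplex

variable {V : Type*} [NormedAddCommGroup V] [NormedSpace ℂ V]
  {M : Type*} [TopologicalSpace M] [ChartedSpace V M]
  {F : Type*} [NormedAddCommGroup F] [NormedSpace ℂ F]

theorem contMDiffWithinAt_real_of_complex {n : ℕ∞ω} {f : M → F} {s : Set M} {x : M}
    (h : ContMDiffWithinAt 𝓘(ℂ, V) 𝓘(ℂ, F) n f s x) :
    ContMDiffWithinAt 𝓘(ℝ, V) 𝓘(ℝ, F) n f s x := by
  rw [contMDiffWithinAt_iff] at h ⊢
  exact ⟨h.1, h.2.restrict_scalars ℝ⟩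

theorem contMDiffOn_real_of_complex {n : ℕ∞ω} {f : M → F} {s : Set M}
    (h : ContMDiffOn 𝓘(ℂ, V) 𝓘(ℂ, F) n f s) : ContMDiffOn 𝓘(ℝ, V) 𝓘(ℝ, F) n f s :=
  fun x hx => contMDiffWithinAt_real_of_complex (h x hx)

theorem hasMFDerivAt_real_of_complex {f : M → F} {x : M}
    (h : MDifferentiableAt 𝓘(ℂ, V) 𝓘(ℂ, F) f x) :
    HasMFDerivAt 𝓘(ℝ, V) 𝓘(ℝ, F) f x ((mvfderiv 𝓘(ℂ, V) f x : V →L[ℂ] F).restrictScalars ℝ) :=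
  ⟨h.hasMFDerivAt.1, h.hasMFDerivAt.2.restrictScalars ℝ⟩

theorem mvfderiv_real_of_complex {f : M → F} {x : M}
    (h : MDifferentiableAt 𝓘(ℂ, V) 𝓘(ℂ, F) f x) (v : V) :
    mvfderiv 𝓘(ℝ, V) f x v = mvfderiv 𝓘(ℂ, V) f x v := by
  change mfderiv 𝓘(ℝ, V) 𝓘(ℝ, F) f x v = _
  rw [(hasMFDerivAt_real_of_complex h).mfderiv]
  rfl

theorem mdifferentiableAt_complex_of_real {f : M → F} {x : M}
    (h : MDifferentiableAt 𝓘(ℝ, V) 𝓘(ℝ, F) f x)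
    (hI : ∀ v : V, mvfderiv 𝓘(ℝ, V) f x (Complex.I • v) = Complex.I • mvfderiv 𝓘(ℝ, V) f x v) :
    MDifferentiableAt 𝓘(ℂ, V) 𝓘(ℂ, F) f x := by
  let g : V →L[ℝ] F := mvfderiv 𝓘(ℝ, V) f x
  have h1 := h.hasMFDerivAt
  have h2 : HasFDerivWithinAt (writtenInExtChartAt 𝓘(ℝ, V) 𝓘(ℝ, F) x f) g
    (Set.range 𝓘(ℝ, V)) (extChartAt 𝓘(ℝ, V) x x) := h1.2
  have h3 : HasFDerivAt (writtenInExtChartAt 𝓘(ℂ, V) 𝓘(ℂ, F) x f) (complexOfReal g hI)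
      (extChartAt 𝓘(ℂ, V) x x) := by
    rw [modelWithCornersSelf_coe, Set.range_id, hasFDerivWithinAt_univ] at h2
    exact hasFDerivAt_of_restrictScalars ℝ h2 rfl
  exact HasMFDerivAt.mdifferentiableAt ⟨h1.1, h3.hasFDerivWithinAt⟩

/-- A smooth function satisfying the Cauchy–Riemann equations is holomorphic. -/
theorem contMDiffOn_complex_of_real [FiniteDimensional ℂ V] [CompleteSpace F]
    [IsManifold 𝓘(ℂ, V) ω M] {f : M → F} {U : Set M} (hU : IsOpen U)
    (h : ContMDiffOn 𝓘(ℝ, V) 𝓘(ℝ, F) ∞ f U)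
    (hI : ∀ x ∈ U, ∀ v : V,
      mvfderiv 𝓘(ℝ, V) f x (Complex.I • v) = Complex.I • mvfderiv 𝓘(ℝ, V) f x v) :
    ContMDiffOn 𝓘(ℂ, V) 𝓘(ℂ, F) ω f U := by
  have : IsManifold 𝓘(ℂ, V) 1 M := .of_le (n := ω) le_top
  have hd : ∀ x ∈ U, MDifferentiableAt 𝓘(ℂ, V) 𝓘(ℂ, F) f x := fun x hx =>
    mdifferentiableAt_complex_of_real
      ((h.contMDiffAt (hU.mem_nhds hx)).mdifferentiableAt (by simp)) (hI x hx)
  intro x hx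
  -- In the chart at x the function is real smooth and complex differentiable, so Osgood's lemma
  -- applies; composing with the holomorphic chart returns to the manifold.
  let φ := extChartAt 𝓘(ℂ, V) x
  let W : Set V := φ.target ∩ φ.symm ⁻¹' U
  have hW : IsOpen W := (continuousOn_extChartAt_symm x).isOpen_inter_preimage
    (isOpen_extChartAt_target x) hU
  have hr : ContDiffOn ℝ ∞ (f ∘ φ.symm) W := by
    have h1 : ContMDiffOn 𝓘(ℝ, V) 𝓘(ℝ, V) ∞ φ.symm φ.target :=
      contMDiffOn_extChartAt_symm (I := 𝓘(ℝ, V)) x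
    exact contMDiffOn_iff_contDiffOn.1 (h.comp (h1.mono Set.inter_subset_left) fun y hy => hy.2)
  have hc : DifferentiableOn ℂ (f ∘ φ.symm) W := by
    intro y hy
    have h1 : MDifferentiableAt 𝓘(ℂ, V) 𝓘(ℂ, V) φ.symm y :=
      ((contMDiffOn_extChartAt_symm (I := 𝓘(ℂ, V)) (n := 1) x).contMDiffAt
        ((isOpen_extChartAt_target x).mem_nhds hy.1)).mdifferentiableAt (by simp)
    exact ((hd _ hy.2).comp y h1).differentiableAt.differentiableWithinAt
  have ha := contDiffOn_omega_of_differentiableOn_complex hW hr hc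
  have h3 : ContMDiffOn 𝓘(ℂ, V) 𝓘(ℂ, F) ω ((f ∘ φ.symm) ∘ φ) (φ.source ∩ φ ⁻¹' W) :=
    ha.contMDiffOn.comp ((contMDiffOn_extChartAt (I := 𝓘(ℂ, V)) (x := x)).mono (by
      rw [← extChartAt_source 𝓘(ℂ, V)]; exact Set.inter_subset_left)) (fun y hy => hy.2)
  have hmem : U ∩ φ.source ∈ 𝓝 x := Filter.inter_mem (hU.mem_nhds hx) (extChartAt_source_mem_nhds x)
  have h4 : ContMDiffAt 𝓘(ℂ, V) 𝓘(ℂ, F) ω ((f ∘ φ.symm) ∘ φ) x := by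
    refine h3.contMDiffAt (Filter.mem_of_superset hmem fun y hy => ⟨hy.2, φ.map_source hy.2, ?_⟩)
    change φ.symm (φ y) ∈ U
    rw [φ.left_inv hy.2]; exact hy.1
  refine (h4.congr_of_eventuallyEq ?_).contMDiffWithinAt
  filter_upwards [hmem] with y hy
  simp [φ.left_inv hy.2]

end RealComplex

/-! ### Derivatives along complexified tangent vectors -/

section CDeriv

variable (V : Type*) [NormedAddCommGroup V] [NormedSpace ℂ V]
  {M : Type*} [TopologicalSpace M] [ChartedSpace V M]

/-- Smooth complex functions on `U`. -/
abbrev Sm (f : M → ℂ) (U : Set M) : Prop := ContMDiffOn 𝓘(ℝ, V) 𝓘(ℝ, ℂ) ∞ f U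

/-- Holomorphic functions on `U`. -/
abbrev Ho (f : M → ℂ) (U : Set M) : Prop := ContMDiffOn 𝓘(ℂ, V) 𝓘(ℂ, ℂ) ω f U

variable {V}

theorem Ho.sm {f : M → ℂ} {U : Set M} (h : Ho V f U) : Sm V f U :=
  (contMDiffOn_real_of_complex h).of_le le_top

theorem Sm.add {f g : M → ℂ} {U : Set M} (hf : Sm V f U) (hg : Sm V g U) :
    Sm V (fun x => f x + g x) U := ContMDiffOn.add hf hg

theorem Sm.sub {f g : M → ℂ} {U : Set M} (hf : Sm V f U) (hg : Sm V g U) :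
    Sm V (fun x => f x - g x) U := ContMDiffOn.sub hf hg

theorem Sm.clm {f : M → ℂ} {U : Set M} (L : ℂ →L[ℝ] ℂ) (hf : Sm V f U) :
    Sm V (fun x => L (f x)) U := (L.contMDiff.contMDiffOn (s := Set.univ)).comp hf fun _ _ => trivial

theorem Sm.mul {f g : M → ℂ} {U : Set M} (hf : Sm V f U) (hg : Sm V g U) :
    Sm V (fun x => f x * g x) U := by
  have h : ContDiff ℝ ∞ (fun p : ℂ × ℂ => p.1 * p.2) := contDiff_mul
  exact (h.contMDiff.contMDiffOn (s := Set.univ)).comp (hf.prodMk_space hg) fun _ _ => trivial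

theorem Sm.const (c : ℂ) (U : Set M) : Sm V (fun _ => c) U := contMDiffOn_const

theorem Sm.sum {ι : Type*} (s : Finset ι) {f : ι → M → ℂ} {U : Set M}
    (hf : ∀ i ∈ s, Sm V (f i) U) : Sm V (fun x => ∑ i ∈ s, f i x) U := by
  classical
  induction s using Finset.induction_on with
  | empty => simpa using Sm.const 0 U
  | insert i s hi h =>
    simp only [Finset.sum_insert hi]
    exact (hf i (by simp)).add (h fun j hj => hf j (by simp [hj]))

theorem Ho.add {f g : M → ℂ} {U : Set M} (hf : Ho V f U) (hg : Ho V g U) :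
    Ho V (fun x => f x + g x) U := ContMDiffOn.add hf hg

theorem Ho.mul {f g : M → ℂ} {U : Set M} (hf : Ho V f U) (hg : Ho V g U) :
    Ho V (fun x => f x * g x) U := ContMDiffOn.smul hf hg

theorem Ho.const (c : ℂ) (U : Set M) : Ho V (fun _ => c) U := contMDiffOn_const

theorem Ho.sum {ι : Type*} (s : Finset ι) {f : ι → M → ℂ} {U : Set M}
    (hf : ∀ i ∈ s, Ho V (f i) U) : Ho V (fun x => ∑ i ∈ s, f i x) U := by
  classical
  induction s using Finset.induction_on with
  | empty => simpa using Ho.const 0 U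
  | insert i s hi h =>
    simp only [Finset.sum_insert hi]
    exact (hf i (by simp)).add (h fun j hj => hf j (by simp [hj]))

theorem Sm.md {f : M → ℂ} {U : Set M} (hf : Sm V f U) (hU : IsOpen U) {x : M} (hx : x ∈ U) :
    MDifferentiableAt 𝓘(ℝ, V) 𝓘(ℝ, ℂ) f x :=
  (hf.contMDiffAt (hU.mem_nhds hx)).mdifferentiableAt (by simp)

theorem Ho.md {f : M → ℂ} {U : Set M} (hf : Ho V f U) (hU : IsOpen U) {x : M} (hx : x ∈ U) :
    MDifferentiableAt 𝓘(ℂ, V) 𝓘(ℂ, ℂ) f x :=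
  (hf.contMDiffAt (hU.mem_nhds hx)).mdifferentiableAt (by simp)

theorem cDeriv_eq {x : M} (X : CTan V x) (f : M → ℂ) :
    cDeriv V x X f = mvfderiv 𝓘(ℝ, V) f x (cRe V x X)
      + Complex.I * mvfderiv 𝓘(ℝ, V) f x (cIm V x X) := rfl

theorem cDeriv_congr {x : M} (X : CTan V x) {f g : M → ℂ} (h : f =ᶠ[𝓝 x] g) :
    cDeriv V x X f = cDeriv V x X g := by
  rw [cDeriv, cDeriv, h.mfderiv_eq]

theorem cDeriv_congr_on {x : M} (X : CTan V x) {f g : M → ℂ} {U : Set M} (hU : IsOpen U)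
    (hx : x ∈ U) (h : ∀ y ∈ U, f y = g y) : cDeriv V x X f = cDeriv V x X g :=
  cDeriv_congr X (Filter.eventuallyEq_of_mem (hU.mem_nhds hx) h)

theorem cDeriv_zero_left {x : M} (f : M → ℂ) : cDeriv V x 0 f = 0 := by
  simpa using cDeriv_smul V x 0 (0 : CTan V x) f

theorem cDeriv_neg_left {x : M} (X : CTan V x) (f : M → ℂ) :
    cDeriv V x (-X) f = - cDeriv V x X f := by
  simpa using cDeriv_smul V x (-1) X f

theorem cDeriv_sub_left {x : M} (X Y : CTan V x) (f : M → ℂ) :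
    cDeriv V x (X - Y) f = cDeriv V x X f - cDeriv V x Y f := by
  rw [sub_eq_add_neg, cDeriv_add, cDeriv_neg_left, sub_eq_add_neg]

theorem cDeriv_sum_left {ι : Type*} (s : Finset ι) {x : M} (X : ι → CTan V x) (f : M → ℂ) :
    cDeriv V x (∑ i ∈ s, X i) f = ∑ i ∈ s, cDeriv V x (X i) f := by
  classical
  induction s using Finset.induction_on with
  | empty => simp [cDeriv_zero_left]
  | insert i s hi h => simp only [Finset.sum_insert hi, cDeriv_add, h]

theorem cDeriv_const {x : M} (X : CTan V x) (c : ℂ) : cDeriv V x X (fun _ => c) = 0 := by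
  have h : ∀ v, mvfderiv 𝓘(ℝ, V) (fun _ : M => c) x v = 0 := fun v => by
    change mfderiv 𝓘(ℝ, V) 𝓘(ℝ, ℂ) (fun _ : M => c) x v = 0
    rw [mfderiv_const]; rfl
  rw [cDeriv_eq, h, h]; simp

theorem cDeriv_fadd {x : M} (X : CTan V x) {f g : M → ℂ}
    (hf : MDifferentiableAt 𝓘(ℝ, V) 𝓘(ℝ, ℂ) f x) (hg : MDifferentiableAt 𝓘(ℝ, V) 𝓘(ℝ, ℂ) g x) :
    cDeriv V x X (fun y => f y + g y) = cDeriv V x X f + cDeriv V x X g := by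
  have h : ∀ v, mvfderiv 𝓘(ℝ, V) (fun y => f y + g y) x v
      = mvfderiv 𝓘(ℝ, V) f x v + mvfderiv 𝓘(ℝ, V) g x v := fun v => by
    change mfderiv 𝓘(ℝ, V) 𝓘(ℝ, ℂ) (f + g) x v = _
    rw [(hf.hasMFDerivAt.add hg.hasMFDerivAt).mfderiv]; rfl
  rw [cDeriv_eq, h, h, cDeriv_eq, cDeriv_eq]; ring

theorem cDeriv_mul {x : M} (X : CTan V x) {f g : M → ℂ}
    (hf : MDifferentiableAt 𝓘(ℝ, V) 𝓘(ℝ, ℂ) f x) (hg : MDifferentiableAt 𝓘(ℝ, V) 𝓘(ℝ, ℂ) g x) :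
    cDeriv V x X (fun y => f y * g y) = cDeriv V x X f * g x + f x * cDeriv V x X g := by
  have h : ∀ v, mvfderiv 𝓘(ℝ, V) (fun y => f y * g y) x v
      = mvfderiv 𝓘(ℝ, V) f x v * g x + f x * mvfderiv 𝓘(ℝ, V) g x v := fun v => by
    change mfderiv 𝓘(ℝ, V) 𝓘(ℝ, ℂ) (f * g) x v = _
    rw [(hf.hasMFDerivAt.mul hg.hasMFDerivAt).mfderiv]
    change f x * mvfderiv 𝓘(ℝ, V) g x v + g x * mvfderiv 𝓘(ℝ, V) f x v = _
    ring
  rw [cDeriv_eq, h, h, cDeriv_eq, cDeriv_eq]; ring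

theorem cDeriv_fsub {x : M} (X : CTan V x) {f g : M → ℂ}
    (hf : MDifferentiableAt 𝓘(ℝ, V) 𝓘(ℝ, ℂ) f x) (hg : MDifferentiableAt 𝓘(ℝ, V) 𝓘(ℝ, ℂ) g x) :
    cDeriv V x X (fun y => f y - g y) = cDeriv V x X f - cDeriv V x X g := by
  have h : ∀ v, mvfderiv 𝓘(ℝ, V) (fun y => f y - g y) x v
      = mvfderiv 𝓘(ℝ, V) f x v - mvfderiv 𝓘(ℝ, V) g x v := fun v => by
    change mfderiv 𝓘(ℝ, V) 𝓘(ℝ, ℂ) (f - g) x v = _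
    rw [(hf.hasMFDerivAt.sub hg.hasMFDerivAt).mfderiv]; rfl
  rw [cDeriv_eq, h, h, cDeriv_eq, cDeriv_eq]; ring

theorem cDeriv_fsum {ι : Type*} (s : Finset ι) {x : M} (X : CTan V x) {f : ι → M → ℂ} {U : Set M}
    (hU : IsOpen U) (hx : x ∈ U) (hf : ∀ i ∈ s, Sm V (f i) U) :
    cDeriv V x X (fun y => ∑ i ∈ s, f i y) = ∑ i ∈ s, cDeriv V x X (f i) := by
  classical
  induction s using Finset.induction_on with
  | empty => simpa using cDeriv_const X 0
  | insert i s hi h =>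
    simp only [Finset.sum_insert hi]
    rw [cDeriv_fadd X ((hf i (by simp)).md hU hx)
      ((Sm.sum s fun j hj => hf j (by simp [hj])).md hU hx), h fun j hj => hf j (by simp [hj])]

theorem cRe_add_cIm {x : M} (X : CTan V x) :
    (1 : ℂ) ⊗ₜ[ℝ] cRe V x X + Complex.I ⊗ₜ[ℝ] cIm V x X = X := by
  induction X using TensorProduct.induction_on with
  | zero => simp
  | tmul z v =>
    simp only [cRe, cIm, LinearMap.comp_apply, LinearMap.rTensor_tmul, LinearEquiv.coe_coe,
      TensorProduct.lid_tmul]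
    rw [← TensorProduct.smul_tmul, ← TensorProduct.smul_tmul, ← TensorProduct.add_tmul]
    congr 1
    apply Complex.ext <;> simp [Complex.reLm, Complex.imLm]
  | add a b ha hb =>
    conv_rhs => rw [← ha, ← hb]
    simp only [map_add, TensorProduct.tmul_add]; abel

@[simp] theorem cRe_mk {x : M} (u v : TangentSpace 𝓘(ℝ, V) x) :
    cRe V x ((1 : ℂ) ⊗ₜ[ℝ] u + Complex.I ⊗ₜ[ℝ] v) = u := by
  simp [cRe, Complex.reLm]

@[simp] theorem cIm_mk {x : M} (u v : TangentSpace 𝓘(ℝ, V) x) :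
    cIm V x ((1 : ℂ) ⊗ₜ[ℝ] u + Complex.I ⊗ₜ[ℝ] v) = v := by
  simp [cIm, Complex.imLm]

@[simp] theorem cRe_one {x : M} (u : TangentSpace 𝓘(ℝ, V) x) :
    cRe V x ((1 : ℂ) ⊗ₜ[ℝ] u) = u := by
  simp [cRe, Complex.reLm]

@[simp] theorem cIm_one {x : M} (u : TangentSpace 𝓘(ℝ, V) x) :
    cIm V x ((1 : ℂ) ⊗ₜ[ℝ] u) = 0 := by
  simp [cIm, Complex.imLm]

theorem cTan_ext {x : M} {X Y : CTan V x} (h1 : cRe V x X = cRe V x Y)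
    (h2 : cIm V x X = cIm V x Y) : X = Y := by
  rw [← cRe_add_cIm X, ← cRe_add_cIm Y, h1, h2]

theorem cRe_JC {x : M} (X : CTan V x) : cRe V x (JC V x X) = J V x (cRe V x X) := by
  conv_lhs => rw [← cRe_add_cIm X]
  simp [JC]

theorem cIm_JC {x : M} (X : CTan V x) : cIm V x (JC V x X) = J V x (cIm V x X) := by
  conv_lhs => rw [← cRe_add_cIm X]
  simp [JC]

theorem mvfderiv_J {x : M} {f : M → ℂ} (hf : MDifferentiableAt 𝓘(ℂ, V) 𝓘(ℂ, ℂ) f x)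
    (v : TangentSpace 𝓘(ℝ, V) x) :
    mvfderiv 𝓘(ℝ, V) f x (J V x v) = Complex.I * mvfderiv 𝓘(ℝ, V) f x v := by
  have key : ∀ w : V, mvfderiv 𝓘(ℝ, V) f x (Complex.I • w)
      = Complex.I * mvfderiv 𝓘(ℝ, V) f x w := fun w => by
    have h := ContinuousLinearMap.map_smul (mvfderiv 𝓘(ℂ, V) f x : V →L[ℂ] ℂ) Complex.I w
    have h1 := mvfderiv_real_of_complex hf w
    have h2 := mvfderiv_real_of_complex hf (Complex.I • w)
    exact h2.trans (h.trans (congrArg (Complex.I * ·) h1.symm))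
  exact key v

theorem cDeriv_JC {x : M} (X : CTan V x) {f : M → ℂ}
    (hf : MDifferentiableAt 𝓘(ℂ, V) 𝓘(ℂ, ℂ) f x) :
    cDeriv V x (JC V x X) f = Complex.I * cDeriv V x X f := by
  rw [cDeriv_eq, cDeriv_eq, cRe_JC, cIm_JC, mvfderiv_J hf, mvfderiv_J hf]; ring

theorem cDeriv_conj {x : M} (X : CTan V x) {f : M → ℂ}
    (hf : MDifferentiableAt 𝓘(ℝ, V) 𝓘(ℝ, ℂ) f x) :
    cDeriv V x X (fun y => starRingEnd ℂ (f y))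
      = starRingEnd ℂ (mvfderiv 𝓘(ℝ, V) f x (cRe V x X))
        + Complex.I * starRingEnd ℂ (mvfderiv 𝓘(ℝ, V) f x (cIm V x X)) := by
  have h : ∀ v, mvfderiv 𝓘(ℝ, V) (fun y => starRingEnd ℂ (f y)) x v
      = starRingEnd ℂ (mvfderiv 𝓘(ℝ, V) f x v) := fun v => by
    have h1 : HasMFDerivAt 𝓘(ℝ, ℂ) 𝓘(ℝ, ℂ) Complex.conjCLE (f x)
        (Complex.conjCLE : ℂ →L[ℝ] ℂ) := Complex.conjCLE.hasMFDerivAt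
    change mfderiv 𝓘(ℝ, V) 𝓘(ℝ, ℂ) (Complex.conjCLE ∘ f) x v = _
    rw [(h1.comp x hf.hasMFDerivAt).mfderiv]; rfl
  rw [cDeriv_eq, h, h]

theorem Sm.conj {f : M → ℂ} {U : Set M} (hf : Sm V f U) :
    Sm V (fun y => starRingEnd ℂ (f y)) U := Sm.clm (Complex.conjCLE : ℂ →L[ℝ] ℂ) hf

theorem cDeriv_JC_conj {x : M} (X : CTan V x) {f : M → ℂ}
    (hf : MDifferentiableAt 𝓘(ℂ, V) 𝓘(ℂ, ℂ) f x) :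
    cDeriv V x (JC V x X) (fun y => starRingEnd ℂ (f y))
      = -Complex.I * cDeriv V x X (fun y => starRingEnd ℂ (f y)) := by
  have hf' := (hasMFDerivAt_real_of_complex hf).mdifferentiableAt
  rw [cDeriv_conj _ hf', cDeriv_conj _ hf', cRe_JC, cIm_JC,
    mvfderiv_J hf, mvfderiv_J hf, map_mul, map_mul, Complex.conj_I]; ring

/-- Differentiating a holomorphic f, J acts as multiplication by i, whereas `J X = -i X`; so `i X(f)
= -i X(f)`. -/
theorem cDeriv_T01 {x : M} {X : CTan V x} (hX : X ∈ T01 V x) {f : M → ℂ}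
    (hf : MDifferentiableAt 𝓘(ℂ, V) 𝓘(ℂ, ℂ) f x) : cDeriv V x X f = 0 := by
  have h1 := cDeriv_JC X hf
  rw [Module.End.mem_eigenspace_iff.1 hX, cDeriv_smul] at h1
  have : Complex.I * cDeriv V x X f = 0 := by linear_combination (-1 / 2 : ℂ) * h1
  exact (mul_eq_zero.1 this).resolve_left Complex.I_ne_zero

theorem coe_pr01 {x : M} (X : CTan V x) :
    (pr01 V x X : CTan V x) = (1 / 2 : ℂ) • (X + Complex.I • JC V x X) := rfl

theorem cDeriv_pr01 {x : M} (X : CTan V x) {f : M → ℂ}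
    (hf : MDifferentiableAt 𝓘(ℂ, V) 𝓘(ℂ, ℂ) f x) : cDeriv V x (pr01 V x X : CTan V x) f = 0 :=
  cDeriv_T01 (pr01 V x X).2 hf

/-- On conjugates of holomorphic functions J acts as -i, so the projection `(1 + iJ) / 2` acts as
the identity: the (1,0)-part of X does not see antiholomorphic functions. -/
theorem cDeriv_pr01_conj {x : M} (X : CTan V x) {f : M → ℂ}
    (hf : MDifferentiableAt 𝓘(ℂ, V) 𝓘(ℂ, ℂ) f x) :
    cDeriv V x (pr01 V x X : CTan V x) (fun y => starRingEnd ℂ (f y))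
      = cDeriv V x X (fun y => starRingEnd ℂ (f y)) := by
  rw [coe_pr01, cDeriv_smul, cDeriv_add, cDeriv_smul, cDeriv_JC_conj X hf]
  linear_combination (-1 / 2 : ℂ) * cDeriv V x X (fun y => starRingEnd ℂ (f y)) * Complex.I_mul_I

theorem holTan_eq {x : M} (v : TangentSpace 𝓘(ℂ, V) x) :
    holTan V x v = (1 / 2 : ℂ) • (((1 : ℂ) ⊗ₜ[ℝ] (id v : TangentSpace 𝓘(ℝ, V) x) : CTan V x)
      - Complex.I • JC V x ((1 : ℂ) ⊗ₜ[ℝ] (id v : TangentSpace 𝓘(ℝ, V) x))) := by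
  rw [JC, LinearMap.baseChange_tmul, TensorProduct.smul_tmul', smul_eq_mul, mul_one]; rfl

theorem cDeriv_holTan {x : M} (v : TangentSpace 𝓘(ℂ, V) x) {f : M → ℂ}
    (hf : MDifferentiableAt 𝓘(ℂ, V) 𝓘(ℂ, ℂ) f x) : cDeriv V x (holTan V x v) f = holDeriv V x v f := by
  rw [holTan_eq, cDeriv_smul, cDeriv_sub_left, cDeriv_smul, cDeriv_JC _ hf, cDeriv_eq, cRe_one, cIm_one,
    map_zero]
  erw [mvfderiv_real_of_complex hf]
  change (1 / 2 : ℂ) * (holDeriv V x v f + Complex.I * 0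
    - Complex.I * (Complex.I * (holDeriv V x v f + Complex.I * 0))) = _
  linear_combination (-1 / 2 : ℂ) * holDeriv V x v f * Complex.I_mul_I

theorem cDeriv_holTan_conj {x : M} (v : TangentSpace 𝓘(ℂ, V) x) {f : M → ℂ}
    (hf : MDifferentiableAt 𝓘(ℂ, V) 𝓘(ℂ, ℂ) f x) :
    cDeriv V x (holTan V x v) (fun y => starRingEnd ℂ (f y)) = 0 := by
  rw [holTan_eq, cDeriv_smul, cDeriv_sub_left, cDeriv_smul, cDeriv_JC_conj _ hf]
  linear_combination (1 / 2 : ℂ) * cDeriv V x ((1 : ℂ) ⊗ₜ[ℝ] (id v : TangentSpace 𝓘(ℝ, V) x))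
    (fun y => starRingEnd ℂ (f y)) * Complex.I_mul_I

end CDeriv

/-! ### Holomorphic coordinates and smooth complex vector fields. -/

section Coordinates

variable {V : Type*} [NormedAddCommGroup V] [NormedSpace ℂ V]
  {M : Type*} [TopologicalSpace M] [ChartedSpace V M] [IsManifold 𝓘(ℂ, V) ω M]

theorem CSmoothOn.mono {X : Π x : M, CTan V x} {U W : Set M} (h : CSmoothOn V X U) (hW : W ⊆ U) :
    CSmoothOn V X W := ⟨h.1.mono hW, h.2.mono hW⟩

theorem CSmoothOn.congr {X Y : Π x : M, CTan V x} {U : Set M} (h : CSmoothOn V X U)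
    (he : ∀ x ∈ U, X x = Y x) : CSmoothOn V Y U :=
  ⟨h.1.congr fun x hx => by rw [he x hx], h.2.congr fun x hx => by rw [he x hx]⟩

theorem CSmoothOn.of_local {X : Π x : M, CTan V x} {U : Set M}
    (h : ∀ x ∈ U, ∃ W, IsOpen W ∧ x ∈ W ∧ CSmoothOn V X W) : CSmoothOn V X U := by
  constructor <;>
  · intro x hx
    obtain ⟨W, hW, hxW, hf⟩ := h x hx
    first
    | exact (hf.1.contMDiffAt (hW.mem_nhds hxW)).contMDiffWithinAt
    | exact (hf.2.contMDiffAt (hW.mem_nhds hxW)).contMDiffWithinAt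

theorem CSmoothOn.add {X Y : Π x : M, CTan V x} {U : Set M} (hX : CSmoothOn V X U)
    (hY : CSmoothOn V Y U) : CSmoothOn V (fun x => X x + Y x) U := by
  constructor
  · simp only [map_add]; exact hX.1.add_section hY.1
  · simp only [map_add]; exact hX.2.add_section hY.2

theorem CSmoothOn.smul {f : M → ℂ} {X : Π x : M, CTan V x} {U : Set M} (hf : Sm V f U)
    (hX : CSmoothOn V X U) : CSmoothOn V (fun x => f x • X x) U := by
  have h1 : ContMDiffOn 𝓘(ℝ, V) 𝓘(ℝ, ℝ) ∞ (fun x => (f x).re) U :=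
    (Complex.reCLM.contMDiff.contMDiffOn (s := Set.univ)).comp hf fun _ _ => trivial
  have h2 : ContMDiffOn 𝓘(ℝ, V) 𝓘(ℝ, ℝ) ∞ (fun x => (f x).im) U :=
    (Complex.imCLM.contMDiff.contMDiffOn (s := Set.univ)).comp hf fun _ _ => trivial
  constructor
  · simp only [cRe_smul]
    exact (h1.smul_section hX.1).sub_section (h2.smul_section hX.2)
  · simp only [cIm_smul]
    exact (h1.smul_section hX.2).add_section (h2.smul_section hX.1)

/-- Smooth functions differentiated along smooth complex vector fields are smooth. -/
theorem Sm.cDeriv {f : M → ℂ} {X : Π x : M, CTan V x} {U : Set M} (hU : IsOpen U) (hf : Sm V f U)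
    (hX : CSmoothOn V X U) : Sm V (fun x => cDeriv V x (X x) f) U := by
  simp only [cDeriv_eq]
  exact Sm.add (contMDiffOn_mvfderiv_apply (by simp) hU hf hX.1)
    (Sm.mul (Sm.const _ _) (contMDiffOn_mvfderiv_apply (by simp) hU hf hX.2))

theorem clm_mvfderiv {f : M → ℂ} {x : M} (hf : MDifferentiableAt 𝓘(ℝ, V) 𝓘(ℝ, ℂ) f x)
    (L : ℂ →L[ℝ] ℝ) (v : TangentSpace 𝓘(ℝ, V) x) :
    L (mvfderiv 𝓘(ℝ, V) f x v) = mvfderiv 𝓘(ℝ, V) (fun y => L (f y)) x v := by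
  have h1 : HasMFDerivAt 𝓘(ℝ, ℂ) 𝓘(ℝ, ℝ) L (f x) L := L.hasMFDerivAt
  change _ = mfderiv 𝓘(ℝ, V) 𝓘(ℝ, ℝ) (L ∘ f) x v
  rw [(h1.comp x hf.hasMFDerivAt).mfderiv]; rfl

theorem mvfderiv_congr_on {F : Type*} [NormedAddCommGroup F] [NormedSpace ℝ F] {x : M}
    {f g : M → F} {U : Set M} (hU : IsOpen U) (hx : x ∈ U) (h : ∀ y ∈ U, f y = g y)
    (v : TangentSpace 𝓘(ℝ, V) x) : mvfderiv 𝓘(ℝ, V) f x v = mvfderiv 𝓘(ℝ, V) g x v := by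
  change mfderiv 𝓘(ℝ, V) 𝓘(ℝ, F) f x v = mfderiv 𝓘(ℝ, V) 𝓘(ℝ, F) g x v
  rw [(Filter.eventuallyEq_of_mem (hU.mem_nhds hx) h).mfderiv_eq]
  rfl

/-- The commutator formula over ℝ concerns real-valued functions; it is applied to the real and
imaginary parts of f. -/
theorem mvfderiv_mlieBracket_complex [CompleteSpace V] {x : M}
    {A B : Π x : M, TangentSpace 𝓘(ℝ, V) x} {U : Set M} (hU : IsOpen U) (hx : x ∈ U)
    (hA : ContMDiffOn 𝓘(ℝ, V) 𝓘(ℝ, V).tangent ∞ (fun x => (⟨x, A x⟩ : TangentBundle 𝓘(ℝ, V) M)) U)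
    (hB : ContMDiffOn 𝓘(ℝ, V) 𝓘(ℝ, V).tangent ∞ (fun x => (⟨x, B x⟩ : TangentBundle 𝓘(ℝ, V) M)) U)
    {f : M → ℂ} (hf : Sm V f U) :
    mvfderiv 𝓘(ℝ, V) f x (VectorField.mlieBracket 𝓘(ℝ, V) A B x)
      = mvfderiv 𝓘(ℝ, V) (fun y => mvfderiv 𝓘(ℝ, V) f y (B y)) x (A x)
        - mvfderiv 𝓘(ℝ, V) (fun y => mvfderiv 𝓘(ℝ, V) f y (A y)) x (B x) := by
  have key : ∀ L : ℂ →L[ℝ] ℝ, L (mvfderiv 𝓘(ℝ, V) f x (VectorField.mlieBracket 𝓘(ℝ, V) A B x))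
      = L (mvfderiv 𝓘(ℝ, V) (fun y => mvfderiv 𝓘(ℝ, V) f y (B y)) x (A x)
        - mvfderiv 𝓘(ℝ, V) (fun y => mvfderiv 𝓘(ℝ, V) f y (A y)) x (B x)) := fun L => by
    have h1 : ContMDiffOn 𝓘(ℝ, V) 𝓘(ℝ, ℝ) ∞ (fun x => L (f x)) U :=
      (L.contMDiff.contMDiffOn (s := Set.univ)).comp hf fun _ _ => trivial
    have h2 : ∀ {C : Π x : M, TangentSpace 𝓘(ℝ, V) x}, ContMDiffOn 𝓘(ℝ, V) 𝓘(ℝ, V).tangent ∞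
        (fun x => (⟨x, C x⟩ : TangentBundle 𝓘(ℝ, V) M)) U →
        Sm V (fun y => mvfderiv 𝓘(ℝ, V) f y (C y)) U := fun hC =>
      contMDiffOn_mvfderiv_apply (by simp) hU hf hC
    rw [map_sub, clm_mvfderiv (hf.md hU hx), mvfderiv_mlieBracket hU hx hA hB h1,
      clm_mvfderiv ((h2 hA).md hU hx), clm_mvfderiv ((h2 hB).md hU hx)]
    congr 1
    · exact mvfderiv_congr_on hU hx (fun y hy => (clm_mvfderiv (hf.md hU hy) L _).symm) _
    · exact mvfderiv_congr_on hU hx (fun y hy => (clm_mvfderiv (hf.md hU hy) L _).symm) _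
  exact Complex.ext (key Complex.reCLM) (key Complex.imCLM)

theorem mvfderiv_add_I_mul {f g : M → ℂ} {x : M} (hf : MDifferentiableAt 𝓘(ℝ, V) 𝓘(ℝ, ℂ) f x)
    (hg : MDifferentiableAt 𝓘(ℝ, V) 𝓘(ℝ, ℂ) g x) (v : TangentSpace 𝓘(ℝ, V) x) :
    mvfderiv 𝓘(ℝ, V) (fun y => f y + Complex.I * g y) x v
      = mvfderiv 𝓘(ℝ, V) f x v + Complex.I * mvfderiv 𝓘(ℝ, V) g x v := by
  have h1 : HasMFDerivAt 𝓘(ℝ, ℂ) 𝓘(ℝ, ℂ) (fun z : ℂ => Complex.I * z) (g x)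
        (ContinuousLinearMap.mul ℝ ℂ Complex.I) := (ContinuousLinearMap.mul ℝ ℂ _).hasMFDerivAt
  change mfderiv 𝓘(ℝ, V) 𝓘(ℝ, ℂ) (f + (fun z => Complex.I * z) ∘ g) x v = _
  rw [(hf.hasMFDerivAt.add (h1.comp x hg.hasMFDerivAt)).mfderiv]; rfl

/-- The bracket of complex vector fields acts on functions as the commutator. -/
theorem cDeriv_cLie [CompleteSpace V] {X Y : Π x : M, CTan V x} {U : Set M} (hU : IsOpen U) {x : M}
    (hx : x ∈ U) (hX : CSmoothOn V X U) (hY : CSmoothOn V Y U) {f : M → ℂ} (hf : Sm V f U) :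
    cDeriv V x (cLie V X Y x) f = cDeriv V x (X x) (fun y => cDeriv V y (Y y) f)
      - cDeriv V x (Y x) (fun y => cDeriv V y (X y) f) := by
  have h2 : ∀ {C : Π x : M, TangentSpace 𝓘(ℝ, V) x}, ContMDiffOn 𝓘(ℝ, V) 𝓘(ℝ, V).tangent ∞
      (fun x => (⟨x, C x⟩ : TangentBundle 𝓘(ℝ, V) M)) U →
      MDifferentiableAt 𝓘(ℝ, V) 𝓘(ℝ, ℂ) (fun y => mvfderiv 𝓘(ℝ, V) f y (C y)) x := fun hC =>
    Sm.md (contMDiffOn_mvfderiv_apply (by simp) hU hf hC) hU hx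
  simp only [cDeriv_eq]
  rw [cLie, cRe_mk, cIm_mk, map_add, map_sub, mvfderiv_mlieBracket_complex hU hx hX.1 hY.1 hf,
    mvfderiv_mlieBracket_complex hU hx hX.1 hY.2 hf,
    mvfderiv_mlieBracket_complex hU hx hX.2 hY.1 hf,
    mvfderiv_mlieBracket_complex hU hx hX.2 hY.2 hf,
    mvfderiv_add_I_mul (h2 hY.1) (h2 hY.2), mvfderiv_add_I_mul (h2 hX.1) (h2 hX.2),
    mvfderiv_add_I_mul (h2 hY.1) (h2 hY.2), mvfderiv_add_I_mul (h2 hX.1) (h2 hX.2)]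
  linear_combination (mvfderiv 𝓘(ℝ, V) (fun y => mvfderiv 𝓘(ℝ, V) f y (cIm V y (X y))) x
      (cIm V x (Y x)) - mvfderiv 𝓘(ℝ, V) (fun y => mvfderiv 𝓘(ℝ, V) f y (cIm V y (Y y))) x
      (cIm V x (X x))) * Complex.I_mul_I

variable [FiniteDimensional ℂ V]

variable (V) in
/-- The holomorphic coordinate functions of the chart at `x₀`. -/
def zc (x₀ : M) (k : Fin (Module.finrank ℂ V)) (y : M) : ℂ :=
  (Module.finBasis ℂ V).coord k (extChartAt 𝓘(ℂ, V) x₀ y)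

variable (V) in
/-- The conjugates of the coordinate functions of the chart at `x₀`. -/
def zbar (x₀ : M) (k : Fin (Module.finrank ℂ V)) (y : M) : ℂ := starRingEnd ℂ (zc V x₀ k y)

theorem ho_zc (x₀ : M) (k : Fin (Module.finrank ℂ V)) : Ho V (zc V x₀ k) (chartAt V x₀).source := by
  have h1 := (((Module.finBasis ℂ V).coord k).toContinuousLinearMap.contMDiff (n := ω)).contMDiffOn
    (s := Set.univ)
  exact h1.comp (contMDiffOn_extChartAt (I := 𝓘(ℂ, V)) (n := ω) (x := x₀)) fun _ _ => trivial

theorem sm_zbar (x₀ : M) (k : Fin (Module.finrank ℂ V)) :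
    Sm V (zbar V x₀ k) (chartAt V x₀).source := (ho_zc x₀ k).sm.conj

variable (V) in
/-- The derivative at `y` of the chart at `x₀`. -/
def dchart (x₀ y : M) : TangentSpace 𝓘(ℝ, V) y →L[ℝ] V :=
  (trivializationAt V (TangentSpace 𝓘(ℝ, V) (M := M)) x₀).continuousLinearMapAt ℝ y

theorem mvfderiv_zc {x₀ y : M} (hy : y ∈ (chartAt V x₀).source) (k : Fin (Module.finrank ℂ V))
    (u : TangentSpace 𝓘(ℝ, V) y) :
    mvfderiv 𝓘(ℝ, V) (zc V x₀ k) y u = (Module.finBasis ℂ V).coord k (dchart V x₀ y u) := by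
  let L : V →L[ℝ] ℂ := (((Module.finBasis ℂ V).coord k).toContinuousLinearMap).restrictScalars ℝ
  have h1 : HasMFDerivAt 𝓘(ℝ, V) 𝓘(ℝ, ℂ) L (extChartAt 𝓘(ℝ, V) x₀ y) L := L.hasMFDerivAt
  have h2 : MDifferentiableAt 𝓘(ℝ, V) 𝓘(ℝ, V) (extChartAt 𝓘(ℝ, V) x₀) y :=
    mdifferentiableAt_extChartAt hy
  change mfderiv 𝓘(ℝ, V) 𝓘(ℝ, ℂ) (L ∘ extChartAt 𝓘(ℝ, V) x₀) y u = _
  rw [(h1.comp y h2.hasMFDerivAt).mfderiv, dchart,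
    TangentBundle.continuousLinearMapAt_trivializationAt (I := 𝓘(ℝ, V)) hy]
  rfl

theorem dchart_injective {x₀ y : M} (hy : y ∈ (chartAt V x₀).source) :
    Function.Injective (dchart V x₀ y) := by
  intro u v h
  have h1 := (trivializationAt V (TangentSpace 𝓘(ℝ, V) (M := M)) x₀).symmL_continuousLinearMapAt
    (R := ℝ) (b := y) hy
  rw [← h1 u, ← h1 v]
  exact congrArg _ h

theorem cDeriv_zc {x₀ y : M} (hy : y ∈ (chartAt V x₀).source) (k : Fin (Module.finrank ℂ V))
    (X : CTan V y) : cDeriv V y X (zc V x₀ k)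
      = (Module.finBasis ℂ V).coord k (dchart V x₀ y (cRe V y X))
        + Complex.I * (Module.finBasis ℂ V).coord k (dchart V x₀ y (cIm V y X)) := by
  rw [cDeriv_eq, mvfderiv_zc hy, mvfderiv_zc hy]

theorem cDeriv_zbar {x₀ y : M} (hy : y ∈ (chartAt V x₀).source) (k : Fin (Module.finrank ℂ V))
    (X : CTan V y) : cDeriv V y X (zbar V x₀ k)
      = starRingEnd ℂ ((Module.finBasis ℂ V).coord k (dchart V x₀ y (cRe V y X)))
        + Complex.I * starRingEnd ℂ ((Module.finBasis ℂ V).coord k (dchart V x₀ y (cIm V y X))) := by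
  have h := cDeriv_conj X ((ho_zc x₀ k).sm.md (chartAt V x₀).open_source hy)
  rw [mvfderiv_zc hy, mvfderiv_zc hy] at h
  exact h

/-- Let a and b be the k-th coordinates of the real and imaginary parts of X. Then `X(z_k) = a +
ib`, and the conjugate of `X(z̄_k)` is `a - ib`. Half the sum is a; the difference gives b in
`coord_cIm`. -/
theorem coord_cRe {x₀ y : M} (hy : y ∈ (chartAt V x₀).source) (k : Fin (Module.finrank ℂ V))
    (X : CTan V y) : (Module.finBasis ℂ V).coord k (dchart V x₀ y (cRe V y X))
      = 1 / 2 * (cDeriv V y X (zc V x₀ k) + starRingEnd ℂ (cDeriv V y X (zbar V x₀ k))) := by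
  rw [cDeriv_zc hy, cDeriv_zbar hy]
  simp only [map_add, map_mul, Complex.conj_conj, Complex.conj_I]
  ring

theorem coord_cIm {x₀ y : M} (hy : y ∈ (chartAt V x₀).source) (k : Fin (Module.finrank ℂ V))
    (X : CTan V y) : (Module.finBasis ℂ V).coord k (dchart V x₀ y (cIm V y X))
      = -Complex.I / 2 * (cDeriv V y X (zc V x₀ k) - starRingEnd ℂ (cDeriv V y X (zbar V x₀ k))) := by
  rw [cDeriv_zc hy, cDeriv_zbar hy]
  simp only [map_add, map_mul, Complex.conj_conj, Complex.conj_I]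
  linear_combination (Module.finBasis ℂ V).coord k (dchart V x₀ y (cIm V y X)) * Complex.I_mul_I

/-- A complex tangent vector is determined by the derivatives of the coordinates and of their
conjugates. -/
theorem cTan_eq_of_coord {x₀ y : M} (hy : y ∈ (chartAt V x₀).source) {X Y : CTan V y}
    (h1 : ∀ k, cDeriv V y X (zc V x₀ k) = cDeriv V y Y (zc V x₀ k))
    (h2 : ∀ k, cDeriv V y X (zbar V x₀ k) = cDeriv V y Y (zbar V x₀ k)) : X = Y := by
  apply cTan_ext <;> apply dchart_injective hy <;>
    apply (Module.finBasis ℂ V).ext_elem <;> intro k <;> simp only [← Module.Basis.coord_apply]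
  · rw [coord_cRe hy, coord_cRe hy, h1, h2]
  · rw [coord_cIm hy, coord_cIm hy, h1, h2]

/-- Both vectors kill the holomorphic coordinates, so only the conjugate ones remain to be compared.
-/
theorem T01_eq_of_coord {x₀ y : M} (hy : y ∈ (chartAt V x₀).source) {X Y : T01 V y}
    (h2 : ∀ k, cDeriv V y (X : CTan V y) (zbar V x₀ k) = cDeriv V y (Y : CTan V y) (zbar V x₀ k)) :
    X = Y := by
  have hz : ∀ k, MDifferentiableAt 𝓘(ℂ, V) 𝓘(ℂ, ℂ) (zc V x₀ k) y := fun k =>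
    (ho_zc x₀ k).md (chartAt V x₀).open_source hy
  exact Subtype.ext (cTan_eq_of_coord hy
    (fun k => by rw [cDeriv_T01 X.2 (hz k), cDeriv_T01 Y.2 (hz k)]) h2)

/-- Turns identities between complex fields into identities between differential operators on local
functions; the coordinates and their conjugates are enough test functions. -/
theorem cTan_eq_of_sm {x : M} {X Y : CTan V x} {U : Set M} (hU : IsOpen U) (hx : x ∈ U)
    (h : ∀ W, IsOpen W → x ∈ W → W ⊆ U → ∀ f, Sm V f W → cDeriv V x X f = cDeriv V x Y f) :
    X = Y := by
  have hs := mem_chart_source V x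
  have hW : IsOpen ((chartAt V x).source ∩ U) := (chartAt V x).open_source.inter hU
  exact cTan_eq_of_coord hs
    (fun k => h _ hW ⟨hs, hx⟩ Set.inter_subset_right _ ((ho_zc x k).sm.mono Set.inter_subset_left))
    (fun k => h _ hW ⟨hs, hx⟩ Set.inter_subset_right _ ((sm_zbar x k).mono Set.inter_subset_left))

theorem smoothOn_of_coord {x₀ : M} {U : Set M} (hU : IsOpen U) (hUs : U ⊆ (chartAt V x₀).source)
    {A : Π x : M, TangentSpace 𝓘(ℝ, V) x}
    (h : ∀ k, Sm V (fun y => (Module.finBasis ℂ V).coord k (dchart V x₀ y (A y))) U) :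
    ContMDiffOn 𝓘(ℝ, V) 𝓘(ℝ, V).tangent ∞ (fun x => (⟨x, A x⟩ : TangentBundle 𝓘(ℝ, V) M)) U := by
  have : IsManifold 𝓘(ℝ, V) (∞ + 1) M := .of_le (n := ω) le_top
  have : ContMDiffVectorBundle ∞ V (TangentSpace 𝓘(ℝ, V) (M := M)) 𝓘(ℝ, V) :=
    TangentBundle.contMDiffVectorBundle
  refine ((trivializationAt V (TangentSpace 𝓘(ℝ, V) (M := M)) x₀).contMDiffOn_section_iff hU hUs).2 ?_
  have h1 : ∀ k, ContMDiffOn 𝓘(ℝ, V) 𝓘(ℝ, V) ∞ (fun y =>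
      (Module.finBasis ℂ V).coord k (dchart V x₀ y (A y)) • Module.finBasis ℂ V k) U := fun k => by
    let L : ℂ →L[ℝ] V := (ContinuousLinearMap.toSpanSingleton ℂ (Module.finBasis ℂ V k)).restrictScalars ℝ
    exact ((L.contMDiff (n := ∞)).contMDiffOn (s := Set.univ)).comp (h k) fun _ _ => trivial
  have h2 : ContMDiffOn 𝓘(ℝ, V) 𝓘(ℝ, V) ∞ (fun y => ∑ k,
      (Module.finBasis ℂ V).coord k (dchart V x₀ y (A y)) • Module.finBasis ℂ V k) U :=
    contMDiffOn_finsetSum fun k _ => h1 k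
  refine h2.congr fun y hy => ?_
  have h3 := (Module.finBasis ℂ V).sum_repr (dchart V x₀ y (A y))
  refine Eq.trans ?_ h3.symm
  rw [dchart, Trivialization.continuousLinearMapAt_apply_of_mem _ _ (hUs hy)]

/-- The components of the real and imaginary parts are combinations of the derivatives of `z_k` and
of the conjugates of the derivatives of `z̄_k`, by `coord_cRe` and `coord_cIm`. -/
theorem cSmoothOn_of_coord {x₀ : M} {U : Set M} (hU : IsOpen U) (hUs : U ⊆ (chartAt V x₀).source)
    {X : Π x : M, CTan V x} (h1 : ∀ k, Sm V (fun y => cDeriv V y (X y) (zc V x₀ k)) U)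
    (h2 : ∀ k, Sm V (fun y => cDeriv V y (X y) (zbar V x₀ k)) U) : CSmoothOn V X U := by
  constructor
  · refine smoothOn_of_coord hU hUs fun k => ?_
    refine ContMDiffOn.congr (Sm.mul (Sm.const (1 / 2) U) ((h1 k).add (h2 k).conj)) fun y hy => ?_
    exact coord_cRe (hUs hy) k (X y)
  · refine smoothOn_of_coord hU hUs fun k => ?_
    refine ContMDiffOn.congr (Sm.mul (Sm.const (-Complex.I / 2) U) ((h1 k).sub (h2 k).conj))
      fun y hy => ?_
    exact coord_cIm (hUs hy) k (X y)

end Coordinates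

/-! ### Brackets of complex vector fields and their types. -/

section ComplexFields

variable {V : Type*} [NormedAddCommGroup V] [NormedSpace ℂ V]
  {M : Type*} [TopologicalSpace M] [ChartedSpace V M] [IsManifold 𝓘(ℂ, V) ω M]
  [FiniteDimensional ℂ V]

theorem cDeriv_pr01_zbar {x₀ y : M} (hy : y ∈ (chartAt V x₀).source) (X : CTan V y)
    (k : Fin (Module.finrank ℂ V)) :
    cDeriv V y (pr01 V y X : CTan V y) (zbar V x₀ k) = cDeriv V y X (zbar V x₀ k) :=
  cDeriv_pr01_conj X ((ho_zc x₀ k).md (chartAt V x₀).open_source hy)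

theorem cDeriv_holTan_zbar {x₀ y : M} (hy : y ∈ (chartAt V x₀).source)
    (v : TangentSpace 𝓘(ℂ, V) y) (k : Fin (Module.finrank ℂ V)) :
    cDeriv V y (holTan V y v) (zbar V x₀ k) = 0 :=
  cDeriv_holTan_conj v ((ho_zc x₀ k).md (chartAt V x₀).open_source hy)

theorem pr01_T01 {y : M} (X : T01 V y) : pr01 V y (X : CTan V y) = X :=
  T01_eq_of_coord (mem_chart_source V y) fun k => cDeriv_pr01_zbar (mem_chart_source V y) _ k

/-- Smoothness is tested on the coordinates and their conjugates, on which the bracket is a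
commutator of operators that preserve smooth functions. -/
theorem CSmoothOn.cLie {X Y : Π x : M, CTan V x} {U : Set M} (hU : IsOpen U)
    (hX : CSmoothOn V X U) (hY : CSmoothOn V Y U) : CSmoothOn V (cLie V X Y) U := by
  have : CompleteSpace V := FiniteDimensional.complete ℂ V
  refine CSmoothOn.of_local fun x hx => ⟨(chartAt V x).source ∩ U,
    (chartAt V x).open_source.inter hU, ⟨mem_chart_source V x, hx⟩, ?_⟩
  have hW := (chartAt V x).open_source.inter hU
  have key : ∀ f, Sm V f ((chartAt V x).source ∩ U) →
      Sm V (fun y => HolAtiyah.cDeriv V y (HolAtiyah.cLie V X Y y) f)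
        ((chartAt V x).source ∩ U) := fun f hf => by
    have hX' := hX.mono (Set.inter_subset_right : (chartAt V x).source ∩ U ⊆ U)
    have hY' := hY.mono (Set.inter_subset_right : (chartAt V x).source ∩ U ⊆ U)
    exact ContMDiffOn.congr ((Sm.cDeriv hW (Sm.cDeriv hW hf hY') hX').sub
      (Sm.cDeriv hW (Sm.cDeriv hW hf hX') hY')) fun y hy => cDeriv_cLie hW hy hX' hY' hf
  exact cSmoothOn_of_coord hW Set.inter_subset_left
    (fun k => key _ ((ho_zc x k).sm.mono Set.inter_subset_left))
    (fun k => key _ ((sm_zbar x k).mono Set.inter_subset_left))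

theorem CSmoothOn.pr01 {X : Π x : M, CTan V x} {U : Set M} (hU : IsOpen U)
    (hX : CSmoothOn V X U) : CSmoothOn V (fun x => (pr01 V x (X x) : CTan V x)) U := by
  refine CSmoothOn.of_local fun x hx => ⟨(chartAt V x).source ∩ U,
    (chartAt V x).open_source.inter hU, ⟨mem_chart_source V x, hx⟩, ?_⟩
  have hW := (chartAt V x).open_source.inter hU
  refine cSmoothOn_of_coord hW Set.inter_subset_left (fun k => ?_) (fun k => ?_)
  · exact ContMDiffOn.congr (Sm.const 0 _) fun y hy =>
      cDeriv_pr01 _ ((ho_zc x k).md (chartAt V x).open_source hy.1)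
  · exact ContMDiffOn.congr (Sm.cDeriv hW ((sm_zbar x k).mono Set.inter_subset_left)
      (hX.mono Set.inter_subset_right)) fun y hy => cDeriv_pr01_zbar hy.1 _ k

theorem Ho.holDeriv {f : M → ℂ} {U : Set M} (hU : IsOpen U) (hf : Ho V f U)
    {v : Π x : M, TangentSpace 𝓘(ℂ, V) x}
    (hv : ContMDiffOn 𝓘(ℂ, V) 𝓘(ℂ, V).tangent ω
      (fun x => (⟨x, v x⟩ : TangentBundle 𝓘(ℂ, V) M)) U) :
    Ho V (fun x => holDeriv V x (v x) f) U :=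
  contMDiffOn_mvfderiv_apply (by simp) hU hf hv

theorem CSmoothOn.holTan {v : Π x : M, TangentSpace 𝓘(ℂ, V) x} {U : Set M} (hU : IsOpen U)
    (hv : ContMDiffOn 𝓘(ℂ, V) 𝓘(ℂ, V).tangent ω
      (fun x => (⟨x, v x⟩ : TangentBundle 𝓘(ℂ, V) M)) U) :
    CSmoothOn V (fun x => holTan V x (v x)) U := by
  refine CSmoothOn.of_local fun x hx => ⟨(chartAt V x).source ∩ U,
    (chartAt V x).open_source.inter hU, ⟨mem_chart_source V x, hx⟩, ?_⟩
  have hW := (chartAt V x).open_source.inter hU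
  refine cSmoothOn_of_coord hW Set.inter_subset_left (fun k => ?_) (fun k => ?_)
  · refine ContMDiffOn.congr (Ho.holDeriv hW ((ho_zc x k).mono Set.inter_subset_left)
      (hv.mono Set.inter_subset_right)).sm fun y hy => ?_
    exact cDeriv_holTan _ ((ho_zc x k).md (chartAt V x).open_source hy.1)
  · exact ContMDiffOn.congr (Sm.const 0 _) fun y hy => cDeriv_holTan_zbar hy.1 _ k

theorem cLie_congr {X X' Y Y' : Π x : M, CTan V x} {U : Set M} (hU : IsOpen U) {x : M} (hx : x ∈ U)
    (hX : ∀ y ∈ U, X y = X' y) (hY : ∀ y ∈ U, Y y = Y' y) : cLie V X Y x = cLie V X' Y' x := by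
  have h : ∀ {Z Z' : Π x : M, CTan V x}, (∀ y ∈ U, Z y = Z' y) →
      (fun y => cRe V y (Z y)) =ᶠ[𝓝 x] (fun y => cRe V y (Z' y)) ∧
      (fun y => cIm V y (Z y)) =ᶠ[𝓝 x] (fun y => cIm V y (Z' y)) := fun hZ =>
    ⟨Filter.eventuallyEq_of_mem (hU.mem_nhds hx) fun y hy => congrArg (cRe V y) (hZ y hy),
      Filter.eventuallyEq_of_mem (hU.mem_nhds hx) fun y hy => congrArg (cIm V y) (hZ y hy)⟩
  rw [cLie, cLie, (h hX).1.mlieBracket_vectorField_eq (h hY).1,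
    (h hX).2.mlieBracket_vectorField_eq (h hY).2, (h hX).1.mlieBracket_vectorField_eq (h hY).2,
    (h hX).2.mlieBracket_vectorField_eq (h hY).1]

section Algebra

variable {X Y Z : Π x : M, CTan V x} {U : Set M} (hU : IsOpen U) {x : M} (hx : x ∈ U)
  (hX : CSmoothOn V X U) (hY : CSmoothOn V Y U) (hZ : CSmoothOn V Z U)
include hU hx hX hY

/-- Complex fields are compared as operators on local smooth functions, where the bracket is a
commutator. The Leibniz rule, additivity and the Jacobi identity below have the same proof. -/
theorem cLie_skew : cLie V X Y x = - cLie V Y X x := by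
  have : CompleteSpace V := FiniteDimensional.complete ℂ V
  refine cTan_eq_of_sm hU hx fun W hW hxW hWU f hf => ?_
  rw [cDeriv_neg_left, cDeriv_cLie hW hxW (hX.mono hWU) (hY.mono hWU) hf,
    cDeriv_cLie hW hxW (hY.mono hWU) (hX.mono hWU) hf]
  ring

theorem cLie_smul_right {g : M → ℂ} (hg : Sm V g U) :
    cLie V X (fun y => g y • Y y) x = cDeriv V x (X x) g • Y x + g x • cLie V X Y x := by
  have : CompleteSpace V := FiniteDimensional.complete ℂ V
  refine cTan_eq_of_sm hU hx fun W hW hxW hWU f hf => ?_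
  have hX' := hX.mono hWU
  have hY' := hY.mono hWU
  have hg' : Sm V g W := hg.mono hWU
  rw [cDeriv_add, cDeriv_smul, cDeriv_smul, cDeriv_cLie hW hxW hX' (hY'.smul hg') hf,
    cDeriv_cLie hW hxW hX' hY' hf, cDeriv_smul]
  simp only [cDeriv_smul]
  rw [cDeriv_mul _ (hg'.md hW hxW) ((hf.cDeriv hW hY').md hW hxW)]
  ring

include hZ

theorem cLie_add_right : cLie V X (fun y => Y y + Z y) x = cLie V X Y x + cLie V X Z x := by
  have : CompleteSpace V := FiniteDimensional.complete ℂ V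
  refine cTan_eq_of_sm hU hx fun W hW hxW hWU f hf => ?_
  have hX' := hX.mono hWU
  have hY' := hY.mono hWU
  have hZ' := hZ.mono hWU
  rw [cDeriv_add, cDeriv_cLie hW hxW hX' (hY'.add hZ') hf, cDeriv_cLie hW hxW hX' hY' hf,
    cDeriv_cLie hW hxW hX' hZ' hf, cDeriv_add]
  simp only [cDeriv_add]
  rw [cDeriv_fadd _ ((hf.cDeriv hW hY').md hW hxW) ((hf.cDeriv hW hZ').md hW hxW)]
  ring

theorem cLie_jacobi : cLie V X (cLie V Y Z) x + cLie V Y (cLie V Z X) x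
    + cLie V Z (cLie V X Y) x = 0 := by
  have : CompleteSpace V := FiniteDimensional.complete ℂ V
  refine cTan_eq_of_sm hU hx fun W hW hxW hWU f hf => ?_
  have key : ∀ {A B C : Π x : M, CTan V x}, CSmoothOn V A W → CSmoothOn V B W → CSmoothOn V C W →
      cDeriv V x (cLie V A (cLie V B C) x) f
        = cDeriv V x (A x) (fun y => cDeriv V y (B y) fun z => cDeriv V z (C z) f)
        - cDeriv V x (A x) (fun y => cDeriv V y (C y) fun z => cDeriv V z (B z) f)
        - (cDeriv V x (B x) (fun y => cDeriv V y (C y) fun z => cDeriv V z (A z) f)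
          - cDeriv V x (C x) (fun y => cDeriv V y (B y) fun z => cDeriv V z (A z) f)) := by
    intro A B C hA hB hC
    rw [cDeriv_cLie hW hxW hA (hB.cLie hW hC) hf, cDeriv_cLie hW hxW hB hC (hf.cDeriv hW hA),
      cDeriv_congr_on (A x) hW hxW fun y hy => cDeriv_cLie hW hy hB hC hf,
      cDeriv_fsub _ (((hf.cDeriv hW hC).cDeriv hW hB).md hW hxW)
        (((hf.cDeriv hW hB).cDeriv hW hC).md hW hxW)]
  have hX' := hX.mono hWU
  have hY' := hY.mono hWU
  have hZ' := hZ.mono hWU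
  rw [cDeriv_add, cDeriv_add, key hX' hY' hZ', key hY' hZ' hX', key hZ' hX' hY', cDeriv_zero_left]
  ring

end Algebra

theorem cSmoothOn_zero (U : Set M) : CSmoothOn V (fun _ => 0) U := by
  refine CSmoothOn.of_local fun x _ => ⟨_, (chartAt V x).open_source, mem_chart_source V x, ?_⟩
  refine cSmoothOn_of_coord (chartAt V x).open_source subset_rfl (fun k => ?_) (fun k => ?_) <;>
  simpa only [cDeriv_zero_left] using Sm.const 0 _

theorem CSmoothOn.sum {ι : Type*} (s : Finset ι) {X : ι → Π x : M, CTan V x} {U : Set M}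
    (h : ∀ i ∈ s, CSmoothOn V (X i) U) : CSmoothOn V (fun x => ∑ i ∈ s, X i x) U := by
  classical
  induction s using Finset.induction_on with
  | empty => simpa using cSmoothOn_zero U
  | insert i s hi ih =>
    simp only [Finset.sum_insert hi]
    exact (h i (by simp)).add (ih fun j hj => h j (by simp [hj]))

theorem cLie_zero_right {X : Π x : M, CTan V x} {U : Set M} (hU : IsOpen U) {x : M} (hx : x ∈ U)
    (hX : CSmoothOn V X U) : cLie V X (fun _ => 0) x = 0 := by
  have h := cLie_smul_right hU hx hX (cSmoothOn_zero U) (Sm.const 0 U)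
  simpa using h

/-- Two complex tangent fields of type `(1,0)` coming from holomorphic fields have the bracket
coming from the holomorphic bracket. -/
theorem holTan_mlieBracket {v w : Π x : M, TangentSpace 𝓘(ℂ, V) x} {U : Set M} (hU : IsOpen U)
    (hv : ContMDiffOn 𝓘(ℂ, V) 𝓘(ℂ, V).tangent ω
      (fun x => (⟨x, v x⟩ : TangentBundle 𝓘(ℂ, V) M)) U)
    (hw : ContMDiffOn 𝓘(ℂ, V) 𝓘(ℂ, V).tangent ω
      (fun x => (⟨x, w x⟩ : TangentBundle 𝓘(ℂ, V) M)) U) {x : M} (hx : x ∈ U) :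
    holTan V x (VectorField.mlieBracket 𝓘(ℂ, V) v w x)
      = cLie V (fun y => holTan V y (v y)) (fun y => holTan V y (w y)) x := by
  have : CompleteSpace V := FiniteDimensional.complete ℂ V
  have hs := (chartAt V x).open_source
  have hW := hs.inter hU
  have hxW : x ∈ (chartAt V x).source ∩ U := ⟨mem_chart_source V x, hx⟩
  have hv' := hv.mono (Set.inter_subset_right : (chartAt V x).source ∩ U ⊆ U)
  have hw' := hw.mono (Set.inter_subset_right : (chartAt V x).source ∩ U ⊆ U)
  have hcv := CSmoothOn.holTan hW hv'
  have hcw := CSmoothOn.holTan hW hw'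
  refine cTan_eq_of_coord (mem_chart_source V x) (fun k => ?_) (fun k => ?_)
  -- On `z_k`: a holomorphic function has the same derivative along a holomorphic field and along
  -- its (1,0)-image, and that derivative is again holomorphic, so both brackets are the same
  -- commutator.
  · have hz : Ho V (zc V x k) ((chartAt V x).source ∩ U) := (ho_zc x k).mono Set.inter_subset_left
    have e : ∀ {a b : Π x : M, TangentSpace 𝓘(ℂ, V) x}, ContMDiffOn 𝓘(ℂ, V) 𝓘(ℂ, V).tangent ω
        (fun x => (⟨x, b x⟩ : TangentBundle 𝓘(ℂ, V) M)) ((chartAt V x).source ∩ U) →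
        cDeriv V x (holTan V x (a x)) (fun y => cDeriv V y (holTan V y (b y)) (zc V x k))
        = mvfderiv 𝓘(ℂ, V) (fun y => mvfderiv 𝓘(ℂ, V) (zc V x k) y (b y)) x (a x) := by
      intro a b hb
      rw [cDeriv_congr_on _ hW hxW fun y hy => cDeriv_holTan (b y) (hz.md hW hy),
        cDeriv_holTan _ ((Ho.holDeriv hW hz hb).md hW hxW)]
      rfl
    rw [cDeriv_holTan _ (hz.md hW hxW), cDeriv_cLie hW hxW hcv hcw hz.sm, e hw', e hv']
    exact mvfderiv_mlieBracket hW hxW (hv'.of_le le_top) (hw'.of_le le_top) (hz.of_le le_top)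
  -- On `z̄_k` both sides vanish, because fields of type (1,0) kill the conjugate coordinates.
  · have hz : Sm V (zbar V x k) ((chartAt V x).source ∩ U) :=
      (sm_zbar x k).mono Set.inter_subset_left
    rw [cDeriv_holTan_zbar (mem_chart_source V x), cDeriv_cLie hW hxW hcv hcw hz,
      cDeriv_congr_on _ hW hxW fun y hy => cDeriv_holTan_zbar hy.1 (w y) k,
      cDeriv_congr_on _ hW hxW fun y hy => cDeriv_holTan_zbar hy.1 (v y) k, cDeriv_const,
      cDeriv_const, sub_zero]

/-- The bracket of fields of type `(0,1)` is of type `(0,1)`. -/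
theorem coe_pr01_cLie {X Y : Π x : M, T01 V x} {U : Set M} (hU : IsOpen U) {x : M} (hx : x ∈ U)
    (hX : CSmoothOn V (fun x => (X x : CTan V x)) U)
    (hY : CSmoothOn V (fun x => (Y x : CTan V x)) U) :
    (pr01 V x (cLie V (fun y => (X y : CTan V y)) (fun y => (Y y : CTan V y)) x) : CTan V x)
      = cLie V (fun y => (X y : CTan V y)) (fun y => (Y y : CTan V y)) x := by
  have : CompleteSpace V := FiniteDimensional.complete ℂ V
  have hs := (chartAt V x).open_source
  have hW := hs.inter hU
  have hxW : x ∈ (chartAt V x).source ∩ U := ⟨mem_chart_source V x, hx⟩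
  have hz : ∀ k, Ho V (zc V x k) ((chartAt V x).source ∩ U) := fun k =>
    (ho_zc x k).mono Set.inter_subset_left
  refine cTan_eq_of_coord (mem_chart_source V x) (fun k => ?_)
    (fun k => cDeriv_pr01_zbar (mem_chart_source V x) _ k)
  rw [cDeriv_pr01 _ ((hz k).md hW hxW), cDeriv_cLie hW hxW (hX.mono Set.inter_subset_right)
      (hY.mono Set.inter_subset_right) (hz k).sm,
    cDeriv_congr_on _ hW hxW fun y hy => cDeriv_T01 (X y).2 ((hz k).md hW hy),
    cDeriv_congr_on _ hW hxW fun y hy => cDeriv_T01 (Y y).2 ((hz k).md hW hy), cDeriv_const,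
    cDeriv_const, sub_zero]

variable (V) in
/-- The coordinate field `∂/∂z̄ₖ` of the chart at `x₀`. -/
def delbar (x₀ : M) (k : Fin (Module.finrank ℂ V)) (y : M) : T01 V y :=
  pr01 V y ((1 : ℂ) ⊗ₜ[ℝ]
    (trivializationAt V (TangentSpace 𝓘(ℝ, V) (M := M)) x₀).symm y (Module.finBasis ℂ V k))

theorem cDeriv_delbar_zbar {x₀ y : M} (hy : y ∈ (chartAt V x₀).source)
    (j k : Fin (Module.finrank ℂ V)) :
    cDeriv V y (delbar V x₀ k y : CTan V y) (zbar V x₀ j) = if j = k then 1 else 0 := by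
  rw [delbar, cDeriv_pr01_zbar hy, cDeriv_zbar hy, cRe_one, cIm_one]
  have h : dchart V x₀ y ((trivializationAt V (TangentSpace 𝓘(ℝ, V) (M := M)) x₀).symm y
      (Module.finBasis ℂ V k)) = Module.finBasis ℂ V k := by
    rw [dchart, Trivialization.continuousLinearMapAt_apply_of_mem _ _ hy,
      Trivialization.apply_mk_symm _ hy]
  rw [h, Module.Basis.coord_apply, Module.Basis.repr_self, Finsupp.single_apply]
  simp [eq_comm]

theorem delbar_smooth (x₀ : M) (k : Fin (Module.finrank ℂ V)) :
    CSmoothOn V (fun y => (delbar V x₀ k y : CTan V y)) (chartAt V x₀).source := by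
  have hs := (chartAt V x₀).open_source
  refine cSmoothOn_of_coord hs subset_rfl (fun j => ?_) (fun j => ?_)
  · exact ContMDiffOn.congr (Sm.const 0 _) fun y hy =>
      cDeriv_T01 (delbar V x₀ k y).2 ((ho_zc x₀ j).md hs hy)
  · exact ContMDiffOn.congr (Sm.const _ _) fun y hy => cDeriv_delbar_zbar hy j k

theorem sum_delbar {x₀ y : M} (hy : y ∈ (chartAt V x₀).source) (X : T01 V y) :
    ∑ k, cDeriv V y (X : CTan V y) (zbar V x₀ k) • delbar V x₀ k y = X := by
  refine T01_eq_of_coord hy fun j => ?_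
  rw [AddSubmonoidClass.coe_finsetSum, cDeriv_sum_left]
  simp [cDeriv_smul, cDeriv_delbar_zbar hy]

end ComplexFields

/-! ### The real bundle underlying a complex one. -/

section RealStructure

variable {V : Type*} [NormedAddCommGroup V] [NormedSpace ℂ V]
  {M : Type*} [TopologicalSpace M] [ChartedSpace V M]
  {F : Type*} [NormedAddCommGroup F] [NormedSpace ℂ F]
  {Fib : M → Type*} [∀ x, AddCommGroup (Fib x)] [∀ x, Module ℂ (Fib x)]
  [∀ x, TopologicalSpace (Fib x)] [TopologicalSpace (TotalSpace F Fib)] [FiberBundle F Fib]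

theorem isLinear_real_of_complex (e : Trivialization F (TotalSpace.proj : TotalSpace F Fib → M))
    [h : e.IsLinear ℂ] : e.IsLinear ℝ where
  linear b hb := by
    have hl := h.linear b hb
    exact ⟨hl.map_add, fun c v => by
      have := hl.map_smul (c : ℂ) v
      simpa only [Complex.coe_smul] using this⟩

theorem coordChangeL_real (e e' : Trivialization F (TotalSpace.proj : TotalSpace F Fib → M))
    [e.IsLinear ℂ] [e'.IsLinear ℂ] [e.IsLinear ℝ] [e'.IsLinear ℝ] {b : M}
    (hb : b ∈ e.baseSet ∩ e'.baseSet) :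
    (e.coordChangeL ℝ e' b : F →L[ℝ] F)
      = ContinuousLinearMap.restrictScalarsL ℂ F F ℝ ℝ (e.coordChangeL ℂ e' b : F →L[ℂ] F) := by
  ext v
  exact (e.coordChangeL_apply (R := ℝ) e' hb v).trans (e.coordChangeL_apply (R := ℂ) e' hb v).symm

/-- The underlying real bundle of a complex vector bundle. -/
theorem vectorBundle_real_of_complex [VectorBundle ℂ F Fib] : VectorBundle ℝ F Fib where
  trivialization_linear' e _ := isLinear_real_of_complex e
  continuousOn_coordChange' e e' _ _ := by
    have := isLinear_real_of_complex e
    have := isLinear_real_of_complex e'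
    exact ((ContinuousLinearMap.restrictScalarsL ℂ F F ℝ ℝ).continuous.comp_continuousOn
      (continuousOn_coordChange ℂ e e')).congr fun b hb => coordChangeL_real e e' hb

/-- The underlying smooth real bundle of a holomorphic vector bundle. -/
theorem contMDiffVectorBundle_real_of_complex [VectorBundle ℂ F Fib] [VectorBundle ℝ F Fib]
    [h : ContMDiffVectorBundle ω F Fib 𝓘(ℂ, V)] : ContMDiffVectorBundle ∞ F Fib 𝓘(ℝ, V) where
  contMDiffOn_coordChangeL e e' _ _ := by
    have h1 := contMDiffOn_real_of_complex (h.contMDiffOn_coordChangeL e e')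
    have h2 := ((ContinuousLinearMap.restrictScalarsL ℂ F F ℝ ℝ).contMDiff (n := ω)).comp_contMDiffOn h1
    exact (h2.congr fun b hb => coordChangeL_real e e' hb).of_le le_top

end RealStructure

/-! ### Regularity tested on linear coordinates. -/

section Coordinates

variable {𝕜 : Type*} [NontriviallyNormedField 𝕜] [NormedAlgebra 𝕜 ℂ]
  {V : Type*} [NormedAddCommGroup V] [NormedSpace 𝕜 V]
  {M : Type*} [TopologicalSpace M] [ChartedSpace V M]
  {F : Type*} [NormedAddCommGroup F] [NormedSpace 𝕜 F] {ι : Type*} [Fintype ι]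

theorem contMDiffOn_iff_coord (L : F →L[𝕜] (ι → ℂ)) (L' : (ι → ℂ) →L[𝕜] F)
    (hL : ∀ v, L' (L v) = v) {n : ℕ∞ω} {f : M → F} {U : Set M} :
    ContMDiffOn 𝓘(𝕜, V) 𝓘(𝕜, F) n f U ↔
      ∀ i, ContMDiffOn 𝓘(𝕜, V) 𝓘(𝕜, ℂ) n (fun x => L (f x) i) U := by
  rw [← contMDiffOn_pi_space]
  refine ⟨fun h => L.contMDiff.comp_contMDiffOn h, fun h => ?_⟩
  exact (L'.contMDiff.comp_contMDiffOn h).congr fun x _ => (hL _).symm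

end Coordinates

/-! ### Complex derivatives commute with complex-linear maps. -/

section ComplexDerivative
variable {V : Type*} [NormedAddCommGroup V] [NormedSpace ℂ V]
  {M : Type*} [TopologicalSpace M] [ChartedSpace V M]
  {F G : Type*} [NormedAddCommGroup F] [NormedSpace ℂ F] [NormedAddCommGroup G] [NormedSpace ℂ G]

theorem cDeriv_continuousLinearMap {x : M} (X : CTan V x) {g : M → F}
    (hg : MDifferentiableAt 𝓘(ℝ, V) 𝓘(ℝ, F) g x) (L : F →L[ℂ] G) :
    cDeriv V x X (fun y => L (g y)) = L (cDeriv V x X g) := by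
  have h1 : HasMFDerivAt 𝓘(ℝ, F) 𝓘(ℝ, G) L (g x) (L.restrictScalars ℝ) :=
    (L.restrictScalars ℝ).hasMFDerivAt
  have h2 := (h1.comp x hg.hasMFDerivAt).mfderiv
  have h3 : ∀ v, mfderiv 𝓘(ℝ, V) 𝓘(ℝ, G) (fun y => L (g y)) x v
      = L (mfderiv 𝓘(ℝ, V) 𝓘(ℝ, F) g x v) := fun v => congrArg (fun T => T v) h2
  have h4 : ∀ a b : F, L (a + Complex.I • b) = L a + Complex.I • L b := fun a b => by
    rw [map_add, map_smul]
  refine (congrArg₂ (fun a b : G => a + Complex.I • b) (h3 _) (h3 _)).trans (h4 _ _).symm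

end ComplexDerivative

/-! ### Local frames and the vector bundles they define. -/

section Frames

variable (V : Type*) [NormedAddCommGroup V] [NormedSpace ℂ V]
  {M : Type*} [TopologicalSpace M] [ChartedSpace V M]

/-- A smooth frame on `U` of a family of vector spaces, with its dual coframe. -/
structure SmFrame (E : SectionFamily M) (ι : Type) [Fintype ι] [DecidableEq ι] (U : Set M) where
  /-- the frame -/
  e : ι → Π x, E.Fib x
  /-- the coordinates -/
  c : ι → ∀ x, E.Fib x →ₗ[ℂ] ℂ
  c_e : ∀ x ∈ U, ∀ i j, c i x (e j x) = if i = j then 1 else 0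
  sum_c : ∀ x ∈ U, ∀ v, ∑ i, c i x v • e i x = v
  smoothOn_iff : ∀ W, IsOpen W → W ⊆ U → ∀ s : Π x, E.Fib x,
    E.SmoothOn s W ↔ ∀ i, Sm V (fun x => c i x (s x)) W

/-- Families of vector spaces with smooth local frames. -/
structure IsLocFree (E : SectionFamily M) : Prop where
  of_local : ∀ U, IsOpen U → ∀ s, (∀ x ∈ U, E.SmoothNear s x) → E.SmoothOn s U
  mono : ∀ U W s, IsOpen U → IsOpen W → W ⊆ U → E.SmoothOn s U → E.SmoothOn s W
  frame : ∃ (ι : Type) (_ : Fintype ι) (_ : DecidableEq ι), ∀ x : M, ∃ U, IsOpen U ∧ x ∈ U ∧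
    Nonempty (SmFrame V E ι U)

variable {V}

/-- The frame given by a local trivialization of a vector bundle. -/
def SmFrame.ofTrivialization {F : Type*} [NormedAddCommGroup F] [NormedSpace ℂ F]
    [FiniteDimensional ℂ F] {E : SectionFamily M}
    [∀ x, TopologicalSpace (E.Fib x)] [TopologicalSpace (TotalSpace F E.Fib)]
    [FiberBundle F E.Fib] [VectorBundle ℂ F E.Fib] [VectorBundle ℝ F E.Fib]
    [ContMDiffVectorBundle ∞ F E.Fib 𝓘(ℝ, V)]
    (hE : ∀ U, IsOpen U → ∀ s : Π x, E.Fib x, E.SmoothOn s U ↔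
      ContMDiffOn 𝓘(ℝ, V) (𝓘(ℝ, V).prod 𝓘(ℝ, F)) ∞ (fun x => TotalSpace.mk' F x (s x)) U)
    (t : Trivialization F (TotalSpace.proj : TotalSpace F E.Fib → M)) [MemTrivializationAtlas t] :
    SmFrame V E (Fin (Module.finrank ℂ F)) t.baseSet where
  e i x := t.symm x (Module.finBasis ℂ F i)
  c i x := (Module.finBasis ℂ F).coord i ∘ₗ t.linearMapAt ℂ x
  c_e x hx i j := by
    have h : t.linearMapAt ℂ x (t.symm x (Module.finBasis ℂ F j)) = Module.finBasis ℂ F j := by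
      rw [t.coe_linearMapAt_of_mem hx]
      exact congrArg Prod.snd (t.apply_mk_symm hx _)
    rw [LinearMap.comp_apply, h, Module.Basis.coord_apply, Module.Basis.repr_self,
      Finsupp.single_apply]
    simp only [eq_comm]
  sum_c x hx v := by
    have h1 : ∀ w, t.symm x w = t.symmₗ ℂ x w := fun w =>
      (congrFun (t.coe_symmₗ (R := ℂ) hx) w).symm
    simp only [h1]
    rw [← t.symmₗ_linearMapAt (R := ℂ) hx v]
    simp only [← map_smul, ← map_sum]
    congr 1
    rw [t.symmₗ_linearMapAt (R := ℂ) hx v]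
    exact (Module.finBasis ℂ F).sum_repr _
  smoothOn_iff W hW hWU s := by
    rw [hE W hW, t.contMDiffOn_section_iff hW hWU,
      contMDiffOn_iff_coord (𝕜 := ℝ) (F := F)
        ((Module.finBasis ℂ F).equivFunL.toContinuousLinearMap.restrictScalars ℝ)
        ((Module.finBasis ℂ F).equivFunL.symm.toContinuousLinearMap.restrictScalars ℝ)
        (Module.finBasis ℂ F).equivFunL.symm_apply_apply]
    refine forall_congr' fun i => contMDiffOn_congr fun x hx => ?_
    rw [LinearMap.comp_apply, t.coe_linearMapAt_of_mem (hWU hx)]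
    rfl

theorem IsLocFree.of_bundle {F : Type*} [NormedAddCommGroup F] [NormedSpace ℂ F]
    [FiniteDimensional ℂ F] {E : SectionFamily M}
    [∀ x, TopologicalSpace (E.Fib x)] [TopologicalSpace (TotalSpace F E.Fib)]
    [FiberBundle F E.Fib] [VectorBundle ℂ F E.Fib] [VectorBundle ℝ F E.Fib]
    [ContMDiffVectorBundle ∞ F E.Fib 𝓘(ℝ, V)]
    (hE : ∀ U, IsOpen U → ∀ s : Π x, E.Fib x, E.SmoothOn s U ↔
      ContMDiffOn 𝓘(ℝ, V) (𝓘(ℝ, V).prod 𝓘(ℝ, F)) ∞ (fun x => TotalSpace.mk' F x (s x)) U) :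
    IsLocFree V E where
  of_local U hU s h := (hE U hU s).2 fun x hx => by
    obtain ⟨W, hW, hxW, hs⟩ := h x hx
    exact (((hE W hW s).1 hs).contMDiffAt (hW.mem_nhds hxW)).contMDiffWithinAt
  mono U W s hU hW hWU h := (hE W hW s).2 (((hE U hU s).1 h).mono hWU)
  frame := ⟨_, _, inferInstance, fun x => ⟨_, (trivializationAt F E.Fib x).open_baseSet,
      mem_baseSet_trivializationAt F E.Fib x, ⟨SmFrame.ofTrivialization hE _⟩⟩⟩

/-- Together with the converse `IsLocFree.isSmoothVectorBundle`, this allows vector bundles to be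
handled through frames only, without topologies on total spaces. -/
theorem IsSmoothVectorBundle.isLocFree {E : SectionFamily M} (hE : IsSmoothVectorBundle V E) :
    IsLocFree V E := by
  obtain ⟨B, hB⟩ := hE
  let _ := B.topFib
  let _ := B.fiberBundle
  have := B.vectorBundle
  have := B.realVectorBundle
  have := B.smooth
  have := B.finiteDimensional
  exact IsLocFree.of_bundle hB

theorem HolVectorBundle.isLocFree {Fib : M → Type*} [∀ x, AddCommGroup (Fib x)]
    [∀ x, Module ℂ (Fib x)] (B : HolVectorBundle V Fib) : IsLocFree V B.smooth := by
  let _ := B.topFib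
  let _ := B.fiberBundle
  have := B.vectorBundle
  have := B.holomorphic
  have := B.finiteDimensional
  have := vectorBundle_real_of_complex (F := B.F) (Fib := Fib)
  have := contMDiffVectorBundle_real_of_complex (V := V) (F := B.F) (Fib := Fib)
  exact IsLocFree.of_bundle (F := B.F) fun _ _ _ => Iff.rfl

/-- Data of frames on an open cover. -/
structure FrameAtlas (Fib : M → Type*) [∀ x, AddCommGroup (Fib x)] [∀ x, Module ℂ (Fib x)]
    (ι : Type) [Fintype ι] [DecidableEq ι] where
  /-- the domain of the frame at a point -/
  U : M → Set M
  isOpen_U : ∀ a, IsOpen (U a)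
  mem_U : ∀ a, a ∈ U a
  /-- the frames -/
  e : M → ι → Π x, Fib x
  /-- the coordinates -/
  c : M → ι → ∀ x, Fib x →ₗ[ℂ] ℂ
  c_e : ∀ a, ∀ x ∈ U a, ∀ i j, c a i x (e a j x) = if i = j then 1 else 0
  sum_c : ∀ a, ∀ x ∈ U a, ∀ v, ∑ i, c a i x v • e a i x = v
  continuousOn_c_e : ∀ a b i j, ContinuousOn (fun x => c a i x (e b j x)) (U b ∩ U a)

namespace FrameAtlas

variable {Fib : M → Type*} [∀ x, AddCommGroup (Fib x)] [∀ x, Module ℂ (Fib x)]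
    {ι : Type} [Fintype ι] [DecidableEq ι] (A : FrameAtlas Fib ι)

/-- The local trivialization given by a frame. -/
def pretrivialization (a : M) : Pretrivialization (ι → ℂ) (TotalSpace.proj : TotalSpace (ι → ℂ) Fib → M) where
  toFun p := (p.1, fun i => A.c a i p.1 p.2)
  invFun p := ⟨p.1, ∑ i, p.2 i • A.e a i p.1⟩
  source := TotalSpace.proj ⁻¹' A.U a
  target := A.U a ×ˢ Set.univ
  map_source' := fun _ h => ⟨h, Set.mem_univ _⟩
  map_target' := fun _ h => h.1
  left_inv' := fun ⟨x, v⟩ h => by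
    simp only [A.sum_c a x h]
  right_inv' := fun ⟨x, w⟩ ⟨h, _⟩ => by
    simp [A.c_e a x h]
  open_target := (A.isOpen_U a).prod isOpen_univ
  baseSet := A.U a
  open_baseSet := A.isOpen_U a
  source_eq := rfl
  target_eq := rfl
  proj_toFun _ _ := rfl

theorem pretrivialization_symm (a : M) {x : M} (hx : x ∈ A.U a) (w : ι → ℂ) :
    (A.pretrivialization a).symm x w = ∑ i, w i • A.e a i x :=
  (A.pretrivialization a).symm_apply hx w

theorem pretrivialization_apply (a x : M) (v : Fib x) (i : ι) :
    ((A.pretrivialization a) ⟨x, v⟩).2 i = A.c a i x v := rfl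

instance (a : M) : (A.pretrivialization a).IsLinear ℂ where
  linear x _ := ⟨fun v w => by ext i; simp [pretrivialization_apply], fun v w => by
    ext i; simp [pretrivialization_apply]⟩

/-- The elementary matrix `(i, j)`. -/
def elementary (ι : Type) [Fintype ι] [DecidableEq ι] (i j : ι) : (ι → ℂ) →L[ℂ] (ι → ℂ) :=
  (ContinuousLinearMap.single ℂ (fun _ => ℂ) i).comp (ContinuousLinearMap.proj j)

/-- The transition function of two frames. -/
def transition (a b : M) (x : M) : (ι → ℂ) →L[ℂ] (ι → ℂ) :=
  ∑ p : ι × ι, A.c b p.1 x (A.e a p.2 x) • elementary ι p.1 p.2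

theorem transition_apply (a b : M) {x : M} (hx : x ∈ A.U a) (w : ι → ℂ) :
    A.transition a b x w
      = ((A.pretrivialization b) ⟨x, (A.pretrivialization a).symm x w⟩).2 := by
  rw [A.pretrivialization_symm a hx]
  ext k
  simp [transition, pretrivialization_apply, elementary, Fintype.sum_prod_type,
    Finset.sum_apply, Pi.single_apply, mul_comm]

/-- The fibre topologies. -/
@[reducible]
def topFib (x : M) : TopologicalSpace (Fib x) :=
  TopologicalSpace.induced (fun v i => A.c x i x v) inferInstance

/-- The vector prebundle given by a family of frames. -/
def prebundle : letI := A.topFib; VectorPrebundle ℂ (ι → ℂ) Fib :=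
  letI := A.topFib
  { pretrivializationAtlas := Set.range A.pretrivialization
    pretrivialization_linear' := by
      rintro _ ⟨a, rfl⟩
      infer_instance
    pretrivializationAt := A.pretrivialization
    mem_base_pretrivializationAt := A.mem_U
    pretrivialization_mem_atlas := fun x => ⟨x, rfl⟩
    exists_coordChange := by
      rintro _ ⟨a, rfl⟩ _ ⟨b, rfl⟩
      refine ⟨A.transition a b, ?_, fun x hx w => A.transition_apply a b hx.1 w⟩
      exact continuousOn_finsetSum _ fun p _ =>
        (A.continuousOn_c_e b a p.1 p.2).smul continuousOn_const
    totalSpaceMk_isInducing := fun x => by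
      refine ⟨?_⟩
      have h : Topology.IsInducing (fun w : ι → ℂ => (x, w)) :=
        (Topology.IsInducing.of_comp (Continuous.prodMk_right x) continuous_snd .id)
      have h2 := h.comp (Topology.IsInducing.mk (f := fun (v : Fib x) i => A.c x i x v)
        (tX := A.topFib x) rfl)
      exact h2.eq_induced }

end FrameAtlas

end Frames

/-! ### Smooth and holomorphic bundles glued from frames. -/

namespace FrameAtlas

variable {V : Type*} [NormedAddCommGroup V] [NormedSpace ℂ V]
  {M : Type*} [TopologicalSpace M] [ChartedSpace V M]
  {Fib : M → Type*} [∀ x, AddCommGroup (Fib x)] [∀ x, Module ℂ (Fib x)]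
  {ι : Type} [Fintype ι] [DecidableEq ι] (A : FrameAtlas Fib ι)

/-- The topology of the total space. -/
@[reducible]
def topTotal : TopologicalSpace (TotalSpace (ι → ℂ) Fib) :=
  let _ := A.topFib
  A.prebundle.totalSpaceTopology

/-- The fibre bundle given by a family of frames. -/
@[reducible]
def fiberBundle : @FiberBundle M (ι → ℂ) _ _ Fib A.topTotal A.topFib :=
  let _ := A.topFib
  A.prebundle.toFiberBundle

theorem vectorBundle : @VectorBundle ℂ M (ι → ℂ) Fib _ _ _ _ _ _ A.topTotal A.topFib
    A.fiberBundle :=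
  let _ := A.topFib
  A.prebundle.toVectorBundle

/-- The trivialization given by the frame at `a`. -/
def triv (a : M) : @Trivialization M (ι → ℂ) _ _ _ A.topTotal
    (TotalSpace.proj : TotalSpace (ι → ℂ) Fib → M) :=
  let _ := A.topFib
  A.prebundle.trivializationOfMemPretrivializationAtlas ⟨a, rfl⟩

theorem mem_atlas (a : M) : let _ := A.topFib; let _ := A.topTotal; let _ := A.fiberBundle;
    MemTrivializationAtlas (A.triv a) :=
  let _ := A.topFib; let _ := A.topTotal; let _ := A.fiberBundle;
  ⟨⟨_, ⟨a, rfl⟩, rfl⟩⟩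

theorem exists_triv : let _ := A.topFib; let _ := A.topTotal; let _ := A.fiberBundle;
    ∀ (t : Trivialization (ι → ℂ) (TotalSpace.proj : TotalSpace (ι → ℂ) Fib → M))
      [MemTrivializationAtlas t], ∃ a, t = A.triv a := by
  intro _ _ _ t ht
  obtain ⟨_, ⟨a, rfl⟩, h⟩ := ht.out
  exact ⟨a, h⟩

/-- The scalar field is left free so that the same transition matrices serve the holomorphic
structure over ℂ and the smooth structure over ℝ. -/
theorem coordChangeL_eq {𝕜 : Type*} [NontriviallyNormedField 𝕜] [NormedAlgebra 𝕜 ℂ]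
    [∀ x, Module 𝕜 (Fib x)] (a b : M) :
    let _ := A.topFib; let _ := A.topTotal; let _ := A.fiberBundle;
    ∀ [(A.triv a).IsLinear 𝕜] [(A.triv b).IsLinear 𝕜], ∀ x ∈ A.U a ∩ A.U b, ∀ w,
      (A.triv a).coordChangeL 𝕜 (A.triv b) x w = A.transition a b x w := by
  intro _ _ _ _ _ x hx w
  rw [(A.triv a).coordChangeL_apply (R := 𝕜) (A.triv b) hx w, A.transition_apply a b hx.1]
  rfl

theorem contMDiffVectorBundle_complex
    (h : ∀ a b i j, Ho V (fun x => A.c a i x (A.e b j x)) (A.U b ∩ A.U a)) :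
    let _ := A.topFib; let _ := A.topTotal; let _ := A.fiberBundle; have := A.vectorBundle
    ContMDiffVectorBundle ω (ι → ℂ) Fib 𝓘(ℂ, V) := by
  intro _ _ _ _
  refine ⟨fun t t' _ _ => ?_⟩
  obtain ⟨a, rfl⟩ := A.exists_triv t
  obtain ⟨b, rfl⟩ := A.exists_triv t'
  have h1 : ContMDiffOn 𝓘(ℂ, V) 𝓘(ℂ, (ι → ℂ) →L[ℂ] (ι → ℂ)) ω (A.transition a b)
      (A.U a ∩ A.U b) :=
    contMDiffOn_finsetSum fun p _ => (h b a p.1 p.2).smul contMDiffOn_const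
  refine h1.congr fun x hx => ?_
  ext1 w
  exact A.coordChangeL_eq a b x hx w

theorem contMDiffVectorBundle_real
    (h : ∀ a b i j, Sm V (fun x => A.c a i x (A.e b j x)) (A.U b ∩ A.U a)) :
    let _ := A.topFib; let _ := A.topTotal; let _ := A.fiberBundle; have := A.vectorBundle
    have := vectorBundle_real_of_complex (F := ι → ℂ) (Fib := Fib)
    ContMDiffVectorBundle ∞ (ι → ℂ) Fib 𝓘(ℝ, V) := by
  intro _ _ _ _ _
  refine ⟨fun t t' _ _ => ?_⟩
  obtain ⟨a, rfl⟩ := A.exists_triv t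
  obtain ⟨b, rfl⟩ := A.exists_triv t'
  have h1 : ContMDiffOn 𝓘(ℝ, V) 𝓘(ℝ, (ι → ℂ) →L[ℂ] (ι → ℂ)) ∞ (A.transition a b)
      (A.U a ∩ A.U b) :=
    contMDiffOn_finsetSum fun p _ =>
      (((ContinuousLinearMap.id ℂ ℂ).smulRight (elementary ι p.1 p.2)).restrictScalars
        ℝ).contMDiff.comp_contMDiffOn (h b a p.1 p.2)
  have h2 := (ContinuousLinearMap.restrictScalarsL ℂ (ι → ℂ) (ι → ℂ) ℝ ℝ).contMDiff.comp_contMDiffOn h1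
  refine h2.congr fun x hx => ?_
  ext1 w
  exact A.coordChangeL_eq a b x hx w

/-- The smooth bundle given by a family of frames. -/
def smoothBundle (h : ∀ a b i j, Sm V (fun x => A.c a i x (A.e b j x)) (A.U b ∩ A.U a)) :
    SmoothVectorBundle V Fib :=
  let _ := A.topFib; let _ := A.topTotal; let _ := A.fiberBundle; have := A.vectorBundle
  have := vectorBundle_real_of_complex (F := ι → ℂ) (Fib := Fib)
  have := A.contMDiffVectorBundle_real h
  { F := ι → ℂ }

theorem smoothBundle_smoothOn_iff
    (h : ∀ a b i j, Sm V (fun x => A.c a i x (A.e b j x)) (A.U b ∩ A.U a)) (a : M) (W : Set M)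
    (hW : IsOpen W) (hWU : W ⊆ A.U a) (s : Π x, Fib x) :
    (A.smoothBundle h).SmoothOn s W ↔ ∀ i, Sm V (fun x => A.c a i x (s x)) W := by
  let _ := A.topFib; let _ := A.topTotal; let _ := A.fiberBundle; have := A.vectorBundle
  have := vectorBundle_real_of_complex (F := ι → ℂ) (Fib := Fib)
  have := A.contMDiffVectorBundle_real h
  have := A.mem_atlas a
  refine ((A.triv a).contMDiffOn_section_iff (IB := 𝓘(ℝ, V)) (n := ∞) hW hWU).trans ?_
  exact contMDiffOn_pi_space

/-- The holomorphic bundle given by a family of frames. -/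
def holBundle (h : ∀ a b i j, Ho V (fun x => A.c a i x (A.e b j x)) (A.U b ∩ A.U a)) :
    HolVectorBundle V Fib :=
  let _ := A.topFib; let _ := A.topTotal; let _ := A.fiberBundle; have := A.vectorBundle
  have := A.contMDiffVectorBundle_complex h
  { F := ι → ℂ }

theorem holBundle_holOn_iff
    (h : ∀ a b i j, Ho V (fun x => A.c a i x (A.e b j x)) (A.U b ∩ A.U a)) (a : M) (W : Set M)
    (hW : IsOpen W) (hWU : W ⊆ A.U a) (s : Π x, Fib x) :
    (A.holBundle h).HolOn s W ↔ ∀ i, Ho V (fun x => A.c a i x (s x)) W := by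
  let _ := A.topFib; let _ := A.topTotal; let _ := A.fiberBundle; have := A.vectorBundle
  have := A.contMDiffVectorBundle_complex h
  have := A.mem_atlas a
  refine ((A.triv a).contMDiffOn_section_iff (IB := 𝓘(ℂ, V)) (n := ω) hW hWU).trans ?_
  exact contMDiffOn_pi_space

/-- The holomorphic and the smooth bundle of an atlas have the same total space and trivializations,
so their smooth sections coincide by definition. -/
theorem holBundle_smoothOn_iff
    (h : ∀ a b i j, Ho V (fun x => A.c a i x (A.e b j x)) (A.U b ∩ A.U a)) (a : M) (W : Set M)
    (hW : IsOpen W) (hWU : W ⊆ A.U a) (s : Π x, Fib x) :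
    (A.holBundle h).smooth.SmoothOn s W ↔ ∀ i, Sm V (fun x => A.c a i x (s x)) W :=
  A.smoothBundle_smoothOn_iff (fun a b i j => (h a b i j).sm) a W hW hWU s

end FrameAtlas

/-! ### Locally free families are smooth vector bundles. -/

section LocFree
variable {V : Type*} [NormedAddCommGroup V] [NormedSpace ℂ V]
  {M : Type*} [TopologicalSpace M] [ChartedSpace V M] {E : SectionFamily M}

theorem SmFrame.smoothOn_e {ι : Type} [Fintype ι] [DecidableEq ι] {U : Set M}
    (f : SmFrame V E ι U) {W : Set M} (hW : IsOpen W) (hWU : W ⊆ U) (j : ι) :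
    E.SmoothOn (f.e j) W :=
  (f.smoothOn_iff W hW hWU _).2 fun i =>
    ContMDiffOn.congr (Sm.const (if i = j then 1 else 0) W) fun x hx => f.c_e x (hWU hx) i j

theorem SmoothVectorBundle.mono {Fib : M → Type*} [∀ x, AddCommGroup (Fib x)]
    [∀ x, Module ℂ (Fib x)] (B : SmoothVectorBundle V Fib) {s : Π x, Fib x} {U W : Set M}
    (h : B.SmoothOn s U) (hW : W ⊆ U) : B.SmoothOn s W := by
  let _ := B.topFib
  let _ := B.fiberBundle
  exact ContMDiffOn.mono h hW

theorem SmoothVectorBundle.of_local {Fib : M → Type*} [∀ x, AddCommGroup (Fib x)]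
    [∀ x, Module ℂ (Fib x)] (B : SmoothVectorBundle V Fib) {s : Π x, Fib x} {U : Set M}
    (h : ∀ x ∈ U, ∃ W, IsOpen W ∧ x ∈ W ∧ B.SmoothOn s W) : B.SmoothOn s U := by
  let _ := B.topFib
  let _ := B.fiberBundle
  intro x hx
  obtain ⟨W, hW, hxW, hs⟩ := h x hx
  exact (ContMDiffOn.contMDiffAt hs (hW.mem_nhds hxW)).contMDiffWithinAt

/-- Frame elements are smooth sections and smoothness is detected by the coordinates of any other
frame, so the transition functions are smooth and the frames form an atlas. The index type is common
to all frames, which provides one model fibre. -/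
theorem IsLocFree.isSmoothVectorBundle (h : IsLocFree V E) : IsSmoothVectorBundle V E := by
  obtain ⟨ι, _, _, hf⟩ := h.frame
  choose U hU hx f using hf
  replace f := fun x => (f x).some
  have hc : ∀ a b i j, Sm V (fun x => (f a).c i x ((f b).e j x)) (U b ∩ U a) := fun a b i j =>
    ((f a).smoothOn_iff _ ((hU b).inter (hU a)) Set.inter_subset_right _).1
      ((f b).smoothOn_e ((hU b).inter (hU a)) Set.inter_subset_left j) i
  let A : FrameAtlas E.Fib ι :=
    { U := U
      isOpen_U := hU
      mem_U := hx
      e := fun a => (f a).e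
      c := fun a => (f a).c
      c_e := fun a => (f a).c_e
      sum_c := fun a => (f a).sum_c
      continuousOn_c_e := fun a b i j => (hc a b i j).continuousOn }
  refine ⟨A.smoothBundle hc, fun W hW s => ⟨fun hs => SmoothVectorBundle.of_local _ fun x hxW =>
    ⟨W ∩ U x, hW.inter (hU x), ⟨hxW, hx x⟩, ?_⟩, fun hs => h.of_local W hW s
    fun x hxW => ⟨W ∩ U x, hW.inter (hU x), ⟨hxW, hx x⟩, ?_⟩⟩⟩
  · have h1 := ((f x).smoothOn_iff _ (hW.inter (hU x)) Set.inter_subset_right s).1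
      (h.mono _ _ s hW (hW.inter (hU x)) Set.inter_subset_left hs)
    exact (A.smoothBundle_smoothOn_iff hc x _ (hW.inter (hU x)) Set.inter_subset_right s).2 h1
  · refine ((f x).smoothOn_iff _ (hW.inter (hU x)) Set.inter_subset_right s).2 ?_
    refine (A.smoothBundle_smoothOn_iff hc x _ (hW.inter (hU x)) Set.inter_subset_right s).1 ?_
    exact SmoothVectorBundle.mono _ hs Set.inter_subset_left

end LocFree

/-! ### Operations on smooth sections, checked in frames. -/

section LocFree

variable {V : Type*} [NormedAddCommGroup V] [NormedSpace ℂ V]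
  {M : Type*} [TopologicalSpace M] [ChartedSpace V M] {E : SectionFamily M}
  {ι : Type} [Fintype ι] [DecidableEq ι]

/-- The restriction of a frame. -/
def SmFrame.restrict {U W : Set M} (f : SmFrame V E ι U) (hW : W ⊆ U) : SmFrame V E ι W where
  e := f.e
  c := f.c
  c_e x hx := f.c_e x (hW hx)
  sum_c x hx := f.sum_c x (hW hx)
  smoothOn_iff W' h' hW' := f.smoothOn_iff W' h' (hW'.trans hW)

theorem SmFrame.sm_c {U : Set M} (f : SmFrame V E ι U) {W : Set M} (hW : IsOpen W) (hWU : W ⊆ U)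
    {s : Π x, E.Fib x} (hs : E.SmoothOn s W) (i : ι) : Sm V (fun x => f.c i x (s x)) W :=
  (f.smoothOn_iff W hW hWU s).1 hs i

theorem SmFrame.ext {U : Set M} (f : SmFrame V E ι U) {x : M} (hx : x ∈ U) {v w : E.Fib x}
    (h : ∀ i, f.c i x v = f.c i x w) : v = w := by
  rw [← f.sum_c x hx v, ← f.sum_c x hx w]
  simp only [h]

theorem IsLocFree.exists_frame (h : IsLocFree V E) {U : Set M} (hU : IsOpen U) {x : M}
    (hx : x ∈ U) : ∃ (ι : Type) (_ : Fintype ι) (_ : DecidableEq ι) (W : Set M), IsOpen W ∧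
      x ∈ W ∧ W ⊆ U ∧ Nonempty (SmFrame V E ι W) := by
  obtain ⟨ι, _, _, hf⟩ := h.frame
  obtain ⟨W, hW, hxW, ⟨f⟩⟩ := hf x
  exact ⟨ι, _, _, W ∩ U, hW.inter hU, ⟨hxW, hx⟩, Set.inter_subset_right,
    ⟨f.restrict Set.inter_subset_left⟩⟩

theorem IsLocFree.smoothOn_of_frames (h : IsLocFree V E) {U : Set M} (hU : IsOpen U)
    {s : Π x, E.Fib x} (key : ∀ (ι : Type) [Fintype ι] [DecidableEq ι] (W : Set M)
      (f : SmFrame V E ι W), IsOpen W → W ⊆ U → ∀ i, Sm V (fun x => f.c i x (s x)) W) :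
    E.SmoothOn s U := h.of_local U hU s fun x hx => by
  obtain ⟨ι, _, _, W, hW, hxW, hWU, ⟨f⟩⟩ := h.exists_frame hU hx
  exact ⟨W, hW, hxW, (f.smoothOn_iff W hW subset_rfl s).2 (key ι W f hW hWU)⟩

namespace IsLocFree

variable (h : IsLocFree V E) {U : Set M} (hU : IsOpen U) {s t : Π x, E.Fib x}
include h hU

theorem congr (hs : E.SmoothOn s U) (he : ∀ x ∈ U, s x = t x) : E.SmoothOn t U :=
  h.smoothOn_of_frames hU fun _ _ _ W f hW hWU i =>
    ContMDiffOn.congr (f.sm_c hW subset_rfl (h.mono _ _ _ hU hW hWU hs) i) fun x hx => by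
      rw [he x (hWU hx)]

theorem add (hs : E.SmoothOn s U) (ht : E.SmoothOn t U) : E.SmoothOn (s + t) U :=
  h.smoothOn_of_frames hU fun _ _ _ W f hW hWU i => by
    simp only [Pi.add_apply, map_add]
    exact (f.sm_c hW subset_rfl (h.mono _ _ _ hU hW hWU hs) i).add
      (f.sm_c hW subset_rfl (h.mono _ _ _ hU hW hWU ht) i)

theorem fsmul {g : M → ℂ} (hg : Sm V g U) (hs : E.SmoothOn s U) :
    E.SmoothOn (fun x => g x • s x) U :=
  h.smoothOn_of_frames hU fun _ _ _ W f hW hWU i => by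
    simp only [map_smul, smul_eq_mul]
    exact Sm.mul (hg.mono hWU) (f.sm_c hW subset_rfl (h.mono _ _ _ hU hW hWU hs) i)

theorem csmul (c : ℂ) (hs : E.SmoothOn s U) : E.SmoothOn (c • s) U :=
  h.fsmul hU (Sm.const c U) hs

theorem zero : E.SmoothOn (fun _ => 0) U :=
  h.smoothOn_of_frames hU fun _ _ _ W f hW hWU i => by
    simpa only [map_zero] using Sm.const 0 W

theorem neg (hs : E.SmoothOn s U) : E.SmoothOn (fun x => - s x) U :=
  h.congr hU (h.csmul hU (-1) hs) fun x _ => by simp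

theorem sub (hs : E.SmoothOn s U) (ht : E.SmoothOn t U) : E.SmoothOn (fun x => s x - t x) U :=
  h.congr hU (h.add hU hs (h.neg hU ht)) fun x _ => by simp [sub_eq_add_neg]

theorem sum {κ : Type*} (a : Finset κ) {s : κ → Π x, E.Fib x} (hs : ∀ k ∈ a, E.SmoothOn (s k) U) :
    E.SmoothOn (fun x => ∑ k ∈ a, s k x) U :=
  h.smoothOn_of_frames hU fun _ _ _ W f hW hWU i => by
    simp only [map_sum]
    exact Sm.sum _ fun k hk => f.sm_c hW subset_rfl (h.mono _ _ _ hU hW hWU (hs k hk)) i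

end IsLocFree

end LocFree

/-! ### Holomorphic frames and the Dolbeault operator. -/

section Hol

variable {V : Type*} [NormedAddCommGroup V] [NormedSpace ℂ V]
  {M : Type*} [TopologicalSpace M] [ChartedSpace V M]
  {Fib : M → Type*} [∀ x, AddCommGroup (Fib x)] [∀ x, Module ℂ (Fib x)]
  {ι : Type} [Fintype ι] [DecidableEq ι]

/-- A holomorphic frame on `U`. -/
structure HolFrame (E : HolVectorBundle V Fib) (ι : Type) [Fintype ι] [DecidableEq ι]
    (U : Set M) extends SmFrame V E.smooth ι U where
  holOn_iff : ∀ W, IsOpen W → W ⊆ U → ∀ s : Π x, Fib x,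
    E.HolOn s W ↔ ∀ i, Ho V (fun x => c i x (s x)) W

/-- The Dolbeault operator at x is defined with the trivialization at x, so the componentwise
formula is immediate only for the frame of that trivialization and only at x. `HolFrame.c_dbarAt`
extends it to every holomorphic frame. -/
theorem HolVectorBundle.exists_holFrame (E : HolVectorBundle V Fib) :
    ∃ (ι : Type) (_ : Fintype ι) (_ : DecidableEq ι), ∀ x : M, ∃ U, IsOpen U ∧ x ∈ U ∧
      ∃ f : HolFrame E ι U, ∀ (X : T01 V x) (s : Π y, Fib y), E.smooth.SmoothNear s x →
        ∀ i, f.c i x (E.dbarAt x X s) = cDeriv V x X (fun y => f.c i y (s y)) := by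
  let _ := E.topFib
  let _ := E.fiberBundle
  have := E.vectorBundle
  have := E.holomorphic
  have := E.finiteDimensional
  have := vectorBundle_real_of_complex (F := E.F) (Fib := Fib)
  have := contMDiffVectorBundle_real_of_complex (V := V) (F := E.F) (Fib := Fib)
  refine ⟨Fin (Module.finrank ℂ E.F), inferInstance, inferInstance, fun x => ?_⟩
  set t := trivializationAt E.F Fib x
  have ht : x ∈ t.baseSet := mem_baseSet_trivializationAt E.F Fib x
  refine ⟨t.baseSet, t.open_baseSet, ht,
    { toSmFrame := SmFrame.ofTrivialization (F := E.F) (E := E.smooth) (fun _ _ _ => Iff.rfl) t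
      holOn_iff := fun W hW hWU s => ?_ }, fun X s hs i => ?_⟩
  · refine (t.contMDiffOn_section_iff (IB := 𝓘(ℂ, V)) (n := ω) hW hWU).trans ?_
    rw [contMDiffOn_iff_coord (𝕜 := ℂ) (F := E.F)
        ((Module.finBasis ℂ E.F).equivFunL.toContinuousLinearMap)
        ((Module.finBasis ℂ E.F).equivFunL.symm.toContinuousLinearMap)
        (Module.finBasis ℂ E.F).equivFunL.symm_apply_apply]
    refine forall_congr' fun i => contMDiffOn_congr fun x hx => ?_
    simp only [SmFrame.ofTrivialization]
    rw [LinearMap.comp_apply, t.coe_linearMapAt_of_mem (hWU hx)]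
    rfl
  · obtain ⟨W, hW, hxW, hs⟩ := hs
    have hsm : ContMDiffOn 𝓘(ℝ, V) 𝓘(ℝ, E.F) ∞ (fun y => (t ⟨y, s y⟩).2) (W ∩ t.baseSet) :=
      (t.contMDiffOn_section_iff (IB := 𝓘(ℝ, V)) (n := ∞) (hW.inter t.open_baseSet)
        Set.inter_subset_right).1 (ContMDiffOn.mono hs Set.inter_subset_left)
    have hmd : MDifferentiableAt 𝓘(ℝ, V) 𝓘(ℝ, E.F) (fun y => (t ⟨y, s y⟩).2) x :=
      (hsm.contMDiffAt ((hW.inter t.open_baseSet).mem_nhds ⟨hxW, ht⟩)).mdifferentiableAt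
        (by simp)
    have h1 := cDeriv_continuousLinearMap (X : CTan V x) hmd
      (LinearMap.toContinuousLinearMap ((Module.finBasis ℂ E.F).coord i))
    have h2 : cDeriv V x (X : CTan V x)
        (fun y => (Module.finBasis ℂ E.F).coord i (t.linearMapAt ℂ y (s y)))
        = cDeriv V x (X : CTan V x) (fun y => (Module.finBasis ℂ E.F).coord i (t ⟨y, s y⟩).2) :=
      cDeriv_congr_on _ t.open_baseSet ht fun y hy => by
        rw [t.coe_linearMapAt_of_mem hy]
    refine Eq.trans ?_ (h1.symm.trans h2.symm)
    have h3 : ∀ w, t.linearMapAt ℂ x (t.symm x w) = w := fun w => by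
      rw [t.coe_linearMapAt_of_mem ht]
      exact congrArg Prod.snd (t.apply_mk_symm ht _)
    exact congrArg ((Module.finBasis ℂ E.F).coord i) (h3 _)

namespace HolFrame

variable {E : HolVectorBundle V Fib} {U : Set M} (f : HolFrame E ι U)

/-- The restriction of a holomorphic frame. -/
def restrict {W : Set M} (hW : W ⊆ U) : HolFrame E ι W where
  toSmFrame := f.toSmFrame.restrict hW
  holOn_iff W' h' hW' := f.holOn_iff W' h' (hW'.trans hW)

theorem holOn_e {W : Set M} (hW : IsOpen W) (hWU : W ⊆ U) (j : ι) : E.HolOn (f.e j) W :=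
  (f.holOn_iff W hW hWU _).2 fun i =>
    ContMDiffOn.congr (Ho.const (if i = j then 1 else 0) W) fun x hx => f.c_e x (hWU hx) i j

/-- The Dolbeault operator in a holomorphic frame. -/
theorem c_dbarAt (hU : IsOpen U) {x : M} (hx : x ∈ U) (X : T01 V x) {s : Π y, Fib y}
    (hs : E.smooth.SmoothNear s x) (i : ι) :
    f.c i x (E.dbarAt x X s) = cDeriv V x X (fun y => f.c i y (s y)) := by
  obtain ⟨κ, _, _, h⟩ := E.exists_holFrame
  obtain ⟨W, hW, hxW, g, hg⟩ := h x
  have hd := hg X s hs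
  obtain ⟨W', hW', hxW', hs'⟩ := hs
  have hN : IsOpen (U ∩ W ∩ W') := (hU.inter hW).inter hW'
  have hxN : x ∈ U ∩ W ∩ W' := ⟨⟨hx, hxW⟩, hxW'⟩
  have hNU : U ∩ W ∩ W' ⊆ U := fun y hy => hy.1.1
  have hNW : U ∩ W ∩ W' ⊆ W := fun y hy => hy.1.2
  have hNW' : U ∩ W ∩ W' ⊆ W' := fun y hy => hy.2
  have hc : ∀ j, Ho V (fun y => f.c i y (g.e j y)) (U ∩ W ∩ W') := fun j =>
    (f.holOn_iff _ hN hNU _).1 (g.holOn_e hN hNW j) i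
  have hgc : ∀ j, Sm V (fun y => g.c j y (s y)) (U ∩ W ∩ W') := fun j =>
    g.sm_c hN hNW (E.isLocFree.mono _ _ _ hW' hN hNW' hs') j
  -- Change of frame: the components in f are those in the distinguished frame g times holomorphic
  -- transition functions, which X kills. Only the derivatives of the g-components survive.
  have h1 : cDeriv V x (X : CTan V x) (fun y => f.c i y (s y))
      = cDeriv V x (X : CTan V x) (fun y => ∑ j, g.c j y (s y) * f.c i y (g.e j y)) :=
    cDeriv_congr_on _ hN hxN fun y hy => by
      conv_lhs => rw [← g.sum_c y (hNW hy) (s y)]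
      simp only [map_sum, map_smul, smul_eq_mul]
  rw [h1, cDeriv_fsum _ _ hN hxN fun j _ => (hgc j).mul (hc j).sm]
  conv_lhs => rw [← g.sum_c x hxW (E.dbarAt x X s)]
  simp only [map_sum, map_smul, smul_eq_mul]
  refine Finset.sum_congr rfl fun j _ => ?_
  rw [cDeriv_mul _ ((hgc j).md hN hxN) ((hc j).sm.md hN hxN),
    cDeriv_T01 X.2 ((hc j).md hN hxN), hd, mul_zero, add_zero]

end HolFrame

namespace HolVectorBundle

variable (E : HolVectorBundle V Fib) {U : Set M} {s t : Π x, Fib x}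

theorem exists_holFrame_subset {U : Set M} (hU : IsOpen U) {x : M}
    (hx : x ∈ U) : ∃ (ι : Type) (_ : Fintype ι) (_ : DecidableEq ι) (W : Set M), IsOpen W ∧
      x ∈ W ∧ W ⊆ U ∧ Nonempty (HolFrame E ι W) := by
  obtain ⟨ι, _, _, hf⟩ := E.exists_holFrame
  obtain ⟨W, hW, hxW, f, -⟩ := hf x
  exact ⟨ι, _, _, W ∩ U, hW.inter hU, ⟨hxW, hx⟩, Set.inter_subset_right,
    ⟨f.restrict Set.inter_subset_left⟩⟩

theorem holOn_mono {W : Set M} (h : E.HolOn s U) (hW : W ⊆ U) : E.HolOn s W := by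
  let _ := E.topFib
  let _ := E.fiberBundle
  exact ContMDiffOn.mono h hW

theorem holOn_of_local (h : ∀ x ∈ U, ∃ W, IsOpen W ∧ x ∈ W ∧ E.HolOn s W) : E.HolOn s U := by
  let _ := E.topFib
  let _ := E.fiberBundle
  intro x hx
  obtain ⟨W, hW, hxW, hs⟩ := h x hx
  exact (ContMDiffOn.contMDiffAt hs (hW.mem_nhds hxW)).contMDiffWithinAt

theorem holOn_of_frames (hU : IsOpen U) (key : ∀ (ι : Type) [Fintype ι] [DecidableEq ι]
    (W : Set M) (f : HolFrame E ι W), IsOpen W → W ⊆ U → ∀ i, Ho V (fun x => f.c i x (s x)) W) :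
    E.HolOn s U := E.holOn_of_local fun x hx => by
  obtain ⟨ι, _, _, W, hW, hxW, hWU, ⟨f⟩⟩ := E.exists_holFrame_subset hU hx
  exact ⟨W, hW, hxW, (f.holOn_iff W hW subset_rfl s).2 (key ι W f hW hWU)⟩

variable {E}

theorem HolOn.ho_c (hs : E.HolOn s U) {W : Set M} (f : HolFrame E ι W) (hW : IsOpen W)
    (hWU : W ⊆ U) (i : ι) : Ho V (fun x => f.c i x (s x)) W :=
  (f.holOn_iff W hW subset_rfl s).1 (E.holOn_mono hs hWU) i

theorem HolOn.smoothOn (hs : E.HolOn s U) (hU : IsOpen U) : E.smooth.SmoothOn s U :=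
  E.isLocFree.of_local U hU s fun x hx => by
    obtain ⟨ι, _, _, W, hW, hxW, hWU, ⟨f⟩⟩ := E.exists_holFrame_subset hU hx
    exact ⟨W, hW, hxW, (f.smoothOn_iff W hW subset_rfl s).2 fun i => (hs.ho_c f hW hWU i).sm⟩

theorem HolOn.congr (hs : E.HolOn s U) (hU : IsOpen U) (he : ∀ x ∈ U, s x = t x) :
    E.HolOn t U := E.holOn_of_frames hU fun _ _ _ W f hW hWU i =>
  ContMDiffOn.congr (hs.ho_c f hW hWU i) fun x hx => by rw [he x (hWU hx)]

theorem HolOn.add (hs : E.HolOn s U) (ht : E.HolOn t U) (hU : IsOpen U) :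
    E.HolOn (s + t) U := E.holOn_of_frames hU fun _ _ _ W f hW hWU i => by
  simp only [Pi.add_apply, map_add]
  exact (hs.ho_c f hW hWU i).add (ht.ho_c f hW hWU i)

theorem HolOn.fsmul (hs : E.HolOn s U) {g : M → ℂ} (hg : Ho V g U) (hU : IsOpen U) :
    E.HolOn (fun x => g x • s x) U := E.holOn_of_frames hU fun _ _ _ W f hW hWU i => by
  simp only [map_smul, smul_eq_mul]
  exact Ho.mul (hg.mono hWU) (hs.ho_c f hW hWU i)

theorem HolOn.sum {κ : Type*} (a : Finset κ) {s : κ → Π x, Fib x} (hU : IsOpen U)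
    (hs : ∀ k ∈ a, E.HolOn (s k) U) : E.HolOn (fun x => ∑ k ∈ a, s k x) U :=
  E.holOn_of_frames hU fun _ _ _ W f hW hWU i => by
    simp only [map_sum]
    exact Ho.sum _ fun k hk => (hs k hk).ho_c f hW hWU i

/-- Holomorphic sections are annihilated by the Dolbeault operator. -/
theorem HolOn.dbarAt_eq_zero (hs : E.HolOn s U) (hU : IsOpen U) {x : M} (hx : x ∈ U)
    (X : T01 V x) : E.dbarAt x X s = 0 := by
  obtain ⟨ι, _, _, W, hW, hxW, hWU, ⟨f⟩⟩ := E.exists_holFrame_subset hU hx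
  refine f.ext hxW fun i => ?_
  rw [f.c_dbarAt hW hxW X ⟨U, hU, hx, hs.smoothOn hU⟩, map_zero,
    cDeriv_T01 X.2 ((hs.ho_c f hW hWU i).md hW hxW)]

/-- Testing on the (0,1)-part `(v + i J v) / 2` of a real vector v gives the Cauchy–Riemann equation
in the direction v for each component, and `contMDiffOn_complex_of_real` applies. -/
theorem holOn_of_dbarAt [FiniteDimensional ℂ V] [IsManifold 𝓘(ℂ, V) ω M] (hU : IsOpen U)
    (hs : E.smooth.SmoothOn s U)
    (h : ∀ x ∈ U, ∀ X : T01 V x, E.dbarAt x X s = 0) : E.HolOn s U :=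
  E.holOn_of_frames hU fun _ _ _ W f hW hWU i => by
    have hsm := f.sm_c hW subset_rfl (E.isLocFree.mono _ _ _ hU hW hWU hs) i
    refine contMDiffOn_complex_of_real hW hsm fun x hx v => ?_
    have h1 := f.c_dbarAt hW hx (pr01 V x ((1 : ℂ) ⊗ₜ[ℝ] (id v : TangentSpace 𝓘(ℝ, V) x)))
      ⟨W, hW, hx, E.isLocFree.mono _ _ _ hU hW hWU hs⟩ i
    rw [h x (hWU hx), map_zero, coe_pr01, cDeriv_smul, cDeriv_add, cDeriv_smul, cDeriv_eq,
      cDeriv_eq, cRe_JC, cIm_JC, cRe_one, cIm_one, map_zero, map_zero, map_zero] at h1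
    have h2 : mvfderiv 𝓘(ℝ, V) (fun x => f.c i x (s x)) x (J V x (id v))
      = Complex.I * mvfderiv 𝓘(ℝ, V) (fun x => f.c i x (s x)) x (id v) := by
      linear_combination (2 * Complex.I) * h1
        + mvfderiv 𝓘(ℝ, V) (fun x => f.c i x (s x)) x (J V x (id v)) * Complex.I_mul_I
    exact h2

theorem dbarAt_add_left {x : M} (X Y : T01 V x) (hs : E.smooth.SmoothNear s x) :
    E.dbarAt x (X + Y) s = E.dbarAt x X s + E.dbarAt x Y s := by
  obtain ⟨ι, _, _, W, hW, hxW, hWU, ⟨f⟩⟩ := E.exists_holFrame_subset isOpen_univ (Set.mem_univ x)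
  refine f.ext hxW fun i => ?_
  simp only [map_add, f.c_dbarAt hW hxW _ hs, Submodule.coe_add, cDeriv_add]

theorem dbarAt_smul_left {x : M} (c : ℂ) (X : T01 V x) (hs : E.smooth.SmoothNear s x) :
    E.dbarAt x (c • X) s = c • E.dbarAt x X s := by
  obtain ⟨ι, _, _, W, hW, hxW, hWU, ⟨f⟩⟩ := E.exists_holFrame_subset isOpen_univ (Set.mem_univ x)
  refine f.ext hxW fun i => ?_
  simp only [map_smul, f.c_dbarAt hW hxW _ hs, Submodule.coe_smul, cDeriv_smul, smul_eq_mul]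

theorem dbarAt_add (hU : IsOpen U) {x : M} (hx : x ∈ U) (X : T01 V x)
    (hs : E.smooth.SmoothOn s U) (ht : E.smooth.SmoothOn t U) :
    E.dbarAt x X (s + t) = E.dbarAt x X s + E.dbarAt x X t := by
  obtain ⟨ι, _, _, W, hW, hxW, hWU, ⟨f⟩⟩ := E.exists_holFrame_subset hU hx
  refine f.ext hxW fun i => ?_
  rw [map_add, f.c_dbarAt hW hxW X ⟨U, hU, hx, hs⟩, f.c_dbarAt hW hxW X ⟨U, hU, hx, ht⟩,
    f.c_dbarAt hW hxW X ⟨U, hU, hx, E.isLocFree.add hU hs ht⟩]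
  simp only [Pi.add_apply, map_add]
  exact cDeriv_fadd _ ((f.sm_c hW subset_rfl (E.isLocFree.mono _ _ _ hU hW hWU hs) i).md hW hxW)
    ((f.sm_c hW subset_rfl (E.isLocFree.mono _ _ _ hU hW hWU ht) i).md hW hxW)

theorem dbarAt_fsmul (hU : IsOpen U) {x : M} (hx : x ∈ U) (X : T01 V x) {g : M → ℂ}
    (hg : Sm V g U) (hs : E.smooth.SmoothOn s U) :
    E.dbarAt x X (fun y => g y • s y) = g x • E.dbarAt x X s + cDeriv V x X g • s x := by
  obtain ⟨ι, _, _, W, hW, hxW, hWU, ⟨f⟩⟩ := E.exists_holFrame_subset hU hx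
  refine f.ext hxW fun i => ?_
  rw [map_add, map_smul, map_smul, f.c_dbarAt hW hxW X ⟨U, hU, hx, hs⟩,
    f.c_dbarAt hW hxW X ⟨U, hU, hx, E.isLocFree.fsmul hU hg hs⟩]
  simp only [map_smul, smul_eq_mul]
  rw [cDeriv_mul _ (hg.md hU hx)
    ((f.sm_c hW subset_rfl (E.isLocFree.mono _ _ _ hU hW hWU hs) i).md hW hxW)]
  ring

end HolVectorBundle

end Hol

/-! ### Reduction of the Lie algebroid axioms to local frames. -/

section PreLie

variable {V : Type*} [NormedAddCommGroup V] [NormedSpace ℂ V] [FiniteDimensional ℂ V]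
  {M : Type*} [TopologicalSpace M] [ChartedSpace V M] [IsManifold 𝓘(ℂ, V) ω M]

/-- On W a section is a finite combination of frame elements with smooth coefficients. The clause
`hcongr` is needed because sections are defined on all of M, while the expansion holds only on W. -/
theorem SmFrame.induction {E : SectionFamily M} (hE : IsLocFree V E) {ι : Type} [Fintype ι]
    [DecidableEq ι] {W : Set M} (f : SmFrame V E ι W) (hW : IsOpen W)
    (P : (Π x, E.Fib x) → Prop) (h0 : P (fun _ => 0)) (he : ∀ i, P (f.e i))
    (hadd : ∀ s t, E.SmoothOn s W → E.SmoothOn t W → P s → P t → P (s + t))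
    (hsmul : ∀ (g : M → ℂ) s, Sm V g W → E.SmoothOn s W → P s → P (fun x => g x • s x))
    (hcongr : ∀ s t, E.SmoothOn s W → (∀ x ∈ W, s x = t x) → P s → P t) :
    ∀ s, E.SmoothOn s W → P s := by
  intro s hs
  have hterm : ∀ i, E.SmoothOn (fun x => f.c i x (s x) • f.e i x) W := fun i =>
    hE.fsmul hW (f.sm_c hW subset_rfl hs i) (f.smoothOn_e hW subset_rfl i)
  have key : ∀ a : Finset ι, P (fun x => ∑ i ∈ a, f.c i x (s x) • f.e i x) := fun a => by
    induction a using Finset.induction_on with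
    | empty => simpa using h0
    | insert i a hi ih =>
      simp only [Finset.sum_insert hi]
      exact hadd _ _ (hterm i) (hE.sum hW a fun k _ => hterm k)
        (hsmul _ _ (f.sm_c hW subset_rfl hs i) (f.smoothOn_e hW subset_rfl i) (he i)) ih
  exact hcongr _ _ (hE.sum hW _ fun k _ => hterm k) (fun x hx => f.sum_c x hx _) (key Finset.univ)

/-- The axioms of a Lie algebroid which do not involve iterated brackets or the bracket of
anchors. -/
structure IsPreLie (A : LieAlgebroidData V M) : Prop where
  locFree : IsLocFree V A.toSectionFamily
  anchor_smooth : ∀ U : Set M, IsOpen U → ∀ s, A.SmoothOn s U →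
    CSmoothOn V (fun x => A.anchor x (s x)) U
  bracket_local : ∀ U : Set M, IsOpen U → ∀ s s' t t', A.SmoothOn s U → A.SmoothOn t U →
    (∀ x ∈ U, s x = s' x) → (∀ x ∈ U, t x = t' x) → ∀ x ∈ U, A.bracket s t x = A.bracket s' t' x
  bracket_add : ∀ U : Set M, IsOpen U → ∀ s t t', A.SmoothOn s U → A.SmoothOn t U →
    A.SmoothOn t' U → ∀ x ∈ U, A.bracket s (t + t') x = A.bracket s t x + A.bracket s t' x
  bracket_skew : ∀ U : Set M, IsOpen U → ∀ s t, A.SmoothOn s U → A.SmoothOn t U →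
    ∀ x ∈ U, A.bracket s t x = -A.bracket t s x
  leibniz : ∀ U : Set M, IsOpen U → ∀ (f : M → ℂ) (s t),
    ContMDiffOn 𝓘(ℝ, V) 𝓘(ℝ, ℂ) ∞ f U → A.SmoothOn s U → A.SmoothOn t U →
    ∀ x ∈ U, A.bracket s (fun y => f y • t y) x
      = cDeriv V x (A.anchor x (s x)) f • t x + f x • A.bracket s t x

namespace IsPreLie

variable {A : LieAlgebroidData V M} (h : IsPreLie A)
include h

theorem zero_right {U : Set M} (hU : IsOpen U) {s : Π x, A.Fib x} (hs : A.SmoothOn s U) {x : M}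
    (hx : x ∈ U) : A.bracket s (fun _ => 0) x = 0 := by
  simpa using h.leibniz U hU (fun _ => 0) s (fun _ => 0) (Sm.const 0 U) hs (h.locFree.zero hU) x hx

theorem bracket_eq_zero {U : Set M} (hU : IsOpen U) {s t : Π x, A.Fib x} (hs : A.SmoothOn s U)
    (ht : ∀ x ∈ U, t x = 0) {x : M} (hx : x ∈ U) : A.bracket s t x = 0 := by
  rw [← h.bracket_local U hU s s (fun _ => 0) t hs (h.locFree.zero hU) (fun _ _ => rfl)
    (fun y hy => (ht y hy).symm) x hx, h.zero_right hU hs hx]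

theorem bracket_smul (U : Set M) (hU : IsOpen U) (c : ℂ) (s t : Π x, A.Fib x)
    (hs : A.SmoothOn s U) (ht : A.SmoothOn t U) (x : M) (hx : x ∈ U) :
    A.bracket s (c • t) x = c • A.bracket s t x := by
  have := h.leibniz U hU (fun _ => c) s t (Sm.const c U) hs ht x hx
  rwa [cDeriv_const, zero_smul, zero_add] at this

section Frame

variable {ι : Type} [Fintype ι] [DecidableEq ι] {W : Set M}
  (f : SmFrame V A.toSectionFamily ι W) (hW : IsOpen W)
  (hsm : ∀ i j, A.SmoothOn (A.bracket (f.e i) (f.e j)) W)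
include hW hsm

/-- The Leibniz rule propagates smoothness in the second argument from frame elements to all
sections. Skew-symmetry exchanges the arguments, and the same step is repeated. -/
theorem bracket_smooth_of_frame {s t : Π x, A.Fib x} (hs : A.SmoothOn s W)
    (ht : A.SmoothOn t W) : A.SmoothOn (A.bracket s t) W := by
  have step : ∀ s, A.SmoothOn s W → (∀ i, A.SmoothOn (A.bracket s (f.e i)) W) → ∀ t,
      A.SmoothOn t W → A.SmoothOn (A.bracket s t) W := fun s hs he =>
    f.induction h.locFree hW (fun t => A.SmoothOn (A.bracket s t) W)
      (h.locFree.congr hW (h.locFree.zero hW) fun x hx => (h.zero_right hW hs hx).symm) he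
      (fun t t' ht ht' h1 h2 => h.locFree.congr hW (h.locFree.add hW h1 h2) fun x hx =>
        (h.bracket_add W hW s t t' hs ht ht' x hx).symm)
      (fun g t hg ht h1 => h.locFree.congr hW (h.locFree.add hW
          (h.locFree.fsmul hW (Sm.cDeriv hW hg (h.anchor_smooth W hW s hs)) ht)
          (h.locFree.fsmul hW hg h1)) fun x hx =>
        (h.leibniz W hW g s t hg hs ht x hx).symm)
      (fun t t' ht he h1 => h.locFree.congr hW h1 fun x hx =>
        h.bracket_local W hW s s t t' hs ht (fun _ _ => rfl) he x hx)
  refine step s hs (fun i => ?_) t ht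
  have h1 := step (f.e i) (f.smoothOn_e hW subset_rfl i) (hsm i) s hs
  exact h.locFree.congr hW (h.locFree.neg hW h1) fun x hx =>
    (h.bracket_skew W hW s _ hs (f.smoothOn_e hW subset_rfl i) x hx).symm

variable (han : ∀ i j, ∀ x ∈ W, A.anchor x (A.bracket (f.e i) (f.e j) x)
  = cLie V (fun y => A.anchor y (f.e i y)) (fun y => A.anchor y (f.e j y)) x)
include han

/-- Both sides are skew and obey the same Leibniz rule, so their difference is linear over smooth
functions in each argument. -/
theorem anchor_bracket_of_frame {s t : Π x, A.Fib x} (hs : A.SmoothOn s W)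
    (ht : A.SmoothOn t W) : ∀ x ∈ W, A.anchor x (A.bracket s t x)
      = cLie V (fun y => A.anchor y (s y)) (fun y => A.anchor y (t y)) x := by
  have ha := h.anchor_smooth W hW
  have step : ∀ s, A.SmoothOn s W → (∀ i, ∀ x ∈ W, A.anchor x (A.bracket s (f.e i) x)
      = cLie V (fun y => A.anchor y (s y)) (fun y => A.anchor y (f.e i y)) x) → ∀ t,
      A.SmoothOn t W → ∀ x ∈ W, A.anchor x (A.bracket s t x)
      = cLie V (fun y => A.anchor y (s y)) (fun y => A.anchor y (t y)) x := fun s hs he =>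
    f.induction h.locFree hW (fun t => ∀ x ∈ W, A.anchor x (A.bracket s t x)
      = cLie V (fun y => A.anchor y (s y)) (fun y => A.anchor y (t y)) x)
      (fun x hx => by
        simp only [h.zero_right hW hs hx, map_zero]
        exact (cLie_zero_right hW hx (ha s hs)).symm) he
      (fun t t' ht ht' h1 h2 x hx => by
        rw [h.bracket_add W hW s t t' hs ht ht' x hx, map_add, h1 x hx, h2 x hx]
        simp only [Pi.add_apply, map_add]
        exact (cLie_add_right hW hx (ha s hs) (ha t ht) (ha t' ht')).symm)
      (fun g t hg ht h1 x hx => by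
        rw [h.leibniz W hW g s t hg hs ht x hx, map_add, map_smul, map_smul, h1 x hx]
        simp only [map_smul]
        exact (cLie_smul_right hW hx (ha s hs) (ha t ht) hg).symm)
      (fun t t' ht he h1 x hx => by
        rw [← h.bracket_local W hW s s t t' hs ht (fun _ _ => rfl) he x hx, h1 x hx]
        exact cLie_congr hW hx (fun _ _ => rfl) fun y hy => by rw [he y hy])
  refine step s hs (fun i x hx => ?_) t ht
  have hei := f.smoothOn_e hW subset_rfl i
  rw [h.bracket_skew W hW s _ hs hei x hx, map_neg, step (f.e i) hei (han i) s hs x hx]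
  exact (cLie_skew hW hx (ha _ hs) (ha _ hei)).symm

/-- The Jacobiator is linear over smooth functions. Replacing u by gu in `[s,[t,u]] - [t,[s,u]] -
[[s,t],u]`, the first-order terms in g cancel, and the second-order terms cancel because the anchor
of `[s,t]` acts as the commutator of the anchors. -/
theorem jacobi_of_frame (hj : ∀ i j k, ∀ x ∈ W, A.bracket (f.e i) (A.bracket (f.e j) (f.e k)) x
      + A.bracket (f.e j) (A.bracket (f.e k) (f.e i)) x
      + A.bracket (f.e k) (A.bracket (f.e i) (f.e j)) x = 0) {s t u : Π x, A.Fib x}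
    (hs : A.SmoothOn s W) (ht : A.SmoothOn t W) (hu : A.SmoothOn u W) :
    ∀ x ∈ W, A.bracket s (A.bracket t u) x + A.bracket t (A.bracket u s) x
      + A.bracket u (A.bracket s t) x = 0 := by
  have ha := h.anchor_smooth W hW
  have hb : ∀ {s t : Π x, A.Fib x}, A.SmoothOn s W → A.SmoothOn t W →
    A.SmoothOn (A.bracket s t) W := fun hs ht => h.bracket_smooth_of_frame f hW hsm hs ht
  have hloc : ∀ {s t t' : Π x, A.Fib x}, A.SmoothOn s W → A.SmoothOn t W →
      (∀ x ∈ W, t x = t' x) → ∀ x ∈ W, A.bracket s t x = A.bracket s t' x := fun hs ht he x hx =>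
    h.bracket_local W hW _ _ _ _ hs ht (fun _ _ => rfl) he x hx
  have hskew : ∀ {s t u : Π x, A.Fib x}, A.SmoothOn s W → A.SmoothOn t W → A.SmoothOn u W →
      ∀ x ∈ W, A.bracket s (A.bracket t u) x = - A.bracket s (A.bracket u t) x := by
    intro s t u hs ht hu x hx
    rw [hloc hs (hb ht hu) (t' := (-1 : ℂ) • A.bracket u t) (fun y hy => by
      rw [h.bracket_skew W hW t u ht hu y hy]; simp) x hx,
      h.bracket_smul W hW _ _ _ hs (hb hu ht) x hx, neg_one_smul]
  have hbadd : ∀ {s t u v : Π x, A.Fib x}, A.SmoothOn s W → A.SmoothOn t W → A.SmoothOn u W →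
      A.SmoothOn v W → ∀ x ∈ W, A.bracket s (A.bracket t (u + v)) x
        = A.bracket s (A.bracket t u) x + A.bracket s (A.bracket t v) x := by
    intro s t u v hs ht hu hv x hx
    rw [hloc hs (hb ht (h.locFree.add hW hu hv)) (t' := A.bracket t u + A.bracket t v)
      (fun y hy => h.bracket_add W hW t u v ht hu hv y hy) x hx,
      h.bracket_add W hW s _ _ hs (hb ht hu) (hb ht hv) x hx]
  have hbsmul : ∀ {s t u : Π x, A.Fib x} {g : M → ℂ}, A.SmoothOn s W → A.SmoothOn t W →
      A.SmoothOn u W → Sm V g W → ∀ x ∈ W, A.bracket s (A.bracket t (fun y => g y • u y)) x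
        = (cDeriv V x (A.anchor x (s x)) fun y => cDeriv V y (A.anchor y (t y)) g) • u x
          + cDeriv V x (A.anchor x (t x)) g • A.bracket s u x
          + (cDeriv V x (A.anchor x (s x)) g • A.bracket t u x
          + g x • A.bracket s (A.bracket t u) x) := by
    intro s t u g hs ht hu hg x hx
    have hd := Sm.cDeriv hW hg (ha t ht)
    have h1 := h.locFree.fsmul hW hd hu
    have h2 := h.locFree.fsmul hW hg (hb ht hu)
    rw [hloc hs (hb ht (h.locFree.fsmul hW hg hu))
      (t' := (fun y => cDeriv V y (A.anchor y (t y)) g • u y) + fun y => g y • A.bracket t u y)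
      (fun y hy => h.leibniz W hW g t u hg ht hu y hy) x hx,
      h.bracket_add W hW s _ _ hs h1 h2 x hx, h.leibniz W hW _ s u hd hs hu x hx,
      h.leibniz W hW g s _ hg hs (hb ht hu) x hx]
  have han' : ∀ {s t : Π x, A.Fib x}, A.SmoothOn s W → A.SmoothOn t W → ∀ {g}, Sm V g W →
      ∀ x ∈ W, cDeriv V x (A.anchor x (A.bracket s t x)) g
        = (cDeriv V x (A.anchor x (s x)) fun y => cDeriv V y (A.anchor y (t y)) g)
          - cDeriv V x (A.anchor x (t x)) fun y => cDeriv V y (A.anchor y (s y)) g := by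
    intro s t hs ht g hg x hx
    have : CompleteSpace V := FiniteDimensional.complete ℂ V
    rw [h.anchor_bracket_of_frame f hW hsm han hs ht x hx]
    exact cDeriv_cLie hW hx (ha s hs) (ha t ht) hg
  have step : ∀ s t, A.SmoothOn s W → A.SmoothOn t W →
      (∀ i, ∀ x ∈ W, A.bracket s (A.bracket t (f.e i)) x + A.bracket t (A.bracket (f.e i) s) x
        + A.bracket (f.e i) (A.bracket s t) x = 0) → ∀ u, A.SmoothOn u W →
      ∀ x ∈ W, A.bracket s (A.bracket t u) x + A.bracket t (A.bracket u s) x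
        + A.bracket u (A.bracket s t) x = 0 := fun s t hs ht he =>
    f.induction h.locFree hW (fun u => ∀ x ∈ W, A.bracket s (A.bracket t u) x
        + A.bracket t (A.bracket u s) x + A.bracket u (A.bracket s t) x = 0)
      (fun x hx => by
        have hz := h.locFree.zero hW
        rw [hskew ht hz hs x hx, h.bracket_skew W hW _ _ hz (hb hs ht) x hx,
          h.zero_right hW (hb hs ht) hx,
          h.bracket_eq_zero hW hs (fun y hy => h.zero_right hW ht hy) hx,
          h.bracket_eq_zero hW ht (fun y hy => h.zero_right hW hs hy) hx]
        simp) he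
      (fun u v hu hv h1 h2 x hx => by
        have huv := h.locFree.add hW hu hv
        have e1 := h1 x hx
        have e2 := h2 x hx
        rw [hskew ht hu hs x hx, h.bracket_skew W hW _ _ hu (hb hs ht) x hx] at e1
        rw [hskew ht hv hs x hx, h.bracket_skew W hW _ _ hv (hb hs ht) x hx] at e2
        rw [hskew ht huv hs x hx, h.bracket_skew W hW _ _ huv (hb hs ht) x hx,
          hbadd hs ht hu hv x hx, hbadd ht hs hu hv x hx,
          h.bracket_add W hW _ _ _ (hb hs ht) hu hv x hx]
        linear_combination (norm := module) e1 + e2)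
      (fun g u hg hu h1 x hx => by
        have hgu := h.locFree.fsmul hW hg hu
        have e1 := h1 x hx
        rw [hskew ht hu hs x hx, h.bracket_skew W hW _ _ hu (hb hs ht) x hx] at e1
        rw [hskew ht hgu hs x hx, h.bracket_skew W hW _ _ hgu (hb hs ht) x hx,
          hbsmul hs ht hu hg x hx, hbsmul ht hs hu hg x hx,
          h.leibniz W hW g _ u hg (hb hs ht) hu x hx, han' hs ht hg x hx]
        linear_combination (norm := module) g x • e1)
      (fun u v hu he h1 x hx => by
        have e1 := h1 x hx
        have hv := h.locFree.congr hW hu he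
        rw [hskew ht hu hs x hx, h.bracket_skew W hW _ _ hu (hb hs ht) x hx,
          hloc hs (hb ht hu) (hloc ht hu he) x hx, hloc ht (hb hs hu) (hloc hs hu he) x hx,
          hloc (hb hs ht) hu he x hx] at e1
        rwa [hskew ht hv hs x hx, h.bracket_skew W hW _ _ hv (hb hs ht) x hx])
  have hei := f.smoothOn_e hW subset_rfl
  -- The three arguments are freed one at a time: `step` treats the last one, and the cyclic
  -- symmetry of the identity brings the next frame element to that place.
  have s1 : ∀ i j, ∀ u, A.SmoothOn u W → _ := fun i j => step _ _ (hei i) (hei j) (hj i j)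
  have s2 : ∀ t i, A.SmoothOn t W → ∀ u, A.SmoothOn u W → _ := fun t i ht =>
    step t (f.e i) ht (hei i) fun j x hx => by
      have := s1 i j t ht x hx
      linear_combination (norm := module) this
  refine step s t hs ht (fun i x hx => ?_) u hu
  have := s2 t i ht s hs x hx
  linear_combination (norm := module) this

end Frame

/-- The Lie algebroid axioms follow from those on local frames. -/
theorem isLieAlgebroid (hf : ∀ x, ∃ (ι : Type) (_ : Fintype ι) (_ : DecidableEq ι) (W : Set M)
    (_ : IsOpen W) (_ : x ∈ W) (f : SmFrame V A.toSectionFamily ι W),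
    (∀ i j, A.SmoothOn (A.bracket (f.e i) (f.e j)) W) ∧
    (∀ i j, ∀ x ∈ W, A.anchor x (A.bracket (f.e i) (f.e j) x)
      = cLie V (fun y => A.anchor y (f.e i y)) (fun y => A.anchor y (f.e j y)) x) ∧
    (∀ i j k, ∀ x ∈ W, A.bracket (f.e i) (A.bracket (f.e j) (f.e k)) x
      + A.bracket (f.e j) (A.bracket (f.e k) (f.e i)) x
      + A.bracket (f.e k) (A.bracket (f.e i) (f.e j)) x = 0)) : IsLieAlgebroid A := by
  have hf' : ∀ U, IsOpen U → ∀ x ∈ U, ∃ (ι : Type) (_ : Fintype ι) (_ : DecidableEq ι)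
    (W : Set M) (_ : IsOpen W) (_ : x ∈ W) (_ : W ⊆ U) (f : SmFrame V A.toSectionFamily ι W),
    (∀ i j, A.SmoothOn (A.bracket (f.e i) (f.e j)) W) ∧
    (∀ i j, ∀ x ∈ W, A.anchor x (A.bracket (f.e i) (f.e j) x)
      = cLie V (fun y => A.anchor y (f.e i y)) (fun y => A.anchor y (f.e j y)) x) ∧
    (∀ i j k, ∀ x ∈ W, A.bracket (f.e i) (A.bracket (f.e j) (f.e k)) x
      + A.bracket (f.e j) (A.bracket (f.e k) (f.e i)) x
      + A.bracket (f.e k) (A.bracket (f.e i) (f.e j)) x = 0) := fun U hU x hx => by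
    obtain ⟨ι, _, _, W, hW, hxW, f, h1, h2, h3⟩ := hf x
    exact ⟨ι, _, _, W ∩ U, hW.inter hU, ⟨hxW, hx⟩, Set.inter_subset_right,
      f.restrict Set.inter_subset_left,
      fun i j => h.locFree.mono _ _ _ hW (hW.inter hU) Set.inter_subset_left (h1 i j),
      fun i j y hy => h2 i j y hy.1, fun i j k y hy => h3 i j k y hy.1⟩
  have hm := fun {U W s} => h.locFree.mono U W s
  exact
  { vectorBundle := h.locFree.isSmoothVectorBundle
    anchor_smooth := h.anchor_smooth
    bracket_smooth := fun U hU s t hs ht => h.locFree.of_local U hU _ fun x hx => by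
      obtain ⟨ι, _, _, W, hW, hxW, hWU, f, h1, h2, h3⟩ := hf' U hU x hx
      exact ⟨W, hW, hxW, h.bracket_smooth_of_frame f hW h1 (hm hU hW hWU hs) (hm hU hW hWU ht)⟩
    bracket_local := h.bracket_local
    bracket_add := h.bracket_add
    bracket_smul := h.bracket_smul
    bracket_skew := h.bracket_skew
    jacobi := fun U hU s t u hs ht hu x hx => by
      obtain ⟨ι, _, _, W, hW, hxW, hWU, f, h1, h2, h3⟩ := hf' U hU x hx
      exact h.jacobi_of_frame f hW h1 h2 h3 (hm hU hW hWU hs) (hm hU hW hWU ht)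
        (hm hU hW hWU hu) x hxW
    anchor_bracket := fun U hU s t hs ht x hx => by
      obtain ⟨ι, _, _, W, hW, hxW, hWU, f, h1, h2, h3⟩ := hf' U hU x hx
      exact h.anchor_bracket_of_frame f hW h1 h2 (hm hU hW hWU hs) (hm hU hW hWU ht) x hxW
    leibniz := h.leibniz }

end IsPreLie

theorem IsLieAlgebroid.isPreLie {A : LieAlgebroidData V M} (h : IsLieAlgebroid A) : IsPreLie A where
  locFree := h.vectorBundle.isLocFree
  anchor_smooth := h.anchor_smooth
  bracket_local := h.bracket_local
  bracket_add := h.bracket_add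
  bracket_skew := h.bracket_skew
  leibniz := h.leibniz

end PreLie

/-! ### The algebroid of (0,1)-vectors and the two flat connections. -/

section Connections

variable {V : Type*} [NormedAddCommGroup V] [NormedSpace ℂ V] [FiniteDimensional ℂ V]
  {M : Type*} [TopologicalSpace M] [ChartedSpace V M] [IsManifold 𝓘(ℂ, V) ω M]

variable (V) in
/-- The frame of `T^{0,1} M` given by a chart. -/
def T01Frame (x₀ : M) : SmFrame V (T01Algebroid V M).toSectionFamily (Fin (Module.finrank ℂ V))
    (chartAt V x₀).source where
  e := delbar V x₀
  c k y :=
    { toFun := fun X => cDeriv V y (X : CTan V y) (zbar V x₀ k)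
      map_add' := fun X Y => cDeriv_add V y _ _ _
      map_smul' := fun c X => cDeriv_smul V y c _ _ }
  c_e _ hx _ _ := cDeriv_delbar_zbar hx _ _
  sum_c _ hx v := sum_delbar hx v
  smoothOn_iff W hW hWU X := by
    refine ⟨fun h k => Sm.cDeriv hW ((sm_zbar x₀ k).mono hWU) h, fun h => ?_⟩
    refine CSmoothOn.congr (CSmoothOn.sum Finset.univ fun k _ => CSmoothOn.smul (h k)
      ((delbar_smooth x₀ k).mono hWU)) fun y hy => ?_
    rw [← sum_delbar (hWU hy) (X y), AddSubmonoidClass.coe_finsetSum]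
    simp only [Submodule.coe_smul]
    rw [sum_delbar (hWU hy) (X y)]
    rfl

theorem T01_isLocFree : IsLocFree V (T01Algebroid V M).toSectionFamily where
  of_local _ _ _ h := CSmoothOn.of_local h
  mono _ _ _ _ _ hW h := CSmoothOn.mono h hW
  frame := ⟨_, inferInstance, inferInstance, fun x => ⟨_, (chartAt V x).open_source,
    mem_chart_source V x, ⟨T01Frame V x⟩⟩⟩

/-- `T^{0,1} M` is a Lie algebroid. -/
theorem T01_isLieAlgebroid : IsLieAlgebroid (T01Algebroid V M) where
  vectorBundle := T01_isLocFree.isSmoothVectorBundle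
  anchor_smooth _ _ _ h := h
  bracket_smooth _ hU _ _ hs ht := (CSmoothOn.cLie hU hs ht).pr01 hU
  bracket_local U hU s s' t t' hs ht h1 h2 x hx := by
    refine congrArg (pr01 V x) (cLie_congr hU hx (fun y hy => ?_) fun y hy => ?_)
    · rw [h1 y hy]
    · rw [h2 y hy]
  bracket_add U hU s t t' hs ht ht' x hx := by
    refine (congrArg (pr01 V x) (cLie_add_right hU hx hs ht ht')).trans ?_
    rw [map_add]
  bracket_smul U hU c s t hs ht x hx := by
    refine (congrArg (pr01 V x) (cLie_smul_right hU hx hs ht (Sm.const c U))).trans ?_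
    rw [cDeriv_const, zero_smul, zero_add, map_smul]
  bracket_skew U hU s t hs ht x hx := by
    refine (congrArg (pr01 V x) (cLie_skew hU hx hs ht)).trans ?_
    rw [map_neg]
  jacobi U hU s t u hs ht hu x hx := by
    -- The inner projection is superfluous, since the bracket of (0,1)-fields is already of type
    -- (0,1). The Jacobi identity is then that of complex fields.
    have key : ∀ {a b c : Π x : M, T01 V x}, CSmoothOn V (fun x => (b x : CTan V x)) U →
        CSmoothOn V (fun x => (c x : CTan V x)) U →
        cLie V (fun y => (a y : CTan V y)) (fun y => (pr01 V y (cLie V (fun z => (b z : CTan V z))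
          (fun z => (c z : CTan V z)) y) : CTan V y)) x
        = cLie V (fun y => (a y : CTan V y)) (cLie V (fun z => (b z : CTan V z))
          (fun z => (c z : CTan V z))) x := fun hb hc =>
      cLie_congr hU hx (fun _ _ => rfl) fun y hy => coe_pr01_cLie hU hy hb hc
    refine (congrArg₂ (· + ·) (congrArg₂ (· + ·) (congrArg (pr01 V x) (key ht hu))
      (congrArg (pr01 V x) (key hu hs))) (congrArg (pr01 V x) (key hs ht))).trans ?_
    rw [← map_add, ← map_add, cLie_jacobi hU hx hs ht hu, map_zero]
  anchor_bracket U hU s t hs ht x hx := coe_pr01_cLie hU hx hs ht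
  leibniz U hU f s t hf hs ht x hx := by
    refine (congrArg (pr01 V x) (cLie_smul_right hU hx hs ht hf)).trans ?_
    rw [map_add, map_smul, map_smul, pr01_T01]
    rfl

/-- Operations given by derivatives of coordinates are flat connections. -/
theorem isFlatConnection_of_frames {A : LieAlgebroidData V M} (hA : IsLieAlgebroid A)
    {E : SectionFamily M} (hE : IsLocFree V E)
    {nab : (Π x, A.Fib x) → (Π x, E.Fib x) → Π x, E.Fib x}
    (hf : ∀ x, ∃ (ι : Type) (_ : Fintype ι) (_ : DecidableEq ι) (W : Set M) (_ : IsOpen W)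
      (_ : x ∈ W) (f : SmFrame V E ι W), ∀ U, IsOpen U → U ⊆ W → ∀ a e, A.SmoothOn a U →
      E.SmoothOn e U → ∀ y ∈ U, ∀ i, f.c i y (nab a e y)
        = cDeriv V y (A.anchor y (a y)) (fun z => f.c i z (e z))) :
    IsFlatConnection A E nab := by
  have hf' : ∀ U, IsOpen U → ∀ x ∈ U, ∃ (ι : Type) (_ : Fintype ι) (_ : DecidableEq ι)
      (W : Set M) (_ : IsOpen W) (_ : x ∈ W) (_ : W ⊆ U) (f : SmFrame V E ι W),
      ∀ a e, A.SmoothOn a U → E.SmoothOn e U → ∀ y ∈ W, ∀ i, f.c i y (nab a e y)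
        = cDeriv V y (A.anchor y (a y)) (fun z => f.c i z (e z)) := fun U hU x hx => by
    obtain ⟨ι, _, _, W, hW, hxW, f, h⟩ := hf x
    exact ⟨ι, _, _, W ∩ U, hW.inter hU, ⟨hxW, hx⟩, Set.inter_subset_right,
      f.restrict Set.inter_subset_left, fun a e ha he y hy i => h (W ∩ U) (hW.inter hU)
        Set.inter_subset_left a e
        (hA.isPreLie.locFree.mono _ _ _ hU (hW.inter hU) Set.inter_subset_right ha)
        (hE.mono _ _ _ hU (hW.inter hU) Set.inter_subset_right he) y hy i⟩
  have hLA := hA.isPreLie.locFree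
  have hsm : ∀ U, IsOpen U → ∀ a e, A.SmoothOn a U → E.SmoothOn e U → E.SmoothOn (nab a e) U :=
    fun U hU a e ha he => hE.of_local U hU _ fun x hx => by
      obtain ⟨ι, _, _, W, hW, hxW, hWU, f, h⟩ := hf' U hU x hx
      refine ⟨W, hW, hxW, (f.smoothOn_iff W hW subset_rfl _).2 fun i => ?_⟩
      exact ContMDiffOn.congr (Sm.cDeriv hW (f.sm_c hW subset_rfl (hE.mono _ _ _ hU hW hWU he) i)
        (CSmoothOn.mono (hA.anchor_smooth U hU a ha) hWU)) fun y hy => h a e ha he y hy i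
  refine ⟨hsm, fun U hU a a' e e' ha he h1 h2 x hx => ?_, fun U hU a a' e ha ha' he x hx => ?_,
    fun U hU a e e' ha he he' x hx => ?_, fun U hU g a e hg ha he x hx => ?_,
    fun U hU g a e hg ha he x hx => ?_, fun U hU a b e ha hb he x hx => ?_⟩ <;>
  obtain ⟨ι, _, _, W, hW, hxW, hWU, f, h⟩ := hf' U hU x hx <;>
  refine f.ext hxW fun i => ?_
  · rw [h a e ha he x hxW, h a' e' (hLA.congr hU ha h1) (hE.congr hU he h2) x hxW, h1 x hx]
    exact cDeriv_congr_on _ hW hxW fun y hy => by rw [h2 y (hWU hy)]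
  · rw [map_add, h _ e ha he x hxW, h _ e ha' he x hxW, h _ e (hLA.add hU ha ha') he x hxW,
      Pi.add_apply, map_add, cDeriv_add]
  · rw [map_add, h a _ ha he x hxW, h a _ ha he' x hxW, h a _ ha (hE.add hU he he') x hxW]
    simp only [Pi.add_apply, map_add]
    exact cDeriv_fadd _ ((f.sm_c hW subset_rfl (hE.mono _ _ _ hU hW hWU he) i).md hW hxW)
      ((f.sm_c hW subset_rfl (hE.mono _ _ _ hU hW hWU he') i).md hW hxW)
  · rw [map_smul, h a e ha he x hxW, h _ e (hLA.fsmul hU hg ha) he x hxW, map_smul, cDeriv_smul,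
      smul_eq_mul]
  · rw [map_add, map_smul, map_smul, h a e ha he x hxW, h a _ ha (hE.fsmul hU hg he) x hxW]
    simp only [map_smul, smul_eq_mul]
    rw [cDeriv_mul _ (Sm.md hg hU hx)
      ((f.sm_c hW subset_rfl (hE.mono _ _ _ hU hW hWU he) i).md hW hxW)]
    ring
  · have : CompleteSpace V := FiniteDimensional.complete ℂ V
    have hc := f.sm_c hW subset_rfl (hE.mono _ _ _ hU hW hWU he) i
    rw [map_sub, map_sub, map_zero, h a _ ha (hsm U hU b e hb he) x hxW,
      h b _ hb (hsm U hU a e ha he) x hxW, h _ e (hA.bracket_smooth U hU a b ha hb) he x hxW,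
      hA.anchor_bracket U hU a b ha hb x hx,
      cDeriv_congr_on _ hW hxW fun y hy => h b e hb he y hy i,
      cDeriv_congr_on _ hW hxW fun y hy => h a e ha he y hy i]
    -- In coordinates the curvature is the commutator of two derivatives minus the derivative along
    -- the bracket of the anchors.
    refine sub_eq_zero.2 (cDeriv_cLie hW hxW ((hA.anchor_smooth U hU a ha).mono hWU)
      ((hA.anchor_smooth U hU b hb).mono hWU) hc).symm

namespace IsFlatConnection

variable {A : LieAlgebroidData V M} {E : SectionFamily M}
  {nab : (Π x, A.Fib x) → (Π x, E.Fib x) → Π x, E.Fib x} (h : IsFlatConnection A E nab)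
  (hA : IsLocFree V A.toSectionFamily) (hE : IsLocFree V E) {U : Set M} (hU : IsOpen U)
include h hU

include hE in
theorem zero_right {a : Π x, A.Fib x} (ha : A.SmoothOn a U) {x : M} (hx : x ∈ U) :
    nab a (fun _ => 0) x = 0 := by
  simpa using h.leibniz U hU (fun _ => 0) a (fun _ => 0) (Sm.const 0 U) ha (hE.zero hU) x hx

include hA in
theorem zero_left {e : Π x, E.Fib x} (he : E.SmoothOn e U) {x : M} (hx : x ∈ U) :
    nab (fun _ => 0) e x = 0 := by
  simpa using h.smul_left U hU (fun _ => 0) (fun _ => 0) e (Sm.const 0 U) (hA.zero hU) he x hx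

end IsFlatConnection

/-- The Dolbeault operator is a flat `T^{0,1} M`-connection. -/
theorem HolVectorBundle.dbar_isFlatConnection {Fib : M → Type*} [∀ x, AddCommGroup (Fib x)]
    [∀ x, Module ℂ (Fib x)] (E : HolVectorBundle V Fib) :
    IsFlatConnection (T01Algebroid V M) E.smooth E.dbar :=
  isFlatConnection_of_frames T01_isLieAlgebroid E.isLocFree fun x => by
    obtain ⟨ι, _, _, W, hW, hxW, -, ⟨f⟩⟩ := E.exists_holFrame_subset isOpen_univ (Set.mem_univ x)
    exact ⟨ι, _, _, W, hW, hxW, f.toSmFrame, fun U hU hUW a e _ he y hy i =>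
      f.c_dbarAt hW (hUW hy) (a y) ⟨U, hU, hy, he⟩ i⟩

/-- In the commutator `ρ(l)(X z̄_k) - X(ρ(l) z̄_k)` the second term vanishes, as ρ(l) is of type
(1,0). So the operation differentiates components in the frame `∂/∂z̄_k`, as flatness requires. -/
theorem cDeriv_del_zbar {A : LieAlgebroidData V M} {x₀ : M} {U : Set M} (hU : IsOpen U)
    (hUs : U ⊆ (chartAt V x₀).source) {l : Π x, A.Fib x} {X : Π x : M, T01 V x}
    (hl : CSmoothOn V (fun x => A.anchor x (l x)) U)
    (hA : ∀ x a, ∃ v, A.anchor x a = holTan V x v)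
    (hX : CSmoothOn V (fun x => (X x : CTan V x)) U) {y : M} (hy : y ∈ U) (k) :
    cDeriv V y (del A l X y : CTan V y) (zbar V x₀ k)
      = cDeriv V y (A.anchor y (l y)) (fun z => cDeriv V z (X z : CTan V z) (zbar V x₀ k)) := by
  have : CompleteSpace V := FiniteDimensional.complete ℂ V
  rw [del, cDeriv_pr01_zbar (hUs hy), cDeriv_cLie hU hy hl hX ((sm_zbar x₀ k).mono hUs),
    cDeriv_congr_on (X y : CTan V y) hU hy (g := fun _ => 0) fun z hz => by
      obtain ⟨v, hv⟩ := hA z (l z)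
      rw [hv, cDeriv_holTan_zbar (hUs hz)], cDeriv_const, sub_zero]

/-- The operation `∂` on `T^{0,1} M` is a flat connection. -/
theorem del_isFlatConnection {A : LieAlgebroidData V M} (h : IsLieAlgebroid A)
    (hA : ∀ x a, ∃ v, A.anchor x a = holTan V x v) :
    IsFlatConnection A (T01Algebroid V M).toSectionFamily (del A) :=
  isFlatConnection_of_frames h T01_isLocFree fun x => ⟨_, inferInstance, inferInstance, _,
    (chartAt V x).open_source, mem_chart_source V x, T01Frame V x, fun U hU hUW a _ ha hX _ hy i =>
      cDeriv_del_zbar hU hUW (h.anchor_smooth U hU a ha) hA hX hy i⟩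

end Connections

/-! ### The bracket on a direct sum with mutual connections. -/

section MatchedSum

variable {V : Type*} [NormedAddCommGroup V] [NormedSpace ℂ V] [FiniteDimensional ℂ V]
  {M : Type*} [TopologicalSpace M] [ChartedSpace V M] [IsManifold 𝓘(ℂ, V) ω M]
  {A B : LieAlgebroidData V M}
  {DA : (Π x, A.Fib x) → (Π x, B.Fib x) → Π x, B.Fib x}
  {DB : (Π x, B.Fib x) → (Π x, A.Fib x) → Π x, A.Fib x}

/-- The frame of a direct sum. -/
def SmFrame.prod {ι κ : Type} [Fintype ι] [DecidableEq ι] [Fintype κ] [DecidableEq κ] {U : Set M}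
    (f : SmFrame V A.toSectionFamily ι U) (g : SmFrame V B.toSectionFamily κ U) :
    SmFrame V (matchedSum A B DA DB).toSectionFamily (ι ⊕ κ) U where
  e := Sum.elim (fun i x => (f.e i x, 0)) (fun k x => (0, g.e k x))
  c := Sum.elim (fun i x => f.c i x ∘ₗ LinearMap.fst ℂ _ _) (fun k x => g.c k x ∘ₗ LinearMap.snd ℂ _ _)
  c_e x hx := by
    rintro (i | i) (j | j) <;> simp [f.c_e x hx, g.c_e x hx]
  sum_c x hx v := by
    rw [Fintype.sum_sum_type]
    ext
    · simpa [Prod.fst_sum] using f.sum_c x hx v.1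
    · simpa [Prod.snd_sum] using g.sum_c x hx v.2
  smoothOn_iff W hW hWU s := by
    refine (and_congr (f.smoothOn_iff W hW hWU _) (g.smoothOn_iff W hW hWU _)).trans ?_
    exact ⟨fun h => Sum.rec h.1 h.2, fun h => ⟨fun i => h (Sum.inl i), fun k => h (Sum.inr k)⟩⟩

theorem IsLocFree.matchedSum (hA : IsLocFree V A.toSectionFamily)
    (hB : IsLocFree V B.toSectionFamily) :
    IsLocFree V (matchedSum A B DA DB).toSectionFamily where
  of_local U hU s h := ⟨hA.of_local U hU _ fun x hx => by
      obtain ⟨W, hW, hxW, h1, -⟩ := h x hx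
      exact ⟨W, hW, hxW, h1⟩, hB.of_local U hU _ fun x hx => by
      obtain ⟨W, hW, hxW, -, h1⟩ := h x hx
      exact ⟨W, hW, hxW, h1⟩⟩
  mono U W s hU hW hWU h := ⟨hA.mono U W _ hU hW hWU h.1, hB.mono U W _ hU hW hWU h.2⟩
  frame := by
    obtain ⟨ι, _, _, hf⟩ := hA.frame
    obtain ⟨κ, _, _, hg⟩ := hB.frame
    refine ⟨ι ⊕ κ, inferInstance, inferInstance, fun x => ?_⟩
    obtain ⟨U, hU, hxU, ⟨f⟩⟩ := hf x
    obtain ⟨W, hW, hxW, ⟨g⟩⟩ := hg x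
    exact ⟨U ∩ W, hU.inter hW, ⟨hxU, hxW⟩,
      ⟨(f.restrict Set.inter_subset_left).prod (g.restrict Set.inter_subset_right)⟩⟩

variable (hA : IsLieAlgebroid A) (hB : IsLieAlgebroid B)
  (hDA : IsFlatConnection A B.toSectionFamily DA) (hDB : IsFlatConnection B A.toSectionFamily DB)
include hA hB hDA hDB

/-- Each axiom is the sum of the corresponding ones for the brackets and the connections. In the
Leibniz rule, the derivative of f along one anchor comes from the bracket and that along the other
from the connection, and together they make the anchor of the sum. -/
theorem matchedSum_isPreLie : IsPreLie (matchedSum A B DA DB) where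
  locFree := hA.isPreLie.locFree.matchedSum hB.isPreLie.locFree
  anchor_smooth U hU s hs := (hA.anchor_smooth U hU _ hs.1).add (hB.anchor_smooth U hU _ hs.2)
  bracket_local U hU s s' t t' hs ht h1 h2 x hx := by
    have a1 : ∀ y ∈ U, (s y).1 = (s' y).1 := fun y hy => by rw [h1 y hy]
    have a2 : ∀ y ∈ U, (s y).2 = (s' y).2 := fun y hy => by rw [h1 y hy]
    have b1 : ∀ y ∈ U, (t y).1 = (t' y).1 := fun y hy => by rw [h2 y hy]
    have b2 : ∀ y ∈ U, (t y).2 = (t' y).2 := fun y hy => by rw [h2 y hy]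
    refine Prod.ext ?_ ?_
    · exact congrArg₂ (· - ·) (congrArg₂ (· + ·) (hA.bracket_local U hU _ _ _ _ hs.1 ht.1 a1 b1 x hx)
        (hDB.nab_local U hU _ _ _ _ hs.2 ht.1 a2 b1 x hx))
        (hDB.nab_local U hU _ _ _ _ ht.2 hs.1 b2 a1 x hx)
    · exact congrArg₂ (· - ·) (congrArg₂ (· + ·) (hB.bracket_local U hU _ _ _ _ hs.2 ht.2 a2 b2 x hx)
        (hDA.nab_local U hU _ _ _ _ hs.1 ht.2 a1 b2 x hx))
        (hDA.nab_local U hU _ _ _ _ ht.1 hs.2 b1 a2 x hx)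
  bracket_add U hU s t t' hs ht ht' x hx := by
    have e1 := hA.bracket_add U hU _ _ _ hs.1 ht.1 ht'.1 x hx
    have e2 := hDB.add_right U hU _ _ _ hs.2 ht.1 ht'.1 x hx
    have e3 := hDB.add_left U hU _ _ _ ht.2 ht'.2 hs.1 x hx
    have e4 := hB.bracket_add U hU _ _ _ hs.2 ht.2 ht'.2 x hx
    have e5 := hDA.add_right U hU _ _ _ hs.1 ht.2 ht'.2 x hx
    have e6 := hDA.add_left U hU _ _ _ ht.1 ht'.1 hs.2 x hx
    refine Prod.ext ?_ ?_
    · refine (congrArg₂ (· - ·) (congrArg₂ (· + ·) e1 e2) e3).trans ?_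
      simp only [Prod.fst_add]
      abel
    · refine (congrArg₂ (· - ·) (congrArg₂ (· + ·) e4 e5) e6).trans ?_
      simp only [Prod.snd_add]
      abel
  bracket_skew U hU s t hs ht x hx := by
    refine Prod.ext ?_ ?_
    · simp only [Prod.fst_neg]
      rw [hA.bracket_skew U hU _ _ hs.1 ht.1 x hx]
      abel
    · simp only [Prod.snd_neg]
      rw [hB.bracket_skew U hU _ _ hs.2 ht.2 x hx]
      abel
  leibniz U hU f s t hf hs ht x hx := by
    have e1 := hA.leibniz U hU f _ _ hf hs.1 ht.1 x hx
    have e2 := hDB.leibniz U hU f _ _ hf hs.2 ht.1 x hx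
    have e3 := hDB.smul_left U hU f _ _ hf ht.2 hs.1 x hx
    have e4 := hB.leibniz U hU f _ _ hf hs.2 ht.2 x hx
    have e5 := hDA.leibniz U hU f _ _ hf hs.1 ht.2 x hx
    have e6 := hDA.smul_left U hU f _ _ hf ht.1 hs.2 x hx
    have e7 : cDeriv V x (((A.anchor x).coprod (B.anchor x)) (s x)) f
      = cDeriv V x (A.anchor x (s x).1) f + cDeriv V x (B.anchor x (s x).2) f := by
      rw [LinearMap.coprod_apply, cDeriv_add]
    rw [e7]
    refine Prod.ext ?_ ?_
    · refine (congrArg₂ (· - ·) (congrArg₂ (· + ·) e1 e2) e3).trans ?_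
      simp only [Prod.fst_add, Prod.smul_fst]
      module
    · refine (congrArg₂ (· - ·) (congrArg₂ (· + ·) e4 e5) e6).trans ?_
      simp only [Prod.snd_add, Prod.smul_snd]
      module

/-- When the components in one summand are zero, all connection terms and the bracket of that
summand vanish, so the other summand is included compatibly with brackets. -/
theorem isMatchedPair_of_isLieAlgebroid (hAB : IsLieAlgebroid (matchedSum A B DA DB)) :
    IsMatchedPair A B DA DB where
  left :=
    { lieAlgebroid := hAB
      lieAlgebroid_sub := hA
      morphism :=
        { smooth := fun U hU s hs => ⟨hs, hB.isPreLie.locFree.zero hU⟩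
          anchor := fun x a => by simp
          bracket := fun U hU s t hs ht x hx => by
            have hLA := hA.isPreLie.locFree
            have hLB := hB.isPreLie.locFree
            refine Prod.ext ?_ ?_
            · simp [hDB.zero_left hLB hU hs hx, hDB.zero_left hLB hU ht hx]
            · simp [hDA.zero_right hLB hU hs hx, hDA.zero_right hLB hU ht hx,
                hB.isPreLie.zero_right hU (hLB.zero hU) hx] }
      injective := fun x => LinearMap.inl_injective }
  right :=
    { lieAlgebroid := hAB
      lieAlgebroid_sub := hB
      morphism :=
        { smooth := fun U hU s hs => ⟨hA.isPreLie.locFree.zero hU, hs⟩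
          anchor := fun x a => by simp
          bracket := fun U hU s t hs ht x hx => by
            have hLA := hA.isPreLie.locFree
            have hLB := hB.isPreLie.locFree
            refine Prod.ext ?_ ?_
            · simp [hDB.zero_right hLA hU hs hx, hDB.zero_right hLA hU ht hx,
                hA.isPreLie.zero_right hU (hLA.zero hU) hx]
            · simp [hDA.zero_left hLA hU hs hx, hDA.zero_left hLA hU ht hx] }
      injective := fun x => LinearMap.inr_injective }
  bott_left := hDA
  bott_right := hDB

end MatchedSum

/-! ### The matched pair attached to a holomorphic Lie algebroid. -/

section DolbeaultPair

variable {V : Type*} [NormedAddCommGroup V] [NormedSpace ℂ V] [FiniteDimensional ℂ V]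
  {M : Type*} [TopologicalSpace M] [ChartedSpace V M] [IsManifold 𝓘(ℂ, V) ω M]
  {A : LieAlgebroidData V M} {𝓐 : HolLieAlgebroid V A.Fib}
  {DA : (Π x : M, T01 V x) → (Π x, A.Fib x) → Π x, A.Fib x}

/-- The smooth frame of the underlying Lie algebroid given by a holomorphic frame. -/
def HolFrame.underlying (h : Underlies A 𝓐) {ι : Type} [Fintype ι] [DecidableEq ι] {U : Set M}
    (f : HolFrame 𝓐.toHolVectorBundle ι U) : SmFrame V A.toSectionFamily ι U where
  e := f.e
  c := f.c
  c_e := f.c_e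
  sum_c := f.sum_c
  smoothOn_iff W hW hWU s := (h.smoothOn W hW s).trans (f.smoothOn_iff W hW hWU s)

variable (h : Underlies A 𝓐)
  (hDA : ∀ U : Set M, IsOpen U → ∀ X s, (T01Algebroid V M).SmoothOn X U → A.SmoothOn s U →
    ∀ x ∈ U, DA X s x = 𝓐.dbar X s x)
include h

theorem Underlies.smoothOn_of_holOn {U : Set M} (hU : IsOpen U) {s : Π x, A.Fib x}
    (hs : 𝓐.HolOn s U) : A.SmoothOn s U := (h.smoothOn U hU s).2 (hs.smoothOn hU)

theorem Underlies.exists_holTan (x : M) (a : A.Fib x) : ∃ v, A.anchor x a = holTan V x v :=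
  ⟨_, h.anchor x a⟩

include hDA

/-- The operation `DA` is only required to agree with the Dolbeault operator on smooth sections.
This freedom lets the results be applied to the Bott operator on the Atiyah algebroid, which is
defined by its own formula. -/
theorem Underlies.isFlatConnection_dbar :
    IsFlatConnection (T01Algebroid V M) A.toSectionFamily DA :=
  isFlatConnection_of_frames T01_isLieAlgebroid h.lieAlgebroid.isPreLie.locFree fun x => by
    obtain ⟨ι, _, _, W, hW, hxW, -, ⟨f⟩⟩ :=
      𝓐.toHolVectorBundle.exists_holFrame_subset isOpen_univ (Set.mem_univ x)
    exact ⟨ι, _, _, W, hW, hxW, f.underlying h, fun U hU hUW a e ha he y hy i =>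
      (congrArg (f.c i y) (hDA U hU a e ha he y hy)).trans
      (f.c_dbarAt hW (hUW hy) (a y) ⟨U, hU, hy, (h.smoothOn U hU e).1 he⟩ i)⟩

section Brackets

variable {x₀ : M} {W : Set M} (hW : IsOpen W) (hWs : W ⊆ (chartAt V x₀).source)
include hW hWs

/-- Coordinate fields commute: their derivatives of the `z̄_i` are constants, and (0,1)-vectors are
determined by the `z̄_i`. The connection terms involve a zero section. -/
theorem Underlies.bracket_delbar_delbar (j k) {y : M} (hy : y ∈ W) :
    (matchedSum (T01Algebroid V M) A DA (del A)).bracket (fun y => (delbar V x₀ j y, 0))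
      (fun y => (delbar V x₀ k y, 0)) y = 0 := by
  have : CompleteSpace V := FiniteDimensional.complete ℂ V
  have hd := fun k => (delbar_smooth x₀ k).mono hWs
  have hLA := h.lieAlgebroid.isPreLie.locFree
  have hDf := h.isFlatConnection_dbar hDA
  have hdel := del_isFlatConnection h.lieAlgebroid h.exists_holTan
  have key : (T01Algebroid V M).bracket (delbar V x₀ j) (delbar V x₀ k) y = 0 := by
    refine T01_eq_of_coord (hWs hy) fun i => ?_
    rw [cDeriv_pr01_zbar (hWs hy), cDeriv_cLie hW hy (hd j) (hd k) ((sm_zbar x₀ i).mono hWs),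
      cDeriv_congr_on _ hW hy fun z hz => cDeriv_delbar_zbar (hWs hz) i k,
      cDeriv_congr_on _ hW hy fun z hz => cDeriv_delbar_zbar (hWs hz) i j, cDeriv_const,
      cDeriv_const, ZeroMemClass.coe_zero, cDeriv_zero_left, sub_zero]
  refine Prod.ext ?_ ?_
  · exact (congrArg₂ (· - ·) (congrArg₂ (· + ·) key (hdel.zero_left hLA hW (hd k) hy))
      (hdel.zero_left hLA hW (hd j) hy)).trans (by simp)
  · simp only [hDf.zero_right hLA hW (hd j) hy, hDf.zero_right hLA hW (hd k) hy,
      h.lieAlgebroid.isPreLie.zero_right hW (hLA.zero hW) hy]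
    simp

/-- The component in A is `∂̄` of a holomorphic section. The component in `T^{0,1} M` has as
coordinates the derivatives along the anchor of s of the constant coefficients of `∂/∂z̄_j`. -/
theorem Underlies.bracket_delbar_hol (j) {s : Π x, A.Fib x} (hs : 𝓐.HolOn s W) {y : M}
    (hy : y ∈ W) :
    (matchedSum (T01Algebroid V M) A DA (del A)).bracket (fun y => (delbar V x₀ j y, 0))
      (fun y => (0, s y)) y = 0 := by
  have hd := fun k => (delbar_smooth x₀ k).mono hWs
  have hs' := h.smoothOn_of_holOn hW hs
  have hLA := h.lieAlgebroid.isPreLie.locFree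
  have hLT := T01_isLocFree (V := V) (M := M)
  have hDf := h.isFlatConnection_dbar hDA
  have hdel := del_isFlatConnection h.lieAlgebroid h.exists_holTan
  have key : del A s (delbar V x₀ j) y = 0 := by
    refine T01_eq_of_coord (hWs hy) fun i => ?_
    rw [cDeriv_del_zbar hW hWs (h.lieAlgebroid.anchor_smooth W hW s hs') h.exists_holTan (hd j) hy,
      cDeriv_congr_on _ hW hy fun z hz => cDeriv_delbar_zbar (hWs hz) i j, cDeriv_const,
      ZeroMemClass.coe_zero, cDeriv_zero_left]
  have key2 : DA (delbar V x₀ j) s y = 0 :=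
    (hDA W hW _ s (hd j) hs' y hy).trans (hs.dbarAt_eq_zero hW hy _)
  refine Prod.ext ?_ ?_
  · exact (congrArg₂ (· - ·) (congrArg₂ (· + ·)
      (T01_isLieAlgebroid.isPreLie.zero_right hW (hd j) hy)
      (hdel.zero_left hLA hW (hLT.zero hW) hy)) key).trans (by simp)
  · simp only [key2, hDf.zero_left hLT hW (hLA.zero hW) hy,
      h.lieAlgebroid.isPreLie.bracket_skew W hW _ _ (hLA.zero hW) hs' y hy,
      h.lieAlgebroid.isPreLie.zero_right hW hs' hy]
    simp

theorem Underlies.bracket_hol_hol {s t : Π x, A.Fib x} (hs : 𝓐.HolOn s W) (ht : 𝓐.HolOn t W)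
    {y : M} (hy : y ∈ W) :
    (matchedSum (T01Algebroid V M) A DA (del A)).bracket (fun y => (0, s y))
      (fun y => (0, t y)) y = (0, 𝓐.bracket s t y) := by
  have hs' := h.smoothOn_of_holOn hW hs
  have ht' := h.smoothOn_of_holOn hW ht
  have hLT := T01_isLocFree (V := V) (M := M)
  have hDf := h.isFlatConnection_dbar hDA
  have hdel := del_isFlatConnection h.lieAlgebroid h.exists_holTan
  refine Prod.ext ?_ ?_
  · exact (congrArg₂ (· - ·) (congrArg₂ (· + ·)
      (T01_isLieAlgebroid.isPreLie.zero_right hW (hLT.zero hW) hy)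
      (hdel.zero_right hLT hW hs' hy)) (hdel.zero_right hLT hW ht' hy)).trans (by simp)
  · simp only [hDf.zero_left hLT hW hs' hy, hDf.zero_left hLT hW ht' hy,
      h.bracket W hW s t hs ht y hy]
    simp

end Brackets

/-- The matched sum of `T^{0,1} M` and the Lie algebroid underlying a holomorphic one. -/
theorem Underlies.matchedSum_isLieAlgebroid :
    IsLieAlgebroid (matchedSum (T01Algebroid V M) A DA (del A)) := by
  have hP := matchedSum_isPreLie T01_isLieAlgebroid h.lieAlgebroid (h.isFlatConnection_dbar hDA)
    (del_isFlatConnection h.lieAlgebroid h.exists_holTan)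
  have hLA := h.lieAlgebroid.isPreLie.locFree
  have hLT := T01_isLocFree (V := V) (M := M)
  refine hP.isLieAlgebroid fun x₀ => ?_
  obtain ⟨κ, _, _, W, hW, hxW, hWs, ⟨f⟩⟩ := 𝓐.toHolVectorBundle.exists_holFrame_subset
    (chartAt V x₀).open_source (mem_chart_source V x₀)
  set B := matchedSum (T01Algebroid V M) A DA (del A) with hB
  let F : SmFrame V B.toSectionFamily (Fin (Module.finrank ℂ V) ⊕ κ) W :=
    ((T01Frame V x₀).restrict hWs).prod (f.underlying h)
  have hd := fun k => (delbar_smooth x₀ k).mono hWs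
  have he := fun k => f.holOn_e hW subset_rfl k
  have hsd : ∀ j, B.SmoothOn (fun y => (delbar V x₀ j y, 0)) W := fun j => ⟨hd j, hLA.zero hW⟩
  have hsh : ∀ {s}, 𝓐.HolOn s W → B.SmoothOn (fun y => (0, s y)) W := fun hs =>
    ⟨hLT.zero hW, h.smoothOn_of_holOn hW hs⟩
  have b1 := fun j k y hy => h.bracket_delbar_delbar hDA hW hWs (y := y) j k hy
  have b2 := fun j s hs y hy => h.bracket_delbar_hol hDA hW hWs j (s := s) hs (y := y) hy
  have b3 : ∀ j s, 𝓐.HolOn s W → ∀ y ∈ W,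
      B.bracket (fun y => (0, s y)) (fun y => (delbar V x₀ j y, 0)) y = 0 := fun j s hs y hy => by
    rw [hP.bracket_skew W hW _ _ (hsh hs) (hsd j) y hy, b2 j s hs y hy, neg_zero]
  have b4 := fun s t hs ht y hy => h.bracket_hol_hol hDA hW hWs (s := s) (t := t) hs ht (y := y) hy
  have hbr := fun s t hs ht => 𝓐.bracket_hol W hW s t hs ht
  have z : ∀ {s t : Π y, B.Fib y}, B.SmoothOn s W → (∀ y ∈ W, t y = 0) → ∀ y ∈ W,
    B.bracket s t y = 0 := fun hs ht y hy => hP.bracket_eq_zero hW hs ht hy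
  -- An inner bracket is known only on W, so locality of the outer bracket is used to replace it by
  -- its value. Holomorphy of the inner holomorphic bracket lets the formulas be applied a second
  -- time.
  have hh : ∀ {r s t}, 𝓐.HolOn r W → 𝓐.HolOn s W → 𝓐.HolOn t W → ∀ y ∈ W,
      B.bracket (fun y => (0, r y)) (B.bracket (fun y => (0, s y)) fun y => (0, t y)) y
        = (0, 𝓐.bracket r (𝓐.bracket s t) y) := fun {r s t} hr hs ht y hy => by
    rw [← hP.bracket_local W hW _ _ _ _ (hsh hr) (hsh (hbr s t hs ht)) (fun _ _ => rfl)
      (fun y hy => (b4 s t hs ht y hy).symm) y hy, b4 _ _ hr (hbr s t hs ht) y hy]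
  have dh : ∀ {j s t}, 𝓐.HolOn s W → 𝓐.HolOn t W → ∀ y ∈ W,
      B.bracket (fun y => (delbar V x₀ j y, 0)) (B.bracket (fun y => (0, s y)) fun y => (0, t y)) y
        = 0 := fun {j s t} hs ht y hy => by
    rw [← hP.bracket_local W hW _ _ _ _ (hsd j) (hsh (hbr s t hs ht)) (fun _ _ => rfl)
      (fun y hy => (b4 s t hs ht y hy).symm) y hy, b2 j _ (hbr s t hs ht) y hy]
  have hB0 := hP.locFree.zero hW
  have haz : ∀ {s t : Π y, B.Fib y} {y}, y ∈ W → B.bracket s t y = 0 →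
      cLie V (fun y => B.anchor y (s y)) (fun y => B.anchor y (t y)) y = 0 →
      B.anchor y (B.bracket s t y)
        = cLie V (fun y => B.anchor y (s y)) (fun y => B.anchor y (t y)) y := fun _ h1 h2 => by
    rw [h1, map_zero, h2]
  refine ⟨_, inferInstance, inferInstance, W, hW, hxW, F, ?_, ?_, ?_⟩
  · rintro (i | i) (j | j)
    · exact hP.locFree.congr hW hB0 fun y hy => (b1 i j y hy).symm
    · exact hP.locFree.congr hW hB0 fun y hy => (b2 i _ (he j) y hy).symm
    · exact hP.locFree.congr hW hB0 fun y hy => (b3 j _ (he i) y hy).symm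
    · exact hP.locFree.congr hW (hsh (hbr _ _ (he i) (he j))) fun y hy =>
        (b4 _ _ (he i) (he j) y hy).symm
  · have : CompleteSpace V := FiniteDimensional.complete ℂ V
    have hAe : ∀ j, CSmoothOn V (fun y => A.anchor y (f.e j y)) W := fun j =>
      h.lieAlgebroid.anchor_smooth W hW _ (h.smoothOn_of_holOn hW (he j))
    -- The anchor must kill the mixed brackets too. On `z_k` the commutator is `∂/∂z̄_i` of a
    -- holomorphic function, because the anchor of `e_j` is holomorphic; on `z̄_k` only derivatives
    -- of constants occur.
    have hmix : ∀ i j, ∀ y ∈ W, cLie V (fun y => (delbar V x₀ i y : CTan V y))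
        (fun y => A.anchor y (f.e j y)) y = 0 := fun i j y hy => by
      have hz : ∀ k, Ho V (zc V x₀ k) W := fun k => (ho_zc (V := V) x₀ k).mono hWs
      have hzb := fun k => (sm_zbar (V := V) x₀ k).mono hWs
      refine cTan_eq_of_coord (hWs hy) (fun k => ?_) fun k => ?_
      · rw [cDeriv_cLie hW hy (hd i) (hAe j) (hz k).sm, cDeriv_zero_left,
          cDeriv_congr_on (A.anchor y (f.e j y)) hW hy fun w hw =>
            cDeriv_T01 (delbar V x₀ i w).2 ((hz k).md hW hw), cDeriv_const, sub_zero,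
          cDeriv_congr_on (g := fun w => holDeriv V w (𝓐.anchor w (f.e j w)) (zc V x₀ k)) _ hW hy
            fun w hw => by rw [h.anchor, cDeriv_holTan _ ((hz k).md hW hw)]]
        exact cDeriv_T01 (delbar V x₀ i y).2
          ((Ho.holDeriv hW (hz k) (𝓐.anchor_hol W hW _ (he j))).md hW hy)
      · rw [cDeriv_cLie hW hy (hd i) (hAe j) (hzb k), cDeriv_zero_left,
          cDeriv_congr_on (A.anchor y (f.e j y)) hW hy fun w hw =>
            cDeriv_delbar_zbar (hWs hw) k i, cDeriv_const, sub_zero,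
          cDeriv_congr_on (g := fun _ => 0) _ hW hy
            fun w hw => by rw [h.anchor, cDeriv_holTan_zbar (hWs hw)], cDeriv_const]
    have a1 : ∀ i y, B.anchor y (F.e (Sum.inl i) y) = (delbar V x₀ i y : CTan V y) := fun i y => by
      change ((T01 V y).subtype.coprod (A.anchor y)) (delbar V x₀ i y, 0) = _
      simp
    have a2 : ∀ j y, B.anchor y (F.e (Sum.inr j) y) = A.anchor y (f.e j y) := fun j y => by
      change ((T01 V y).subtype.coprod (A.anchor y)) (0, f.e j y) = _
      simp
    rintro (i | i) (j | j) y hy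
    · refine haz hy (b1 i j y hy) ?_
      simp only [a1]
      have := congrArg Prod.fst (b1 i j y hy)
      rw [← coe_pr01_cLie hW hy (hd i) (hd j)]
      refine (congrArg Subtype.val (a₂ := 0) ?_)
      have hdel := del_isFlatConnection h.lieAlgebroid h.exists_holTan
      simpa [hB, hdel.zero_left hLA hW (hd i) hy, hdel.zero_left hLA hW (hd j) hy] using this
    · refine haz hy (b2 i _ (he j) y hy) ?_
      simp only [a1, a2]
      exact hmix i j y hy
    · refine haz hy (b3 j _ (he i) y hy) ?_
      simp only [a1, a2]
      rw [cLie_skew hW hy (hAe i) (hd j), hmix j i y hy, neg_zero]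
    · simp only [a2]
      refine (congrArg (B.anchor y) (b4 _ _ (he i) (he j) y hy)).trans ?_
      rw [← h.lieAlgebroid.anchor_bracket W hW _ _ (h.smoothOn_of_holOn hW (he i))
        (h.smoothOn_of_holOn hW (he j)) y hy, h.bracket W hW _ _ (he i) (he j) y hy]
      change ((T01 V y).subtype.coprod (A.anchor y)) (0, _) = _
      simp
  · have d1 := fun i => hsd i
    have d2 := fun j => hsh (he j)
    have zb : ∀ {r s t : Π y, B.Fib y} {y}, y ∈ W → B.SmoothOn r W → (∀ y ∈ W, B.bracket s t y = 0) →
      B.bracket r (B.bracket s t) y = 0 := fun hy hr hst => z hr hst _ hy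
    -- In the seven cases with some `∂/∂z̄` every term of the Jacobi sum vanishes separately. The
    -- remaining case is the Jacobi identity of the holomorphic algebroid.
    rintro (i | i) (j | j) (k | k) y hy
    · exact (congrArg₂ (· + ·) (congrArg₂ (· + ·) (zb hy (d1 i) (b1 j k)) (zb hy (d1 j) (b1 k i)))
        (zb hy (d1 k) (b1 i j))).trans (by simp)
    · exact (congrArg₂ (· + ·) (congrArg₂ (· + ·) (zb hy (d1 i) (b2 j _ (he k)))
        (zb hy (d1 j) (b3 i _ (he k)))) (zb hy (d2 k) (b1 i j))).trans (by simp)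
    · exact (congrArg₂ (· + ·) (congrArg₂ (· + ·) (zb hy (d1 i) (b3 k _ (he j)))
        (zb hy (d2 j) (b1 k i))) (zb hy (d1 k) (b2 i _ (he j)))).trans (by simp)
    · exact (congrArg₂ (· + ·) (congrArg₂ (· + ·) (dh (he j) (he k) y hy)
        (zb hy (d2 j) (b3 i _ (he k)))) (zb hy (d2 k) (b2 i _ (he j)))).trans (by simp)
    · exact (congrArg₂ (· + ·) (congrArg₂ (· + ·) (zb hy (d2 i) (b1 j k))
        (zb hy (d1 j) (b2 k _ (he i)))) (zb hy (d1 k) (b3 j _ (he i)))).trans (by simp)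
    · exact (congrArg₂ (· + ·) (congrArg₂ (· + ·) (zb hy (d2 i) (b2 j _ (he k)))
        (dh (he k) (he i) y hy)) (zb hy (d2 k) (b3 j _ (he i)))).trans (by simp)
    · exact (congrArg₂ (· + ·) (congrArg₂ (· + ·) (zb hy (d2 i) (b3 k _ (he j)))
        (zb hy (d2 j) (b2 k _ (he i)))) (dh (he i) (he j) y hy)).trans (by simp)
    · refine (congrArg₂ (· + ·) (congrArg₂ (· + ·) (hh (he i) (he j) (he k) y hy)
        (hh (he j) (he k) (he i) y hy)) (hh (he k) (he i) (he j) y hy)).trans ?_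
      refine Prod.ext ?_ ?_
      · exact (by simp : (0 : T01 V y) + 0 + 0 = 0)
      · exact 𝓐.jacobi W hW _ _ _ (he i) (he j) (he k) y hy

/-- `T^{0,1} M` and the Lie algebroid underlying a holomorphic one form a matched pair. -/
theorem Underlies.isMatchedPair : IsMatchedPair (T01Algebroid V M) A DA (del A) :=
  isMatchedPair_of_isLieAlgebroid T01_isLieAlgebroid h.lieAlgebroid (h.isFlatConnection_dbar hDA)
    (del_isFlatConnection h.lieAlgebroid h.exists_holTan) (h.matchedSum_isLieAlgebroid hDA)

end DolbeaultPair

/-! ### Extension of the holomorphic bracket to smooth sections. -/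

section ExtendBracket

variable {V : Type*} [NormedAddCommGroup V] [NormedSpace ℂ V] [FiniteDimensional ℂ V]
  {M : Type*} [TopologicalSpace M] [ChartedSpace V M] [IsManifold 𝓘(ℂ, V) ω M]
  {LF : M → Type*} [∀ x, AddCommGroup (LF x)] [∀ x, Module ℂ (LF x)]

/-- Holomorphic counterpart of `SmFrame.induction`: the coefficients of a holomorphic section in a
holomorphic frame are holomorphic. -/
theorem HolFrame.induction {E : HolVectorBundle V LF} {ι : Type} [Fintype ι]
    [DecidableEq ι] {W : Set M} (f : HolFrame E ι W) (hW : IsOpen W)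
    (P : (Π x, LF x) → Prop) (h0 : P (fun _ => 0)) (he : ∀ i, P (f.e i))
    (hadd : ∀ s t, E.HolOn s W → E.HolOn t W → P s → P t → P (s + t))
    (hsmul : ∀ (g : M → ℂ) s, Ho V g W → E.HolOn s W → P s → P (fun x => g x • s x))
    (hcongr : ∀ s t, E.HolOn s W → (∀ x ∈ W, s x = t x) → P s → P t) :
    ∀ s, E.HolOn s W → P s := by
  intro s hs
  have hterm : ∀ i, E.HolOn (fun x => f.c i x (s x) • f.e i x) W := fun i =>
    (f.holOn_e hW subset_rfl i).fsmul (hs.ho_c f hW subset_rfl i) hW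
  have key : ∀ a : Finset ι, P (fun x => ∑ i ∈ a, f.c i x (s x) • f.e i x) := fun a => by
    induction a using Finset.induction_on with
    | empty => simpa using h0
    | insert i a hi ih =>
      simp only [Finset.sum_insert hi]
      exact hadd _ _ (hterm i) (HolVectorBundle.HolOn.sum a hW fun k _ => hterm k)
        (hsmul _ _ (hs.ho_c f hW subset_rfl i) (f.holOn_e hW subset_rfl i) (he i)) ih
  exact hcongr _ _ (HolVectorBundle.HolOn.sum _ hW fun k _ => hterm k)
    (fun x hx => f.sum_c x hx _) (key Finset.univ)

variable {𝓛 : HolLieAlgebroid V LF} {ι : Type} [Fintype ι] [DecidableEq ι] {W : Set M}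
  (f : HolFrame 𝓛.toHolVectorBundle ι W)

/-- The bracket of smooth sections extending that of holomorphic sections, in a holomorphic
frame. -/
def HolFrame.bracket (s t : Π x, LF x) (x : M) : LF x :=
  ∑ i, ∑ j, (f.c i x (s x) * f.c j x (t x)) • 𝓛.bracket (f.e i) (f.e j) x
    + (∑ j, cDeriv V x (holTan V x (𝓛.anchor x (s x))) (fun y => f.c j y (t y)) • f.e j x
    - ∑ j, cDeriv V x (holTan V x (𝓛.anchor x (t x))) (fun y => f.c j y (s y)) • f.e j x)

namespace HolFrame

variable (hW : IsOpen W) {x : M} (hxW : x ∈ W) {s s' t t' : Π x, LF x}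

include hW hxW in
theorem bracket_congr (hs : ∀ y ∈ W, s y = s' y) (ht : ∀ y ∈ W, t y = t' y) :
    f.bracket s t x = f.bracket s' t' x := by
  have h1 : ∀ j X, cDeriv V x X (fun y => f.c j y (s y)) = cDeriv V x X (fun y => f.c j y (s' y)) :=
    fun j X => cDeriv_congr_on X hW hxW fun y hy => by rw [hs y hy]
  have h2 : ∀ j X, cDeriv V x X (fun y => f.c j y (t y)) = cDeriv V x X (fun y => f.c j y (t' y)) :=
    fun j X => cDeriv_congr_on X hW hxW fun y hy => by rw [ht y hy]
  simp only [bracket, h1, h2, hs x hxW, ht x hxW]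

include hW hxW in
theorem bracket_skew : f.bracket s t x = - f.bracket t s x := by
  have h1 : ∑ i, ∑ j, (f.c i x (s x) * f.c j x (t x)) • 𝓛.bracket (f.e i) (f.e j) x
      = - ∑ i, ∑ j, (f.c i x (t x) * f.c j x (s x)) • 𝓛.bracket (f.e i) (f.e j) x := by
    rw [Finset.sum_comm]
    simp only [← Finset.sum_neg_distrib]
    refine Finset.sum_congr rfl fun i _ => Finset.sum_congr rfl fun j _ => ?_
    rw [𝓛.bracket_skew W hW _ _ (f.holOn_e hW subset_rfl j) (f.holOn_e hW subset_rfl i) x hxW,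
      mul_comm, smul_neg]
  rw [bracket, bracket, h1]
  abel

variable (hs : 𝓛.smooth.SmoothOn s W) (ht : 𝓛.smooth.SmoothOn t W) (ht' : 𝓛.smooth.SmoothOn t' W)

include hW hxW ht ht' in
theorem bracket_add : f.bracket s (t + t') x = f.bracket s t x + f.bracket s t' x := by
  have h1 : ∀ j X, cDeriv V x X (fun y => f.c j y ((t + t') y))
      = cDeriv V x X (fun y => f.c j y (t y)) + cDeriv V x X (fun y => f.c j y (t' y)) :=
    fun j X => by
      simp only [Pi.add_apply, map_add]
      exact cDeriv_fadd _ ((f.sm_c hW subset_rfl ht j).md hW hxW)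
        ((f.sm_c hW subset_rfl ht' j).md hW hxW)
  simp only [bracket, h1]
  simp only [Pi.add_apply, map_add, cDeriv_add, mul_add, add_smul, Finset.sum_add_distrib]
  abel

include hW hxW ht in
theorem bracket_leibniz {g : M → ℂ} (hg : Sm V g W) : f.bracket s (fun y => g y • t y) x
    = cDeriv V x (holTan V x (𝓛.anchor x (s x))) g • t x + g x • f.bracket s t x := by
  have h1 : ∀ j X, cDeriv V x X (fun y => f.c j y (g y • t y))
      = cDeriv V x X g * f.c j x (t x) + g x * cDeriv V x X (fun y => f.c j y (t y)) :=
    fun j X => by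
      simp only [map_smul, smul_eq_mul]
      exact cDeriv_mul _ (hg.md hW hxW) ((f.sm_c hW subset_rfl ht j).md hW hxW)
  simp only [bracket, h1]
  simp only [map_smul, cDeriv_smul, smul_eq_mul, add_smul, Finset.sum_add_distrib, mul_smul,
    ← Finset.smul_sum, f.sum_c x hxW, smul_add, smul_sub]
  simp only [smul_comm (_ : ℂ) (g x), ← Finset.smul_sum]
  abel

include hW hxW in
-- Frame elements have constant coordinates, so the derivative terms drop out.
theorem bracket_e (i j : ι) : f.bracket (f.e i) (f.e j) x = 𝓛.bracket (f.e i) (f.e j) x := by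
  have h1 : ∀ i j X, cDeriv V x X (fun y => f.c i y (f.e j y)) = 0 := fun i j X => by
    rw [cDeriv_congr_on X hW hxW fun y hy => f.c_e y hy i j, cDeriv_const]
  simp [bracket, h1, f.c_e x hxW]

include hW hxW in
/-- The bracket in a holomorphic frame extends the bracket of holomorphic sections. -/
theorem bracket_of_hol {s t : Π x, LF x} (hs : 𝓛.HolOn s W) (ht : 𝓛.HolOn t W) :
    f.bracket s t x = 𝓛.bracket s t x := by
  have step : ∀ s, 𝓛.HolOn s W → (∀ i, f.bracket s (f.e i) x = 𝓛.bracket s (f.e i) x) →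
      ∀ t, 𝓛.HolOn t W → f.bracket s t x = 𝓛.bracket s t x := fun s hs he =>
    f.induction hW (fun t => f.bracket s t x = 𝓛.bracket s t x)
      (by
        have h0 : 𝓛.HolOn (fun _ => 0) W := by
          simpa using HolVectorBundle.HolOn.sum (s := fun (_ : Empty) (x : M) => (0 : LF x))
            (E := 𝓛.toHolVectorBundle) Finset.univ hW (fun k => k.elim)
        have h1 := f.bracket_leibniz hW hxW (s := s) (h0.smoothOn hW) (Sm.const 0 W)
        have h2 := 𝓛.leibniz W hW (fun _ => 0) s _ (Ho.const 0 W) hs h0 x hxW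
        simp only [smul_zero, zero_smul, add_zero] at h1 h2
        rw [h1, h2]) he
      (fun t t' ht ht' h1 h2 => by
        rw [f.bracket_add hW hxW (ht.smoothOn hW) (ht'.smoothOn hW),
          𝓛.bracket_add W hW s t t' hs ht ht' x hxW, h1, h2])
      (fun g t hg ht h1 => by
        rw [f.bracket_leibniz hW hxW (ht.smoothOn hW) hg.sm,
          𝓛.leibniz W hW g s t hg hs ht x hxW, h1, cDeriv_holTan _ (hg.md hW hxW)])
      (fun t t' ht he h1 => by
        rw [← f.bracket_congr hW hxW (fun _ _ => rfl) he,
          ← 𝓛.bracket_local W hW s s t t' hs ht (fun _ _ => rfl) he x hxW, h1])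
  refine step s hs (fun i => ?_) t ht
  have hei := f.holOn_e hW subset_rfl i
  rw [f.bracket_skew hW hxW, 𝓛.bracket_skew W hW _ _ hs hei x hxW,
    step _ hei (fun j => f.bracket_e hW hxW i j) s hs]

end HolFrame

theorem HolLieAlgebroid.anchor_smooth (𝓛 : HolLieAlgebroid V LF) (U : Set M) (hU : IsOpen U)
    (s : Π x, LF x) (hs : 𝓛.smooth.SmoothOn s U) :
    CSmoothOn V (fun x => holTan V x (𝓛.anchor x (s x))) U := CSmoothOn.of_local fun x hx => by
  obtain ⟨ι, _, _, W, hW, hxW, hWU, ⟨f⟩⟩ := 𝓛.exists_holFrame_subset hU hx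
  have hs' := 𝓛.isLocFree.mono _ _ _ hU hW hWU hs
  refine ⟨W, hW, hxW, CSmoothOn.congr (CSmoothOn.sum Finset.univ fun i _ => CSmoothOn.smul
    (f.sm_c hW subset_rfl hs' i)
    (CSmoothOn.holTan hW (𝓛.anchor_hol W hW _ (f.holOn_e hW subset_rfl i)))) fun y hy => ?_⟩
  conv_rhs => rw [← f.sum_c y hy (s y)]
  simp only [map_sum, map_smul]

/-- A holomorphic Lie algebroid has an underlying smooth Lie algebroid. -/
theorem HolLieAlgebroid.exists_underlies (𝓛 : HolLieAlgebroid V LF) :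
    ∃ br, Underlies (𝓛.withBracket br) 𝓛 := by
  obtain ⟨ι, _, _, hf⟩ := 𝓛.exists_holFrame
  choose N hN hxN f _ using hf
  -- At each point the bracket uses the frame chosen at that point. Smoothness across points is not
  -- evident from this definition; it follows from `hbr`, by which frame elements have their
  -- holomorphic bracket whatever frame is used.
  let br : (Π x, LF x) → (Π x, LF x) → Π x, LF x := fun s t x => (f x).bracket s t x
  have hL := 𝓛.toHolVectorBundle.isLocFree
  have loc : ∀ {U : Set M} (_ : IsOpen U) {x} (_ : x ∈ U), IsOpen (N x ∩ U) ∧ x ∈ N x ∩ U ∧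
      N x ∩ U ⊆ N x ∧ N x ∩ U ⊆ U ∧ ∀ {s}, 𝓛.smooth.SmoothOn s U → 𝓛.smooth.SmoothOn s (N x ∩ U) :=
    fun hU x hx => ⟨(hN x).inter hU, ⟨hxN x, hx⟩, Set.inter_subset_left, Set.inter_subset_right,
      fun hs => hL.mono _ _ _ hU ((hN x).inter hU) Set.inter_subset_right hs⟩
  have hP : IsPreLie (𝓛.withBracket br) :=
    { locFree := hL
      anchor_smooth := 𝓛.anchor_smooth
      bracket_local := fun U hU s s' t t' _ _ h1 h2 x hx => by
        obtain ⟨hW, hxW, hWN, hWU, hm⟩ := loc hU hx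
        exact ((f x).restrict hWN).bracket_congr hW hxW (fun y hy => h1 y (hWU hy))
          fun y hy => h2 y (hWU hy)
      bracket_add := fun U hU s t t' _ ht ht' x hx => by
        obtain ⟨hW, hxW, hWN, hWU, hm⟩ := loc hU hx
        exact ((f x).restrict hWN).bracket_add hW hxW (hm ht) (hm ht')
      bracket_skew := fun U hU s t _ _ x hx => (f x).bracket_skew (hN x) (hxN x)
      leibniz := fun U hU g s t hg _ ht x hx => by
        obtain ⟨hW, hxW, hWN, hWU, hm⟩ := loc hU hx
        exact ((f x).restrict hWN).bracket_leibniz hW hxW (hm ht) (hg.mono hWU) }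
  have hbr : ∀ U : Set M, IsOpen U → ∀ s t, 𝓛.HolOn s U → 𝓛.HolOn t U →
      ∀ x ∈ U, br s t x = 𝓛.bracket s t x := fun U hU s t hs ht x hx => by
    obtain ⟨hW, hxW, hWN, hWU, hm⟩ := loc hU hx
    exact ((f x).restrict hWN).bracket_of_hol hW hxW (𝓛.holOn_mono hs hWU) (𝓛.holOn_mono ht hWU)
  refine ⟨br, ?_, fun _ _ _ => Iff.rfl, fun _ _ => rfl, hbr⟩
  refine hP.isLieAlgebroid fun x => ⟨ι, _, _, N x, hN x, hxN x, (f x).toSmFrame, ?_, ?_, ?_⟩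
  · intro i j
    have hi := (f x).holOn_e (hN x) subset_rfl i
    have hj := (f x).holOn_e (hN x) subset_rfl j
    exact hL.congr (hN x) ((𝓛.bracket_hol _ (hN x) _ _ hi hj).smoothOn (hN x)) fun y hy =>
      (hbr _ (hN x) _ _ hi hj y hy).symm
  · intro i j y hy
    have hi := (f x).holOn_e (hN x) subset_rfl i
    have hj := (f x).holOn_e (hN x) subset_rfl j
    refine (congrArg (fun a => holTan V y (𝓛.anchor y a)) (hbr _ (hN x) _ _ hi hj y hy)).trans ?_
    refine (congrArg (holTan V y) (𝓛.anchor_bracket _ (hN x) _ _ hi hj y hy)).trans ?_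
    exact holTan_mlieBracket (hN x) (𝓛.anchor_hol _ (hN x) _ hi) (𝓛.anchor_hol _ (hN x) _ hj) hy
  · intro i j k y hy
    have he := (f x).holOn_e (hN x) subset_rfl
    have hb := fun i j => 𝓛.bracket_hol _ (hN x) _ _ (he i) (he j)
    have key : ∀ i j k, br ((f x).e i) (br ((f x).e j) ((f x).e k)) y
        = 𝓛.bracket ((f x).e i) (𝓛.bracket ((f x).e j) ((f x).e k)) y := fun i j k => by
      refine (hP.bracket_local _ (hN x) _ _ _ _ ((he i).smoothOn (hN x)) ((hb j k).smoothOn (hN x))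
        (fun _ _ => rfl) (fun z hz => (hbr _ (hN x) _ _ (he j) (he k) z hz).symm) y hy).symm.trans ?_
      exact hbr _ (hN x) _ _ (he i) (hb j k) y hy
    refine (congrArg₂ (· + ·) (congrArg₂ (· + ·) (key i j k) (key j k i)) (key k i j)).trans ?_
    exact 𝓛.jacobi _ (hN x) _ _ _ (he i) (he j) (he k) y hy

end ExtendBracket

/-! ### Elements of the Atiyah algebroid at a point. -/

section Fibre

variable {V : Type*} [NormedAddCommGroup V] [NormedSpace ℂ V]
  {M : Type*} [TopologicalSpace M] [ChartedSpace V M] [IsManifold 𝓘(ℂ, V) ω M]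
  {A : LieAlgebroidData V M} {E : SectionFamily M} {m : M}

theorem SectionFamily.SmoothNear.exists_subset (hE : IsLocFree V E) {e : Π x, E.Fib x}
    (h : E.SmoothNear e m) {U : Set M} (hU : IsOpen U) (hm : m ∈ U) :
    ∃ N, IsOpen N ∧ m ∈ N ∧ N ⊆ U ∧ E.SmoothOn e N := by
  obtain ⟨W, hW, hmW, he⟩ := h
  exact ⟨W ∩ U, hW.inter hU, ⟨hmW, hm⟩, Set.inter_subset_right,
    hE.mono _ _ _ hW (hW.inter hU) Set.inter_subset_left he⟩

theorem opAt_of_not (d : atiyahFib A E m) {e : Π x, E.Fib x} (h : ¬ E.SmoothNear e m) :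
    opAt d e = 0 := d.2.1.1 e h

theorem opAt_add (d : atiyahFib A E m) {e e' : Π x, E.Fib x} (h : E.SmoothNear e m)
    (h' : E.SmoothNear e' m) : opAt d (e + e') = opAt d e + opAt d e' := d.2.1.2.1 e e' h h'

theorem opAt_smul (d : atiyahFib A E m) (c : ℂ) {e : Π x, E.Fib x} (h : E.SmoothNear e m) :
    opAt d (c • e) = c • opAt d e := d.2.1.2.2.1 c e h

theorem opAt_fsmul (d : atiyahFib A E m) {U : Set M} (hU : IsOpen U) (hm : m ∈ U) {f : M → ℂ}
    (hf : Sm V f U) {e : Π x, E.Fib x} (h : E.SmoothNear e m) :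
    opAt d (fun y => f y • e y)
      = f m • opAt d e + cDeriv V m (A.anchor m (symAt d)) f • e m := by
  have h1 := d.2.1.2.2.2 f e ⟨U, hU, hm, hf⟩ h
  have h2 : d.1.1.2 = A.anchor m (symAt d) := d.2.2
  rw [← h2]
  exact h1

theorem opAt_neg (d : atiyahFib A E m) {e : Π x, E.Fib x} (h : E.SmoothNear e m) :
    opAt d (-e) = - opAt d e := by
  have := opAt_smul d (-1) h
  rwa [neg_one_smul, neg_one_smul] at this

@[simp] theorem opAt_add_left (d d' : atiyahFib A E m) (e : Π x, E.Fib x) :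
    opAt (d + d') e = opAt d e + opAt d' e := rfl

@[simp] theorem opAt_smul_left (c : ℂ) (d : atiyahFib A E m) (e : Π x, E.Fib x) :
    opAt (c • d) e = c • opAt d e := rfl

@[simp] theorem opAt_neg_left (d : atiyahFib A E m) (e : Π x, E.Fib x) :
    opAt (-d) e = - opAt d e := rfl

@[simp] theorem opAt_zero_left (e : Π x, E.Fib x) : opAt (0 : atiyahFib A E m) e = 0 := rfl

@[simp] theorem symAt_add (d d' : atiyahFib A E m) : symAt (d + d') = symAt d + symAt d' := rfl

@[simp] theorem symAt_smul (c : ℂ) (d : atiyahFib A E m) : symAt (c • d) = c • symAt d := rfl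

@[simp] theorem symAt_neg (d : atiyahFib A E m) : symAt (-d) = - symAt d := rfl

/-- The operator, as a linear function of the element of the Atiyah algebroid. -/
def opLin (A : LieAlgebroidData V M) (m : M) (e : Π x, E.Fib x) : atiyahFib A E m →ₗ[ℂ] E.Fib m where
  toFun d := opAt d e
  map_add' _ _ := rfl
  map_smul' _ _ := rfl

/-- The symbol, as a linear function. -/
def symLin (A : LieAlgebroidData V M) (E : SectionFamily M) (m : M) :
    atiyahFib A E m →ₗ[ℂ] A.Fib m where
  toFun d := symAt d
  map_add' _ _ := rfl
  map_smul' _ _ := rfl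

theorem symAt_eq_symLin (d : atiyahFib A E m) : symAt d = symLin A E m d := rfl

theorem opAt_eq_opLin (d : atiyahFib A E m) (e : Π x, E.Fib x) : opAt d e = opLin A m e d := rfl

/-- The symbol in the complexified tangent space is forced to be the anchor of l, and operators
vanish on sections that are not smooth near m. -/
theorem atiyah_ext {d d' : atiyahFib A E m} (h1 : symAt d = symAt d')
    (h2 : ∀ e, E.SmoothNear e m → opAt d e = opAt d' e) : d = d' := by
  refine Subtype.ext (Prod.ext (Prod.ext ?_ ?_) h1)
  · funext e
    by_cases he : E.SmoothNear e m
    · exact h2 e he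
    · exact (opAt_of_not d he).trans (opAt_of_not d' he).symm
  · have e1 : d.1.1.2 = A.anchor m (symAt d) := d.2.2
    have e2 : d'.1.1.2 = A.anchor m (symAt d') := d'.2.2
    rw [e1, e2, h1]

/-- The difference w of the two sections equals χw, with χ equal to 0 on U and to 1 elsewhere.
Smoothness is only required near m, so this discontinuous χ is admissible, and the Leibniz rule
gives 0 since χ and w vanish at m. -/
theorem opAt_congr (hE : IsLocFree V E) (d : atiyahFib A E m) {U : Set M} (hU : IsOpen U)
    (hm : m ∈ U) {e e' : Π x, E.Fib x} (he : E.SmoothOn e U) (h : ∀ x ∈ U, e x = e' x) :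
    opAt d e = opAt d e' := by
  classical
  have he' : E.SmoothOn e' U := hE.congr hU he h
  have hw : E.SmoothOn (fun x => e x - e' x) U := hE.sub hU he he'
  have h0 : opAt d (fun x => e x - e' x) = 0 := by
    have h1 : (fun x => e x - e' x)
        = fun x => (if x ∈ U then (0 : ℂ) else 1) • (e x - e' x) := by
      funext x
      by_cases hx : x ∈ U
      · simp [h x hx]
      · simp [hx]
    have hf : Sm V (fun x => if x ∈ U then (0 : ℂ) else 1) U :=
      ContMDiffOn.congr (Sm.const 0 U) fun x hx => if_pos hx
    rw [h1, opAt_fsmul d hU hm hf ⟨U, hU, hm, hw⟩, if_pos hm, zero_smul, h m hm]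
    simp
  have h2 : e = e' + fun x => e x - e' x := by
    funext x
    simp
  rw [h2, opAt_add d ⟨U, hU, hm, he'⟩ ⟨U, hU, hm, hw⟩, h0, add_zero]

theorem opAt_sub (hE : IsLocFree V E) (d : atiyahFib A E m) {U : Set M} (hU : IsOpen U)
    (hm : m ∈ U) {e e' : Π x, E.Fib x} (he : E.SmoothOn e U) (he' : E.SmoothOn e' U) :
    opAt d (fun x => e x - e' x) = opAt d e - opAt d e' := by
  have h2 : (fun x => e x - e' x) = e + (-e') := by
    funext x
    simp [sub_eq_add_neg]
  rw [h2, opAt_add d (e' := -e') ⟨U, hU, hm, he⟩ ⟨U, hU, hm, hE.neg hU he'⟩, sub_eq_add_neg]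
  exact congrArg _ (opAt_neg d ⟨U, hU, hm, he'⟩)

theorem opAt_zero (hE : IsLocFree V E) (d : atiyahFib A E m) : opAt d (fun _ => 0) = 0 := by
  have := opAt_smul d 0 (e := fun _ => 0) ⟨Set.univ, isOpen_univ, trivial, hE.zero isOpen_univ⟩
  rw [zero_smul, zero_smul] at this
  exact this

theorem opAt_sum (hE : IsLocFree V E) (d : atiyahFib A E m) {U : Set M} (hU : IsOpen U)
    (hm : m ∈ U) {κ : Type*} (s : Finset κ) {e : κ → Π x, E.Fib x}
    (he : ∀ k ∈ s, E.SmoothOn (e k) U) :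
    opAt d (fun x => ∑ k ∈ s, e k x) = ∑ k ∈ s, opAt d (e k) := by
  classical
  induction s using Finset.induction_on with
  | empty => simpa using opAt_zero hE d
  | insert i s hi ih =>
    have hs : ∀ k ∈ s, E.SmoothOn (e k) U := fun k hk => he k (Finset.mem_insert_of_mem hk)
    simp only [Finset.sum_insert hi]
    rw [← ih hs]
    exact opAt_add d ⟨U, hU, hm, he i (Finset.mem_insert_self i s)⟩
      ⟨U, hU, hm, hE.sum hU s hs⟩

/-- Expanding the section in the frame and applying the Leibniz rule shows that the symbol and the
values on the frame determine the operator. This is the source of the frames of the Atiyah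
algebroid. -/
theorem opAt_frame (hE : IsLocFree V E) (d : atiyahFib A E m) {ι : Type} [Fintype ι]
    [DecidableEq ι] {W : Set M} (f : SmFrame V E ι W) (hW : IsOpen W) (hm : m ∈ W)
    {e : Π x, E.Fib x} (he : E.SmoothNear e m) :
    opAt d e = ∑ j, (f.c j m (e m) • opAt d (f.e j)
      + cDeriv V m (A.anchor m (symAt d)) (fun y => f.c j y (e y)) • f.e j m) := by
  obtain ⟨N, hN, hmN, hNW, heN⟩ := he.exists_subset hE hW hm
  have hc := fun j => f.sm_c hN hNW heN j
  have hfe := fun j => f.smoothOn_e hN hNW j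
  rw [← opAt_congr hE d hN hmN (hE.sum hN Finset.univ fun j _ => hE.fsmul hN (hc j) (hfe j))
    (fun x hx => f.sum_c x (hNW hx) (e x)),
    opAt_sum hE d hN hmN _ fun j _ => hE.fsmul hN (hc j) (hfe j)]
  exact Finset.sum_congr rfl fun j _ => opAt_fsmul d hN hmN (hc j) ⟨N, hN, hmN, hfe j⟩

/-- Additivity and the Leibniz rule are the only conditions to check for a pair to lie in the fibre;
complex homogeneity is the Leibniz rule with constant functions. -/
theorem atiyahMk_spec (hE : IsLocFree V E) {δ : (Π x, E.Fib x) → E.Fib m} {l : A.Fib m}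
    (hadd : ∀ e e', E.SmoothNear e m → E.SmoothNear e' m → δ (e + e') = δ e + δ e')
    (hf : ∀ (f : M → ℂ) (e), ∀ U : Set M, IsOpen U → m ∈ U → Sm V f U → E.SmoothOn e U →
      δ (fun y => f y • e y) = f m • δ e + cDeriv V m (A.anchor m l) f • e m) :
    symAt (atiyahMk A E m δ l) = l ∧
      ∀ e, E.SmoothNear e m → opAt (atiyahMk A E m δ l) e = δ e := by
  classical
  have hmem : (((fun e => if E.SmoothNear e m then δ e else 0, A.anchor m l), l) :
      (((Π x, E.Fib x) → E.Fib m) × CTan V m) × A.Fib m) ∈ atiyahFib A E m := by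
    refine ⟨⟨fun e h => if_neg h, fun e e' h h' => ?_, fun c e h => ?_, fun f e h h' => ?_⟩, rfl⟩
    · obtain ⟨U, hU, hm, he⟩ := h
      obtain ⟨N, hN, hmN, hNU, he'⟩ := h'.exists_subset hE hU hm
      have h1 := hE.mono _ _ _ hU hN hNU he
      have h2 := hadd e e' ⟨N, hN, hmN, h1⟩ ⟨N, hN, hmN, he'⟩
      simp only [LinearMap.fst_apply]
      rw [if_pos ⟨N, hN, hmN, hE.add hN h1 he'⟩, if_pos ⟨N, hN, hmN, h1⟩, if_pos ⟨N, hN, hmN, he'⟩,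
        h2]
    · obtain ⟨U, hU, hm, he⟩ := h
      simp only [LinearMap.fst_apply]
      rw [if_pos ⟨U, hU, hm, hE.csmul hU c he⟩, if_pos ⟨U, hU, hm, he⟩]
      have := hf (fun _ => c) e U hU hm (Sm.const c U) he
      rw [cDeriv_const, zero_smul, add_zero] at this
      exact this
    · obtain ⟨U, hU, hm, hfU⟩ := h
      obtain ⟨N, hN, hmN, hNU, he⟩ := h'.exists_subset hE hU hm
      simp only [LinearMap.fst_apply]
      rw [if_pos ⟨N, hN, hmN, hE.fsmul hN (hfU.mono hNU) he⟩, if_pos ⟨N, hN, hmN, he⟩]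
      exact hf f e N hN hmN (hfU.mono hNU) he
  have h1 : atiyahMk A E m δ l = ⟨_, hmem⟩ := dif_pos hmem
  rw [h1]
  exact ⟨rfl, fun e he => if_pos he⟩

end Fibre

/-! ### Frames of the Atiyah algebroid. -/

section AtiyahFrame

variable {V : Type*} [NormedAddCommGroup V] [NormedSpace ℂ V] [FiniteDimensional ℂ V]
  {M : Type*} [TopologicalSpace M] [ChartedSpace V M] [IsManifold 𝓘(ℂ, V) ω M]
  {A : LieAlgebroidData V M} {E : SectionFamily M}
  {ι κ : Type} [Fintype ι] [DecidableEq ι] [Fintype κ] [DecidableEq κ] {W : Set M}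
  (f : SmFrame V E ι W) (g : SmFrame V A.toSectionFamily κ W)

variable (A) in
/-- The endomorphism with matrix elementary in the frame. -/
def SmFrame.matUnit (i j : ι) (x : M) : atiyahFib A E x :=
  atiyahMk A E x (fun e => f.c j x (e x) • f.e i x) 0

/-- The covariant derivative for which the frame is parallel. -/
def SmFrame.covar (k : κ) (x : M) : atiyahFib A E x :=
  atiyahMk A E x (fun e => ∑ j, cDeriv V x (A.anchor x (g.e k x)) (fun y => f.c j y (e y)) • f.e j x)
    (g.e k x)

theorem SmFrame.matUnit_spec (hE : IsLocFree V E) (i j : ι) (x : M) :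
    symAt (f.matUnit A i j x) = 0 ∧
      ∀ e, E.SmoothNear e x → opAt (f.matUnit A i j x) e = f.c j x (e x) • f.e i x :=
  atiyahMk_spec hE (fun e e' _ _ => by rw [Pi.add_apply, map_add, add_smul])
    fun h e U hU hm hh he => by
      rw [map_zero, cDeriv_zero_left, zero_smul, add_zero, map_smul, smul_eq_mul, mul_smul]

theorem SmFrame.covar_spec (hE : IsLocFree V E) (hW : IsOpen W) (k : κ) {x : M} (hx : x ∈ W) :
    symAt (f.covar g k x) = g.e k x ∧ ∀ e, E.SmoothNear e x → opAt (f.covar g k x) e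
      = ∑ j, cDeriv V x (A.anchor x (g.e k x)) (fun y => f.c j y (e y)) • f.e j x := by
  have hc : ∀ {e : Π x, E.Fib x}, E.SmoothNear e x → ∀ j,
      MDifferentiableAt 𝓘(ℝ, V) 𝓘(ℝ, ℂ) (fun y => f.c j y (e y)) x := fun he j => by
    obtain ⟨N, hN, hxN, hNW, he⟩ := he.exists_subset hE hW hx
    exact (f.sm_c hN hNW he j).md hN hxN
  refine atiyahMk_spec hE (fun e e' he he' => ?_) fun h e U hU hm hh he => ?_
  · rw [← Finset.sum_add_distrib]
    refine Finset.sum_congr rfl fun j _ => ?_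
    simp only [Pi.add_apply, map_add]
    rw [cDeriv_fadd _ (hc he j) (hc he' j), add_smul]
  · rw [← f.sum_c x hx (e x), Finset.smul_sum, Finset.smul_sum, ← Finset.sum_add_distrib]
    refine Finset.sum_congr rfl fun j _ => ?_
    simp only [map_smul, smul_eq_mul]
    rw [cDeriv_mul _ (hh.md hU hm) (hc ⟨U, hU, hm, he⟩ j)]
    module

/-- By `opAt_frame`, the image of any smooth section is a combination, with smooth coefficients, of
the images of the frame and the frame itself. The matrix of values on the frame therefore controls
the operator on all smaller open sets. -/
theorem atiyah_smoothOn_iff (hE : IsLocFree V E) (hA : IsPreLie A) {U : Set M} (hU : IsOpen U)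
    (hUW : U ⊆ W) (s : Π x, atiyahFib A E x) : (atiyah A E).SmoothOn s U ↔
      (∀ k, Sm V (fun x => g.c k x (symAt (s x))) U) ∧
        ∀ i j, Sm V (fun x => f.c i x (opAt (s x) (f.e j))) U := by
  refine ⟨fun h => ⟨fun k => g.sm_c hU hUW h.1 k, fun i j =>
    f.sm_c hU hUW (h.2 U hU subset_rfl _ (f.smoothOn_e hU hUW j)) i⟩, fun h => ?_⟩
  have h1 : A.SmoothOn (sym s) U := (g.smoothOn_iff U hU hUW _).2 h.1
  refine ⟨h1, fun N hN hNU e he => ?_⟩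
  have hNW := hNU.trans hUW
  have hop : ∀ j, E.SmoothOn (op s (f.e j)) N := fun j =>
    (f.smoothOn_iff N hN hNW _).2 fun i => (h.2 i j).mono hNU
  refine hE.congr hN (hE.sum hN Finset.univ fun j _ => hE.add hN
    (hE.fsmul hN (f.sm_c hN hNW he j) (hop j)) (hE.fsmul hN (Sm.cDeriv hN (f.sm_c hN hNW he j)
      (hA.anchor_smooth N hN _ (hA.locFree.mono _ _ _ hU hN hNU h1))) (f.smoothOn_e hN hNW j)))
    fun x hx => ?_
  exact (opAt_frame hE (s x) (f.restrict hNW) hN hx ⟨N, hN, hx, he⟩).symm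

/-- The frame of the Atiyah algebroid given by frames of the bundle and of the algebroid. -/
def SmFrame.atiyah (hE : IsLocFree V E) (hA : IsPreLie A) (hW : IsOpen W) :
    SmFrame V (atiyah A E).toSectionFamily (ι × ι ⊕ κ) W where
  e := Sum.elim (fun p => f.matUnit A p.1 p.2) (fun k => f.covar g k)
  c := Sum.elim (fun p x => f.c p.1 x ∘ₗ opLin A x (f.e p.2)) (fun k x => g.c k x ∘ₗ symLin A E x)
  c_e x hx := by
    have hn : ∀ j, E.SmoothNear (f.e j) x := fun j => ⟨W, hW, hx, f.smoothOn_e hW subset_rfl j⟩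
    rintro (⟨i, j⟩ | k) (⟨i', j'⟩ | k')
    · change f.c i x (opAt (f.matUnit A i' j' x) (f.e j)) = _
      rw [(f.matUnit_spec hE i' j' x).2 _ (hn j), map_smul, f.c_e x hx, f.c_e x hx]
      simp only [Sum.inl.injEq, Prod.mk.injEq, smul_eq_mul]
      split_ifs <;> simp_all
    · change f.c i x (opAt (f.covar g k' x) (f.e j)) = _
      rw [(f.covar_spec g hE hW k' hx).2 _ (hn j)]
      have h0 : ∀ l, cDeriv V x (A.anchor x (g.e k' x)) (fun y => f.c l y (f.e j y)) = 0 := fun l => by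
        rw [cDeriv_congr_on _ hW hx fun y hy => f.c_e y hy l j, cDeriv_const]
      simp [h0]
    · change g.c k x (symAt (f.matUnit A i' j' x)) = _
      rw [(f.matUnit_spec hE i' j' x).1, map_zero]
      simp
    · change g.c k x (symAt (f.covar g k' x)) = _
      rw [(f.covar_spec g hE hW k' hx).1, g.c_e x hx]
      simp
  sum_c x hx d := by
    rw [Fintype.sum_sum_type]
    refine atiyah_ext ?_ fun e he => ?_
    · refine (symAt_eq_symLin _).trans ?_
      simp only [map_add, map_sum, map_smul]
      have h1 : ∀ p : ι × ι, symLin A E x (f.matUnit A p.1 p.2 x) = 0 := fun p =>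
        (f.matUnit_spec hE p.1 p.2 x).1
      have h2 : ∀ k, symLin A E x (f.covar g k x) = g.e k x := fun k =>
        (f.covar_spec g hE hW k hx).1
      simp only [Sum.elim_inl, Sum.elim_inr, h1, h2, smul_zero, Finset.sum_const_zero, zero_add]
      exact g.sum_c x hx (symAt d)
    · rw [opAt_frame hE d f hW hx he]
      refine (opAt_eq_opLin _ e).trans ?_
      simp only [map_add, map_sum, map_smul]
      have h1 : ∀ p : ι × ι, opLin A x e (f.matUnit A p.1 p.2 x) = f.c p.2 x (e x) • f.e p.1 x :=
        fun p => (f.matUnit_spec hE p.1 p.2 x).2 e he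
      have h2 : ∀ k, opLin A x e (f.covar g k x) = ∑ j, cDeriv V x (A.anchor x (g.e k x))
          (fun y => f.c j y (e y)) • f.e j x := fun k => (f.covar_spec g hE hW k hx).2 e he
      simp only [Sum.elim_inl, Sum.elim_inr, h1, h2, Fintype.sum_prod_type, Finset.sum_add_distrib]
      -- The matrix units reproduce the part of `opAt_frame` involving the values on the frame; the
      -- parallel derivatives reproduce the part involving derivatives of the components.
      congr 1
      · rw [Finset.sum_comm]
        refine Finset.sum_congr rfl fun j _ => ?_
        conv_rhs => rw [← f.sum_c x hx (opAt d (f.e j)), Finset.smul_sum]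
        exact Finset.sum_congr rfl fun i _ => smul_comm _ _ _
      · simp only [Finset.smul_sum]
        rw [Finset.sum_comm]
        refine Finset.sum_congr rfl fun j _ => ?_
        rw [← g.sum_c x hx (symAt d), map_sum, cDeriv_sum_left, Finset.sum_smul]
        refine Finset.sum_congr rfl fun k _ => ?_
        rw [map_smul, cDeriv_smul, mul_smul]
        rfl
  smoothOn_iff U hU hUW s := by
    rw [atiyah_smoothOn_iff f g hE hA hU hUW s]
    exact ⟨fun h => Sum.rec (fun p => h.2 p.1 p.2) h.1,
      fun h => ⟨fun k => h (Sum.inr k), fun i j => h (Sum.inl (i, j))⟩⟩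

theorem atiyah_isLocFree (hE : IsLocFree V E) (hA : IsPreLie A) :
    IsLocFree V (atiyah A E).toSectionFamily where
  of_local U hU s h := by
    refine ⟨hA.locFree.of_local U hU _ fun x hx => ?_, fun W hW hWU e he =>
      hE.of_local W hW _ fun x hx => ?_⟩
    · obtain ⟨N, hN, hxN, h1, -⟩ := h x hx
      exact ⟨N, hN, hxN, h1⟩
    · obtain ⟨N, hN, hxN, -, h2⟩ := h x (hWU hx)
      exact ⟨W ∩ N, hW.inter hN, ⟨hx, hxN⟩, h2 _ (hW.inter hN) Set.inter_subset_right e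
        (hE.mono _ _ _ hW (hW.inter hN) Set.inter_subset_left he)⟩
  mono U W s hU hW hWU h := ⟨hA.locFree.mono _ _ _ hU hW hWU h.1,
    fun N hN hNW e he => h.2 N hN (hNW.trans hWU) e he⟩
  frame := by
    obtain ⟨ι, _, _, hf⟩ := hE.frame
    obtain ⟨κ, _, _, hg⟩ := hA.locFree.frame
    refine ⟨ι × ι ⊕ κ, inferInstance, inferInstance, fun x => ?_⟩
    obtain ⟨U, hU, hxU, ⟨f⟩⟩ := hf x
    obtain ⟨W, hW, hxW, ⟨g⟩⟩ := hg x
    exact ⟨U ∩ W, hU.inter hW, ⟨hxU, hxW⟩, ⟨(f.restrict Set.inter_subset_left).atiyah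
      (g.restrict Set.inter_subset_right) hE hA (hU.inter hW)⟩⟩

end AtiyahFrame

/-! ### The Lie algebroid structure of the Atiyah algebroid. -/

section AtiyahAlgebroid

variable {V : Type*} [NormedAddCommGroup V] [NormedSpace ℂ V] [FiniteDimensional ℂ V]
  {M : Type*} [TopologicalSpace M] [ChartedSpace V M] [IsManifold 𝓘(ℂ, V) ω M]
  {A : LieAlgebroidData V M} {E : SectionFamily M}

theorem op_smooth {s : Π x, atiyahFib A E x} {U N : Set M} (hs : (atiyah A E).SmoothOn s U)
    (hN : IsOpen N) (hNU : N ⊆ U) {e : Π x, E.Fib x} (he : E.SmoothOn e N) :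
    E.SmoothOn (op s e) N := hs.2 N hN hNU e he

theorem op_add {s : Π x, atiyahFib A E x} {U : Set M} (hU : IsOpen U) {e e' : Π x, E.Fib x}
    (he : E.SmoothOn e U) (he' : E.SmoothOn e' U) {x : M} (hx : x ∈ U) :
    op s (e + e') x = (op s e + op s e') x := opAt_add (s x) ⟨U, hU, hx, he⟩ ⟨U, hU, hx, he'⟩

theorem op_fsmul {s : Π x, atiyahFib A E x} {U : Set M} (hU : IsOpen U) {f : M → ℂ}
    (hf : Sm V f U) {e : Π x, E.Fib x} (he : E.SmoothOn e U) {x : M} (hx : x ∈ U) :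
    op s (fun y => f y • e y) x
      = f x • op s e x + cDeriv V x (A.anchor x (sym s x)) f • e x :=
  opAt_fsmul (s x) hU hx hf ⟨U, hU, hx, he⟩

variable (hE : IsLocFree V E) (hA : IsLieAlgebroid A)
include hE hA

/-- The bracket of the Atiyah algebroid is the commutator. -/
theorem atiyahBracketFormula : AtiyahBracketFormula A E := by
  intro U hU s t hs ht x hx
  have hL := atiyah_isLocFree hE hA.isPreLie
  refine atiyahMk_spec hE (fun e e' he he' => ?_) fun f e W hW hxW hf he => ?_
  · obtain ⟨N, hN, hxN, hNU, he⟩ := he.exists_subset hE hU hx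
    obtain ⟨N', hN', hxN', hNN, he'⟩ := he'.exists_subset hE hN hxN
    replace he := hE.mono _ _ _ hN hN' hNN he
    have hN'U := hNN.trans hNU
    have key : ∀ {s t : Π x, atiyahFib A E x}, (atiyah A E).SmoothOn s U →
        (atiyah A E).SmoothOn t U →
        opAt (s x) (op t (e + e')) = opAt (s x) (op t e) + opAt (s x) (op t e') :=
      fun hs ht => by
        rw [← opAt_add _ ⟨_, hN', hxN', op_smooth ht hN' hN'U he⟩
          ⟨_, hN', hxN', op_smooth ht hN' hN'U he'⟩]
        exact opAt_congr hE _ hN' hxN' (op_smooth ht hN' hN'U (hE.add hN' he he'))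
          fun y hy => op_add hN' he he' hy
    rw [key hs ht, key ht hs]
    abel
  · have hN := hU.inter hW
    have hNU : U ∩ W ⊆ U := Set.inter_subset_left
    have hxN : x ∈ U ∩ W := ⟨hx, hxW⟩
    replace he := hE.mono _ _ _ hW hN Set.inter_subset_right he
    replace hf : Sm V f (U ∩ W) := hf.mono Set.inter_subset_right
    have han : ∀ {s : Π x, atiyahFib A E x}, (atiyah A E).SmoothOn s U →
      CSmoothOn V (fun y => A.anchor y (sym s y)) (U ∩ W) := fun hs =>
      (hA.anchor_smooth U hU _ hs.1).mono hNU
    -- Two Leibniz rules in succession. The two terms with a single derivative of f are exchanged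
    -- when s and t are, hence cancel in the commutator; the second-order terms leave the commutator
    -- of the anchors, which is the anchor of the bracket of symbols.
    have key : ∀ {s t : Π x, atiyahFib A E x}, (atiyah A E).SmoothOn s U →
        (atiyah A E).SmoothOn t U →
        opAt (s x) (op t (fun y => f y • e y)) = f x • opAt (s x) (op t e)
          + cDeriv V x (A.anchor x (sym s x)) f • op t e x
          + (cDeriv V x (A.anchor x (sym t x)) f • op s e x
          + (cDeriv V x (A.anchor x (sym s x)) fun y => cDeriv V y (A.anchor y (sym t y)) f)
            • e x) :=
      fun {s t} hs ht => by
        have ht' := op_smooth ht hN hNU he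
        have hd := Sm.cDeriv hN hf (han ht)
        rw [opAt_congr hE (s x) hN hxN (op_smooth ht hN hNU (hE.fsmul hN hf he))
          (e' := (fun y => f y • op t e y) + fun y => cDeriv V y (A.anchor y (sym t y)) f • e y)
          (fun y hy => op_fsmul hN hf he hy),
          opAt_add _ ⟨_, hN, hxN, hE.fsmul hN hf ht'⟩ ⟨_, hN, hxN, hE.fsmul hN hd he⟩,
          opAt_fsmul _ hN hxN hf ⟨_, hN, hxN, ht'⟩, opAt_fsmul _ hN hxN hd ⟨_, hN, hxN, he⟩]
        rfl
    have : CompleteSpace V := FiniteDimensional.complete ℂ V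
    rw [key hs ht, key ht hs, hA.anchor_bracket U hU _ _ hs.1 ht.1 x hx,
      cDeriv_cLie hN hxN (han hs) (han ht) hf]
    module

/-- The Atiyah algebroid is a Lie algebroid. -/
theorem atiyah_isLieAlgebroid : IsLieAlgebroid (atiyah A E) := by
  have hL := atiyah_isLocFree hE hA.isPreLie
  have hF := atiyahBracketFormula hE hA
  have hN : ∀ {U : Set M} (_ : IsOpen U) {x : M} (_ : x ∈ U) {e : Π x, E.Fib x},
      E.SmoothNear e x → ∃ N, IsOpen N ∧ x ∈ N ∧ N ⊆ U ∧ E.SmoothOn e N :=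
    fun hU x hx e he => he.exists_subset hE hU hx
  have hbs : ∀ U : Set M, IsOpen U → ∀ s t, (atiyah A E).SmoothOn s U →
      (atiyah A E).SmoothOn t U → (atiyah A E).SmoothOn ((atiyah A E).bracket s t) U := by
    intro U hU s t hs ht
    refine ⟨hA.isPreLie.locFree.congr hU (hA.bracket_smooth U hU _ _ hs.1 ht.1)
      fun x hx => (hF U hU s t hs ht x hx).1.symm, fun W hW hWU e he => ?_⟩
    exact hE.congr hW (hE.sub hW (op_smooth hs hW hWU (op_smooth ht hW hWU he))
      (op_smooth ht hW hWU (op_smooth hs hW hWU he))) fun x hx =>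
      ((hF U hU s t hs ht x (hWU hx)).2 e ⟨W, hW, hx, he⟩).symm
  refine
  { vectorBundle := hL.isSmoothVectorBundle
    anchor_smooth := fun U hU s hs => hA.anchor_smooth U hU _ hs.1
    bracket_smooth := hbs
    bracket_local := fun U hU s s' t t' hs ht h1 h2 x hx => ?_
    bracket_add := fun U hU s t t' hs ht ht' x hx => ?_
    bracket_smul := fun U hU c s t hs ht x hx => ?_
    bracket_skew := fun U hU s t hs ht x hx => ?_
    jacobi := fun U hU s t u hs ht hu x hx => ?_
    anchor_bracket := fun U hU s t hs ht x hx => ?_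
    leibniz := fun U hU f s t hf hs ht x hx => ?_ }
  · have hs' := hL.congr hU hs h1
    have ht' := hL.congr hU ht h2
    obtain ⟨a1, a2⟩ := hF U hU s t hs ht x hx
    obtain ⟨b1, b2⟩ := hF U hU s' t' hs' ht' x hx
    refine atiyah_ext ?_ fun e he => ?_
    · rw [a1, b1]
      exact hA.bracket_local U hU _ _ _ _ hs.1 ht.1 (fun y hy => congrArg symAt (h1 y hy))
        (fun y hy => congrArg symAt (h2 y hy)) x hx
    · rw [a2 e he, b2 e he]
      obtain ⟨N, hN, hxN, hNU, he⟩ := hN hU hx he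
      simp only [op] at *
      rw [h1 x hx, h2 x hx]
      refine congrArg₂ (· - ·) (opAt_congr hE _ hN hxN (op_smooth ht hN hNU he) fun y hy => ?_)
        (opAt_congr hE _ hN hxN (op_smooth hs hN hNU he) fun y hy => ?_)
      · exact congrArg (fun d => opAt d e) (h2 y (hNU hy))
      · exact congrArg (fun d => opAt d e) (h1 y (hNU hy))
  · obtain ⟨a1, a2⟩ := hF U hU s (t + t') hs (hL.add hU ht ht') x hx
    obtain ⟨b1, b2⟩ := hF U hU s t hs ht x hx
    obtain ⟨c1, c2⟩ := hF U hU s t' hs ht' x hx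
    refine atiyah_ext ?_ fun e he => ?_
    · refine a1.trans ?_
      rw [symAt_add, b1, c1]
      exact hA.bracket_add U hU _ _ _ hs.1 ht.1 ht'.1 x hx
    · refine (a2 e he).trans ?_
      rw [opAt_add_left, b2 e he, c2 e he]
      obtain ⟨N, hN, hxN, hNU, he⟩ := hN hU hx he
      have h1 : op s (op (t + t') e) x = op s (op t e) x + op s (op t' e) x :=
        opAt_add (s x) ⟨N, hN, hxN, op_smooth ht hN hNU he⟩ ⟨N, hN, hxN, op_smooth ht' hN hNU he⟩
      have h2 : op (t + t') (op s e) x = op t (op s e) x + op t' (op s e) x := rfl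
      rw [h1, h2]
      abel
  · obtain ⟨a1, a2⟩ := hF U hU s (c • t) hs (hL.csmul hU c ht) x hx
    obtain ⟨b1, b2⟩ := hF U hU s t hs ht x hx
    refine atiyah_ext ?_ fun e he => ?_
    · refine a1.trans ?_
      rw [symAt_smul, b1]
      exact hA.bracket_smul U hU _ _ _ hs.1 ht.1 x hx
    · refine (a2 e he).trans ?_
      rw [opAt_smul_left, b2 e he, smul_sub]
      obtain ⟨N, hN, hxN, hNU, he⟩ := hN hU hx he
      have h1 : op s (op (c • t) e) x = c • op s (op t e) x :=
        opAt_smul (s x) c ⟨N, hN, hxN, op_smooth ht hN hNU he⟩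
      rw [h1]
      rfl
  · obtain ⟨a1, a2⟩ := hF U hU s t hs ht x hx
    obtain ⟨b1, b2⟩ := hF U hU t s ht hs x hx
    refine atiyah_ext ?_ fun e he => ?_
    · refine a1.trans ?_
      rw [symAt_neg, b1]
      exact hA.bracket_skew U hU _ _ hs.1 ht.1 x hx
    · refine (a2 e he).trans ?_
      rw [opAt_neg_left, b2 e he, neg_sub]
  · have hh := fun s t hs ht => hF U hU s t hs ht
    refine atiyah_ext ?_ fun e he => ?_
    · have key : ∀ {s t u}, (atiyah A E).SmoothOn s U → (atiyah A E).SmoothOn t U →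
          (atiyah A E).SmoothOn u U → symAt ((atiyah A E).bracket s ((atiyah A E).bracket t u) x)
          = A.bracket (sym s) (A.bracket (sym t) (sym u)) x := fun {s t u} hs ht hu => by
        refine (hF U hU s _ hs (hbs U hU t u ht hu) x hx).1.trans ?_
        exact hA.bracket_local U hU _ _ _ _ hs.1 (hbs U hU t u ht hu).1 (fun _ _ => rfl)
          (fun y hy => (hF U hU t u ht hu y hy).1) x hx
      rw [symAt_add, symAt_add, key hs ht hu, key ht hu hs, key hu hs ht]
      exact hA.jacobi U hU _ _ _ hs.1 ht.1 hu.1 x hx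
    · obtain ⟨N, hN, hxN, hNU, he⟩ := hN hU hx he
      -- Each double bracket is a sum of four threefold compositions, and the twelve terms of the
      -- cyclic sum cancel in pairs.
      have key : ∀ {s t u}, (atiyah A E).SmoothOn s U → (atiyah A E).SmoothOn t U →
          (atiyah A E).SmoothOn u U →
          opAt ((atiyah A E).bracket s ((atiyah A E).bracket t u) x) e
          = op s (op t (op u e)) x - op s (op u (op t e)) x
            - (op t (op u (op s e)) x - op u (op t (op s e)) x) := fun {s t u} hs ht hu => by
        refine ((hF U hU s _ hs (hbs U hU t u ht hu) x hx).2 e ⟨N, hN, hxN, he⟩).trans ?_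
        have h1 : op s (op ((atiyah A E).bracket t u) e) x
            = op s (op t (op u e)) x - op s (op u (op t e)) x := by
          refine (opAt_congr hE (s x) hN hxN (op_smooth (hbs U hU t u ht hu) hN hNU he)
            fun y hy => (hF U hU t u ht hu y (hNU hy)).2 e ⟨N, hN, hy, he⟩).trans ?_
          exact opAt_sub hE (s x) hN hxN (op_smooth ht hN hNU (op_smooth hu hN hNU he))
            (op_smooth hu hN hNU (op_smooth ht hN hNU he))
        have h2 := (hF U hU t u ht hu x hx).2 (op s e) ⟨N, hN, hxN, op_smooth hs hN hNU he⟩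
        rw [h1]
        exact congrArg _ h2
      rw [opAt_add_left, opAt_add_left, key hs ht hu, key ht hu hs, key hu hs ht, opAt_zero_left]
      abel
  · refine (congrArg (A.anchor x) (hF U hU s t hs ht x hx).1).trans ?_
    exact hA.anchor_bracket U hU _ _ hs.1 ht.1 x hx
  · obtain ⟨a1, a2⟩ := hF U hU s _ hs (hL.fsmul hU hf ht) x hx
    obtain ⟨b1, b2⟩ := hF U hU s t hs ht x hx
    refine atiyah_ext ?_ fun e he => ?_
    · refine a1.trans ?_
      rw [symAt_add, symAt_smul, symAt_smul, b1]
      exact hA.leibniz U hU f _ _ hf hs.1 ht.1 x hx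
    · refine (a2 e he).trans ?_
      rw [opAt_add_left, opAt_smul_left, opAt_smul_left, b2 e he]
      obtain ⟨N, hN, hxN, hNU, he⟩ := hN hU hx he
      have h1 : op s (op (fun y => f y • t y) e) x = f x • op s (op t e) x
          + cDeriv V x (A.anchor x (sym s x)) f • op t e x :=
        opAt_fsmul (s x) hU hx hf ⟨N, hN, hxN, op_smooth ht hN hNU he⟩
      have h2 : op (fun y => f y • t y) (op s e) x = f x • op t (op s e) x := rfl
      rw [h1, h2, smul_sub, add_sub_right_comm, add_comm]
      rfl

end AtiyahAlgebroid

/-! ### The Bott connection on the Atiyah algebroid. -/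

section Bott

variable {V : Type*} [NormedAddCommGroup V] [NormedSpace ℂ V] [FiniteDimensional ℂ V]
  {M : Type*} [TopologicalSpace M] [ChartedSpace V M] [IsManifold 𝓘(ℂ, V) ω M]
  {A B : LieAlgebroidData V M} {E : SectionFamily M}
  {DA : (Π x, A.Fib x) → (Π x, B.Fib x) → Π x, B.Fib x}
  {DB : (Π x, B.Fib x) → (Π x, A.Fib x) → Π x, A.Fib x}
  {nab : (Π x, A.Fib x) → (Π x, E.Fib x) → Π x, E.Fib x}

/-- In a matched pair, the anchor of `D_a b` is `[ρ(a), ρ(b)] + ρ(D_b a)`. -/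
theorem IsMatchedPair.anchor_conn (h : IsMatchedPair A B DA DB) {U : Set M} (hU : IsOpen U)
    {a : Π x, A.Fib x} {b : Π x, B.Fib x} (ha : A.SmoothOn a U) (hb : B.SmoothOn b U) {x : M}
    (hx : x ∈ U) : B.anchor x (DA a b x)
      = cLie V (fun y => A.anchor y (a y)) (fun y => B.anchor y (b y)) x + A.anchor x (DB b a x) := by
  have hA := h.left.lieAlgebroid_sub
  have hB := h.right.lieAlgebroid_sub
  have hLA := hA.isPreLie.locFree
  have hLB := hB.isPreLie.locFree
  have h1 := h.left.lieAlgebroid.anchor_bracket U hU (fun y => (a y, 0)) (fun y => (0, b y))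
    ⟨ha, hLB.zero hU⟩ ⟨hLA.zero hU, hb⟩ x hx
  -- In the matched sum the bracket of a and b is `D_a b - D_b a`. The anchor of the sum respects
  -- brackets, which relates the two anchors.
  have h2 : (matchedSum A B DA DB).bracket (fun y => (a y, 0)) (fun y => (0, b y)) x
      = (- DB b a x, DA a b x) := by
    refine Prod.ext ?_ ?_
    · exact (congrArg₂ (· - ·) (congrArg₂ (· + ·) (hA.isPreLie.zero_right hU ha hx)
        (h.bott_right.zero_left hLB hU (hLA.zero hU) hx)) rfl).trans (by simp)
    · have h3 : B.bracket (fun _ => 0) b x = 0 := by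
        rw [hB.bracket_skew U hU _ _ (hLB.zero hU) hb x hx, hB.isPreLie.zero_right hU hb hx, neg_zero]
      exact (congrArg₂ (· - ·) (congrArg₂ (· + ·) h3 rfl)
        (h.bott_left.zero_left hLA hU (hLB.zero hU) hx)).trans (by simp)
  have h4 := (congrArg ((matchedSum A B DA DB).anchor x) h2).symm.trans h1
  simp only [LinearMap.coprod_apply, map_zero, add_zero, zero_add, map_neg] at h4
  rw [← h4]
  abel

/-- The formula for the Bott connection on the Atiyah algebroid. -/
theorem bottAtiyahFormula (h : IsMatchedPair A B DA DB) (hE : IsLocFree V E)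
    (hn : IsFlatConnection A E nab) : BottAtiyahFormula A B E DA DB nab := by
  have hA := h.left.lieAlgebroid_sub
  have hB := h.right.lieAlgebroid_sub
  intro U hU a s ha hs x hx
  have hDB := h.bott_right.smooth U hU _ a hs.1 ha
  refine atiyahMk_spec hE (fun e e' he he' => ?_) fun f e W hW hxW hf he => ?_
  · obtain ⟨N, hN, hxN, hNU, he⟩ := he.exists_subset hE hU hx
    obtain ⟨N', hN', hxN', hNN, he'⟩ := he'.exists_subset hE hN hxN
    replace he := hE.mono _ _ _ hN hN' hNN he
    have hN'U := hNN.trans hNU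
    replace ha := hA.isPreLie.locFree.mono _ _ _ hU hN' hN'U ha
    have hDB' := hA.isPreLie.locFree.mono _ _ _ hU hN' hN'U hDB
    have hse := op_smooth hs hN' hN'U he
    have hse' := op_smooth hs hN' hN'U he'
    have e1 : nab a (op s (e + e')) x = nab a (op s e) x + nab a (op s e') x := by
      rw [← hn.add_right N' hN' a _ _ ha hse hse' x hxN']
      exact hn.nab_local N' hN' _ _ _ _ ha (op_smooth hs hN' hN'U (hE.add hN' he he'))
        (fun _ _ => rfl) (fun y hy => op_add hN' he he' hy) x hxN'
    have e2 : opAt (s x) (nab a (e + e')) = opAt (s x) (nab a e) + opAt (s x) (nab a e') := by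
      rw [← opAt_add _ ⟨_, hN', hxN', hn.smooth N' hN' a e ha he⟩
        ⟨_, hN', hxN', hn.smooth N' hN' a e' ha he'⟩]
      exact opAt_congr hE _ hN' hxN' (hn.smooth N' hN' a _ ha (hE.add hN' he he'))
        fun y hy => hn.add_right N' hN' a e e' ha he he' y hy
    rw [e1, e2, hn.add_right N' hN' _ e e' hDB' he he' x hxN']
    abel
  · have hN := hU.inter hW
    have hNU : U ∩ W ⊆ U := Set.inter_subset_left
    have hxN : x ∈ U ∩ W := ⟨hx, hxW⟩
    replace he := hE.mono _ _ _ hW hN Set.inter_subset_right he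
    replace hf : Sm V f (U ∩ W) := hf.mono Set.inter_subset_right
    have ha' := hA.isPreLie.locFree.mono _ _ _ hU hN hNU ha
    have hDB' := hA.isPreLie.locFree.mono _ _ _ hU hN hNU hDB
    have hra := hA.anchor_smooth _ hN a ha'
    have hrs := (hB.anchor_smooth U hU _ hs.1).mono hNU
    have hse := op_smooth hs hN hNU he
    have hne := hn.smooth _ hN a e ha' he
    have hdf := Sm.cDeriv hN hf hra
    have hdf' := Sm.cDeriv hN hf hrs
    have e1 : nab a (op s (fun y => f y • e y)) x = (f x • nab a (op s e) x
        + cDeriv V x (A.anchor x (a x)) f • op s e x)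
        + (cDeriv V x (B.anchor x (sym s x)) f • nab a e x
          + (cDeriv V x (A.anchor x (a x)) fun y => cDeriv V y (B.anchor y (sym s y)) f)
            • e x) := by
      rw [← hn.leibniz _ hN f a _ hf ha' hse x hxN, ← hn.leibniz _ hN _ a _ hdf' ha' he x hxN,
        ← hn.add_right _ hN a _ _ ha' (hE.fsmul hN hf hse) (hE.fsmul hN hdf' he) x hxN]
      exact hn.nab_local _ hN _ _ _ _ ha' (op_smooth hs hN hNU (hE.fsmul hN hf he))
        (fun _ _ => rfl) (fun y hy => op_fsmul hN hf he hy) x hxN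
    have e2 : opAt (s x) (nab a (fun y => f y • e y)) = (f x • opAt (s x) (nab a e)
        + cDeriv V x (B.anchor x (sym s x)) f • nab a e x)
        + (cDeriv V x (A.anchor x (a x)) f • opAt (s x) e
          + (cDeriv V x (B.anchor x (sym s x)) fun y => cDeriv V y (A.anchor y (a y)) f)
            • e x) := by
      refine (opAt_congr hE _ hN hxN (hn.smooth _ hN a _ ha' (hE.fsmul hN hf he))
        fun y hy => hn.leibniz _ hN f a e hf ha' he y hy).trans ?_
      refine (opAt_add _ ⟨_, hN, hxN, hE.fsmul hN hf hne⟩ ⟨_, hN, hxN, hE.fsmul hN hdf he⟩).trans ?_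
      exact congrArg₂ (· + ·) (opAt_fsmul _ hN hxN hf ⟨_, hN, hxN, hne⟩)
        (opAt_fsmul _ hN hxN hdf ⟨_, hN, hxN, he⟩)
    have : CompleteSpace V := FiniteDimensional.complete ℂ V
    -- The first-order terms of the commutator cancel, so its symbol is `[ρ(a), ρ(b)]`, which need
    -- not be the anchor of `D_a b`. The term `∇_{D_b a}` adds `ρ(D_b a)`, exactly the missing part
    -- by `IsMatchedPair.anchor_conn`.
    rw [e1, e2, hn.leibniz _ hN f _ e hf hDB' he x hxN, h.anchor_conn hU ha hs.1 hx, cDeriv_add,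
      cDeriv_cLie hN hxN hra hrs hf]
    change _ = f x • (nab a (op s e) x - opAt (s x) (nab a e) + nab (DB (sym s) a) e x) + _
    have e3 : op s e x = opAt (s x) e := rfl
    rw [e3]
    module

end Bott

/-! ### The isomorphism of the two Lie algebroids. -/

section Iso

variable {V : Type*} [NormedAddCommGroup V] [NormedSpace ℂ V] [FiniteDimensional ℂ V]
  {M : Type*} [TopologicalSpace M] [ChartedSpace V M] [IsManifold 𝓘(ℂ, V) ω M]

/-- For the inverse, compatibility with anchors and brackets is formal; only smoothness is a genuine
condition. -/
theorem isLieAlgebroidIso_of_morphism {A B : LieAlgebroidData V M} (φ : ∀ x, A.Fib x ≃ₗ[ℂ] B.Fib x)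
    (h : IsLieAlgebroidMorphism A B (fun x => (φ x).toLinearMap))
    (hs : ∀ U : Set M, IsOpen U → ∀ s, B.SmoothOn s U → A.SmoothOn (fun x => (φ x).symm (s x)) U) :
    IsLieAlgebroidIso A B φ := by
  refine ⟨h, hs, fun x b => ?_, fun U hU s t hs' ht' x hx => ?_⟩
  · have := h.anchor x ((φ x).symm b)
    simp only [LinearEquiv.coe_coe, LinearEquiv.apply_symm_apply] at this
    exact this.symm
  · have := h.bracket U hU _ _ (hs U hU s hs') (hs U hU t ht') x hx
    simp only [LinearEquiv.coe_coe, LinearEquiv.apply_symm_apply] at this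
    simp only [LinearEquiv.coe_coe]
    rw [← this, LinearEquiv.symm_apply_apply]

variable {A : LieAlgebroidData V M} {EF : M → Type*} [∀ x, AddCommGroup (EF x)]
  [∀ x, Module ℂ (EF x)] (𝓔 : HolVectorBundle V EF)
  {DA : (Π x : M, T01 V x) → (Π x, A.Fib x) → Π x, A.Fib x}
  {DB : (Π x, A.Fib x) → (Π x : M, T01 V x) → Π x : M, T01 V x}

variable (A DA DB) in
/-- The element `(∂̄_X + δ, X ⊕ l)`. -/
def addDbar (x : M) (p : T01 V x × atiyahFib A 𝓔.smooth x) :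
    atiyahFib (matchedSum (T01Algebroid V M) A DA DB) 𝓔.smooth x :=
  atiyahMk (matchedSum (T01Algebroid V M) A DA DB) 𝓔.smooth x
    (fun e => 𝓔.dbarAt x p.1 e + opAt p.2 e) (p.1, symAt p.2)

variable (A DA DB) in
/-- The element `X ⊕ (δ - ∂̄_X, l)`. -/
def subDbar (x : M) (d : atiyahFib (matchedSum (T01Algebroid V M) A DA DB) 𝓔.smooth x) :
    T01 V x × atiyahFib A 𝓔.smooth x :=
  ((symAt d).1, atiyahMk A 𝓔.smooth x
    (fun e => opAt d e - 𝓔.dbarAt x (symAt d).1 e) (symAt d).2)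

theorem dbarAt_add_near {x : M} (X : T01 V x) {e e' : Π y, EF y} (he : 𝓔.smooth.SmoothNear e x)
    (he' : 𝓔.smooth.SmoothNear e' x) :
    𝓔.dbarAt x X (e + e') = 𝓔.dbarAt x X e + 𝓔.dbarAt x X e' := by
  obtain ⟨U, hU, hx, he⟩ := he
  obtain ⟨N, hN, hxN, hNU, he'⟩ := he'.exists_subset 𝓔.isLocFree hU hx
  exact HolVectorBundle.dbarAt_add hN hxN X (𝓔.isLocFree.mono _ _ _ hU hN hNU he) he'

theorem addDbar_spec (x : M) (p : T01 V x × atiyahFib A 𝓔.smooth x) :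
    symAt (addDbar A 𝓔 DA DB x p) = (p.1, symAt p.2) ∧ ∀ e, 𝓔.smooth.SmoothNear e x →
      opAt (addDbar A 𝓔 DA DB x p) e = 𝓔.dbarAt x p.1 e + opAt p.2 e := by
  refine atiyahMk_spec 𝓔.isLocFree (fun e e' he he' => ?_) fun f e U hU hx hf he => ?_
  · rw [dbarAt_add_near 𝓔 _ he he', opAt_add _ he he']
    abel
  · rw [HolVectorBundle.dbarAt_fsmul hU hx _ hf he, opAt_fsmul _ hU hx hf ⟨U, hU, hx, he⟩,
      LinearMap.coprod_apply, cDeriv_add]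
    simp only [Submodule.subtype_apply]
    module

theorem subDbar_spec (x : M) (d : atiyahFib (matchedSum (T01Algebroid V M) A DA DB) 𝓔.smooth x) :
    symAt (subDbar A 𝓔 DA DB x d).2 = (symAt d).2 ∧ ∀ e, 𝓔.smooth.SmoothNear e x →
      opAt (subDbar A 𝓔 DA DB x d).2 e = opAt d e - 𝓔.dbarAt x (symAt d).1 e := by
  refine atiyahMk_spec 𝓔.isLocFree (fun e e' he he' => ?_) fun f e U hU hx hf he => ?_
  · rw [dbarAt_add_near 𝓔 _ he he', opAt_add _ he he']
    abel
  · rw [HolVectorBundle.dbarAt_fsmul hU hx _ hf he, opAt_fsmul _ hU hx hf ⟨U, hU, hx, he⟩,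
      LinearMap.coprod_apply, cDeriv_add]
    simp only [Submodule.subtype_apply]
    module

variable (A DA DB) in
/-- The isomorphism `X ⊕ (δ, l) ↦ (∂̄_X + δ, X ⊕ l)` at a point. -/
def atiyahIso (x : M) : (T01 V x × atiyahFib A 𝓔.smooth x) ≃ₗ[ℂ]
    atiyahFib (matchedSum (T01Algebroid V M) A DA DB) 𝓔.smooth x where
  toFun := addDbar A 𝓔 DA DB x
  invFun := subDbar A 𝓔 DA DB x
  map_add' p q := by
    refine atiyah_ext ?_ fun e he => ?_
    · rw [symAt_add, (addDbar_spec 𝓔 x _).1, (addDbar_spec 𝓔 x _).1, (addDbar_spec 𝓔 x _).1]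
      rfl
    · rw [opAt_add_left, (addDbar_spec 𝓔 x _).2 e he, (addDbar_spec 𝓔 x _).2 e he,
        (addDbar_spec 𝓔 x _).2 e he, Prod.fst_add, Prod.snd_add, opAt_add_left,
        HolVectorBundle.dbarAt_add_left _ _ he]
      abel
  map_smul' c p := by
    refine atiyah_ext ?_ fun e he => ?_
    · rw [RingHom.id_apply, symAt_smul, (addDbar_spec 𝓔 x _).1, (addDbar_spec 𝓔 x _).1]
      rfl
    · rw [RingHom.id_apply, opAt_smul_left, (addDbar_spec 𝓔 x _).2 e he,
        (addDbar_spec 𝓔 x _).2 e he, Prod.smul_fst, Prod.smul_snd, opAt_smul_left,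
        HolVectorBundle.dbarAt_smul_left _ _ he, smul_add]
  left_inv p := by
    have h1 := (addDbar_spec (DA := DA) (DB := DB) 𝓔 x p).1
    have h2 : (symAt (addDbar A 𝓔 DA DB x p)).1 = p.1 := congrArg Prod.fst h1
    refine Prod.ext h2 (atiyah_ext ?_ fun e he => ?_)
    · exact (subDbar_spec 𝓔 x _).1.trans (congrArg Prod.snd h1)
    · refine ((subDbar_spec 𝓔 x _).2 e he).trans ?_
      rw [(addDbar_spec 𝓔 x _).2 e he, h2]
      abel
  right_inv d := by
    refine atiyah_ext ?_ fun e he => ?_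
    · rw [(addDbar_spec 𝓔 x _).1, (subDbar_spec 𝓔 x _).1]
      rfl
    · rw [(addDbar_spec 𝓔 x _).2 e he, (subDbar_spec 𝓔 x _).2 e he]
      exact add_sub_cancel _ _

/-- The isomorphism of the matched sum of `T^{0,1} M` and the Atiyah algebroid with the Atiyah
algebroid of the matched sum. -/
theorem atiyahIso_isLieAlgebroidIso (h : IsMatchedPair (T01Algebroid V M) A DA (del A)) :
    IsLieAlgebroidIso (matchedSum (T01Algebroid V M) (atiyah A 𝓔.smooth)
        (bottAtiyah (T01Algebroid V M) A 𝓔.smooth DA (del A) 𝓔.dbar) (del (atiyah A 𝓔.smooth)))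
      (atiyah (matchedSum (T01Algebroid V M) A DA (del A)) 𝓔.smooth)
      (atiyahIso A 𝓔 DA (del A)) := by
  have hE := 𝓔.isLocFree
  have hn := 𝓔.dbar_isFlatConnection
  have hA := h.right.lieAlgebroid_sub
  have hT := T01_isLieAlgebroid (V := V) (M := M)
  have hLT := hT.isPreLie.locFree
  have hF := atiyahBracketFormula hE hA
  have hB := bottAtiyahFormula h hE hn
  have hsm : ∀ U : Set M, IsOpen U → ∀ X d, (T01Algebroid V M).SmoothOn X U →
      (atiyah A 𝓔.smooth).SmoothOn d U → (atiyah (matchedSum (T01Algebroid V M) A DA (del A))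
        𝓔.smooth).SmoothOn (fun x => addDbar A 𝓔 DA (del A) x (X x, d x)) U := by
    intro U hU X d hX hd
    have h1 : ∀ x, symAt (addDbar A 𝓔 DA (del A) x (X x, d x)) = (X x, symAt (d x)) := fun x =>
      (addDbar_spec 𝓔 x _).1
    refine ⟨⟨hLT.congr hU hX fun x _ => (congrArg Prod.fst (h1 x)).symm,
      hA.isPreLie.locFree.congr hU hd.1 fun x _ => (congrArg Prod.snd (h1 x)).symm⟩,
      fun W hW hWU e he => ?_⟩
    exact hE.congr hW (hE.add hW (hn.smooth W hW X e (hLT.mono _ _ _ hU hW hWU hX) he)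
      (hd.2 W hW hWU e he)) fun x hx => ((addDbar_spec 𝓔 x (X x, d x)).2 e ⟨W, hW, hx, he⟩).symm
  refine isLieAlgebroidIso_of_morphism _ ⟨fun U hU s hs => hsm U hU _ _ hs.1 hs.2,
    fun x p => ?_, fun U hU s t hs ht x hx => ?_⟩ fun U hU s hs => ?_
  · exact congrArg ((matchedSum (T01Algebroid V M) A DA (del A)).anchor x)
      (addDbar_spec 𝓔 x p).1
  · have hTL := h.left.lieAlgebroid
    obtain ⟨f1, f2⟩ := atiyahBracketFormula hE hTL U hU _ _ (hsm U hU _ _ hs.1 hs.2)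
      (hsm U hU _ _ ht.1 ht.2) x hx
    obtain ⟨a1, a2⟩ := hF U hU _ _ hs.2 ht.2 x hx
    obtain ⟨b1, b2⟩ := hB U hU _ _ hs.1 ht.2 x hx
    obtain ⟨c1, c2⟩ := hB U hU _ _ ht.1 hs.2 x hx
    refine atiyah_ext (((addDbar_spec 𝓔 x _).1.trans ?_).trans f1.symm)
      fun e he => (((addDbar_spec 𝓔 x _).2 e he).trans ?_).trans (f2 e he).symm
    · have h1 : ∀ {u : Π x, T01 V x × atiyahFib A 𝓔.smooth x},
          (sym fun y => addDbar A 𝓔 DA (del A) y ((u y).1, (u y).2))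
          = fun y => ((u y).1, symAt (u y).2) := fun {u} => by
        funext y
        exact (addDbar_spec 𝓔 y _).1
      rw [h1, h1]
      refine Prod.ext rfl ?_
      exact congrArg₂ (· - ·) (congrArg₂ (· + ·) a1 b1) c1
    · obtain ⟨N, hN, hxN, hNU, heN⟩ := he.exists_subset hE hU hx
      -- The composite of the operators `∂̄_X + δ` and `∂̄_Y + δ'` has four terms; antisymmetrizing
      -- them gives the commutator to be compared with the operator of the matched bracket.
      have key : ∀ {u v : Π x, T01 V x × atiyahFib A 𝓔.smooth x},
          CSmoothOn V (fun y => ((u y).1 : CTan V y)) U →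
          (atiyah A 𝓔.smooth).SmoothOn (fun y => (u y).2) U →
          CSmoothOn V (fun y => ((v y).1 : CTan V y)) U →
          (atiyah A 𝓔.smooth).SmoothOn (fun y => (v y).2) U →
          op (fun y => addDbar A 𝓔 DA (del A) y ((u y).1, (u y).2))
            (op (fun y => addDbar A 𝓔 DA (del A) y ((v y).1, (v y).2)) e) x
          = 𝓔.dbar (fun y => (u y).1) (𝓔.dbar (fun y => (v y).1) e) x
            + 𝓔.dbar (fun y => (u y).1) (op (fun y => (v y).2) e) x
            + (op (fun y => (u y).2) (𝓔.dbar (fun y => (v y).1) e) x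
            + op (fun y => (u y).2) (op (fun y => (v y).2) e) x) := by
        intro u v hu1 hu2 hv1 hv2
        have w1 := hn.smooth N hN _ e (CSmoothOn.mono hv1 hNU) heN
        have w2 := op_smooth hv2 hN hNU heN
        have w3 : ∀ y ∈ N, (𝓔.dbar (fun y => (v y).1) e + op (fun y => (v y).2) e) y
            = op (fun y => addDbar A 𝓔 DA (del A) y ((v y).1, (v y).2)) e y := fun y hy =>
          ((addDbar_spec 𝓔 y _).2 e ⟨N, hN, hy, heN⟩).symm
        refine (opAt_congr hE _ hN hxN (hE.add hN w1 w2) w3).symm.trans ?_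
        refine ((addDbar_spec 𝓔 x _).2 _ ⟨N, hN, hxN, hE.add hN w1 w2⟩).trans ?_
        exact congrArg₂ (· + ·) (dbarAt_add_near 𝓔 _ ⟨N, hN, hxN, w1⟩ ⟨N, hN, hxN, w2⟩)
          (opAt_add _ ⟨N, hN, hxN, w1⟩ ⟨N, hN, hxN, w2⟩)
      refine Eq.trans ?_ (congrArg₂ (· - ·) (key hs.1 hs.2 ht.1 ht.2)
        (key ht.1 ht.2 hs.1 hs.2)).symm
      -- Flatness identifies `∂̄_[X,Y]` with `[∂̄_X, ∂̄_Y]`. The extra terms `∂̄_{∂_{ρ(l)} X}` in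
      -- the Bott formula cancel those coming from the (0,1)-component of the bracket, by `e2` and
      -- `e3`.
      have hfl := hn.flat N hN _ _ e (CSmoothOn.mono hs.1 hNU) (CSmoothOn.mono ht.1 hNU) heN x hxN
      have d1 : ∀ X Y Z : T01 V x, 𝓔.dbarAt x (X + Y - Z) e
          = 𝓔.dbarAt x X e + 𝓔.dbarAt x Y e - 𝓔.dbarAt x Z e := fun X Y Z => by
        have : X + Y - Z = X + Y + (-1 : ℂ) • Z := by
          module
        rw [this, HolVectorBundle.dbarAt_add_left _ _ he, HolVectorBundle.dbarAt_add_left _ _ he,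
          HolVectorBundle.dbarAt_smul_left _ _ he, neg_one_smul, sub_eq_add_neg]
      have d2 : ∀ a b c : atiyahFib A 𝓔.smooth x, opAt (a + b - c) e
          = opAt a e + opAt b e - opAt c e := fun a b c => by
        rw [sub_eq_add_neg, opAt_add_left, opAt_add_left, opAt_neg_left, sub_eq_add_neg]
      refine (congrArg₂ (· + ·) (d1 _ _ _) ((d2 _ _ _).trans (congrArg₂ (· - ·)
        (congrArg₂ (· + ·) (a2 e he) (b2 e he)) (c2 e he)))).trans ?_
      have e1 : 𝓔.dbarAt x ((T01Algebroid V M).bracket (fun y => (s y).1) (fun y => (t y).1) x) e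
          = 𝓔.dbar (fun y => (s y).1) (𝓔.dbar (fun y => (t y).1) e) x
            - 𝓔.dbar (fun y => (t y).1) (𝓔.dbar (fun y => (s y).1) e) x :=
        (sub_eq_zero.1 hfl).symm
      rw [e1]
      have e2 : 𝓔.dbarAt x (del (atiyah A 𝓔.smooth) (fun y => (s y).2) (fun y => (t y).1) x) e
        = 𝓔.dbar (del A (sym fun y => (s y).2) fun y => (t y).1) e x := rfl
      have e3 : 𝓔.dbarAt x (del (atiyah A 𝓔.smooth) (fun y => (t y).2) (fun y => (s y).1) x) e
        = 𝓔.dbar (del A (sym fun y => (t y).2) fun y => (s y).1) e x := rfl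
      rw [e2, e3]
      abel
  · have h1 : ∀ x, symAt (subDbar A 𝓔 DA (del A) x (s x)).2 = (symAt (s x)).2 := fun x =>
      (subDbar_spec 𝓔 x _).1
    refine ⟨hs.1.1, hA.isPreLie.locFree.congr hU hs.1.2 fun x _ => (h1 x).symm,
      fun W hW hWU e he => ?_⟩
    exact hE.congr hW (hE.sub hW (hs.2 W hW hWU e he)
      (hn.smooth W hW _ e (hLT.mono _ _ _ hU hW hWU hs.1.1) he)) fun x hx =>
      ((subDbar_spec 𝓔 x _).2 e ⟨W, hW, hx, he⟩).symm

end Iso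

/-! ### The holomorphic structure of the Atiyah algebroid. -/

section HolAtiyahAlgebroid

variable {V : Type*} [NormedAddCommGroup V] [NormedSpace ℂ V] [FiniteDimensional ℂ V]
  {M : Type*} [TopologicalSpace M] [ChartedSpace V M] [IsManifold 𝓘(ℂ, V) ω M]
  {LF : M → Type*} [∀ x, AddCommGroup (LF x)] [∀ x, Module ℂ (LF x)]
  {EF : M → Type*} [∀ x, AddCommGroup (EF x)] [∀ x, Module ℂ (EF x)]
  {𝓛 : HolLieAlgebroid V LF} {𝓔 : HolVectorBundle V EF}
  {br : (Π x, LF x) → (Π x, LF x) → Π x, LF x}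

theorem HolVectorBundle.HolOn.sub {s t : Π x, EF x} {U : Set M} (hs : 𝓔.HolOn s U)
    (ht : 𝓔.HolOn t U) (hU : IsOpen U) : 𝓔.HolOn (fun x => s x - t x) U :=
  ((hs.add (ht.fsmul (Ho.const (-1) U) hU) hU)).congr hU fun x _ => by
    simp [sub_eq_add_neg]

variable (𝓛 𝓔 br) in
/-- The holomorphic sections of the Atiyah algebroid: the symbol is holomorphic, and the operator
maps holomorphic sections to holomorphic sections. -/
def HolAtiyahOn (s : Π x, atiyahFib (𝓛.withBracket br) 𝓔.smooth x) (U : Set M) : Prop :=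
  𝓛.HolOn (sym s) U ∧
    ∀ W : Set M, IsOpen W → W ⊆ U → ∀ e, 𝓔.HolOn e W → 𝓔.HolOn (op s e) W

theorem cDeriv_anchor {x : M} (a : LF x) {f : M → ℂ} {U : Set M} (hf : Ho V f U) (hU : IsOpen U)
    (hx : x ∈ U) :
    cDeriv V x ((𝓛.withBracket br).anchor x a) f = holDeriv V x (𝓛.anchor x a) f :=
  cDeriv_holTan _ (hf.md hU hx)

section Frame

variable {ι κ : Type} [Fintype ι] [DecidableEq ι] [Fintype κ] [DecidableEq κ] {W : Set M}

variable (br) in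
/-- The frame of the Atiyah algebroid given by holomorphic frames. -/
abbrev HolFrame.atiyahFrame (f : HolFrame 𝓔 ι W) (g : HolFrame 𝓛.toHolVectorBundle κ W)
    (hA : IsPreLie (𝓛.withBracket br)) (hW : IsOpen W) :
    SmFrame V (atiyah (𝓛.withBracket br) 𝓔.smooth).toSectionFamily (ι × ι ⊕ κ) W :=
  SmFrame.atiyah (A := 𝓛.withBracket br) f.toSmFrame g.toSmFrame 𝓔.isLocFree hA hW

variable (f : HolFrame 𝓔 ι W) (g : HolFrame 𝓛.toHolVectorBundle κ W)
    (hA : IsPreLie (𝓛.withBracket br)) (hW : IsOpen W)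

/-- Parallel to `atiyah_smoothOn_iff`. The expansion of the operator in a holomorphic frame
preserves holomorphy because a holomorphic symbol differentiates holomorphic functions to
holomorphic functions. -/
theorem holAtiyahOn_iff {U : Set M} (hU : IsOpen U) (hUW : U ⊆ W)
    (s : Π x, atiyahFib (𝓛.withBracket br) 𝓔.smooth x) : HolAtiyahOn 𝓛 𝓔 br s U ↔
      ∀ p, Ho V (fun x => (f.atiyahFrame br g hA hW).c p x (s x)) U := by
  refine ⟨fun h => ?_, fun h => ?_⟩
  · rintro (⟨i, j⟩ | k)
    · exact (f.holOn_iff U hU hUW _).1 (h.2 U hU subset_rfl _ (f.holOn_e hU hUW j)) i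
    · exact (g.holOn_iff U hU hUW _).1 h.1 k
  have h1 : 𝓛.HolOn (sym s) U := (g.holOn_iff U hU hUW _).2 fun k => h (Sum.inr k)
  refine ⟨h1, fun N hN hNU e he => ?_⟩
  have hNW := hNU.trans hUW
  have hop : ∀ j, 𝓔.HolOn (op s (f.e j)) N := fun j =>
    (f.holOn_iff N hN hNW _).2 fun i => (h (Sum.inl (i, j))).mono hNU
  have hc : ∀ j, Ho V (fun x => f.c j x (e x)) N := fun j => (f.holOn_iff N hN hNW _).1 he j
  refine HolVectorBundle.HolOn.congr (HolVectorBundle.HolOn.sum Finset.univ hN fun j _ =>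
    HolVectorBundle.HolOn.add ((hop j).fsmul (hc j) hN) ((f.holOn_e hN hNW j).fsmul
      (Ho.holDeriv hN (hc j) (𝓛.anchor_hol N hN _ (𝓛.holOn_mono h1 hNU))) hN) hN) hN
    fun x hx => ?_
  refine Eq.trans ?_ (opAt_frame 𝓔.isLocFree (s x) (f.toSmFrame.restrict hNW) hN hx
    ⟨N, hN, hx, he.smoothOn hN⟩).symm
  refine Finset.sum_congr rfl fun j _ => congrArg₂ (· + ·) rfl (congrArg (· • f.e j x) ?_)
  exact (cDeriv_anchor (br := br) (sym s x) (hc j) hN hx).symm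

theorem holAtiyahOn_e {U : Set M} (hU : IsOpen U) (hUW : U ⊆ W) (p) :
    HolAtiyahOn 𝓛 𝓔 br ((f.atiyahFrame br g hA hW).e p) U :=
  (holAtiyahOn_iff f g hA hW hU hUW _).2 fun q =>
    ContMDiffOn.congr (Ho.const (if q = p then 1 else 0) U) fun x hx =>
      (f.atiyahFrame br g hA hW).c_e x (hUW hx) q p

end Frame

variable (𝓛 𝓔) in
theorem exists_holFrame_pair {U : Set M} (hU : IsOpen U) {x : M} (hx : x ∈ U) :
    ∃ (ι κ : Type) (_ : Fintype ι) (_ : DecidableEq ι) (_ : Fintype κ) (_ : DecidableEq κ)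
      (W : Set M), IsOpen W ∧ x ∈ W ∧ W ⊆ U ∧ Nonempty (HolFrame 𝓔 ι W) ∧
      Nonempty (HolFrame 𝓛.toHolVectorBundle κ W) := by
  obtain ⟨ι, _, _, W, hW, hxW, hWU, ⟨f⟩⟩ := 𝓔.exists_holFrame_subset hU hx
  obtain ⟨κ, _, _, N, hN, hxN, hNW, ⟨g⟩⟩ := 𝓛.exists_holFrame_subset hW hxW
  exact ⟨ι, κ, _, _, _, _, N, hN, hxN, hNW.trans hWU, ⟨f.restrict hNW⟩, ⟨g⟩⟩

theorem HolAtiyahOn.mono {s : Π x, atiyahFib (𝓛.withBracket br) 𝓔.smooth x} {U W : Set M}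
    (h : HolAtiyahOn 𝓛 𝓔 br s U) (hW : W ⊆ U) : HolAtiyahOn 𝓛 𝓔 br s W :=
  ⟨𝓛.holOn_mono h.1 hW, fun N hN hNW e he => h.2 N hN (hNW.trans hW) e he⟩

theorem HolAtiyahOn.of_local {s : Π x, atiyahFib (𝓛.withBracket br) 𝓔.smooth x} {U : Set M}
    (h : ∀ x ∈ U, ∃ W, IsOpen W ∧ x ∈ W ∧ HolAtiyahOn 𝓛 𝓔 br s W) : HolAtiyahOn 𝓛 𝓔 br s U := by
  refine ⟨𝓛.holOn_of_local fun x hx => ?_, fun W hW hWU e he => 𝓔.holOn_of_local fun x hx => ?_⟩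
  · obtain ⟨N, hN, hxN, h1, -⟩ := h x hx
    exact ⟨N, hN, hxN, h1⟩
  · obtain ⟨N, hN, hxN, -, h2⟩ := h x (hWU hx)
    exact ⟨W ∩ N, hW.inter hN, ⟨hx, hxN⟩, h2 _ (hW.inter hN) Set.inter_subset_right e
      (𝓔.holOn_mono he Set.inter_subset_left)⟩

/-- A holomorphic bundle structure on the Atiyah algebroid with the expected holomorphic and smooth
sections. -/
structure IsHolAtiyah (𝓛 : HolLieAlgebroid V LF) (𝓔 : HolVectorBundle V EF)
    (br : (Π x, LF x) → (Π x, LF x) → Π x, LF x)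
    (B : HolVectorBundle V fun x => atiyahFib (𝓛.withBracket br) 𝓔.smooth x) : Prop where
  holOn_iff : ∀ U : Set M, IsOpen U → ∀ s, B.HolOn s U ↔ HolAtiyahOn 𝓛 𝓔 br s U
  smoothOn_iff : ∀ U : Set M, IsOpen U → ∀ s,
    B.smooth.SmoothOn s U ↔ (atiyah (𝓛.withBracket br) 𝓔.smooth).SmoothOn s U

/-- Frame elements built from holomorphic frames are holomorphic in the intrinsic sense of
`HolAtiyahOn`, hence have holomorphic coordinates in any other such frame. These frames thus form a
holomorphic atlas. The model fibre consists of functions from a small finite index type to ℂ, whence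
the universe 0. -/
theorem exists_isHolAtiyah (hA : IsPreLie (𝓛.withBracket br)) :
    ∃ B : HolVectorBundle.{_, _, _, 0} V fun x => atiyahFib (𝓛.withBracket br) 𝓔.smooth x,
      IsHolAtiyah 𝓛 𝓔 br B := by
  obtain ⟨ι, _, _, hf⟩ := 𝓔.exists_holFrame
  obtain ⟨κ, _, _, hg⟩ := 𝓛.exists_holFrame
  choose N hN hxN f _ using hf
  choose N' hN' hxN' g _ using hg
  have hU := fun a => (hN a).inter (hN' a)
  let F := fun a => HolFrame.atiyahFrame br ((f a).restrict (W := N a ∩ N' a) Set.inter_subset_left)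
    ((g a).restrict Set.inter_subset_right) hA (hU a)
  have hiff : ∀ a, ∀ {U : Set M}, IsOpen U → U ⊆ N a ∩ N' a → ∀ s,
      HolAtiyahOn 𝓛 𝓔 br s U ↔ ∀ p, Ho V (fun x => (F a).c p x (s x)) U := fun a U hU' hUW s =>
    holAtiyahOn_iff _ _ hA (hU a) hU' hUW s
  have hc : ∀ a b i j, Ho V (fun x => (F a).c i x ((F b).e j x))
      ((N b ∩ N' b) ∩ (N a ∩ N' a)) := fun a b i j =>
    (hiff a ((hU b).inter (hU a)) Set.inter_subset_right _).1
      (holAtiyahOn_e _ _ hA (hU b) ((hU b).inter (hU a)) Set.inter_subset_left j) i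
  let A : FrameAtlas (fun x => atiyahFib (𝓛.withBracket br) 𝓔.smooth x) (ι × ι ⊕ κ) :=
    { U := fun a => N a ∩ N' a
      isOpen_U := hU
      mem_U := fun a => ⟨hxN a, hxN' a⟩
      e := fun a => (F a).e
      c := fun a => (F a).c
      c_e := fun a => (F a).c_e
      sum_c := fun a => (F a).sum_c
      continuousOn_c_e := fun a b i j => (hc a b i j).continuousOn }
  have hL := atiyah_isLocFree 𝓔.isLocFree hA
  refine ⟨A.holBundle hc, fun U hUo s => ⟨fun hs => HolAtiyahOn.of_local fun x hx =>
    ⟨U ∩ (N x ∩ N' x), hUo.inter (hU x), ⟨hx, hxN x, hxN' x⟩, ?_⟩,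
    fun hs => HolVectorBundle.holOn_of_local _ fun x hx =>
    ⟨U ∩ (N x ∩ N' x), hUo.inter (hU x), ⟨hx, hxN x, hxN' x⟩, ?_⟩⟩,
    fun U hUo s => ⟨fun hs => hL.of_local U hUo s fun x hx =>
    ⟨U ∩ (N x ∩ N' x), hUo.inter (hU x), ⟨hx, hxN x, hxN' x⟩, ?_⟩,
    fun hs => (A.holBundle hc).isLocFree.of_local U hUo s fun x hx =>
    ⟨U ∩ (N x ∩ N' x), hUo.inter (hU x), ⟨hx, hxN x, hxN' x⟩, ?_⟩⟩⟩
  · refine (hiff x (hUo.inter (hU x)) Set.inter_subset_right s).2 ?_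
    exact (A.holBundle_holOn_iff hc x _ (hUo.inter (hU x)) Set.inter_subset_right s).1
      (HolVectorBundle.holOn_mono _ hs Set.inter_subset_left)
  · refine (A.holBundle_holOn_iff hc x _ (hUo.inter (hU x)) Set.inter_subset_right s).2 ?_
    exact (hiff x (hUo.inter (hU x)) Set.inter_subset_right s).1 (hs.mono Set.inter_subset_left)
  · refine ((F x).smoothOn_iff _ (hUo.inter (hU x)) Set.inter_subset_right s).2 ?_
    exact (A.holBundle_smoothOn_iff hc x _ (hUo.inter (hU x)) Set.inter_subset_right s).1
      ((A.holBundle hc).isLocFree.mono _ _ _ hUo (hUo.inter (hU x)) Set.inter_subset_left hs)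
  · refine (A.holBundle_smoothOn_iff hc x _ (hUo.inter (hU x)) Set.inter_subset_right s).2 ?_
    exact ((F x).smoothOn_iff _ (hUo.inter (hU x)) Set.inter_subset_right s).1
      (hL.mono _ _ _ hUo (hUo.inter (hU x)) Set.inter_subset_left hs)

variable {B : HolVectorBundle V fun x => atiyahFib (𝓛.withBracket br) 𝓔.smooth x}
  (h : Underlies (𝓛.withBracket br) 𝓛) (hB : IsHolAtiyah 𝓛 𝓔 br B)

include hB in
theorem IsHolAtiyah.smoothOn {U : Set M} (hU : IsOpen U)
    {s : Π x, atiyahFib (𝓛.withBracket br) 𝓔.smooth x} (hs : B.HolOn s U) :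
    (atiyah (𝓛.withBracket br) 𝓔.smooth).SmoothOn s U :=
  (hB.smoothOn_iff U hU s).1 (hs.smoothOn hU)

/-- The holomorphic Atiyah algebroid. -/
def IsHolAtiyah.algebroid : HolLieAlgebroid V fun x => atiyahFib (𝓛.withBracket br) 𝓔.smooth x :=
  have hD := atiyah_isLieAlgebroid 𝓔.isLocFree h.lieAlgebroid
  have hF := atiyahBracketFormula 𝓔.isLocFree h.lieAlgebroid
  have hsym : ∀ U : Set M, IsOpen U → ∀ s t, B.HolOn s U → B.HolOn t U → ∀ x ∈ U,
      symAt ((atiyah (𝓛.withBracket br) 𝓔.smooth).bracket s t x)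
        = 𝓛.bracket (sym s) (sym t) x := fun U hU s t hs ht x hx =>
    (hF U hU s t (hB.smoothOn hU hs) (hB.smoothOn hU ht) x hx).1.trans
      (h.bracket U hU _ _ ((hB.holOn_iff U hU s).1 hs).1 ((hB.holOn_iff U hU t).1 ht).1 x hx)
  { toHolVectorBundle := B
    anchor := fun x => 𝓛.anchor x ∘ₗ symLin (𝓛.withBracket br) 𝓔.smooth x
    bracket := (atiyah (𝓛.withBracket br) 𝓔.smooth).bracket
    anchor_hol := fun U hU s hs => 𝓛.anchor_hol U hU _ ((hB.holOn_iff U hU s).1 hs).1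
    bracket_hol := fun U hU s t hs ht => by
      have hs' := (hB.holOn_iff U hU s).1 hs
      have ht' := (hB.holOn_iff U hU t).1 ht
      refine (hB.holOn_iff U hU _).2 ⟨(𝓛.bracket_hol U hU _ _ hs'.1 ht'.1).congr hU
        fun x hx => (hsym U hU s t hs ht x hx).symm, fun W hW hWU e he => ?_⟩
      refine ((hs'.2 W hW hWU _ (ht'.2 W hW hWU e he)).sub
        (ht'.2 W hW hWU _ (hs'.2 W hW hWU e he)) hW).congr hW fun x hx => ?_
      exact ((hF U hU s t (hB.smoothOn hU hs) (hB.smoothOn hU ht) x (hWU hx)).2 e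
        ⟨W, hW, hx, he.smoothOn hW⟩).symm
    bracket_local := fun U hU s s' t t' hs ht h1 h2 =>
      hD.bracket_local U hU s s' t t' (hB.smoothOn hU hs) (hB.smoothOn hU ht) h1 h2
    bracket_add := fun U hU s t t' hs ht ht' =>
      hD.bracket_add U hU s t t' (hB.smoothOn hU hs) (hB.smoothOn hU ht) (hB.smoothOn hU ht')
    bracket_smul := fun U hU c s t hs ht =>
      hD.bracket_smul U hU c s t (hB.smoothOn hU hs) (hB.smoothOn hU ht)
    bracket_skew := fun U hU s t hs ht =>
      hD.bracket_skew U hU s t (hB.smoothOn hU hs) (hB.smoothOn hU ht)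
    jacobi := fun U hU s t u hs ht hu =>
      hD.jacobi U hU s t u (hB.smoothOn hU hs) (hB.smoothOn hU ht) (hB.smoothOn hU hu)
    anchor_bracket := fun U hU s t hs ht x hx =>
      (congrArg (𝓛.anchor x) (hsym U hU s t hs ht x hx)).trans
        (𝓛.anchor_bracket U hU _ _ ((hB.holOn_iff U hU s).1 hs).1
          ((hB.holOn_iff U hU t).1 ht).1 x hx)
    leibniz := fun U hU f s t hf hs ht x hx =>
      (hD.leibniz U hU f s t (Ho.sm hf) (hB.smoothOn hU hs) (hB.smoothOn hU ht) x hx).trans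
        (congrArg (fun c => c • t x + f x • (atiyah (𝓛.withBracket br) 𝓔.smooth).bracket s t x)
          (cDeriv_anchor (br := br) (sym s x) hf hU hx)) }

theorem IsHolAtiyah.underlies :
    Underlies (atiyah (𝓛.withBracket br) 𝓔.smooth) (hB.algebroid h) where
  lieAlgebroid := atiyah_isLieAlgebroid 𝓔.isLocFree h.lieAlgebroid
  smoothOn U hU s := (hB.smoothOn_iff U hU s).symm
  anchor _ _ := rfl
  bracket _ _ _ _ _ _ _ _ := rfl

include h hB

/-- The Dolbeault operator of the holomorphic Atiyah algebroid. -/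
theorem IsHolAtiyah.dbar_eq {U : Set M} (hU : IsOpen U) {X : Π x : M, T01 V x}
    {s : Π x, atiyahFib (𝓛.withBracket br) 𝓔.smooth x} (hX : (T01Algebroid V M).SmoothOn X U)
    (hs : (atiyah (𝓛.withBracket br) 𝓔.smooth).SmoothOn s U) {x : M} (hx : x ∈ U) :
    B.dbar X s x = dbarAtiyah 𝓛 br 𝓔 X s x := by
  obtain ⟨ι, κ, _, _, _, _, W, hW, hxW, hWU, ⟨f⟩, ⟨g⟩⟩ := exists_holFrame_pair 𝓛 𝓔 hU hx
  have hA := h.lieAlgebroid.isPreLie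
  have hE := 𝓔.isLocFree
  let F := f.atiyahFrame br g hA hW
  -- The Atiyah frame of two holomorphic frames is a holomorphic frame of B, so the Dolbeault
  -- operator of B differentiates its coordinates.
  let G : HolFrame B (ι × ι ⊕ κ) W :=
    { e := F.e
      c := F.c
      c_e := F.c_e
      sum_c := F.sum_c
      smoothOn_iff := fun N hN hNW s =>
        (hB.smoothOn_iff N hN s).trans (F.smoothOn_iff N hN hNW s)
      holOn_iff := fun N hN hNW s =>
        (hB.holOn_iff N hN s).trans (holAtiyahOn_iff f g hA hW hN hNW s) }
  have hL := atiyah_isLocFree hE hA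
  have hs' := hL.mono _ _ _ hU hW hWU hs
  have hX' : CSmoothOn V (fun y => (X y : CTan V y)) W := CSmoothOn.mono hX hWU
  obtain ⟨b1, b2⟩ := bottAtiyahFormula (h.isMatchedPair (DA := 𝓛.dbar)
    fun _ _ _ _ _ _ _ _ => rfl) hE 𝓔.dbar_isFlatConnection W hW X s hX' hs' x hxW
  refine F.ext hxW fun p => (G.c_dbarAt hW hxW (X x) ⟨W, hW, hxW, (hB.smoothOn_iff W hW s).2 hs'⟩
    p).trans ?_
  rcases p with ⟨i, j⟩ | k
  -- Matrix coordinates are read on the holomorphic section `e_j`. As `∂̄ e_j = 0`, only `∂̄_X(δ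
  -- e_j)` survives in the Bott formula, and its components are the derivatives along X of those of
  -- `δ e_j`.
  · have hej := f.holOn_e hW subset_rfl j
    have hse := op_smooth hs' hW subset_rfl (hej.smoothOn hW)
    have h0 : op s (𝓔.dbar X (f.e j)) x = 0 :=
      (opAt_congr hE (s x) hW hxW (hE.zero hW) fun y hy =>
        (hej.dbarAt_eq_zero hW hy (X y)).symm).symm.trans (opAt_zero hE _)
    have h1 : 𝓔.dbar (del (𝓛.withBracket br) (sym s) X) (f.e j) x = 0 :=
      hej.dbarAt_eq_zero hW hxW _
    refine (f.c_dbarAt hW hxW (X x) ⟨W, hW, hxW, hse⟩ i).symm.trans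
      (congrArg (f.c i x) (Eq.symm ((b2 (f.e j) ⟨W, hW, hxW, hej.smoothOn hW⟩).trans ?_)))
    rw [h0, h1, sub_zero, add_zero]
    rfl
  · exact (g.c_dbarAt hW hxW (X x) ⟨W, hW, hxW, hs'.1⟩ k).symm.trans
      (congrArg (g.c k x) b1.symm)

end HolAtiyahAlgebroid

/-! ### Extension of a fibre element to a smooth section. -/

section Extension

variable {V : Type*} [NormedAddCommGroup V] [NormedSpace ℂ V] [FiniteDimensional ℂ V]
  {M : Type*} [TopologicalSpace M] [T2Space M] [ChartedSpace V M] [IsManifold 𝓘(ℂ, V) ω M]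
  {E : SectionFamily M}

/-- Every element of a fibre is the value of a global smooth section. -/
theorem IsLocFree.exists_extension (hE : IsLocFree V E) (x : M) (v : E.Fib x) :
    ∃ s, E.SmoothOn s Set.univ ∧ s x = v := by
  have : FiniteDimensional ℝ V := FiniteDimensional.complexToReal V
  obtain ⟨ι, _, _, W, hW, hxW, -, ⟨f⟩⟩ := hE.exists_frame isOpen_univ (Set.mem_univ x)
  obtain ⟨b, -, hb⟩ := (SmoothBumpFunction.nhds_basis_tsupport (I := 𝓘(ℝ, V)) x).mem_iff.1
    (hW.mem_nhds hxW)
  have hbs : ∀ U, Sm V (fun y => ((b y : ℝ) : ℂ)) U := fun U =>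
    Complex.ofRealCLM.contMDiff.comp_contMDiffOn (b.contMDiff.contMDiffOn (s := U))
  refine ⟨fun y => ((b y : ℝ) : ℂ) • ∑ i, f.c i x v • f.e i y,
    hE.of_local _ isOpen_univ _ fun y _ => ?_, ?_⟩
  · by_cases hy : y ∈ W
    · exact ⟨W, hW, hy, hE.fsmul hW (hbs W) (hE.sum hW _ fun i _ =>
        hE.fsmul hW (Sm.const _ W) (f.smoothOn_e hW subset_rfl i))⟩
    · have ho : IsOpen (tsupport b)ᶜ := (isClosed_tsupport b).isOpen_compl
      refine ⟨_, ho, fun h => hy (hb h), hE.congr ho (hE.zero ho) fun z hz => ?_⟩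
      rw [image_eq_zero_of_notMem_tsupport hz, Complex.ofReal_zero, zero_smul]
  · simp only [b.eq_one, Complex.ofReal_one, one_smul]
    exact f.sum_c x hxW v

end Extension

/-! ### Holomorphic sections as holomorphic differential operators. -/

section Operators

variable {V : Type*} [NormedAddCommGroup V] [NormedSpace ℂ V] [FiniteDimensional ℂ V]
  {M : Type*} [TopologicalSpace M] [ChartedSpace V M] [IsManifold 𝓘(ℂ, V) ω M]
  {LF : M → Type*} [∀ x, AddCommGroup (LF x)] [∀ x, Module ℂ (LF x)]
  {EF : M → Type*} [∀ x, AddCommGroup (EF x)] [∀ x, Module ℂ (EF x)]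
  {𝓛 : HolLieAlgebroid V LF} {𝓔 : HolVectorBundle V EF}
  {br : (Π x, LF x) → (Π x, LF x) → Π x, LF x}

theorem HolAtiyahOn.isHolCovDiffOp {s : Π x, atiyahFib (𝓛.withBracket br) 𝓔.smooth x} {U : Set M}
    (hs : HolAtiyahOn 𝓛 𝓔 br s U) : IsHolCovDiffOp 𝓛 𝓔 U (op s) (sym s) where
  symbol_hol := hs.1
  hol := hs.2
  op_local _ hW _ _ _ he h x hx := opAt_congr 𝓔.isLocFree (s x) hW hx (he.smoothOn hW) h
  add _ hW _ _ _ he he' _ hx := op_add hW (he.smoothOn hW) (he'.smoothOn hW) hx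
  leibniz _ hW _ _ e hf he x hx :=
    (op_fsmul hW (Ho.sm hf) (he.smoothOn hW) hx).trans
      (congrArg (_ + · • e x) (cDeriv_anchor (br := br) (sym s x) hf hW hx))

variable (br) in
-- At each x, the operator is extended to smooth sections by its values on a holomorphic frame near
-- x and the Leibniz rule with symbol l. On holomorphic sections it agrees with δ, since both are
-- local and additive, obey the same Leibniz rule and agree on the frame.
theorem IsHolCovDiffOp.exists_section {U : Set M} (hU : IsOpen U) {δ : (Π x, EF x) → Π x, EF x} {l : Π x, LF x}
    (hδ : IsHolCovDiffOp 𝓛 𝓔 U δ l) : ∃ s : Π x, atiyahFib (𝓛.withBracket br) 𝓔.smooth x,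
      HolAtiyahOn 𝓛 𝓔 br s U ∧ (∀ x, sym s x = l x) ∧
      ∀ W : Set M, IsOpen W → W ⊆ U → ∀ e, 𝓔.HolOn e W → ∀ x ∈ W, op s e x = δ e x := by
  obtain ⟨ι, _, _, hf⟩ := 𝓔.exists_holFrame
  choose N hN hxN f _ using hf
  have hE := 𝓔.isLocFree
  let s : Π x, atiyahFib (𝓛.withBracket br) 𝓔.smooth x := fun x =>
    atiyahMk (𝓛.withBracket br) 𝓔.smooth x (fun e => ∑ j, ((f x).c j x (e x) • δ ((f x).e j) x
      + cDeriv V x ((𝓛.withBracket br).anchor x (l x)) (fun y => (f x).c j y (e y))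
        • (f x).e j x)) (l x)
  have hc : ∀ x {e : Π y, EF y}, 𝓔.smooth.SmoothNear e x → ∀ j,
      MDifferentiableAt 𝓘(ℝ, V) 𝓘(ℝ, ℂ) (fun y => (f x).c j y (e y)) x := fun x e he j => by
    obtain ⟨N', hN', hxN', hNN, he⟩ := he.exists_subset hE (hN x) (hxN x)
    exact ((f x).sm_c hN' hNN he j).md hN' hxN'
  have hspec : ∀ x, symAt (s x) = l x ∧ ∀ e, 𝓔.smooth.SmoothNear e x → opAt (s x) e =
      ∑ j, ((f x).c j x (e x) • δ ((f x).e j) x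
      + cDeriv V x ((𝓛.withBracket br).anchor x (l x)) (fun y => (f x).c j y (e y))
        • (f x).e j x) := fun x => by
    refine atiyahMk_spec hE (fun e e' he he' => ?_) fun g e U hU hx hg he => ?_
    · rw [← Finset.sum_add_distrib]
      refine Finset.sum_congr rfl fun j _ => ?_
      simp only [Pi.add_apply, map_add]
      rw [cDeriv_fadd _ (hc x he j) (hc x he' j)]
      module
    · conv_rhs => rw [← (f x).sum_c x (hxN x) (e x)]
      rw [Finset.smul_sum, Finset.smul_sum, ← Finset.sum_add_distrib]
      refine Finset.sum_congr rfl fun j _ => ?_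
      rw [(f x).sum_c x (hxN x) (e x)]
      simp only [map_smul, smul_eq_mul]
      rw [cDeriv_mul _ (hg.md hU hx) (hc x ⟨U, hU, hx, he⟩ j)]
      module
  have hop : ∀ W : Set M, IsOpen W → W ⊆ U → ∀ e, 𝓔.HolOn e W → ∀ x ∈ W, op s e x = δ e x := by
    intro W hW hWU e he x hx
    have hK : IsOpen (N x ∩ W) := (hN x).inter hW
    have hxK : x ∈ N x ∩ W := ⟨hxN x, hx⟩
    have hKU : N x ∩ W ⊆ U := Set.inter_subset_right.trans hWU
    have near : ∀ {e}, 𝓔.HolOn e (N x ∩ W) → 𝓔.smooth.SmoothNear e x := fun he =>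
      ⟨_, hK, hxK, he.smoothOn hK⟩
    have hz : 𝓔.HolOn (fun _ => 0) (N x ∩ W) := by
      simpa using HolVectorBundle.HolOn.sum (E := 𝓔) (κ := Empty) ∅ (s := fun k _ => k.elim) hK (by simp)
    -- Agreement at the fixed point x is proved by induction over the sections that are holomorphic
    -- on a neighbourhood where the frame at x is defined.
    refine HolFrame.induction ((f x).restrict Set.inter_subset_left) hK
      (fun e => opAt (s x) e = δ e x) ?_ (fun i => ?_) (fun e e' he he' h1 h2 => ?_)
      (fun g e hg he h1 => ?_) (fun e e' he h h1 => ?_) e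
      (𝓔.holOn_mono he Set.inter_subset_right)
    -- The value of δ on the zero section is 0 because additivity makes it equal to its double.
    · have h1 := hδ.add _ hK hKU _ _ hz hz x hxK
      have h2 : ((fun _ => 0) + fun _ => 0 : Π y, EF y) = fun _ => 0 := by
        funext y
        simp
      rw [h2] at h1
      rw [opAt_zero hE]
      exact (left_eq_add.1 h1).symm
    · refine ((hspec x).2 _ (near ((f x).holOn_e hK Set.inter_subset_left i))).trans ?_
      have h1 : ∀ j, cDeriv V x ((𝓛.withBracket br).anchor x (l x))
          (fun y => (f x).c j y ((f x).e i y)) = 0 := fun j => by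
        rw [cDeriv_congr_on _ (hN x) (hxN x) fun y hy => (f x).c_e y hy j i, cDeriv_const]
      have h2 := fun j => (f x).c_e x (hxN x) j i
      refine (Finset.sum_congr rfl fun j _ => congrArg₂ (· + ·)
        (congrArg (· • δ ((f x).e j) x) (h2 j)) (congrArg (· • (f x).e j x) (h1 j))).trans ?_
      simp
      rfl
    · rw [opAt_add _ (near he) (near he'), h1, h2, hδ.add _ hK hKU _ _ he he' x hxK]
    · rw [opAt_fsmul _ hK hxK hg.sm (near he), h1, hδ.leibniz _ hK hKU g e hg he x hxK,
        cDeriv_anchor (br := br) _ hg hK hxK]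
      exact congrArg (fun a => _ + holDeriv V x (𝓛.anchor x a) g • e x) (hspec x).1
    · rw [← opAt_congr hE _ hK hxK (he.smoothOn hK) h, h1]
      exact hδ.op_local _ hK hKU e e' he h x hxK
  refine ⟨s, ?_, fun x => (hspec x).1, hop⟩
  exact ⟨hδ.symbol_hol.congr hU fun x _ => (hspec x).1.symm, fun W hW hWU e he =>
    (hδ.hol W hW hWU e he).congr hW fun x hx => (hop W hW hWU e he x hx).symm⟩

/-- The coordinates in an Atiyah frame involve only the symbol and the values on a holomorphic
frame, so holomorphic test sections suffice. -/
theorem HolAtiyahOn.eq_of {U : Set M} (hU : IsOpen U) (hA : IsPreLie (𝓛.withBracket br))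
    {s s' : Π x, atiyahFib (𝓛.withBracket br) 𝓔.smooth x}
    (h1 : ∀ x ∈ U, sym s x = sym s' x)
    (h2 : ∀ W : Set M, IsOpen W → W ⊆ U → ∀ e, 𝓔.HolOn e W → ∀ x ∈ W, op s e x = op s' e x) :
    ∀ x ∈ U, s x = s' x := fun x hx => by
  obtain ⟨ι, κ, _, _, _, _, W, hW, hxW, hWU, ⟨f⟩, ⟨g⟩⟩ := exists_holFrame_pair 𝓛 𝓔 hU hx
  refine (f.atiyahFrame br g hA hW).ext hxW fun p => ?_
  rcases p with ⟨i, j⟩ | k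
  · exact congrArg (f.c i x) (h2 W hW hWU _ (f.holOn_e hW subset_rfl j) x hxW)
  · exact congrArg (g.c k x) (h1 x hx)

end Operators

end HolAtiyah

end

/-! ### Assembly of the theorem. -/

theorem proposition5p8
    {V : Type*} [NormedAddCommGroup V] [NormedSpace ℂ V] [FiniteDimensional ℂ V]
    {M : Type*} [TopologicalSpace M] [T2Space M] [ParacompactSpace M] [ChartedSpace V M]
    [IsManifold 𝓘(ℂ, V) ω M]
    {LF : M → Type*} [∀ x, AddCommGroup (LF x)] [∀ x, Module ℂ (LF x)]
    {EF : M → Type*} [∀ x, AddCommGroup (EF x)] [∀ x, Module ℂ (EF x)]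
    (𝓛 : HolAtiyah.HolLieAlgebroid V LF) (𝓔 : HolAtiyah.HolVectorBundle V EF) :
    -- `𝓛` has an underlying smooth Lie algebroid `L`
    (∃ br, HolAtiyah.Underlies (𝓛.withBracket br) 𝓛) ∧
    ∀ br, HolAtiyah.Underlies (𝓛.withBracket br) 𝓛 →
      let L : HolAtiyah.LieAlgebroidData V M := 𝓛.withBracket br
      let E : HolAtiyah.SectionFamily M := 𝓔.smooth
      let T : HolAtiyah.LieAlgebroidData V M := HolAtiyah.T01Algebroid V M
      -- the matched sum `T^{0,1} M ⋈ L`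
      let TL : HolAtiyah.LieAlgebroidData V M :=
        HolAtiyah.matchedSum T L 𝓛.dbar (HolAtiyah.del L)
      let DL : HolAtiyah.LieAlgebroidData V M := HolAtiyah.atiyah L E
      -- the matched sum `T^{0,1} M ⋈ 𝔇_L(E)`
      let TDL : HolAtiyah.LieAlgebroidData V M :=
        HolAtiyah.matchedSum T DL (HolAtiyah.dbarAtiyah 𝓛 br 𝓔) (HolAtiyah.del DL)
      let DTL : HolAtiyah.LieAlgebroidData V M := HolAtiyah.atiyah TL E
      -- (a)
      HolAtiyah.IsMatchedPair T L 𝓛.dbar (HolAtiyah.del L) ∧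
      HolAtiyah.IsLieTriad TL T (fun _ => LinearMap.inl ℂ _ _) E 𝓔.dbar ∧
      -- (b)
      HolAtiyah.IsLieAlgebroid DL ∧ HolAtiyah.AtiyahBracketFormula L E ∧
      HolAtiyah.IsMatchedPair T DL (HolAtiyah.dbarAtiyah 𝓛 br 𝓔) (HolAtiyah.del DL) ∧
      HolAtiyah.BottAtiyahFormula T L E 𝓛.dbar (HolAtiyah.del L) 𝓔.dbar ∧
      HolAtiyah.IsLieAlgebroid DTL ∧ HolAtiyah.AtiyahBracketFormula TL E ∧
      (∃ Φ : ∀ x, TDL.Fib x ≃ₗ[ℂ] DTL.Fib x, HolAtiyah.IsLieAlgebroidIso TDL DTL Φ ∧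
        ∀ (x : M) (a : T.Fib x) (d : DL.Fib x),
          HolAtiyah.symAt (Φ x (a, d)) = (a, HolAtiyah.symAt d) ∧
          ∀ e, E.SmoothNear e x →
            HolAtiyah.opAt (Φ x (a, d)) e = 𝓔.dbarAt x a e + HolAtiyah.opAt d e) ∧
      ∃ 𝓓 : HolAtiyah.HolLieAlgebroid.{_, _, _, 0} V DL.Fib,
        HolAtiyah.Underlies DL 𝓓 ∧
        (∀ U : Set M, IsOpen U → ∀ X s, T.SmoothOn X U → DL.SmoothOn s U →
          ∀ x ∈ U, 𝓓.dbar X s x = HolAtiyah.dbarAtiyah 𝓛 br 𝓔 X s x) ∧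
        -- (c)
        ∀ U : Set M, IsOpen U →
          (∀ s, 𝓓.HolOn s U ↔
            DL.SmoothOn s U ∧ ∀ X, T.SmoothOn X U → ∀ x ∈ U, HolAtiyah.dbarAtiyah 𝓛 br 𝓔 X s x = 0) ∧
          (∀ s, 𝓓.HolOn s U ↔ DL.SmoothOn s U ∧
            HolAtiyah.IsHolCovDiffOp 𝓛 𝓔 U (HolAtiyah.op s) (HolAtiyah.sym s)) ∧
          (∀ δ l, HolAtiyah.IsHolCovDiffOp 𝓛 𝓔 U δ l →
            ∃ s, 𝓓.HolOn s U ∧ (∀ x ∈ U, HolAtiyah.sym s x = l x) ∧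
              ∀ W : Set M, IsOpen W → W ⊆ U → ∀ e, 𝓔.HolOn e W →
                ∀ x ∈ W, HolAtiyah.op s e x = δ e x) ∧
          (∀ s s', 𝓓.HolOn s U → 𝓓.HolOn s' U →
            (∀ x ∈ U, HolAtiyah.sym s x = HolAtiyah.sym s' x) →
            (∀ W : Set M, IsOpen W → W ⊆ U → ∀ e, 𝓔.HolOn e W →
              ∀ x ∈ W, HolAtiyah.op s e x = HolAtiyah.op s' e x) →
            ∀ x ∈ U, s x = s' x) := by
  refine ⟨𝓛.exists_underlies, fun br h => ?_⟩
  intro L E T TL DL TDL DTL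
  have hE := 𝓔.isLocFree
  have hn := 𝓔.dbar_isFlatConnection
  have hA := h.lieAlgebroid.isPreLie
  have hm : HolAtiyah.IsMatchedPair T L 𝓛.dbar (HolAtiyah.del L) :=
    h.isMatchedPair fun _ _ _ _ _ _ _ _ => rfl
  obtain ⟨B, hB⟩ := HolAtiyah.exists_isHolAtiyah (𝓔 := 𝓔) hA
  have hU := hB.underlies h
  have hd : ∀ U : Set M, IsOpen U → ∀ X s, T.SmoothOn X U → DL.SmoothOn s U →
      ∀ x ∈ U, B.dbar X s x = HolAtiyah.dbarAtiyah 𝓛 br 𝓔 X s x :=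
    fun U hU X s hX hs x hx => hB.dbar_eq h hU hX hs hx
  refine ⟨hm, ⟨hm.left, hE.isSmoothVectorBundle, hn⟩,
    HolAtiyah.atiyah_isLieAlgebroid hE h.lieAlgebroid,
    HolAtiyah.atiyahBracketFormula hE h.lieAlgebroid,
    -- The matched pair of `T^{0,1} M` and the Atiyah algebroid is the matched pair of a holomorphic
    -- Lie algebroid, here the holomorphic Atiyah algebroid; its Dolbeault operator agrees with the
    -- Bott operator on smooth sections.
    hU.isMatchedPair fun U hU X s hX hs x hx => (hd U hU X s hX hs x hx).symm,
    HolAtiyah.bottAtiyahFormula hm hE hn,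
    HolAtiyah.atiyah_isLieAlgebroid hE hm.left.lieAlgebroid,
    HolAtiyah.atiyahBracketFormula hE hm.left.lieAlgebroid,
    ⟨HolAtiyah.atiyahIso L 𝓔 𝓛.dbar (HolAtiyah.del L),
      HolAtiyah.atiyahIso_isLieAlgebroidIso 𝓔 hm,
      fun x a d => HolAtiyah.addDbar_spec 𝓔 x (a, d)⟩,
    hB.algebroid h, hU, hd, fun U hUo => ⟨fun s => ⟨fun hs => ?_, fun hs => ?_⟩,
      fun s => ⟨fun hs => ?_, fun hs => ?_⟩, fun δ l hδ => ?_, fun s s' _ _ h1 h2 => ?_⟩⟩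
  · exact ⟨hB.smoothOn hUo hs, fun X hX x hx =>
      (hd U hUo X s hX (hB.smoothOn hUo hs) x hx).symm.trans (hs.dbarAt_eq_zero hUo hx (X x))⟩
  · refine HolAtiyah.HolVectorBundle.holOn_of_dbarAt (E := B) hUo
      ((hB.smoothOn_iff U hUo s).2 hs.1) fun x hx v => ?_
    -- The hypothesis concerns smooth (0,1)-fields on U, while the Cauchy–Riemann criterion needs
    -- each single vector; a bump function extends the vector to a field.
    obtain ⟨X, hX, rfl⟩ := HolAtiyah.T01_isLocFree.exists_extension x v
    have hX' : T.SmoothOn X U := HolAtiyah.CSmoothOn.mono hX (Set.subset_univ U)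
    exact (hd U hUo X s hX' hs.1 x hx).trans (hs.2 X hX' x hx)
  · exact ⟨hB.smoothOn hUo hs, ((hB.holOn_iff U hUo s).1 hs).isHolCovDiffOp⟩
  · exact (hB.holOn_iff U hUo s).2 ⟨hs.2.symbol_hol, hs.2.hol⟩
  · obtain ⟨s, h1, h2, h3⟩ := hδ.exists_section br hUo
    exact ⟨s, (hB.holOn_iff U hUo s).2 h1, fun x _ => h2 x, h3⟩
  · exact HolAtiyah.HolAtiyahOn.eq_of hUo hA h1 h2
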